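/- Let $0<|a|<M$ and let $g=g_{M,a}$ be the subextremal Kerr exterior metric in Boyer–Lindquist coordinates $(t,r,\theta,\varphi)$ on $\mathcal M_{M,a}=\mathbb R\times(r_+,\infty)\times\mathbb S^2$, with $r_\pm=M\pm\sqrt{M^2-a^2}$, $\Delta=(r-r_+)(r-r_-)$, $\rho^2=r^2+a^2\cos^2\theta$, and let $r_*:(r_+,\infty)\to\mathbb R$ satisfy $dr_*/dr=(r^2+a^2)/\Delta$. For real $\omega$, $m\in\mathbb Z$ and $l\ge|m|$, let $\lambda_{\omega ml}$ be the eigenvalues, listed in increasing order with $l=|m|,|m|+1,\dots$, of $$-\frac1{\sin\theta}\frac{d}{d\theta}\Big(\sin\theta\frac{dS}{d\theta}\Big)+\Big(\frac{m^2}{\sin^2\theta}-a^2\omega^2\cos^2\theta\Big)S=\lambda S,\qquad S\text{ bounded on }(0,\pi).$$ For complex $\omega$ close to the real axis, $\lambda_{\omega ml}$ is the value at $\omega$ of the holomorphic family of eigenvalues, defined on a disc around $\mathrm{Re}\,\omega$, that starts from $\lambda_{(\mathrm{Re}\,\omega)ml}$; $S_{\omega ml}$ denotes a corresponding nonzero eigenfunction.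 Set $$V_{\omega ml}=\frac{4Mram\omega-a^2m^2+\Delta(\lambda_{\omega ml}+a^2\omega^2)}{(r^2+a^2)^2}+\frac{\Delta}{(r^2+a^2)^4}\big(a^2\Delta+2Mr(r^2-a^2)\big).$$ An outgoing mode solution with parameters $(\omega,m,l)$, where $\omega\ne0$ and $\mathrm{Im}\,\omega\ge0$ is small, of $$\square_g\psi-\frac{(r^2+a^2)^2}{\Delta\rho^2}V(r)\,\psi=0\qquad(\ast)$$ is a smooth solution $\psi\not\equiv0$ on $\mathcal M_{M,a}$ of the form $\psi=e^{-i\omega t}e^{im\varphi}S_{\omega ml}(\theta)R(r)$ such that $u(r_*)=(r^2+a^2)^{1/2}R(r)$ satisfies (with $'=d/dr_*$) $$u''+(\omega^2-V_{\omega ml}-V)u=0,\qquad e^{-i\omega r_*}(u'-i\omega u)\to0\ \text{ as } r_*\to+\infty,$$ $$e^{i(\omega-\frac{am}{2Mr_+})r_*}\Big(u'+i\big(\omega-\tfrac{am}{2Mr_+}\big)u\Big)\to0\ \text{ as } r_*\to-\infty.$$ **Theorem.** Let $0<|a|<M$ and let $(\omega_R,m,l)\in(\mathbb R\setminus\{0\})\times\mathbb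 Z\times\mathbb Z_{\ge|m|}$ be superradiant, i.e. $\omega_R\big(\omega_R-\frac{am}{2Mr_+}\big)<0$. There exist constants $C>r_+$ and $C^{(0)}>0$, depending only on $\omega_R,m,l,M,a$, such that for every $r_0>C$ there is $\varepsilon>0$, depending only on $\omega_R,m,l,M,a,r_0$, such that for every $0\le\omega_I<\varepsilon$ there is a smooth function $V:(r_+,\infty)\to[0,2\omega_R^2]$, supported in $\{r_0\le r\le r_0+C^{(0)}\}$, for which $(\ast)$ admits an outgoing mode solution with parameters $(\omega_R+i\omega_I,m,l)$. (In particular, $\omega_I=0$ gives real modes and $0<\omega_I<\varepsilon$ gives exponentially growing modes, for compactly supported non-negative potentials.) -/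

import Mathlib

noncomputable section

namespace Kerr

/-- The area radius `r₊ = M + √(M² - a²)` of the event horizon. -/
def rPlus (M a : ℝ) : ℝ := M + √(M ^ 2 - a ^ 2)

/-- The inner radius `r₋ = M - √(M² - a²)`. -/
def rMinus (M a : ℝ) : ℝ := M - √(M ^ 2 - a ^ 2)

/-- `Δ = (r - r₊)(r - r₋)`. -/
def Del (M a r : ℝ) : ℝ := (r - rPlus M a) * (r - rMinus M a)

/-- `ρ² = r² + a² cos² θ`. -/
def rhoSq (a r θ : ℝ) : ℝ := r ^ 2 + a ^ 2 * Real.cos θ ^ 2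

/-- `Π = (r² + a²)² - a² sin² θ Δ`. -/
def bigPi (M a r θ : ℝ) : ℝ := (r ^ 2 + a ^ 2) ^ 2 - a ^ 2 * Real.sin θ ^ 2 * Del M a r

/-- The components of the Kerr metric in Boyer–Lindquist coordinates
`x 0 = t`, `x 1 = r`, `x 2 = θ`, `x 3 = φ`. -/
def metric (M a : ℝ) (x : Fin 4 → ℝ) : Matrix (Fin 4) (Fin 4) ℝ :=
  !![-(1 - 2 * M * x 1 / rhoSq a (x 1) (x 2)), 0, 0,
        -(2 * M * a * x 1 * Real.sin (x 2) ^ 2 / rhoSq a (x 1) (x 2));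
     0, rhoSq a (x 1) (x 2) / Del M a (x 1), 0, 0;
     0, 0, rhoSq a (x 1) (x 2), 0;
     -(2 * M * a * x 1 * Real.sin (x 2) ^ 2 / rhoSq a (x 1) (x 2)), 0, 0,
        Real.sin (x 2) ^ 2 * bigPi M a (x 1) (x 2) / rhoSq a (x 1) (x 2)]

/-- The range of the Boyer–Lindquist chart (with `φ` understood modulo `2π`): it covers the
exterior `ℝ × (r₊, ∞) × S²` except for the axis. -/
def chartDomain (M a : ℝ) : Set (Fin 4 → ℝ) :=
  {x | rPlus M a < x 1 ∧ x 2 ∈ Set.Ioo 0 Real.pi}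

/-- The partial derivative `∂_i f` at `x`. -/
def pderiv (i : Fin 4) (f : (Fin 4 → ℝ) → ℂ) (x : Fin 4 → ℝ) : ℂ :=
  deriv (fun s : ℝ => f (Function.update x i s)) (x i)

/-- The wave operator
`□_g ψ = (-det g)^(-1/2) ∑ ∂_α ((-det g)^(1/2) g^{αβ} ∂_β ψ)`
of a metric `g` given by its components in a coordinate chart. -/
def waveOp (g : (Fin 4 → ℝ) → Matrix (Fin 4) (Fin 4) ℝ) (ψ : (Fin 4 → ℝ) → ℂ)
    (x : Fin 4 → ℝ) : ℂ :=
  ((1 / √(-(g x).det) : ℝ) : ℂ) *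
    ∑ α, ∑ β, pderiv α
      (fun y => ((√(-(g y).det) * (g y)⁻¹ α β : ℝ) : ℂ) * pderiv β ψ y) x

/-- The point of `ℝ × {y ∈ ℝ³ : ‖y‖ > r₊}` with Boyer–Lindquist coordinates `x`. Through the usual
spherical coordinates that space is diffeomorphic to the exterior `ℝ × (r₊, ∞) × S²`. -/
def toExterior (x : Fin 4 → ℝ) : ℝ × EuclideanSpace ℝ (Fin 3) :=
  (x 0, !₂[x 1 * Real.sin (x 2) * Real.cos (x 3), x 1 * Real.sin (x 2) * Real.sin (x 3),
    x 1 * Real.cos (x 2)])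

/-- `ψ`, given in Boyer–Lindquist coordinates, is a smooth function on the whole exterior
`ℝ × (r₊, ∞) × S²`, the axis included. -/
def SmoothOnExterior (M a : ℝ) (ψ : (Fin 4 → ℝ) → ℂ) : Prop :=
  ∃ Ψ : ℝ × EuclideanSpace ℝ (Fin 3) → ℂ,
    ContDiffOn ℝ (⊤ : ℕ∞) Ψ {p | rPlus M a < ‖p.2‖} ∧
    ∀ x ∈ chartDomain M a, ψ x = Ψ (toExterior x)

/-- `ψ` is a smooth solution on the Kerr exterior of
`□_g ψ - (r² + a²)² / (Δ ρ²) V(r) ψ = 0`.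
(For smooth `ψ` the equation on the axis follows by continuity.) -/
def IsWaveSolution (M a : ℝ) (V : ℝ → ℂ) (ψ : (Fin 4 → ℝ) → ℂ) : Prop :=
  SmoothOnExterior M a ψ ∧
  ∀ x ∈ chartDomain M a,
    waveOp (metric M a) ψ x -
      (((x 1 ^ 2 + a ^ 2) ^ 2 / (Del M a (x 1) * rhoSq a (x 1) (x 2)) : ℝ) : ℂ) *
        V (x 1) * ψ x = 0

/-- `S` is a nonzero bounded solution on `(0, π)` of the angular equation
`-(sin θ)⁻¹ (sin θ S')' + (m² / sin² θ - a² ω² cos² θ) S = lam S`. -/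
def IsAngularEigenfunction (a : ℝ) (ω : ℂ) (m : ℤ) (lam : ℂ) (S : ℝ → ℂ) : Prop :=
  ContDiffOn ℝ (⊤ : ℕ∞) S (Set.Ioo 0 Real.pi) ∧
  (∀ θ ∈ Set.Ioo 0 Real.pi,
    -(1 / (Real.sin θ : ℂ)) * deriv (fun s : ℝ => (Real.sin s : ℂ) * deriv S s) θ +
      ((m : ℂ) ^ 2 / (Real.sin θ : ℂ) ^ 2 -
        (a : ℂ) ^ 2 * ω ^ 2 * (Real.cos θ : ℂ) ^ 2) * S θ = lam * S θ) ∧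
  (∃ B : ℝ, ∀ θ ∈ Set.Ioo 0 Real.pi, ‖S θ‖ ≤ B) ∧
  ∃ θ ∈ Set.Ioo 0 Real.pi, S θ ≠ 0

/-- `lam` is an eigenvalue of the angular equation. -/
def IsAngularEigenvalue (a : ℝ) (ω : ℂ) (m : ℤ) (lam : ℂ) : Prop :=
  ∃ S : ℝ → ℂ, IsAngularEigenfunction a ω m lam S

/-- For real `ω`: `lam` is the eigenvalue `λ_{ωml}`, `l ≥ |m|`, in increasing order, so that exactly
`l - |m|` eigenvalues lie below it (`λ_{0ml} = l (l + 1)`). -/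
def IsRealSpheroidalEigenvalue (a ω : ℝ) (m : ℤ) (l : ℕ) (lam : ℝ) : Prop :=
  IsAngularEigenvalue a (ω : ℂ) m (lam : ℂ) ∧
  {μ : ℝ | μ < lam ∧ IsAngularEigenvalue a (ω : ℂ) m (μ : ℂ)}.encard + (m.natAbs : ℕ∞) = l

/-- For complex `ω` near the real axis: `lam = λ_{ωml}` is obtained from the simple eigenvalue
`λ_{(Re ω)ml}` by perturbation theory, that is, as the value at `ω` of the holomorphic family of
eigenvalues on a disc around `Re ω` that starts from it. -/
def IsSpheroidalEigenvalue (a : ℝ) (ω : ℂ) (m : ℤ) (l : ℕ) (lam : ℂ) : Prop :=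
  ∃ (ε : ℝ) (Λ : ℂ → ℂ), |ω.im| < ε ∧
    DifferentiableOn ℂ Λ (Metric.ball (ω.re : ℂ) ε) ∧
    (∀ z ∈ Metric.ball (ω.re : ℂ) ε, IsAngularEigenvalue a z m (Λ z)) ∧
    (∃ lam₀ : ℝ, IsRealSpheroidalEigenvalue a ω.re m l lam₀ ∧ Λ (ω.re : ℂ) = (lam₀ : ℂ)) ∧
    Λ ω = lam

/-- The radial function `r_*`, a primitive of `(r² + a²) / Δ` on `(r₊, ∞)`. -/
def rStar (M a r : ℝ) : ℝ :=
  r + 2 * M * rPlus M a / (rPlus M a - rMinus M a) * Real.log (r - rPlus M a)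
    - 2 * M * rMinus M a / (rPlus M a - rMinus M a) * Real.log (r - rMinus M a)

theorem hasDerivAt_rStar {M a r : ℝ} (h : |a| < M) (hr : rPlus M a < r) :
    HasDerivAt (rStar M a) ((r ^ 2 + a ^ 2) / Del M a r) r := by
  have hM : 0 < M := lt_of_le_of_lt (abs_nonneg a) h
  have hpos : 0 < M ^ 2 - a ^ 2 := by
    have := sq_lt_sq' (by linarith [abs_nonneg a]) h
    rw [sq_abs] at this
    linarith
  have hs : 0 < √(M ^ 2 - a ^ 2) := Real.sqrt_pos.2 hpos
  have hs2 : √(M ^ 2 - a ^ 2) ^ 2 = M ^ 2 - a ^ 2 := Real.sq_sqrt hpos.le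
  have h1 : r - rPlus M a ≠ 0 := by linarith
  have h2 : r - rMinus M a ≠ 0 := by unfold rPlus at hr; unfold rMinus; linarith
  have h3 : rPlus M a - rMinus M a ≠ 0 := by unfold rPlus rMinus; linarith
  have e1 : HasDerivAt (fun r : ℝ => Real.log (r - rPlus M a)) (1 / (r - rPlus M a)) r :=
    ((hasDerivAt_id r).sub_const _).log h1
  have e2 : HasDerivAt (fun r : ℝ => Real.log (r - rMinus M a)) (1 / (r - rMinus M a)) r :=
    ((hasDerivAt_id r).sub_const _).log h2
  have e := ((hasDerivAt_id r).add
    (e1.const_mul (2 * M * rPlus M a / (rPlus M a - rMinus M a)))).sub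
    (e2.const_mul (2 * M * rMinus M a / (rPlus M a - rMinus M a)))
  have hsum : rPlus M a + rMinus M a = 2 * M := by unfold rPlus rMinus; ring
  have hprod : rPlus M a * rMinus M a = a ^ 2 := by unfold rPlus rMinus; linear_combination -hs2
  refine HasDerivAt.congr_deriv e ?_
  unfold Del
  field_simp
  linear_combination (r * (rMinus M a - rPlus M a)) * hsum + (rPlus M a - rMinus M a) * hprod

/-- The potential `V_{ωml}` of the separated radial equation, with `lam = λ_{ωml}`. -/
def radialPotential (M a : ℝ) (ω : ℂ) (m : ℤ) (lam : ℂ) (r : ℝ) : ℂ :=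
  (4 * M * r * a * m * ω - (a : ℂ) ^ 2 * (m : ℂ) ^ 2 +
      (Del M a r : ℂ) * (lam + (a : ℂ) ^ 2 * ω ^ 2)) / ((r : ℂ) ^ 2 + (a : ℂ) ^ 2) ^ 2 +
    ((Del M a r / (r ^ 2 + a ^ 2) ^ 4 *
      (a ^ 2 * Del M a r + 2 * M * r * (r ^ 2 - a ^ 2)) : ℝ) : ℂ)

/-- `u`, a function of `r_*`, satisfies `u'' + (ω² - V_{ωml} - V) u = 0` and the outgoing boundary
conditions at `r_* = ±∞`. The function `r ↦ r_*` is a bijection from `(r₊, ∞)` onto `ℝ`, so that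
the equation is imposed on all of `ℝ`. -/
def IsOutgoingRadial (M a : ℝ) (V : ℝ → ℂ) (ω : ℂ) (m : ℤ) (lam : ℂ) (u : ℝ → ℂ) : Prop :=
  ContDiff ℝ (⊤ : ℕ∞) u ∧
  (∀ r : ℝ, rPlus M a < r →
    deriv (deriv u) (rStar M a r) +
      (ω ^ 2 - radialPotential M a ω m lam r - V r) * u (rStar M a r) = 0) ∧
  Filter.Tendsto (fun s : ℝ => Complex.exp (-(Complex.I * ω * s)) *
      (deriv u s - Complex.I * ω * u s)) Filter.atTop (nhds 0) ∧
  Filter.Tendsto (fun s : ℝ =>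
      Complex.exp (Complex.I * (ω - ((a * m / (2 * M * rPlus M a) : ℝ) : ℂ)) * s) *
      (deriv u s + Complex.I * (ω - ((a * m / (2 * M * rPlus M a) : ℝ) : ℂ)) * u s))
    Filter.atBot (nhds 0)

/-- `ψ` (not identically zero) is an outgoing mode solution with parameters `(ω, m, l)` of
`□_g ψ - (r² + a²)² / (Δ ρ²) V(r) ψ = 0` on the Kerr exterior:
`ψ = e^{-iωt} e^{imφ} S_{ωml}(θ) R(r)`, where `u(r_*) = (r² + a²)^{1/2} R(r)` satisfies the separated
radial equation and the outgoing boundary conditions. -/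
def IsOutgoingMode (M a : ℝ) (V : ℝ → ℂ) (ω : ℂ) (m : ℤ) (l : ℕ) (ψ : (Fin 4 → ℝ) → ℂ) : Prop :=
  ω ≠ 0 ∧ 0 ≤ ω.im ∧ m.natAbs ≤ l ∧
  IsWaveSolution M a V ψ ∧
  (∃ x ∈ chartDomain M a, ψ x ≠ 0) ∧
  ∃ (lam : ℂ) (S R u : ℝ → ℂ),
    IsSpheroidalEigenvalue a ω m l lam ∧
    IsAngularEigenfunction a ω m lam S ∧
    (∀ x ∈ chartDomain M a,
      ψ x = Complex.exp (-(Complex.I * ω * x 0)) * Complex.exp (Complex.I * m * x 3) *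
        S (x 2) * R (x 1)) ∧
    (∀ r : ℝ, rPlus M a < r → u (rStar M a r) = (√(r ^ 2 + a ^ 2) : ℂ) * R r) ∧
    IsOutgoingRadial M a V ω m lam u

end Kerr

end

/-!
The construction puts a long smooth plateau of the potential far from the horizon, on which the
radial equation degenerates to `u'' = 0`, and glues there the solution that is outgoing at the
horizon to the one that is outgoing at infinity.

Write `s = r_*` and `h(s) = ω² - V_{ωml}`. For large `r₀` set `W = edgeL * edgeR * Re h - E`, where
the two edges form a smooth bump equal to `1` on `[α, α + L]`, with `α = r_*(r₀) + 1`. Let `u` be the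
solution that is outgoing at the horizon for the potential with the left edge only, and `v` the one
that is outgoing at infinity for the potential with the right edge only (`exists_horizon_family`,
`exists_infinity_family`, both from the Jost solutions `exists_jost`). On `[α, α + L]` both satisfy
`u'' = -i (Im h) u`, so they are affine when `ω` is real. Their fluxes `Im (u' ū)` are then the
constants `-(ω_R - a m / (2 M r₊))` and `ω_R`, and superradiance says exactly that these have the
same sign. After scaling `|v|²` by a positive `c` the fluxes agree, and a function `w` of modulus
squared `P = (1 - χ) |u|² + χ c |v|²` and of that flux solves `w'' = -E w` with
`E = (flux² + (P')² / 4 - P P'' / 2) / P²`. Such a `w` is `u` on the left and a multiple of `v` on the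
right (`exists_glued`). Since affine functions of nonzero flux grow linearly, `P` is of size `L²` and
`E = O(L⁻²)` (`exists_glueE_bound`). The bounds on `u` at `α` and on `v` at `α + L` do not depend on
`r₀` or `L` (the potential `V_{ωml}` is `O(r⁻²)`), so one `L` makes `|E| < ω_R² / 4` for every `r₀`,
while `Re h` is close to `ω_R²` there. This gives `0 ≤ W ≤ 2 ω_R²` for real `ω`.

For `ω = ω_R + iτ` the same formulas work with `w'' = -(E + i Im h) w`, as soon as the interpolated
flux is corrected by an integral whose total vanishes for a suitable `c`. Everything depends
continuously on `τ`, which gives a whole interval of `τ` (`eventually_glue`,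
`exists_trapping_potential`).

The angular eigenvalues are zeros in `L = λ - |m| (|m| + 1)` of a function `angD` of `(L, z)`,
`z = a² ω²`: the value, or the derivative, at the equator of the power series solution at the pole.
Green's identity for two such solutions (`angD_green`) replaces spectral theory: it shows that the
zeros are real for real `z`, isolated and simple, and, through a Rouché type argument, that they
continue holomorphically in `z` (`exists_zero_branch`). Continuation from `z = 0`, where the solutions
are polynomials, shows that there are infinitely many, so that the `l`-th one exists
(`exists_spheroidal_family`). Separation of variables (`waveOp_separated`) and the smoothness of
`(sin θ e^{± iφ})^{|m|} F(cos θ)` across the axis reduce the theorem to the radial problem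
(`exists_isOutgoingMode`).
-/

noncomputable section

namespace Kerr

open Filter Topology MeasureTheory Set

/-! ### Jost solutions with a parameter -/

theorem hasDerivAt_integral_Ioi {h : ℝ → ℂ} (hc : Continuous h)
    (hi : ∀ s, IntegrableOn h (Ioi s)) (s : ℝ) :
    HasDerivAt (fun s => ∫ t in Ioi s, h t) (-h s) s := by
  have e : (fun s => ∫ t in Ioi s, h t) = fun s => (∫ t in Ioi (0 : ℝ), h t) - ∫ t in (0:ℝ)..s, h t := by
    funext s
    rw [eq_sub_iff_add_eq, add_comm, intervalIntegral.integral_interval_add_Ioi (hi 0) (hi s)]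
  rw [e]
  exact (intervalIntegral.integral_hasDerivAt_right (hc.intervalIntegrable _ _)
    (hc.stronglyMeasurableAtFilter _ _) hc.continuousAt).const_sub _

theorem continuous_integral_Ioi {X : Type*} [TopologicalSpace X] [FirstCountableTopology X]
    {F : X → ℝ → ℝ → ℂ} (hF : Continuous fun p : X × ℝ × ℝ => F p.1 p.2.1 p.2.2)
    {b : ℝ → ℝ} (hb : ∀ s, IntegrableOn b (Ioi s)) (hle : ∀ x s t, s ≤ t → ‖F x s t‖ ≤ b t) :
    Continuous fun p : X × ℝ => ∫ t in Ioi p.2, F p.1 p.2 t := by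
  rw [continuous_iff_continuousAt]
  rintro ⟨x₀, s₀⟩
  have e : (fun p : X × ℝ => ∫ t in Ioi p.2, F p.1 p.2 t) =
      fun p : X × ℝ => ∫ t, (Ioi p.2).indicator (F p.1 p.2) t := by
    funext p
    rw [integral_indicator measurableSet_Ioi]
  rw [e]
  have b0 : ∀ t, 0 ≤ b t := fun t => (norm_nonneg _).trans (hle x₀ t t le_rfl)
  refine continuousAt_of_dominated (bound := (Ioi (s₀ - 1)).indicator b) ?_ ?_ ?_ ?_
  · refine Eventually.of_forall fun p => ?_
    have : Continuous (F p.1 p.2) := hF.comp (by fun_prop : Continuous fun t => (p.1, p.2, t))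
    exact this.aestronglyMeasurable.indicator measurableSet_Ioi
  · have : ∀ᶠ p : X × ℝ in 𝓝 (x₀, s₀), s₀ - 1 < p.2 :=
      continuous_snd.continuousAt.eventually (lt_mem_nhds (by simp))
    filter_upwards [this] with p hp
    refine Eventually.of_forall fun t => ?_
    by_cases ht : t ∈ Ioi p.2
    · rw [indicator_of_mem ht, indicator_of_mem (show t ∈ Ioi (s₀ - 1) from lt_trans hp ht)]
      exact hle _ _ _ (le_of_lt ht)
    · rw [indicator_of_notMem ht, norm_zero]
      exact indicator_nonneg (fun t _ => b0 t) t
  · exact (integrable_indicator_iff measurableSet_Ioi).2 (hb _)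
  · have : ∀ᵐ t : ℝ, t ≠ s₀ := by
      simp [ae_iff]
    filter_upwards [this] with t ht
    rcases lt_or_gt_of_ne ht with h | h
    · have : ∀ᶠ p : X × ℝ in 𝓝 (x₀, s₀), t < p.2 :=
        continuous_snd.continuousAt.eventually (lt_mem_nhds h)
      refine ContinuousAt.congr (f := fun _ => (0:ℂ)) continuousAt_const ?_
      filter_upwards [this] with p hp
      rw [indicator_of_notMem (by simp [hp.le])]
    · have : ∀ᶠ p : X × ℝ in 𝓝 (x₀, s₀), p.2 < t :=
        continuous_snd.continuousAt.eventually (gt_mem_nhds h)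
      refine ContinuousAt.congr (f := fun p : X × ℝ => F p.1 p.2 t) ?_ ?_
      · exact (hF.comp (by fun_prop : Continuous fun p : X × ℝ => (p.1, p.2, t))).continuousAt
      · filter_upwards [this] with p hp
        rw [indicator_of_mem (by exact hp)]

/-- The weight `exp (∫_s^∞ b)` integrates its own logarithmic derivative. -/
theorem integral_mul_exp_tail {b : ℝ → ℝ} (hc : Continuous b) (h0 : ∀ t, 0 ≤ b t)
    (hb : ∀ s, IntegrableOn b (Ioi s)) :
    Continuous (fun s => ∫ t in Ioi s, b t) ∧
    Tendsto (fun s => ∫ t in Ioi s, b t) atTop (𝓝 0) ∧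
    ∀ s, IntegrableOn (fun t => b t * Real.exp (∫ τ in Ioi t, b τ)) (Ioi s) ∧
      ∫ t in Ioi s, b t * Real.exp (∫ τ in Ioi t, b τ) = Real.exp (∫ τ in Ioi s, b τ) - 1 := by
  have e : (fun s => ∫ t in Ioi s, b t) = fun s => (∫ t in Ioi (0 : ℝ), b t) - ∫ t in (0:ℝ)..s, b t := by
    funext s
    rw [eq_sub_iff_add_eq, add_comm, intervalIntegral.integral_interval_add_Ioi (hb 0) (hb s)]
  have hd : ∀ s, HasDerivAt (fun s => ∫ t in Ioi s, b t) (-b s) s := by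
    intro s
    rw [e]
    exact (intervalIntegral.integral_hasDerivAt_right (hc.intervalIntegrable _ _)
      (hc.stronglyMeasurableAtFilter _ _) hc.continuousAt).const_sub _
  have ht : Tendsto (fun s => ∫ t in Ioi s, b t) atTop (𝓝 0) := tendsto_integral_Ioi_zero tendsto_id
  refine ⟨continuous_iff_continuousAt.2 fun s => (hd s).continuousAt, ht, fun s => ?_⟩
  have hd2 : ∀ s, HasDerivAt (fun s => -Real.exp (∫ t in Ioi s, b t))
      (b s * Real.exp (∫ τ in Ioi s, b τ)) s := by
    intro s
    refine ((hd s).exp.neg).congr_deriv (by ring)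
  have ht2 : Tendsto (fun s => -Real.exp (∫ t in Ioi s, b t)) atTop (𝓝 (-1)) := by
    have := ((Real.continuous_exp.tendsto 0).comp ht).neg
    simpa using this
  have hp : ∀ x ∈ Ioi s, 0 ≤ b x * Real.exp (∫ τ in Ioi x, b τ) :=
    fun x _ => mul_nonneg (h0 x) (Real.exp_pos _).le
  exact ⟨integrableOn_Ioi_deriv_of_nonneg' (fun x _ => hd2 x) hp ht2, by
    rw [integral_Ioi_of_hasDerivAt_of_nonneg' (fun x _ => hd2 x) hp ht2]; ring⟩

theorem norm_cexp_kernel_le {κ : ℂ} (h : 0 ≤ κ.im) {τ : ℝ} (hτ : 0 ≤ τ) :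
    ‖Complex.exp (2 * Complex.I * κ * τ)‖ ≤ 1 := by
  rw [Complex.norm_exp, Real.exp_le_one_iff]
  have : (2 * Complex.I * κ * τ).re = -2 * κ.im * τ := by
    simp
  rw [this]
  nlinarith [mul_nonneg h hτ]

/-- The condition `0 ≤ Im κ` is what keeps the kernel bounded: the exponential does not grow. -/
theorem norm_volterra_kernel_le {κ : ℂ} (h : 0 ≤ κ.im) {κ₀ : ℝ} (h0 : 0 < κ₀) (hκ : κ₀ ≤ ‖κ‖)
    {τ : ℝ} (hτ : 0 ≤ τ) :
    ‖(Complex.exp (2 * Complex.I * κ * τ) - 1) / (2 * Complex.I * κ)‖ ≤ 1 / κ₀ := by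
  rw [norm_div]
  have h1 : ‖Complex.exp (2 * Complex.I * κ * τ) - 1‖ ≤ 2 := by
    refine (norm_sub_le _ _).trans ?_
    rw [norm_one]
    linarith [norm_cexp_kernel_le h hτ]
  have h2 : ‖2 * Complex.I * κ‖ = 2 * ‖κ‖ := by simp
  rw [h2, div_le_div_iff₀ (by linarith) h0]
  nlinarith [norm_nonneg (Complex.exp (2 * Complex.I * κ * τ) - 1)]

/-- The Volterra equation `v(s) = 1 + ∫_s^∞ (e^{2iκ(t-s)} - 1)/(2iκ) U(t) v(t) dt` has a solution
that depends continuously on parameters. It is the fixed point of a contraction on the bounded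
continuous functions of `(x, s)`, after division by the weight `exp (∫_s^∞ 2 B / κ₀)`. -/
theorem exists_volterra_solution {X : Type*} [TopologicalSpace X] [FirstCountableTopology X]
    {κ : X → ℂ} (hκ : Continuous κ) (hκim : ∀ x, 0 ≤ (κ x).im) {κ₀ : ℝ} (hκ₀ : 0 < κ₀)
    (hκn : ∀ x, κ₀ ≤ ‖κ x‖) {U : X → ℝ → ℂ} (hU : Continuous fun p : X × ℝ => U p.1 p.2)
    {B : ℝ → ℝ} (hB : Continuous B) (hBi : ∀ s, IntegrableOn B (Ioi s))
    (hUB : ∀ x t, ‖U x t‖ ≤ B t) (hB0 : ∀ t, 0 ≤ B t) :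
    ∃ v : X → ℝ → ℂ, Continuous (fun p : X × ℝ => v p.1 p.2) ∧
      (∀ x s, ‖v x s‖ ≤ 2 * Real.exp (2 / κ₀ * ∫ t in Ioi s, B t)) ∧
      ∀ x s, v x s = 1 + ∫ t in Ioi s,
        (Complex.exp (2 * Complex.I * κ x * (t - s : ℝ)) - 1) / (2 * Complex.I * κ x) *
          (U x t * v x t) := by
  obtain ⟨b, hbdef⟩ : ∃ b : ℝ → ℝ, b = fun t => 2 / κ₀ * B t := ⟨_, rfl⟩
  have hb0 : ∀ t, 0 ≤ b t := fun t => hbdef ▸ mul_nonneg (by positivity) (hB0 t)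
  have hbi : ∀ s, IntegrableOn b (Ioi s) := fun s => hbdef ▸ (hBi s).const_mul _
  have hbc : Continuous b := hbdef ▸ hB.const_mul (2 / κ₀)
  obtain ⟨hβc, -, hβi⟩ := integral_mul_exp_tail hbc hb0 hbi
  have hβ0 : ∀ s, 0 ≤ ∫ t in Ioi s, b t :=
    fun s => setIntegral_nonneg measurableSet_Ioi fun t _ => hb0 t
  have hβB : ∀ s, ∫ t in Ioi s, b t = 2 / κ₀ * ∫ t in Ioi s, B t := fun s => by
    rw [hbdef, integral_const_mul]
  set β : ℝ → ℝ := fun s => ∫ t in Ioi s, b t with hβdef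
  replace hβ0 : ∀ s, 0 ≤ β s := hβ0
  replace hβB : ∀ s, β s = 2 / κ₀ * ∫ t in Ioi s, B t := hβB
  replace hβi : ∀ s, IntegrableOn (fun t => b t * Real.exp (β t)) (Ioi s) ∧
      ∫ t in Ioi s, b t * Real.exp (β t) = Real.exp (β s) - 1 := hβi
  have hκne : ∀ x, 2 * Complex.I * κ x ≠ 0 := fun x => by
    have : κ x ≠ 0 := norm_pos_iff.1 (hκ₀.trans_le (hκn x))
    simp [this]
  obtain ⟨K, hK⟩ : ∃ K : X → ℝ → ℂ, K = fun x (τ : ℝ) =>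
    (Complex.exp (2 * Complex.I * κ x * τ) - 1) / (2 * Complex.I * κ x) := ⟨_, rfl⟩
  have hKc : Continuous fun p : X × ℝ => K p.1 p.2 := by
    rw [hK]
    refine Continuous.div ?_ ?_ fun p => hκne _
    · fun_prop
    · fun_prop
  have hKle : ∀ x τ, 0 ≤ τ → ‖K x τ‖ ≤ 1 / κ₀ := fun x τ hτ =>
    hK ▸ norm_volterra_kernel_le (hκim x) hκ₀ (hκn x) hτ
  clear_value β
  let F : BoundedContinuousFunction (X × ℝ) ℂ → X → ℝ → ℝ → ℂ := fun g x s t =>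
    K x (t - s) * (U x t * (Real.exp (β t) * g (x, t)))
  have hFc : ∀ g, Continuous fun p : X × ℝ × ℝ => F g p.1 p.2.1 p.2.2 := by
    intro g
    have h1 : Continuous fun p : X × ℝ × ℝ => K p.1 (p.2.2 - p.2.1) :=
      hKc.comp (by fun_prop : Continuous fun p : X × ℝ × ℝ => (p.1, p.2.2 - p.2.1))
    have h2 : Continuous fun p : X × ℝ × ℝ => U p.1 p.2.2 :=
      hU.comp (by fun_prop : Continuous fun p : X × ℝ × ℝ => (p.1, p.2.2))
    have h3 : Continuous fun p : X × ℝ × ℝ => β p.2.2 := hβc.comp (by fun_prop)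
    have h4 : Continuous fun p : X × ℝ × ℝ => g (p.1, p.2.2) := g.continuous.comp (by fun_prop)
    have h5 : Continuous fun p : X × ℝ × ℝ => ((Real.exp (β p.2.2) : ℝ) : ℂ) :=
      Complex.continuous_ofReal.comp (Real.continuous_exp.comp h3)
    exact h1.mul (h2.mul (h5.mul h4))
  have hFle : ∀ g x s t, s ≤ t → ‖F g x s t‖ ≤ (1 / 2 * ‖g‖) * (b t * Real.exp (β t)) := by
    intro g x s t hst
    have h1 : ‖K x (t - s)‖ ≤ 1 / κ₀ := hKle x _ (sub_nonneg.2 hst)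
    have h2 : ‖g (x, t)‖ ≤ ‖g‖ := g.norm_coe_le_norm _
    simp only [F, norm_mul, Complex.norm_real, Real.norm_eq_abs, Real.abs_exp]
    calc ‖K x (t - s)‖ * (‖U x t‖ * (Real.exp (β t) * ‖g (x, t)‖))
        ≤ 1 / κ₀ * (B t * (Real.exp (β t) * ‖g‖)) := by
          gcongr
          · exact hB0 t
          · exact hUB x t
      _ = _ := by
          simp only [hbdef]; field_simp
  have hFi : ∀ s C, IntegrableOn (fun t => C * (b t * Real.exp (β t))) (Ioi s) :=
    fun s C => (hβi s).1.const_mul C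
  have hIc : ∀ g, Continuous fun p : X × ℝ => ∫ t in Ioi p.2, F g p.1 p.2 t := fun g =>
    continuous_integral_Ioi (hFc g) (fun s => hFi s _) (hFle g)
  have hIle : ∀ g x s, ‖∫ t in Ioi s, F g x s t‖ ≤ 1 / 2 * ‖g‖ * (Real.exp (β s) - 1) := by
    intro g x s
    refine (norm_integral_le_of_norm_le (hFi s (1 / 2 * ‖g‖)) ?_).trans_eq ?_
    · exact (ae_restrict_iff' measurableSet_Ioi).2
        (Eventually.of_forall fun t ht => hFle g x s t (le_of_lt ht))
    · rw [integral_const_mul, (hβi s).2]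
  let T : BoundedContinuousFunction (X × ℝ) ℂ → BoundedContinuousFunction (X × ℝ) ℂ := fun g =>
    BoundedContinuousFunction.ofNormedAddCommGroup
      (fun p => ((Real.exp (-β p.2) : ℝ) : ℂ) * (1 + ∫ t in Ioi p.2, F g p.1 p.2 t))
      ((Complex.continuous_ofReal.comp (Real.continuous_exp.comp
        (hβc.comp continuous_snd).neg)).mul (continuous_const.add (hIc g)))
      (1 + 1 / 2 * ‖g‖) (by
        rintro ⟨x, s⟩
        rw [norm_mul, Complex.norm_real, Real.norm_eq_abs, Real.abs_exp, Real.exp_neg]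
        rw [inv_mul_le_iff₀ (Real.exp_pos _)]
        refine (norm_add_le _ _).trans ?_
        rw [norm_one]
        have h1 : 1 ≤ Real.exp (β s) := Real.one_le_exp (hβ0 s)
        nlinarith [hIle g x s, norm_nonneg g])
  have hT : ContractingWith (1 / 2) T := by
    refine ⟨by norm_num, LipschitzWith.of_dist_le_mul fun g h => ?_⟩
    rw [BoundedContinuousFunction.dist_le (by positivity)]
    rintro ⟨x, s⟩
    rw [dist_eq_norm, dist_eq_norm]
    have hsub : ∫ t in Ioi s, F g x s t = (∫ t in Ioi s, F h x s t) + ∫ t in Ioi s, F (g - h) x s t := by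
      have hint : ∀ g, IntegrableOn (fun t => F g x s t) (Ioi s) := fun g => by
        refine Integrable.mono' (hFi s (1 / 2 * ‖g‖)) ?_ ?_
        · exact ((hFc g).comp (by fun_prop : Continuous fun t : ℝ => (x, s, t))).aestronglyMeasurable
        · exact (ae_restrict_iff' measurableSet_Ioi).2
            (Eventually.of_forall fun t ht => hFle g x s t (le_of_lt ht))
      rw [← integral_add (hint h) (hint (g - h))]
      congr 1
      funext t
      simp only [F, BoundedContinuousFunction.coe_sub, Pi.sub_apply]
      ring
    have e : (T g) (x, s) - (T h) (x, s) =
        ((Real.exp (-β s) : ℝ) : ℂ) * ∫ t in Ioi s, F (g - h) x s t := by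
      simp only [T, BoundedContinuousFunction.coe_ofNormedAddCommGroup]
      rw [hsub]; ring
    rw [e, norm_mul, Complex.norm_real, Real.norm_eq_abs, Real.abs_exp, Real.exp_neg,
      inv_mul_le_iff₀ (Real.exp_pos _)]
    refine (hIle _ x s).trans ?_
    have : ((1 / 2 : NNReal) : ℝ) = 1 / 2 := by norm_num
    rw [this]
    nlinarith [norm_nonneg (g - h), Real.exp_pos (β s)]
  have hne : Nonempty (BoundedContinuousFunction (X × ℝ) ℂ) := ⟨0⟩
  set g := ContractingWith.fixedPoint T hT with hg
  have hfix : T g = g := hT.fixedPoint_isFixedPt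
  have hgval : ∀ x s, g (x, s) =
      ((Real.exp (-β s) : ℝ) : ℂ) * (1 + ∫ t in Ioi s, F g x s t) := by
    intro x s
    conv_lhs => rw [← hfix]
    simp only [T, BoundedContinuousFunction.coe_ofNormedAddCommGroup]
  have hgn : ‖g‖ ≤ 2 := by
    have : ‖T g‖ ≤ 1 + 1 / 2 * ‖g‖ :=
      BoundedContinuousFunction.norm_ofNormedAddCommGroup_le _ (by positivity) _
    rw [hfix] at this
    linarith
  refine ⟨fun x s => ((Real.exp (β s) : ℝ) : ℂ) * g (x, s), ?_, ?_, ?_⟩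
  · exact (Complex.continuous_ofReal.comp (Real.continuous_exp.comp
      (hβc.comp continuous_snd))).mul g.continuous
  · intro x s
    rw [norm_mul, Complex.norm_real, Real.norm_eq_abs, Real.abs_exp, hβB, mul_comm]
    gcongr
    exact (g.norm_coe_le_norm _).trans hgn
  · intro x s
    beta_reduce
    rw [hgval, ← mul_assoc, ← Complex.ofReal_mul, ← Real.exp_add, add_neg_cancel, Real.exp_zero,
      Complex.ofReal_one, one_mul]
    simp only [F, hK]

/-- **Jost solutions.** The function `e^{iκs} v` solves `u'' = (U - κ²) u` and is asymptotic to
`e^{iκs}` at `+∞`, locally uniformly in the parameter. -/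
theorem exists_jost {X : Type*} [TopologicalSpace X] [FirstCountableTopology X]
    {κ : X → ℂ} (hκ : Continuous κ) (hκim : ∀ x, 0 ≤ (κ x).im) {κ₀ : ℝ} (hκ₀ : 0 < κ₀)
    (hκn : ∀ x, κ₀ ≤ ‖κ x‖) {U : X → ℝ → ℂ} (hU : Continuous fun p : X × ℝ => U p.1 p.2)
    {B : ℝ → ℝ} (hB : Continuous B) (hBi : ∀ s, IntegrableOn B (Ioi s))
    (hUB : ∀ x t, ‖U x t‖ ≤ B t) (hB0 : ∀ t, 0 ≤ B t) :
    ∃ v v' : X → ℝ → ℂ, Continuous (fun p : X × ℝ => v p.1 p.2) ∧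
      Continuous (fun p : X × ℝ => v' p.1 p.2) ∧
      (∀ x s, HasDerivAt (v x) (v' x s) s) ∧
      (∀ x s, HasDerivAt (v' x) (U x s * v x s - 2 * Complex.I * κ x * v' x s) s) ∧
      (∀ x s, ‖v x s‖ ≤ 2 * Real.exp (2 / κ₀ * ∫ t in Ioi s, B t)) ∧
      (∀ x s, ‖v' x s‖ ≤ κ₀ * Real.exp (2 / κ₀ * ∫ t in Ioi s, B t)) ∧
      (∀ x, Tendsto (v x) atTop (𝓝 1)) ∧ ∀ x, Tendsto (v' x) atTop (𝓝 0) := by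
  obtain ⟨v, hvc, hvb, hv⟩ := exists_volterra_solution hκ hκim hκ₀ hκn hU hB hBi hUB hB0
  have hb0 : ∀ t, 0 ≤ 2 / κ₀ * B t := fun t => mul_nonneg (by positivity) (hB0 t)
  obtain ⟨hβc, hβt, hβi⟩ := integral_mul_exp_tail (hB.const_mul (2 / κ₀)) hb0
    (fun s => (hBi s).const_mul _)
  simp only [integral_const_mul] at hβc hβt hβi
  have hκne : ∀ x, 2 * Complex.I * κ x ≠ 0 := fun x => by
    have : κ x ≠ 0 := norm_pos_iff.1 (hκ₀.trans_le (hκn x))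
    simp [this]
  set β : ℝ → ℝ := fun s => 2 / κ₀ * ∫ t in Ioi s, B t with hβ
  have hhc : ∀ x, Continuous fun t => U x t * v x t := fun x =>
    (hU.mul hvc).comp (by fun_prop : Continuous fun t : ℝ => (x, t))
  -- all integrands are dominated by `κ₀ b e^β`
  have hhle : ∀ x t, ‖U x t * v x t‖ ≤ κ₀ * (2 / κ₀ * B t * Real.exp (β t)) := by
    intro x t
    rw [norm_mul]
    calc ‖U x t‖ * ‖v x t‖ ≤ B t * (2 * Real.exp (β t)) := by
          gcongr
          · exact hB0 t
          · exact hUB x t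
          · exact hvb x t
      _ = _ := by field_simp
  have hint : ∀ s, IntegrableOn (fun t => κ₀ * (2 / κ₀ * B t * Real.exp (β t))) (Ioi s) :=
    fun s => (hβi s).1.const_mul _
  have hI : ∀ s, ∫ t in Ioi s, κ₀ * (2 / κ₀ * B t * Real.exp (β t)) =
      κ₀ * (Real.exp (β s) - 1) := fun s => by rw [integral_const_mul, (hβi s).2]
  let v' : X → ℝ → ℂ := fun x s =>
    -∫ t in Ioi s, Complex.exp (2 * Complex.I * κ x * (t - s : ℝ)) * (U x t * v x t)
  have hFle : ∀ x s t, s ≤ t → ‖Complex.exp (2 * Complex.I * κ x * (t - s : ℝ)) * (U x t * v x t)‖ ≤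
      κ₀ * (2 / κ₀ * B t * Real.exp (β t)) := by
    intro x s t hst
    rw [norm_mul]
    calc _ ≤ 1 * (κ₀ * (2 / κ₀ * B t * Real.exp (β t))) := by
          gcongr
          · exact norm_cexp_kernel_le (hκim x) (sub_nonneg.2 hst)
          · exact hhle x t
      _ = _ := one_mul _
  have hv'c : Continuous fun p : X × ℝ => v' p.1 p.2 := by
    refine (continuous_integral_Ioi (F := fun x s t =>
      Complex.exp (2 * Complex.I * κ x * (t - s : ℝ)) * (U x t * v x t)) ?_ hint hFle).neg
    have h1 : Continuous fun p : X × ℝ × ℝ => U p.1 p.2.2 * v p.1 p.2.2 :=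
      (hU.mul hvc).comp (by fun_prop : Continuous fun p : X × ℝ × ℝ => (p.1, p.2.2))
    fun_prop
  have hv'b : ∀ x s, ‖v' x s‖ ≤ κ₀ * (Real.exp (β s) - 1) := by
    intro x s
    simp only [v', norm_neg]
    refine (norm_integral_le_of_norm_le (hint s) ?_).trans_eq (hI s)
    exact (ae_restrict_iff' measurableSet_Ioi).2
      (Eventually.of_forall fun t ht => hFle x s t (le_of_lt ht))
  -- splitting the kernels into products
  have hEi : ∀ x s, IntegrableOn
      (fun t : ℝ => Complex.exp (2 * Complex.I * κ x * t) * (U x t * v x t)) (Ioi s) := by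
    intro x s
    refine Integrable.mono' ((hint s).const_mul ‖Complex.exp (2 * Complex.I * κ x * s)‖) ?_ ?_
    · exact (Continuous.mul (by fun_prop) (hhc x)).aestronglyMeasurable
    · refine (ae_restrict_iff' measurableSet_Ioi).2 (Eventually.of_forall fun t ht => ?_)
      have e : Complex.exp (2 * Complex.I * κ x * t) * (U x t * v x t) =
          Complex.exp (2 * Complex.I * κ x * s) *
            (Complex.exp (2 * Complex.I * κ x * (t - s : ℝ)) * (U x t * v x t)) := by
        rw [← mul_assoc, ← mul_assoc, ← mul_assoc, ← Complex.exp_add]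
        congr 4
        push_cast
        ring
      rw [e, norm_mul]
      gcongr
      exact hFle x s t (le_of_lt ht)
  have hhi : ∀ x s, IntegrableOn (fun t : ℝ => U x t * v x t) (Ioi s) := fun x s =>
    Integrable.mono' (hint s) (hhc x).aestronglyMeasurable (Eventually.of_forall (hhle x))
  have hv'e : ∀ x s, v' x s = -(Complex.exp (-(2 * Complex.I * κ x * s)) *
      ∫ t in Ioi s, Complex.exp (2 * Complex.I * κ x * t) * (U x t * v x t)) := by
    intro x s
    simp only [v']
    rw [← integral_const_mul]
    congr 2
    funext t
    rw [← mul_assoc, ← mul_assoc, ← mul_assoc, ← Complex.exp_add]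
    congr 4
    push_cast
    ring
  have hve : ∀ x s, v x s = 1 + (2 * Complex.I * κ x)⁻¹ *
      (-v' x s - ∫ t in Ioi s, U x t * v x t) := by
    intro x s
    have hEi' : IntegrableOn (fun t : ℝ => Complex.exp (2 * Complex.I * κ x * (t - s : ℝ)) *
        (U x t * v x t)) (Ioi s) := by
      refine Integrable.mono' (hint s) (Continuous.mul (by fun_prop) (hhc x)).aestronglyMeasurable ?_
      exact (ae_restrict_iff' measurableSet_Ioi).2
        (Eventually.of_forall fun t ht => hFle x s t (le_of_lt ht))
    simp only [v', neg_neg]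
    rw [← integral_sub hEi' (hhi x s), ← integral_const_mul]
    conv_lhs => rw [hv x s]
    congr 2
    funext t
    field_simp
  have hexp : ∀ x (s : ℝ), HasDerivAt (fun s : ℝ => Complex.exp (-(2 * Complex.I * κ x * s)))
      (-(2 * Complex.I * κ x) * Complex.exp (-(2 * Complex.I * κ x * s))) s := by
    intro x s
    have h1 : HasDerivAt (fun s : ℝ => (s : ℂ)) 1 s := Complex.ofRealCLM.hasDerivAt
    exact ((h1.const_mul (2 * Complex.I * κ x)).fun_neg.cexp).congr_deriv (by ring)
  have hv'd : ∀ x s, HasDerivAt (v' x) (U x s * v x s - 2 * Complex.I * κ x * v' x s) s := by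
    intro x s
    have h2 := hasDerivAt_integral_Ioi (h := fun t : ℝ => Complex.exp (2 * Complex.I * κ x * t) *
      (U x t * v x t)) (Continuous.mul (by fun_prop) (hhc x)) (hEi x) s
    have h3 := ((hexp x s).mul h2).neg
    rw [show v' x = _ from funext (hv'e x)]
    refine h3.congr_deriv ?_
    have : Complex.exp (-(2 * Complex.I * κ x * s)) * Complex.exp (2 * Complex.I * κ x * s) = 1 := by
      rw [← Complex.exp_add, neg_add_cancel, Complex.exp_zero]
    linear_combination (U x s * v x s) * this
  have hlim : Tendsto (fun s => κ₀ * (Real.exp (β s) - 1)) atTop (𝓝 0) := by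
    have h1 : Tendsto (fun s => Real.exp (β s)) atTop (𝓝 1) := by
      rw [← Real.exp_zero]
      exact (Real.continuous_exp.tendsto 0).comp hβt
    simpa using (h1.sub_const 1).const_mul κ₀
  have hv't : ∀ x, Tendsto (v' x) atTop (𝓝 0) := fun x =>
    squeeze_zero_norm (hv'b x) hlim
  refine ⟨v, v', hvc, hv'c, ?_, hv'd, hvb, ?_, ?_, hv't⟩
  · intro x s
    have h1 := ((hv'd x s).neg.sub (hasDerivAt_integral_Ioi (hhc x) (hhi x) s)).const_mul
      (2 * Complex.I * κ x)⁻¹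
    have h2 := h1.const_add 1
    have e : v x = fun s => 1 + (2 * Complex.I * κ x)⁻¹ *
      (-v' x s - ∫ t in Ioi s, U x t * v x t) := funext (hve x)
    rw [e]
    refine h2.congr_deriv ?_
    have := hκne x
    calc _ = (2 * Complex.I * κ x)⁻¹ * (2 * Complex.I * κ x) * v' x s := by ring
      _ = _ := by rw [inv_mul_cancel₀ this, one_mul]
  · intro x s
    refine (hv'b x s).trans ?_
    nlinarith [Real.exp_pos (β s)]
  · intro x
    have h0 : Tendsto (fun s => ∫ t in Ioi s, U x t * v x t) atTop (𝓝 0) :=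
      tendsto_integral_Ioi_zero tendsto_id
    have := (((hv't x).neg.sub h0).const_mul (2 * Complex.I * κ x)⁻¹).const_add 1
    rw [show v x = _ from funext (hve x)]
    simpa using this

/-! ### The regular solution of the angular equation -/

/-- The triple `(c n, c (n-1), c (n-2))` of coefficients of the power series `∑ c n * y ^ n` that
solves `y (2 - y) f'' + 2 (μ + 1) (1 - y) f' + (L + z (1 - y) ^ 2) f = 0`, `f 0 = 1`; coefficients
of negative index are `0`. -/
def angTriple (μ : ℕ) (L z : ℂ) : ℕ → ℂ × ℂ × ℂ
  | 0 => (1, 0, 0)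
  | n + 1 =>
    (((n * (n + 2 * μ + 1) - L - z) * (angTriple μ L z n).1 + 2 * z * (angTriple μ L z n).2.1 -
      z * (angTriple μ L z n).2.2) / (2 * (n + 1) * (n + μ + 1)),
      (angTriple μ L z n).1, (angTriple μ L z n).2.1)

/-- The coefficients of the regular solution `angSol` of the angular equation. -/
def angCoeff (μ : ℕ) (L z : ℂ) (n : ℕ) : ℂ := (angTriple μ L z n).1

/-- The solution, regular at `y = 0` with value `1`, of
`y (2 - y) f'' + 2 (μ + 1) (1 - y) f' + (L + z (1 - y) ^ 2) f = 0`. This is the angular equation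
after the substitutions `y = 1 - cos θ`, `S = sin θ ^ μ * f`, `lam = L + μ (μ + 1)`,
`z = a ^ 2 * ω ^ 2`. -/
def angSol (μ : ℕ) (L z y : ℂ) : ℂ := ∑' n, angCoeff μ L z n * y ^ n

/-- The derivative of `angSol`. -/
def angSol' (μ : ℕ) (L z y : ℂ) : ℂ := ∑' n : ℕ, (n + 1 : ℂ) * angCoeff μ L z (n + 1) * y ^ n

/-- The second derivative of `angSol`. -/
def angSol'' (μ : ℕ) (L z y : ℂ) : ℂ :=
  ∑' n : ℕ, (n + 1 : ℂ) * ((n + 1 + 1 : ℂ) * angCoeff μ L z (n + 1 + 1)) * y ^ n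

/-- The recursion divides by `2 (n + 1) (n + μ + 1)`, so that asymptotically the coefficients gain a
factor `1 / 2`; any rate above `1 / 2` can be reached, uniformly for bounded parameters. The rate
`3 / 4` gives convergence for `|y| < 4 / 3`, beyond the equator `y = 1`. -/
theorem exists_angCoeff_bound (μ : ℕ) {R : ℝ} (hR : 0 ≤ R) :
    ∃ K : ℝ, 0 ≤ K ∧ ∀ L z : ℂ, ‖L‖ ≤ R → ‖z‖ ≤ R → ∀ n, ‖angCoeff μ L z n‖ ≤ K * (3 / 4) ^ n := by
  set A : ℝ := 7 * R with hA
  let α : ℕ → ℝ := fun n => 4 / 3 * ((n * (n + 2 * μ + 1) + A) / (2 * (n + 1) * (n + μ + 1)))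
  let M : ℕ → ℝ := fun n => ∏ k ∈ Finset.range n, max 1 (α k)
  have hMs : ∀ n, M (n + 1) = M n * max 1 (α n) := fun n => Finset.prod_range_succ _ _
  have hM0 : ∀ n, 0 ≤ M n := fun n =>
    Finset.prod_nonneg fun k _ => zero_le_one.trans (le_max_left _ _)
  have hMle : ∀ n, M n ≤ M (n + 1) := fun n => by
    rw [hMs]; exact le_mul_of_one_le_right (hM0 n) (le_max_left _ _)
  obtain ⟨N, hN⟩ := exists_nat_ge ((μ : ℝ) + 2 * A + 1)
  have hα : ∀ n, N ≤ n → α n ≤ 1 := by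
    intro n hn
    have h1 : (μ : ℝ) + 2 * A + 1 ≤ n := hN.trans (by exact_mod_cast hn)
    have h2 : (0 : ℝ) ≤ μ := by positivity
    have h3 : 0 ≤ A := by positivity
    have h4 : (0 : ℝ) < 2 * (n + 1) * (n + μ + 1) := by positivity
    simp only [α]
    rw [← mul_div_assoc, div_le_one h4]
    have h5 : (1:ℝ) ≤ n := by linarith
    nlinarith [mul_nonneg (by linarith : (0:ℝ) ≤ n - 1) h3,
      mul_nonneg (by linarith : (0:ℝ) ≤ n) (by linarith : (0:ℝ) ≤ n - μ - 2 * A - 1)]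
  have hMN : ∀ n, M n ≤ M N := by
    intro n
    rcases le_total n N with h | h
    · exact monotone_nat_of_le_succ hMle h
    · induction n, h using Nat.le_induction with
      | base => exact le_rfl
      | succ n hn ih => rw [hMs, max_eq_left (hα n hn), mul_one]; exact ih
  refine ⟨M N, hM0 N, fun L z hL hz n => ?_⟩
  have key : ∀ n, ‖(angTriple μ L z n).1‖ ≤ M n * (3 / 4) ^ n ∧
      ‖(angTriple μ L z n).2.1‖ ≤ M n * (3 / 4) ^ n * (4 / 3) ∧
      ‖(angTriple μ L z n).2.2‖ ≤ M n * (3 / 4) ^ n * (16 / 9) := by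
    intro n
    induction n with
    | zero => norm_num [angTriple, M]
    | succ n ih =>
      obtain ⟨h1, h2, h3⟩ := ih
      have hX : 0 ≤ M n * (3 / 4 : ℝ) ^ n := mul_nonneg (hM0 n) (by positivity)
      have hle : M n * (3 / 4 : ℝ) ^ n * (3 / 4) ≤ M (n + 1) * (3 / 4) ^ (n + 1) := by
        rw [pow_succ, ← mul_assoc]
        gcongr
        exact hMle n
      refine ⟨?_, ?_, ?_⟩
      · have hden : ‖(2 * (n + 1) * (n + μ + 1) : ℂ)‖ = 2 * (n + 1) * (n + μ + 1) := by
          have : (2 * (n + 1) * (n + μ + 1) : ℂ) = ((2 * (n + 1) * (n + μ + 1) : ℝ) : ℂ) := by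
            push_cast; ring
          rw [this, Complex.norm_real, Real.norm_eq_abs, abs_of_nonneg (by positivity)]
        have hnum : ‖((n : ℂ) * (n + 2 * μ + 1) - L - z)‖ ≤ n * (n + 2 * μ + 1) + 2 * R := by
          have : ‖((n : ℂ) * (n + 2 * μ + 1))‖ = n * (n + 2 * μ + 1) := by
            have : ((n : ℂ) * (n + 2 * μ + 1)) = ((n * (n + 2 * μ + 1) : ℝ) : ℂ) := by
              push_cast; ring
            rw [this, Complex.norm_real, Real.norm_eq_abs, abs_of_nonneg (by positivity)]
          calc _ ≤ ‖((n : ℂ) * (n + 2 * μ + 1))‖ + ‖L‖ + ‖z‖ :=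
                (norm_sub_le _ _).trans (add_le_add_left (norm_sub_le _ _) _)
            _ ≤ _ := by rw [this]; linarith
        simp only [angTriple]
        rw [norm_div, hden, div_le_iff₀ (by positivity)]
        have hstep : ‖(n * (n + 2 * μ + 1) - L - z) * (angTriple μ L z n).1 +
            2 * z * (angTriple μ L z n).2.1 - z * (angTriple μ L z n).2.2‖ ≤
            (n * (n + 2 * μ + 1) + A) * (M n * (3 / 4) ^ n) := by
          calc _ ≤ ‖((n : ℂ) * (n + 2 * μ + 1) - L - z)‖ * ‖(angTriple μ L z n).1‖ +
                2 * ‖z‖ * ‖(angTriple μ L z n).2.1‖ + ‖z‖ * ‖(angTriple μ L z n).2.2‖ := by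
                refine (norm_sub_le _ _).trans ?_
                refine (add_le_add_left (norm_add_le _ _) _).trans_eq ?_
                simp
            _ ≤ (n * (n + 2 * μ + 1) + 2 * R) * (M n * (3 / 4) ^ n) +
                2 * R * (M n * (3 / 4) ^ n * (4 / 3)) + R * (M n * (3 / 4) ^ n * (16 / 9)) := by
                gcongr
            _ ≤ _ := by
                rw [hA]
                nlinarith [mul_nonneg hR hX]
        refine hstep.trans ?_
        have hαe : (n * (n + 2 * μ + 1) + A) = 3 / 4 * α n * (2 * (n + 1) * (n + μ + 1)) := by
          simp only [α]
          field_simp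
        rw [hαe, hMs, pow_succ]
        have : α n ≤ max 1 (α n) := le_max_right _ _
        calc 3 / 4 * α n * (2 * (n + 1) * (n + μ + 1)) * (M n * (3 / 4) ^ n)
            = α n * (3 / 4 * (2 * (n + 1) * (n + μ + 1)) * (M n * (3 / 4) ^ n)) := by ring
          _ ≤ max 1 (α n) * (3 / 4 * (2 * (n + 1) * (n + μ + 1)) * (M n * (3 / 4) ^ n)) := by
              gcongr
          _ = _ := by ring
      · simp only [angTriple]
        linarith
      · simp only [angTriple]
        linarith
  exact (key n).1.trans (mul_le_mul_of_nonneg_right (hMN n) (by positivity))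

theorem deriv_coeff_bound {c : ℕ → ℂ} {K q q' : ℝ} (hK : 0 ≤ K) (hq : 0 < q) (hqq : q < q')
    (hc : ∀ n, ‖c n‖ ≤ K * q ^ n) :
    ∀ n : ℕ, ‖(n + 1 : ℂ) * c (n + 1)‖ ≤ K * (q * q' / (q' - q)) * q' ^ n := by
  intro n
  have hd : 0 < q' - q := by linarith
  have hb := one_add_mul_le_pow (a := (q' - q) / q) (by have := div_pos hd hq; linarith) (n + 1)
  have e : 1 + (q' - q) / q = q' / q := by field_simp; ring
  rw [e, div_pow] at hb
  have h1 : ((n : ℝ) + 1) * ((q' - q) / q) ≤ q' ^ (n + 1) / q ^ (n + 1) := by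
    push_cast at hb; linarith
  have h2 : ((n : ℝ) + 1) * (q' - q) * q ^ (n + 1) ≤ q * q' ^ (n + 1) := by
    rw [← mul_div_assoc, div_le_div_iff₀ hq (by positivity)] at h1
    linarith
  have h3 : ‖(n + 1 : ℂ)‖ = (n : ℝ) + 1 := by
    have : (n + 1 : ℂ) = ((n + 1 : ℝ) : ℂ) := by push_cast; rfl
    rw [this, Complex.norm_real, Real.norm_eq_abs, abs_of_nonneg (by positivity)]
  rw [norm_mul, h3]
  calc ((n : ℝ) + 1) * ‖c (n + 1)‖ ≤ ((n : ℝ) + 1) * (K * q ^ (n + 1)) := by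
        gcongr; exact hc _
    _ = K * (((n : ℝ) + 1) * (q' - q) * q ^ (n + 1)) / (q' - q) := by field_simp
    _ ≤ K * (q * q' ^ (n + 1)) / (q' - q) := by gcongr
    _ = _ := by rw [pow_succ]; field_simp

theorem summable_coeff {c : ℕ → ℂ} {K q : ℝ} (hq : 0 < q)
    (hc : ∀ n, ‖c n‖ ≤ K * q ^ n) {y : ℂ} (hy : ‖y‖ * q < 1) : Summable fun n => c n * y ^ n := by
  refine Summable.of_norm_bounded (g := fun n => K * (q * ‖y‖) ^ n) ?_ fun n => ?_
  · exact (summable_geometric_of_lt_one (by positivity) (by linarith)).mul_left K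
  · rw [norm_mul, norm_pow, mul_pow, ← mul_assoc]
    gcongr
    exact hc n

theorem hasDerivAt_coeff {c : ℕ → ℂ} {K q : ℝ} (hq : 0 < q)
    (hc : ∀ n, ‖c n‖ ≤ K * q ^ n) {y : ℂ} (hy : ‖y‖ * q < 1) :
    HasDerivAt (fun y => ∑' n, c n * y ^ n) (∑' n : ℕ, (n + 1 : ℂ) * c (n + 1) * y ^ n) y := by
  obtain ⟨r, hr1, hr2⟩ := exists_between ((lt_div_iff₀ hq).2 hy)
  have hr0 : 0 < r := (norm_nonneg _).trans_lt hr1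
  have hrq : r * q < 1 := (lt_div_iff₀ hq).1 hr2
  have hsum : Summable fun n : ℕ => K * r⁻¹ * ((n : ℝ) ^ 1 * (q * r) ^ n) := by
    have h1 : ‖q * r‖ < 1 := by
      rw [Real.norm_eq_abs, abs_of_nonneg (by positivity)]
      linarith
    exact (summable_pow_mul_geometric_of_norm_lt_one (R := ℝ) 1 h1).mul_left _
  have hbd : ∀ (n : ℕ) (y : ℂ), ‖y‖ ≤ r →
      ‖c n * (n * y ^ (n - 1))‖ ≤ K * r⁻¹ * ((n : ℝ) ^ 1 * (q * r) ^ n) := by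
    intro n y hy
    rcases n with _ | n
    · simp
    · rw [norm_mul, norm_mul, norm_pow, Complex.norm_natCast, Nat.add_sub_cancel]
      calc ‖c (n + 1)‖ * (((n + 1 : ℕ) : ℝ) * ‖y‖ ^ n)
          ≤ (K * q ^ (n + 1)) * (((n + 1 : ℕ) : ℝ) * r ^ n) := by
            refine mul_le_mul (hc _) ?_ (by positivity) ((norm_nonneg _).trans (hc _))
            gcongr
        _ = _ := by rw [mul_pow, pow_succ r]; field_simp
  have hder : ∀ (n : ℕ) (y : ℂ), HasDerivAt (fun y => c n * y ^ n) (c n * (n * y ^ (n - 1))) y :=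
    fun n y => (hasDerivAt_pow n y).const_mul (c n)
  have hs0 : Summable fun n => c n * (0:ℂ) ^ n := by
    refine summable_of_ne_finset_zero (s := {0}) fun n hn => ?_
    have : n ≠ 0 := by simpa using hn
    simp [this]
  have h : HasDerivAt (fun y => ∑' n, c n * y ^ n) (∑' n : ℕ, c n * (n * y ^ (n - 1))) y :=
    hasDerivAt_tsum_of_isPreconnected hsum
      (Metric.isOpen_ball (x := (0:ℂ)) (ε := r)) (convex_ball _ _).isPreconnected
      (fun n y _ => hder n y) (fun n y hy => hbd n y (mem_ball_zero_iff.1 hy).le)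
      (by simpa using hr0) hs0 (by simpa using hr1)
  convert h using 1
  rw [Summable.tsum_eq_zero_add (Summable.of_norm_bounded hsum fun n => hbd n y hr1.le)]
  simp only [Nat.cast_zero, zero_mul, mul_zero, zero_add, Nat.add_sub_cancel]
  congr 1
  funext n
  push_cast
  ring

theorem exists_deriv_coeff_bound {c : ℕ → ℂ} {K q t : ℝ} (hK : 0 ≤ K) (hq : 0 < q)
    (hc : ∀ n, ‖c n‖ ≤ K * q ^ n) (ht : 0 ≤ t) (htq : t * q < 1) :
    ∃ K' q' : ℝ, 0 ≤ K' ∧ 0 < q' ∧ t * q' < 1 ∧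
      ∀ n : ℕ, ‖(n + 1 : ℂ) * c (n + 1)‖ ≤ K' * q' ^ n := by
  obtain ⟨q', hqq, hq'⟩ : ∃ q', q < q' ∧ t * q' < 1 := by
    rcases ht.eq_or_lt with rfl | ht
    · exact ⟨q + 1, by linarith, by simp⟩
    · obtain ⟨q', h1, h2⟩ := exists_between ((lt_div_iff₀' ht).2 htq)
      exact ⟨q', h1, (lt_div_iff₀' ht).1 h2⟩
  have : 0 < q' - q := sub_pos.2 hqq
  have hq0 : 0 < q' := hq.trans hqq
  exact ⟨_, q', by positivity, hq0, hq', deriv_coeff_bound hK hq hqq hc⟩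

theorem hasSum_shift {g u : ℕ → ℂ} {a y : ℂ} (h : HasSum g a) (h0 : u 0 = 0)
    (hu : ∀ n, u (n + 1) = y * g n) : HasSum u (y * a) := by
  rw [← hasSum_nat_add_iff' 1]
  simp only [Finset.range_one, Finset.sum_singleton, h0, sub_zero, hu]
  exact h.mul_left y

/-- The power series solves the angular equation inside any disc on which its coefficients are
geometrically bounded. -/
theorem angSol_ode_of_bound (μ : ℕ) (L z : ℂ) {K q : ℝ} (hK : 0 ≤ K) (hq : 0 < q)
    (hc : ∀ n, ‖angCoeff μ L z n‖ ≤ K * q ^ n) {y : ℂ} (hy : ‖y‖ * q < 1) :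
    HasDerivAt (angSol μ L z) (angSol' μ L z y) y ∧
    HasDerivAt (angSol' μ L z) (angSol'' μ L z y) y ∧
    y * (2 - y) * angSol'' μ L z y + 2 * (μ + 1) * (1 - y) * angSol' μ L z y +
      (L + z * (1 - y) ^ 2) * angSol μ L z y = 0 := by
  obtain ⟨K₁, q₁, hK₁, hq₁, hy₁, h1⟩ := exists_deriv_coeff_bound hK hq hc (norm_nonneg y) hy
  obtain ⟨K₂, q₂, hK₂, hq₂, hy₂, h2⟩ := exists_deriv_coeff_bound
    (c := fun n => (n + 1 : ℂ) * angCoeff μ L z (n + 1)) hK₁ hq₁ h1 (norm_nonneg y) hy₁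
  push_cast at h2
  refine ⟨hasDerivAt_coeff hq hc hy, ?_, ?_⟩
  · have := hasDerivAt_coeff (c := fun n => (n + 1 : ℂ) * angCoeff μ L z (n + 1)) hq₁ h1 hy₁
    push_cast at this
    exact this
  have F0 := (summable_coeff hq hc hy).hasSum
  have F1 := (summable_coeff hq₁ h1 hy₁).hasSum
  have F2 := (summable_coeff hq₂ h2 hy₂).hasSum
  have yF1 := hasSum_shift (u := fun n : ℕ => (n : ℂ) * angCoeff μ L z n * y ^ n) (y := y) F1
    (by simp) (fun n => by push_cast; ring)
  have yF2 := hasSum_shift (u := fun n : ℕ => (n : ℂ) * ((n + 1 : ℂ) * angCoeff μ L z (n + 1)) * y ^ n)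
    (y := y) F2 (by simp) (fun n => by push_cast; ring)
  have yyF2 := hasSum_shift (u := fun n : ℕ => ((n : ℂ) - 1) * (n * angCoeff μ L z n) * y ^ n)
    (y := y) yF2 (by simp) (fun n => by push_cast; ring)
  have yF0 := hasSum_shift (u := fun n : ℕ => (angTriple μ L z n).2.1 * y ^ n) (y := y) F0
    (by simp [angTriple]) (fun n => by simp only [angTriple, angCoeff]; ring)
  have yyF0 := hasSum_shift (u := fun n : ℕ => (angTriple μ L z n).2.2 * y ^ n) (y := y) yF0
    (by simp [angTriple]) (fun n => by simp only [angTriple]; ring)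
  have S := ((((((yF2.mul_left 2).sub yyF2).add ((F1.sub yF1).mul_left (2 * ((μ : ℂ) + 1)))).add
    (F0.mul_left (L + z))).sub (yF0.mul_left (2 * z))).add (yyF0.mul_left z))
  rw [show (fun n : ℕ => 2 * ((n : ℂ) * ((n + 1 : ℂ) * angCoeff μ L z (n + 1)) * y ^ n) -
      ((n : ℂ) - 1) * (n * angCoeff μ L z n) * y ^ n +
      2 * ((μ : ℂ) + 1) * ((n + 1 : ℂ) * angCoeff μ L z (n + 1) * y ^ n -
        (n : ℂ) * angCoeff μ L z n * y ^ n) + (L + z) * (angCoeff μ L z n * y ^ n) -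
      2 * z * ((angTriple μ L z n).2.1 * y ^ n) + z * ((angTriple μ L z n).2.2 * y ^ n)) =
      fun _ => 0 from funext fun n => by
    have hrec : angCoeff μ L z (n + 1) * (2 * (n + 1) * (n + μ + 1)) =
        (n * (n + 2 * μ + 1) - L - z) * angCoeff μ L z n + 2 * z * (angTriple μ L z n).2.1 -
        z * (angTriple μ L z n).2.2 := by
      simp only [angCoeff, angTriple]
      refine div_mul_cancel₀ _ ?_
      have h1 : (n + 1 : ℂ) ≠ 0 := by exact_mod_cast Nat.succ_ne_zero n
      have h2 : (n + μ + 1 : ℂ) ≠ 0 := by exact_mod_cast Nat.succ_ne_zero (n + μ)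
      exact mul_ne_zero (mul_ne_zero two_ne_zero h1) h2
    linear_combination (y ^ n) * hrec] at S
  have := S.unique hasSum_zero
  simp only [angSol, angSol', angSol'']
  linear_combination this

theorem angSol_ode (μ : ℕ) (L z : ℂ) {y : ℂ} (hy : ‖y‖ < 4 / 3) :
    HasDerivAt (angSol μ L z) (angSol' μ L z y) y ∧
    HasDerivAt (angSol' μ L z) (angSol'' μ L z y) y ∧
    y * (2 - y) * angSol'' μ L z y + 2 * (μ + 1) * (1 - y) * angSol' μ L z y +
      (L + z * (1 - y) ^ 2) * angSol μ L z y = 0 := by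
  obtain ⟨K, hK, h⟩ := exists_angCoeff_bound μ (R := ‖L‖ + ‖z‖) (by positivity)
  exact angSol_ode_of_bound μ L z hK (by norm_num)
    (h L z (by linarith [norm_nonneg z]) (by linarith [norm_nonneg L])) (by linarith)

theorem continuous_angTriple (μ n : ℕ) :
    Continuous fun p : ℂ × ℂ => angTriple μ p.1 p.2 n := by
  induction n with
  | zero => exact continuous_const
  | succ n ih =>
    simp only [angTriple]
    fun_prop

/-- Projection of the real line onto `[0, 1]`. Composition with it turns continuity of `angSol` on
`[0, 1]` into continuity on the line, which the lemmas on parametric integrals ask for. -/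
def clampUnit (y : ℝ) : ℝ := max 0 (min y 1)

theorem continuous_clampUnit : Continuous clampUnit := by unfold clampUnit; fun_prop

theorem norm_clampUnit_le (y : ℝ) : ‖(clampUnit y : ℂ)‖ ≤ 1 := by
  rw [Complex.norm_real, Real.norm_eq_abs, abs_of_nonneg (le_max_left _ _)]
  exact max_le zero_le_one (min_le_right _ _)

theorem clampUnit_of_mem {y : ℝ} (h0 : 0 ≤ y) (h1 : y ≤ 1) : clampUnit y = y := by
  rw [clampUnit, min_eq_left h1, max_eq_right h0]

theorem continuous_angSol_clamp (μ : ℕ) :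
    Continuous (fun p : (ℂ × ℂ) × ℝ => angSol μ p.1.1 p.1.2 (clampUnit p.2)) ∧
    Continuous (fun p : (ℂ × ℂ) × ℝ => angSol' μ p.1.1 p.1.2 (clampUnit p.2)) := by
  have hc : ∀ n, Continuous fun p : (ℂ × ℂ) × ℝ => angCoeff μ p.1.1 p.1.2 n := fun n =>
    ((continuous_angTriple μ n).comp continuous_fst).fst
  have hcl : Continuous fun p : (ℂ × ℂ) × ℝ => (clampUnit p.2 : ℂ) :=
    Complex.continuous_ofReal.comp (continuous_clampUnit.comp continuous_snd)
  rw [continuous_iff_continuousAt, continuous_iff_continuousAt, ← forall_and]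
  rintro ⟨⟨L₀, z₀⟩, y₀⟩
  obtain ⟨K, hK, h⟩ := exists_angCoeff_bound μ (R := ‖L₀‖ + ‖z₀‖ + 1) (by positivity)
  obtain ⟨s, hsdef⟩ : ∃ s : Set ((ℂ × ℂ) × ℝ), s =
      {p | ‖p.1.1‖ < ‖L₀‖ + ‖z₀‖ + 1 ∧ ‖p.1.2‖ < ‖L₀‖ + ‖z₀‖ + 1} :=
    ⟨_, rfl⟩
  have hs : IsOpen s := by
    rw [hsdef]
    exact (isOpen_lt (continuous_fst.fst.norm) continuous_const).inter
      (isOpen_lt (continuous_fst.snd.norm) continuous_const)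
  have hmem : ((L₀, z₀), y₀) ∈ s :=
    hsdef ▸ ⟨by simp only; linarith [norm_nonneg z₀], by simp only; linarith [norm_nonneg L₀]⟩
  have h0 : ∀ p ∈ s, ∀ n, ‖angCoeff μ p.1.1 p.1.2 n‖ ≤ K * (3 / 4) ^ n :=
    fun p hp => by
      rw [hsdef] at hp
      exact h _ _ hp.1.le hp.2.le
  constructor
  · refine (continuousOn_tsum (u := fun n => K * (3 / 4) ^ n) (s := s) ?_ ?_ ?_).continuousAt
      (hs.mem_nhds hmem)
    · exact fun n => ((hc n).mul (hcl.pow n)).continuousOn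
    · exact (summable_geometric_of_lt_one (by norm_num) (by norm_num)).mul_left K
    · intro n p hp
      rw [norm_mul, norm_pow]
      exact (mul_le_of_le_one_right (norm_nonneg _)
        (pow_le_one₀ (norm_nonneg _) (norm_clampUnit_le _))).trans (h0 p hp n)
  · refine (continuousOn_tsum (u := fun n => K * ((3 / 4) * (4 / 5) / (4 / 5 - 3 / 4)) * (4 / 5) ^ n)
      (s := s) ?_ ?_ ?_).continuousAt (hs.mem_nhds hmem)
    · exact fun n => ((continuous_const.mul (hc (n + 1))).mul (hcl.pow n)).continuousOn
    · exact (summable_geometric_of_lt_one (by norm_num) (by norm_num)).mul_left _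
    · intro n p hp
      rw [norm_mul, norm_pow]
      exact (mul_le_of_le_one_right (norm_nonneg _)
        (pow_le_one₀ (norm_nonneg _) (norm_clampUnit_le _))).trans
        (deriv_coeff_bound hK (by norm_num) (by norm_num) (h0 p hp) n)

theorem angSol_zero (μ : ℕ) (L z : ℂ) : angSol μ L z 0 = 1 := by
  unfold angSol
  rw [tsum_eq_single 0 (fun n hn => by simp [hn])]
  simp [angCoeff, angTriple]

open ComplexConjugate in
/-- The coefficients are real for real parameters. -/
theorem angSol_conj (μ : ℕ) (L z : ℂ) (y : ℝ) :
    angSol μ (conj L) (conj z) y = conj (angSol μ L z y) ∧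
    angSol' μ (conj L) (conj z) y = conj (angSol' μ L z y) := by
  have h : ∀ n, angTriple μ (conj L) (conj z) n = (conj (angTriple μ L z n).1,
      conj (angTriple μ L z n).2.1, conj (angTriple μ L z n).2.2) := by
    intro n
    induction n with
    | zero => simp [angTriple]
    | succ n ih =>
      have h2 : conj (2 : ℂ) = 2 := Complex.conj_ofNat 2
      simp [angTriple, ih, h2]
  have h' : ∀ n, angCoeff μ (conj L) (conj z) n = conj (angCoeff μ L z n) := fun n => by
    simp [angCoeff, h]
  constructor
  · simp [angSol, Complex.conj_tsum, h']
  · simp [angSol', Complex.conj_tsum, h']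

/-- **Green's identity** for two regular solutions. -/
theorem angSol_green (μ : ℕ) (L₁ z₁ L₂ z₂ : ℂ) :
    angSol μ L₁ z₁ 1 * angSol' μ L₂ z₂ 1 - angSol' μ L₁ z₁ 1 * angSol μ L₂ z₂ 1 =
      ∫ y in (0:ℝ)..1, ((L₁ - L₂) + (z₁ - z₂) * (1 - y) ^ 2) *
        (angSol μ L₁ z₁ y * angSol μ L₂ z₂ y * ((y * (2 - y) : ℝ) : ℂ) ^ μ) := by
  have hy : ∀ y ∈ uIcc (0:ℝ) 1, ‖(y : ℂ)‖ < 4 / 3 := by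
    intro y hy
    rw [uIcc_of_le zero_le_one] at hy
    rw [Complex.norm_real, Real.norm_eq_abs, abs_of_nonneg hy.1]
    linarith [hy.2]
  have hd : ∀ L z : ℂ, ∀ y ∈ uIcc (0:ℝ) 1, HasDerivAt (fun y : ℝ => angSol μ L z y)
      (angSol' μ L z y) y := fun L z y h => (angSol_ode μ L z (hy y h)).1.comp_ofReal
  have hd' : ∀ L z : ℂ, ∀ y ∈ uIcc (0:ℝ) 1, HasDerivAt (fun y : ℝ => angSol' μ L z y)
      (angSol'' μ L z y) y := fun L z y h => (angSol_ode μ L z (hy y h)).2.1.comp_ofReal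
  have key : ∀ y ∈ uIcc (0:ℝ) 1, HasDerivAt (fun y : ℝ => ((y : ℂ) * (2 - y)) ^ (μ + 1) *
      (angSol μ L₁ z₁ y * angSol' μ L₂ z₂ y - angSol' μ L₁ z₁ y * angSol μ L₂ z₂ y))
      (((L₁ - L₂) + (z₁ - z₂) * (1 - y) ^ 2) *
        (angSol μ L₁ z₁ y * angSol μ L₂ z₂ y * ((y * (2 - y) : ℝ) : ℂ) ^ μ)) y := by
    intro y h
    have h1 : HasDerivAt (fun s : ℝ => (s : ℂ)) 1 y := Complex.ofRealCLM.hasDerivAt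
    have hp := (h1.mul (h1.const_sub 2)).fun_pow (μ + 1)
    have hW := ((hd L₁ z₁ y h).mul (hd' L₂ z₂ y h)).sub ((hd' L₁ z₁ y h).mul (hd L₂ z₂ y h))
    refine (hp.mul hW).congr_deriv ?_
    have o1 := (angSol_ode μ L₁ z₁ (hy y h)).2.2
    have o2 := (angSol_ode μ L₂ z₂ (hy y h)).2.2
    simp only [Nat.add_sub_cancel, Pi.mul_apply, Pi.sub_apply]
    push_cast
    rw [pow_succ]
    linear_combination ((y:ℂ) * (2 - y)) ^ μ * (angSol μ L₁ z₁ y) * o2 -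
      ((y:ℂ) * (2 - y)) ^ μ * (angSol μ L₂ z₂ y) * o1
  have hint := intervalIntegral.integral_eq_sub_of_hasDerivAt key ?_
  · rw [hint]
    push_cast
    norm_num
  · refine ContinuousOn.intervalIntegrable fun y h => ContinuousAt.continuousWithinAt ?_
    have a1 := (hd L₁ z₁ y h).continuousAt
    have a2 := (hd L₂ z₂ y h).continuousAt
    refine ContinuousAt.mul (by fun_prop) ((a1.mul a2).mul (by fun_prop))

/-! ### Zeros of the equatorial data and their holomorphic continuation -/

/-- Uniqueness for `u'' = a u' + b u`; the coefficients only need to be bounded. -/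
theorem linear_ode_zero {a b : ℝ → ℂ} {α β t₀ C : ℝ} {u u' : ℝ → ℂ}
    (hC : ∀ t ∈ Ioo α β, ‖a t‖ ≤ C ∧ ‖b t‖ ≤ C) (ht : t₀ ∈ Ioo α β)
    (hu : ∀ t ∈ Ioo α β, HasDerivAt u (u' t) t)
    (hu' : ∀ t ∈ Ioo α β, HasDerivAt u' (a t * u' t + b t * u t) t)
    (h0 : u t₀ = 0) (h0' : u' t₀ = 0) : ∀ t ∈ Ioo α β, u t = 0 ∧ u' t = 0 := by
  have hC0 : 0 ≤ C := (norm_nonneg _).trans (hC t₀ ht).1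
  let v : ℝ → ℂ × ℂ → ℂ × ℂ := fun t p => (p.2, a t * p.2 + b t * p.1)
  have hv : ∀ t ∈ Ioo α β, LipschitzOnWith (Real.toNNReal (2 * C + 1)) (v t) univ := by
    intro t ht
    refine (LipschitzWith.of_dist_le_mul fun p q => ?_).lipschitzOnWith
    rw [Real.coe_toNNReal _ (by positivity), dist_eq_norm, dist_eq_norm]
    have h1 : ‖(p - q).1‖ ≤ ‖p - q‖ := norm_fst_le _
    have h2 : ‖(p - q).2‖ ≤ ‖p - q‖ := norm_snd_le _
    have e : v t p - v t q = ((p - q).2, a t * (p - q).2 + b t * (p - q).1) := by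
      ext <;> simp [v]
      ring
    rw [e, Prod.norm_mk]
    refine max_le ?_ ?_
    · nlinarith [norm_nonneg (p - q)]
    · calc _ ≤ ‖a t‖ * ‖(p - q).2‖ + ‖b t‖ * ‖(p - q).1‖ := by
            refine (norm_add_le _ _).trans ?_; rw [norm_mul, norm_mul]
        _ ≤ C * ‖p - q‖ + C * ‖p - q‖ := by
            gcongr
            · exact (hC t ht).1
            · exact (hC t ht).2
        _ ≤ _ := by nlinarith [norm_nonneg (p - q)]
  have := ODE_solution_unique_of_mem_Ioo (f := fun t => (u t, u' t)) (g := fun _ => (0, 0)) hv ht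
    (fun t ht => ⟨(hu t ht).prodMk (hu' t ht), mem_univ _⟩)
    (fun t ht => ⟨(hasDerivAt_const t ((0 : ℂ), (0 : ℂ))).congr_deriv (by simp [v]; rfl),
      mem_univ _⟩) (by simp [h0, h0'])
  intro t ht
  have := this ht
  simpa using this

theorem hasDerivAt_angSol_real (μ : ℕ) (L z : ℂ) {y : ℝ} (hy : y ∈ Ioo (-(4 / 3) : ℝ) (4 / 3)) :
    HasDerivAt (fun y : ℝ => angSol μ L z y) (angSol' μ L z y) y ∧
    HasDerivAt (fun y : ℝ => angSol' μ L z y) (angSol'' μ L z y) y ∧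
    (y : ℂ) * (2 - y) * angSol'' μ L z y + 2 * (μ + 1) * (1 - y) * angSol' μ L z y +
      (L + z * (1 - y) ^ 2) * angSol μ L z y = 0 := by
  have : ‖(y : ℂ)‖ < 4 / 3 := by
    rw [Complex.norm_real, Real.norm_eq_abs]; exact abs_lt.2 hy
  obtain ⟨h1, h2, h3⟩ := angSol_ode μ L z this
  exact ⟨h1.comp_ofReal, h2.comp_ofReal, h3⟩

/-- The Cauchy data of the regular solution do not vanish, since it equals `1` at the pole. -/
theorem angSol_cauchyData_ne_zero (μ : ℕ) (L z : ℂ) {y : ℝ} (hy : y ∈ Ioc (0 : ℝ) 1)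
    (h0 : angSol μ L z y = 0) (h1 : angSol' μ L z y = 0) : False := by
  -- near `y = 0` the solution does not vanish
  have hc : ContinuousAt (fun y : ℝ => angSol μ L z y) 0 :=
    (hasDerivAt_angSol_real μ L z (by norm_num)).1.continuousAt
  have hne : ∀ᶠ c : ℝ in 𝓝 0, angSol μ L z (c : ℂ) ≠ 0 :=
    hc.eventually_ne (by simp [angSol_zero])
  obtain ⟨c, hc1, hc2⟩ := ((hne.filter_mono nhdsWithin_le_nhds).and
    (Ioo_mem_nhdsGT hy.1)).exists
  have hc0 : 0 < c / 2 := by linarith [hc2.1]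
  have hb : ∃ C, ∀ t ∈ Icc (c / 2) (7 / 6),
      ‖-(2 * (μ + 1) * (1 - t) : ℂ) / (t * (2 - t))‖ ≤ C ∧
      ‖-(L + z * (1 - t) ^ 2 : ℂ) / (t * (2 - t))‖ ≤ C := by
    have hden : ∀ t ∈ Icc (c / 2) (7 / 6), (t * (2 - t) : ℂ) ≠ 0 := by
      intro t ht
      have : t * (2 - t) ≠ 0 := by nlinarith [ht.1, ht.2]
      exact_mod_cast this
    obtain ⟨C₁, h₁⟩ := isCompact_Icc.exists_bound_of_continuousOn (s := Icc (c / 2) (7 / 6))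
      (f := fun t : ℝ => -(2 * (μ + 1) * (1 - t) : ℂ) / (t * (2 - t)))
      (ContinuousOn.div (by fun_prop) (by fun_prop) hden)
    obtain ⟨C₂, h₂⟩ := isCompact_Icc.exists_bound_of_continuousOn (s := Icc (c / 2) (7 / 6))
      (f := fun t : ℝ => -(L + z * (1 - t) ^ 2 : ℂ) / (t * (2 - t)))
      (ContinuousOn.div (by fun_prop) (by fun_prop) hden)
    exact ⟨max C₁ C₂, fun t ht => ⟨(h₁ t ht).trans (le_max_left _ _),
      (h₂ t ht).trans (le_max_right _ _)⟩⟩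
  obtain ⟨C, hC⟩ := hb
  have key := linear_ode_zero (u := fun y : ℝ => angSol μ L z y)
    (u' := fun y : ℝ => angSol' μ L z y) (α := c / 2) (β := 7 / 6) (t₀ := y)
    (fun t ht => hC t (Ioo_subset_Icc_self ht))
    ⟨by linarith [hc2.2], by linarith [hy.2]⟩
    (fun t ht => (hasDerivAt_angSol_real μ L z ⟨by linarith [ht.1], by linarith [ht.2]⟩).1)
    (fun t ht => by
      obtain ⟨-, h2, h3⟩ := hasDerivAt_angSol_real μ L z (y := t)
        ⟨by linarith [ht.1], by linarith [ht.2]⟩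
      refine h2.congr_deriv ?_
      have hden : (t * (2 - t) : ℂ) ≠ 0 := by
        have : t * (2 - t) ≠ 0 := by nlinarith [ht.1, ht.2]
        exact_mod_cast this
      rw [div_mul_eq_mul_div, div_mul_eq_mul_div, ← add_div, eq_div_iff hden]
      linear_combination h3) h0 h1 c ⟨by linarith, by linarith [hc2.2, hy.2]⟩
  exact hc1 key.1

/-- The function of the parameters `p = (L, z)` whose zeros are the eigenvalues with even (`true`)
or odd (`false`) eigenfunctions. -/
def angD (μ : ℕ) (σ : Bool) (p : ℂ × ℂ) : ℂ :=
  bif σ then angSol' μ p.1 p.2 1 else angSol μ p.1 p.2 1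

/-- The Cauchy datum at the equator complementary to `angD`. -/
def angE (μ : ℕ) (σ : Bool) (p : ℂ × ℂ) : ℂ :=
  bif σ then -angSol μ p.1 p.2 1 else angSol' μ p.1 p.2 1

/-- The weighted moments `∫ (1 - y) ^ (2 k) f_p f_q (y (2 - y)) ^ μ` over `[0, 1]`. -/
def angJ (μ k : ℕ) (p q : ℂ × ℂ) : ℂ :=
  ∫ y in (0:ℝ)..1, (1 - y : ℂ) ^ (2 * k) *
    (angSol μ p.1 p.2 y * angSol μ q.1 q.2 y * ((y * (2 - y) : ℝ) : ℂ) ^ μ)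

theorem continuous_angJ (μ k : ℕ) :
    Continuous fun x : (ℂ × ℂ) × (ℂ × ℂ) => angJ μ k x.1 x.2 := by
  have e : (fun x : (ℂ × ℂ) × (ℂ × ℂ) => angJ μ k x.1 x.2) = fun x =>
      ∫ y in (0:ℝ)..1, (1 - y : ℂ) ^ (2 * k) *
        (angSol μ x.1.1 x.1.2 (clampUnit y) * angSol μ x.2.1 x.2.2 (clampUnit y) *
          ((y * (2 - y) : ℝ) : ℂ) ^ μ) := by
    funext x
    refine intervalIntegral.integral_congr fun y hy => ?_
    rw [uIcc_of_le zero_le_one] at hy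
    simp only [clampUnit_of_mem hy.1 hy.2]
  rw [e]
  refine intervalIntegral.continuous_parametric_intervalIntegral_of_continuous ?_ continuous_const
  have h := (continuous_angSol_clamp μ).1
  have h1 : Continuous fun q : ((ℂ × ℂ) × (ℂ × ℂ)) × ℝ =>
      angSol μ q.1.1.1 q.1.1.2 (clampUnit q.2) :=
    h.comp (by fun_prop : Continuous fun q : ((ℂ × ℂ) × (ℂ × ℂ)) × ℝ => (q.1.1, q.2))
  have h2 : Continuous fun q : ((ℂ × ℂ) × (ℂ × ℂ)) × ℝ =>
      angSol μ q.1.2.1 q.1.2.2 (clampUnit q.2) :=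
    h.comp (by fun_prop : Continuous fun q : ((ℂ × ℂ) × (ℂ × ℂ)) × ℝ => (q.1.2, q.2))
  have h3 : Continuous fun q : ((ℂ × ℂ) × (ℂ × ℂ)) × ℝ => (1 - q.2 : ℂ) ^ (2 * k) := by fun_prop
  have h4 : Continuous fun q : ((ℂ × ℂ) × (ℂ × ℂ)) × ℝ => ((q.2 * (2 - q.2) : ℝ) : ℂ) ^ μ := by
    fun_prop
  exact h3.mul ((h1.mul h2).mul h4)

attribute [irreducible] angJ

theorem continuous_angD_angE (μ : ℕ) (σ : Bool) : Continuous (angD μ σ) ∧ Continuous (angE μ σ) := by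
  have h1 : clampUnit 1 = 1 := clampUnit_of_mem zero_le_one le_rfl
  have a : Continuous fun p : ℂ × ℂ => angSol μ p.1 p.2 1 := by
    have := (continuous_angSol_clamp μ).1.comp (by fun_prop : Continuous fun p : ℂ × ℂ => (p, (1:ℝ)))
    simpa [Function.comp_def, h1] using this
  have b : Continuous fun p : ℂ × ℂ => angSol' μ p.1 p.2 1 := by
    have := (continuous_angSol_clamp μ).2.comp (by fun_prop : Continuous fun p : ℂ × ℂ => (p, (1:ℝ)))
    simpa [Function.comp_def, h1] using this
  cases σ
  · exact ⟨a, b⟩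
  · exact ⟨b, a.neg⟩

/-- Green's identity in terms of the data at the equator: the same for both parities. -/
theorem angD_green (μ : ℕ) (σ : Bool) (p q : ℂ × ℂ) :
    angD μ σ p * angE μ σ q - angE μ σ p * angD μ σ q =
      (p.1 - q.1) * angJ μ 0 p q + (p.2 - q.2) * angJ μ 1 p q := by
  have hc : ∀ k, IntervalIntegrable (fun y : ℝ => (1 - y : ℂ) ^ (2 * k) *
    (angSol μ p.1 p.2 y * angSol μ q.1 q.2 y * ((y * (2 - y) : ℝ) : ℂ) ^ μ)) volume 0 1 := by
    intro k
    refine ContinuousOn.intervalIntegrable fun y h => ContinuousAt.continuousWithinAt ?_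
    rw [uIcc_of_le zero_le_one] at h
    have hy : y ∈ Ioo (-(4 / 3) : ℝ) (4 / 3) := ⟨by linarith [h.1], by linarith [h.2]⟩
    have a1 := (hasDerivAt_angSol_real μ p.1 p.2 hy).1.continuousAt
    have a2 := (hasDerivAt_angSol_real μ q.1 q.2 hy).1.continuousAt
    exact ContinuousAt.mul (by fun_prop) ((a1.mul a2).mul (by fun_prop))
  have h := angSol_green μ p.1 p.2 q.1 q.2
  have e : (p.1 - q.1) * angJ μ 0 p q + (p.2 - q.2) * angJ μ 1 p q =
      ∫ y in (0:ℝ)..1, ((p.1 - q.1) + (p.2 - q.2) * (1 - y) ^ 2) *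
        (angSol μ p.1 p.2 y * angSol μ q.1 q.2 y * ((y * (2 - y) : ℝ) : ℂ) ^ μ) := by
    simp only [angJ]
    rw [← intervalIntegral.integral_const_mul, ← intervalIntegral.integral_const_mul,
      ← intervalIntegral.integral_add ((hc 0).const_mul _) ((hc 1).const_mul _)]
    congr 1
    funext y
    ring
  rw [e, ← h]
  cases σ
  · simp [angD, angE]
  · simp only [angD, angE, cond_true]; ring

theorem angE_ne_zero (μ : ℕ) (σ : Bool) (p : ℂ × ℂ) (h : angD μ σ p = 0) : angE μ σ p ≠ 0 := by
  intro h2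
  have h1 : (1 : ℝ) ∈ Ioc (0 : ℝ) 1 := by norm_num
  cases σ
  · exact angSol_cauchyData_ne_zero μ p.1 p.2 h1 (by simpa [angD] using h) (by simpa [angE] using h2)
  · exact angSol_cauchyData_ne_zero μ p.1 p.2 h1 (by simpa [angE] using h2) (by simpa [angD] using h)

open ComplexConjugate in
theorem angD_conj (μ : ℕ) (σ : Bool) (L z : ℂ) :
    angD μ σ (conj L, conj z) = conj (angD μ σ (L, z)) := by
  have := angSol_conj μ L z 1
  push_cast at this
  cases σ <;> simp [angD, this]

theorem exists_angSol_ne_zero (μ : ℕ) (L z : ℂ) : ∃ c : ℝ, c ∈ Ioo (0 : ℝ) 1 ∧ angSol μ L z c ≠ 0 := by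
  by_contra! h
  have h1 : HasDerivAt (fun y : ℝ => angSol μ L z y) 0 (1 / 2) := by
    refine (hasDerivAt_const (1 / 2 : ℝ) (0 : ℂ)).congr_of_eventuallyEq ?_
    filter_upwards [Ioo_mem_nhds (by norm_num : (0:ℝ) < 1 / 2) (by norm_num : (1/2 : ℝ) < 1)]
      with y hy using h y hy
  exact angSol_cauchyData_ne_zero μ L z (y := 1 / 2) (by norm_num) (h _ (by norm_num))
    ((hasDerivAt_angSol_real μ L z (by norm_num)).1.unique h1)

theorem continuousOn_angSol_Icc (μ : ℕ) (L z : ℂ) :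
    ContinuousOn (fun y : ℝ => angSol μ L z y) (Icc 0 1) ∧
    ContinuousOn (fun y : ℝ => angSol' μ L z y) (Icc 0 1) := by
  constructor <;> intro y hy
  · exact (hasDerivAt_angSol_real μ L z
      ⟨by linarith [hy.1], by linarith [hy.2]⟩).1.continuousAt.continuousWithinAt
  · exact (hasDerivAt_angSol_real μ L z
      ⟨by linarith [hy.1], by linarith [hy.2]⟩).2.1.continuousAt.continuousWithinAt

open ComplexConjugate in
theorem exists_angJ_conj_pos (μ : ℕ) (L : ℂ) (z : ℝ) : ∃ r₀ r₁ : ℝ, 0 < r₁ ∧ r₁ < r₀ ∧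
    angJ μ 0 (conj L, z) (L, z) = r₀ ∧ angJ μ 1 (conj L, z) (L, z) = r₁ := by
  have hf := (continuousOn_angSol_Icc μ L z).1
  let g : ℕ → ℝ → ℝ := fun k y =>
    (1 - y) ^ (2 * k) * (‖angSol μ L z y‖ ^ 2 * (y * (2 - y)) ^ μ)
  have hg : ∀ k, ContinuousOn (g k) (Icc 0 1) := fun k => by
    have := hf.norm
    exact ContinuousOn.mul (by fun_prop) ((this.pow 2).mul (by fun_prop))
  have hw : ∀ y ∈ Icc (0:ℝ) 1, 0 ≤ y * (2 - y) := fun y hy => by nlinarith [hy.1, hy.2]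
  have hJ : ∀ k, angJ μ k (conj L, z) (L, z) = ((∫ y in (0:ℝ)..1, g k y : ℝ) : ℂ) := by
    intro k
    rw [angJ, ← intervalIntegral.integral_ofReal]
    congr 1
    funext y
    have := (angSol_conj μ L z y).1
    rw [Complex.conj_ofReal] at this
    simp only [this, g]
    push_cast
    rw [← Complex.conj_mul']
  obtain ⟨c, hc, hne⟩ := exists_angSol_ne_zero μ L z
  have hc' : c ∈ Icc (0:ℝ) 1 := ⟨hc.1.le, hc.2.le⟩
  have hpos : 0 < ‖angSol μ L z c‖ ^ 2 * (c * (2 - c)) ^ μ := by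
    have h1 : 0 < ‖angSol μ L z c‖ := norm_pos_iff.2 hne
    have h2 : 0 < c * (2 - c) := mul_pos hc.1 (by linarith [hc.2])
    positivity
  refine ⟨∫ y in (0:ℝ)..1, g 0 y, ∫ y in (0:ℝ)..1, g 1 y, ?_, ?_, hJ 0, hJ 1⟩
  · refine intervalIntegral.integral_pos zero_lt_one (hg 1) (fun y hy => ?_) ⟨c, hc', ?_⟩
    · have h1 := hw y ⟨hy.1.le, hy.2⟩
      have h2 : 0 ≤ 1 - y := by linarith [hy.2]
      exact mul_nonneg (pow_nonneg h2 _) (by positivity)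
    · have : 0 < 1 - c := by linarith [hc.2]
      exact mul_pos (pow_pos this _) hpos
  · have hi : ∀ k, IntervalIntegrable (g k) volume 0 1 := fun k =>
      ContinuousOn.intervalIntegrable (by rw [uIcc_of_le zero_le_one]; exact hg k)
    rw [← sub_pos, ← intervalIntegral.integral_sub (hi 0) (hi 1)]
    have hd : ∀ y, g 0 y - g 1 y =
        (y * (2 - y)) * (‖angSol μ L z y‖ ^ 2 * (y * (2 - y)) ^ μ) := fun y => by
      simp only [g]; ring
    refine intervalIntegral.integral_pos zero_lt_one ((hg 0).sub (hg 1)) (fun y hy => ?_)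
      ⟨c, hc', ?_⟩
    · have := hw y ⟨hy.1.le, hy.2⟩
      rw [hd]
      positivity
    · rw [hd]
      exact mul_pos (mul_pos hc.1 (by linarith [hc.2])) hpos

/-- For real `z` the eigenvalues are real: Green's identity for a solution and its conjugate. -/
theorem angD_zero_real (μ : ℕ) (σ : Bool) (L : ℂ) (z : ℝ) (h : angD μ σ (L, z) = 0) :
    L.im = 0 := by
  obtain ⟨r₀, r₁, h1, h2, h3, -⟩ := exists_angJ_conj_pos μ L z
  have hc : angD μ σ ((starRingEnd ℂ) L, z) = 0 := by
    have := angD_conj μ σ L z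
    rw [Complex.conj_ofReal] at this
    rw [this, h, map_zero]
  have := angD_green μ σ ((starRingEnd ℂ) L, z) (L, z)
  rw [h, hc, h3] at this
  simp only [zero_mul, mul_zero, sub_self, add_zero] at this
  have hr : (r₀ : ℂ) ≠ 0 := by exact_mod_cast (h1.trans h2).ne'
  rcases mul_eq_zero.1 this.symm with h | h
  · exact Complex.conj_eq_iff_im.1 (sub_eq_zero.1 h)
  · exact absurd h hr

set_option maxHeartbeats 1000000 in
/-- A holomorphic implicit function theorem for the zeros of `D`, with no differentiability
assumption: the identity `hG` controls all the difference quotients. The quotient `D / E` is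
holomorphic in the first variable, with derivative near `J₀ / E²`, so that it covers a disc of fixed
radius; hence its value `0` is attained for all nearby second variables. -/
theorem exists_zero_branch {D E : ℂ × ℂ → ℂ} {J₀ J₁ : ℂ × ℂ → ℂ × ℂ → ℂ}
    (hDc : Continuous D) (hEc : Continuous E)
    (hJ0c : Continuous fun x : (ℂ × ℂ) × (ℂ × ℂ) => J₀ x.1 x.2)
    (hJ1c : Continuous fun x : (ℂ × ℂ) × (ℂ × ℂ) => J₁ x.1 x.2)
    (hG : ∀ p q, D p * E q - E p * D q = (p.1 - q.1) * J₀ p q + (p.2 - q.2) * J₁ p q)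
    {p₀ : ℂ × ℂ} (h0 : D p₀ = 0) (hE0 : E p₀ ≠ 0) (hJ : J₀ p₀ p₀ ≠ 0) :
    ∃ δ > 0, ∃ Λ : ℂ → ℂ, Λ p₀.2 = p₀.1 ∧ ∀ z ∈ Metric.ball p₀.2 δ, D (Λ z, z) = 0 ∧
      HasDerivAt Λ (-(J₁ (Λ z, z) (Λ z, z) / J₀ (Λ z, z) (Λ z, z))) z := by
  -- on a ball of radius `r` all of `J₀`, `J₁`, `E` are comparable to their values at `p₀`
  set c₁ := ‖J₀ p₀ p₀‖ / 2 with hc₁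
  have hc₁0 : 0 < c₁ := half_pos (norm_pos_iff.2 hJ)
  set c₂ := ‖E p₀‖ with hc₂
  have hc₂0 : 0 < c₂ := norm_pos_iff.2 hE0
  set c₃ := ‖J₁ p₀ p₀‖ + 1 with hc₃
  have hc₃0 : 0 < c₃ := by positivity
  have ev : ∀ᶠ x : (ℂ × ℂ) × (ℂ × ℂ) in 𝓝 (p₀, p₀), c₁ < ‖J₀ x.1 x.2‖ ∧
      ‖J₁ x.1 x.2‖ < c₃ ∧ c₂ / 2 < ‖E x.1‖ ∧ ‖E x.1‖ < 2 * c₂ := by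
    have hE1 : Continuous fun x : (ℂ × ℂ) × (ℂ × ℂ) => ‖E x.1‖ :=
      (hEc.comp continuous_fst).norm
    refine (hJ0c.norm.continuousAt.eventually (lt_mem_nhds ?_)).and
      ((hJ1c.norm.continuousAt.eventually (gt_mem_nhds ?_)).and
      ((hE1.continuousAt.eventually (lt_mem_nhds ?_)).and
      (hE1.continuousAt.eventually (gt_mem_nhds ?_)))) <;> simp only <;> linarith
  obtain ⟨r, hr0, hr⟩ := Metric.eventually_nhds_iff.1 ev
  have hB : ∀ L z L' z', dist L p₀.1 < r → dist z p₀.2 < r → dist L' p₀.1 < r → dist z' p₀.2 < r →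
      c₁ < ‖J₀ (L, z) (L', z')‖ ∧ ‖J₁ (L, z) (L', z')‖ < c₃ ∧
      c₂ / 2 < ‖E (L, z)‖ ∧ ‖E (L, z)‖ < 2 * c₂ := by
    intro L z L' z' h1 h2 h3 h4
    exact hr (y := ((L, z), (L', z'))) (max_lt (max_lt h1 h2) (max_lt h3 h4))
  have hEne : ∀ L z, dist L p₀.1 < r → dist z p₀.2 < r → E (L, z) ≠ 0 := fun L z h1 h2 =>
    norm_pos_iff.1 ((half_pos hc₂0).trans (hB L z L z h1 h2 h1 h2).2.2.1)
  have hJne : ∀ L z L' z', dist L p₀.1 < r → dist z p₀.2 < r → dist L' p₀.1 < r →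
      dist z' p₀.2 < r → J₀ (L, z) (L', z') ≠ 0 := fun L z L' z' h1 h2 h3 h4 =>
    norm_pos_iff.1 (hc₁0.trans (hB L z L' z' h1 h2 h3 h4).1)
  -- the differences of the quotient `D / E` for fixed `z`
  have hm : ∀ L L' z, dist L p₀.1 < r → dist z p₀.2 < r → dist L' p₀.1 < r →
      D (L, z) / E (L, z) - D (L', z) / E (L', z) =
      (L - L') * (J₀ (L, z) (L', z) / (E (L, z) * E (L', z))) := by
    intro L L' z h1 h2 h3
    have g := hG (L, z) (L', z)
    have e1 := hEne L z h1 h2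
    have e2 := hEne L' z h3 h2
    simp only [sub_self, zero_mul, add_zero] at g
    field_simp
    linear_combination g
  set r' := r / 2 with hr'
  have hr'0 : 0 < r' := half_pos hr0
  have hr'r : r' < r := half_lt_self hr0
  set ε := r' * (c₁ / (2 * c₂ * (2 * c₂))) with hε
  have hε0 : 0 < ε := by positivity
  have hmc : ContinuousAt (fun z => D (p₀.1, z) / E (p₀.1, z)) p₀.2 := by
    have h1 : Continuous fun z => D (p₀.1, z) := hDc.comp (by fun_prop)
    have h2 : Continuous fun z => E (p₀.1, z) := hEc.comp (by fun_prop)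
    exact h1.continuousAt.div h2.continuousAt hE0
  have hmz : ∀ᶠ z in 𝓝 p₀.2, ‖D (p₀.1, z) / E (p₀.1, z)‖ < ε / 2 := by
    refine hmc.norm.eventually (gt_mem_nhds ?_)
    have : D (p₀.1, p₀.2) = 0 := h0
    simp only [this, zero_div, norm_zero]
    positivity
  obtain ⟨δ₀, hδ₀, hδ⟩ := Metric.eventually_nhds_iff.1 hmz
  have hex : ∀ z, ∃ L, z ∈ Metric.ball p₀.2 (min δ₀ r) →
      dist L p₀.1 < r ∧ D (L, z) = 0 := by
    intro z
    by_cases hz : z ∈ Metric.ball p₀.2 (min δ₀ r)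
    swap
    · exact ⟨0, fun h => absurd h hz⟩
    have hz1 : dist z p₀.2 < δ₀ := lt_of_lt_of_le hz (min_le_left _ _)
    have hz2 : dist z p₀.2 < r := lt_of_lt_of_le hz (min_le_right _ _)
    have h00 : dist p₀.1 p₀.1 < r := by simpa using hr0
    set m : ℂ → ℂ := fun L => D (L, z) / E (L, z) with hmdef
    have hdiff : ∀ L, dist L p₀.1 < r → DifferentiableAt ℂ m L := by
      intro L hL
      have : HasDerivAt m (J₀ (L, z) (L, z) / (E (L, z) * E (L, z))) L := by
        rw [hasDerivAt_iff_tendsto_slope]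
        have hc : ContinuousAt (fun L' => J₀ (L', z) (L, z) /
            (E (L', z) * E (L, z))) L := by
          have h1 : Continuous fun L' => J₀ (L', z) (L, z) :=
            hJ0c.comp (by fun_prop : Continuous fun L' : ℂ => ((L', z), (L, z)))
          have h2 : Continuous fun L' => E (L', z) := hEc.comp (by fun_prop)
          exact h1.continuousAt.div (h2.continuousAt.mul continuousAt_const)
            (mul_ne_zero (hEne L z hL hz2) (hEne L z hL hz2))
        refine (hc.tendsto.mono_left nhdsWithin_le_nhds).congr' ?_
        have hnear : ∀ᶠ L' in 𝓝[≠] L, dist L' p₀.1 < r :=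
          mem_nhdsWithin_of_mem_nhds
            (Metric.isOpen_ball.mem_nhds (show L ∈ Metric.ball p₀.1 r from hL))
        filter_upwards [hnear, self_mem_nhdsWithin] with L' hL' hne
        have hne' : L' - L ≠ 0 := sub_ne_zero.2 hne
        rw [slope_def_field, hm L' L z hL' hz2 hL, mul_div_cancel_left₀ _ hne']
      exact this.differentiableAt
    have hdc : DiffContOnCl ℂ m (Metric.ball p₀.1 r') := by
      refine DifferentiableOn.diffContOnCl fun L hL => (hdiff L ?_).differentiableWithinAt
      rw [closure_ball _ hr'0.ne'] at hL
      exact lt_of_le_of_lt hL hr'r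
    have hsph : ∀ L ∈ Metric.sphere p₀.1 r', ε ≤ ‖m L - m p₀.1‖ := by
      intro L hL
      have hL' : dist L p₀.1 < r := by rw [Metric.mem_sphere.1 hL]; exact hr'r
      obtain ⟨b1, -, -, b2⟩ := hB L z p₀.1 z hL' hz2 h00 hz2
      obtain ⟨-, -, -, b3⟩ := hB p₀.1 z p₀.1 z h00 hz2 h00 hz2
      have e1 := norm_pos_iff.2 (hEne L z hL' hz2)
      have e2 := norm_pos_iff.2 (hEne p₀.1 z h00 hz2)
      rw [hm L p₀.1 z hL' hz2 h00, norm_mul, norm_div, norm_mul, ← dist_eq_norm,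
        Metric.mem_sphere.1 hL, hε]
      gcongr
    have hfreq : ∃ᶠ L in 𝓝 p₀.1, m L ≠ m p₀.1 := by
      have : ∀ᶠ L in 𝓝[≠] p₀.1, m L ≠ m p₀.1 := by
        have hnear : ∀ᶠ L' in 𝓝[≠] p₀.1, dist L' p₀.1 < r :=
          mem_nhdsWithin_of_mem_nhds (Metric.ball_mem_nhds p₀.1 hr0)
        filter_upwards [hnear, self_mem_nhdsWithin] with L hL hne
        rw [← sub_ne_zero, hm L p₀.1 z hL hz2 h00]
        exact mul_ne_zero (sub_ne_zero.2 hne) (div_ne_zero (hJne _ _ _ _ hL hz2 h00 hz2)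
          (mul_ne_zero (hEne _ _ hL hz2) (hEne _ _ h00 hz2)))
      exact this.frequently.filter_mono nhdsWithin_le_nhds
    -- the image of the disc contains a disc about `m p₀.1`, and `m p₀.1` is small
    have hsub := hdc.ball_subset_image_closedBall hr'0 hsph hfreq
    have h0mem : (0 : ℂ) ∈ Metric.ball (m p₀.1) (ε / 2) := by
      rw [Metric.mem_ball, dist_eq_norm, zero_sub, norm_neg]
      exact hδ hz1
    obtain ⟨L, hL, hL0⟩ := hsub h0mem
    have hLr : dist L p₀.1 < r := lt_of_le_of_lt hL hr'r
    refine ⟨L, fun _ => ⟨hLr, ?_⟩⟩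
    rcases div_eq_zero_iff.1 hL0 with h | h
    · exact h
    · exact absurd h (hEne L z hLr hz2)
  choose Λ hΛ using hex
  have hδ1 : 0 < min δ₀ r := lt_min hδ₀ hr0
  -- Green's identity for two members of the family
  have hrel : ∀ z z', z ∈ Metric.ball p₀.2 (min δ₀ r) → z' ∈ Metric.ball p₀.2 (min δ₀ r) →
      (Λ z - Λ z') * J₀ (Λ z, z) (Λ z', z') +
        (z - z') * J₁ (Λ z, z) (Λ z', z') = 0 := by
    intro z z' hz hz'
    have g := hG (Λ z, z) (Λ z', z')
    rw [(hΛ z hz).2, (hΛ z' hz').2] at g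
    simp only [zero_mul, mul_zero, sub_zero] at g
    exact g.symm
  have hzr : ∀ z ∈ Metric.ball p₀.2 (min δ₀ r), dist z p₀.2 < r := fun z hz =>
    lt_of_lt_of_le hz (min_le_right _ _)
  refine ⟨min δ₀ r, hδ1, Λ, ?_, fun z hz => ⟨(hΛ z hz).2, ?_⟩⟩
  · have hz := Metric.mem_ball_self (x := p₀.2) hδ1
    have g := hG (Λ p₀.2, p₀.2) (p₀.1, p₀.2)
    rw [(hΛ _ hz).2, show D (p₀.1, p₀.2) = 0 from h0] at g
    simp only [zero_mul, mul_zero, sub_self, add_zero] at g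
    rcases mul_eq_zero.1 g.symm with h | h
    · exact sub_eq_zero.1 h
    · exact absurd h (hJne _ _ _ _ (hΛ _ hz).1 (hzr _ hz) (by simpa using hr0) (hzr _ hz))
  · have hnear : ∀ᶠ z' in 𝓝 z, z' ∈ Metric.ball p₀.2 (min δ₀ r) :=
      Metric.isOpen_ball.mem_nhds hz
    -- `Λ` was chosen pointwise; Green's identity shows that it is Lipschitz
    have hcont : Tendsto Λ (𝓝 z) (𝓝 (Λ z)) := by
      rw [tendsto_iff_norm_sub_tendsto_zero]
      have hl : Tendsto (fun z' => c₃ / c₁ * ‖z' - z‖) (𝓝 z) (𝓝 0) := by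
        have : Continuous fun z' => c₃ / c₁ * ‖z' - z‖ := by fun_prop
        simpa using this.tendsto z
      refine squeeze_zero' (Eventually.of_forall fun _ => norm_nonneg _) ?_ hl
      filter_upwards [hnear] with z' hz'
      obtain ⟨b1, b2, -, -⟩ := hB (Λ z') z' (Λ z) z (hΛ z' hz').1 (hzr z' hz') (hΛ z hz).1 (hzr z hz)
      have e : ‖Λ z' - Λ z‖ * ‖J₀ (Λ z', z') (Λ z, z)‖ =
          ‖z' - z‖ * ‖J₁ (Λ z', z') (Λ z, z)‖ := by
        rw [← norm_mul, ← norm_mul, eq_neg_of_add_eq_zero_left (hrel z' z hz' hz), norm_neg]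
      rw [div_mul_eq_mul_div, le_div_iff₀ hc₁0]
      calc ‖Λ z' - Λ z‖ * c₁ ≤ ‖Λ z' - Λ z‖ * ‖J₀ (Λ z', z') (Λ z, z)‖ := by gcongr
        _ = _ := e
        _ ≤ ‖z' - z‖ * c₃ := by gcongr
        _ = _ := mul_comm _ _
    rw [hasDerivAt_iff_tendsto_slope]
    have hpair : Tendsto (fun z' => ((Λ z', z'), (Λ z, z))) (𝓝 z) (𝓝 ((Λ z, z), (Λ z, z))) :=
      (hcont.prodMk_nhds tendsto_id).prodMk_nhds tendsto_const_nhds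
    have hlim : Tendsto (fun z' => -(J₁ (Λ z', z') (Λ z, z) / J₀ (Λ z', z') (Λ z, z)))
        (𝓝 z) (𝓝 (-(J₁ (Λ z, z) (Λ z, z) / J₀ (Λ z, z) (Λ z, z)))) :=
      (((hJ1c.tendsto _).comp hpair).div ((hJ0c.tendsto _).comp hpair)
        (hJne _ _ _ _ (hΛ z hz).1 (hzr z hz) (hΛ z hz).1 (hzr z hz))).neg
    refine (hlim.mono_left nhdsWithin_le_nhds).congr' ?_
    filter_upwards [hnear.filter_mono nhdsWithin_le_nhds, self_mem_nhdsWithin] with z' hz' hne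
    have hne' : z' - z ≠ 0 := sub_ne_zero.2 hne
    have hj := hJne _ _ _ _ (hΛ z' hz').1 (hzr z' hz') (hΛ z hz).1 (hzr z hz)
    rw [slope_def_field]
    field_simp
    linear_combination -(hrel z' z hz' hz)

/-- A simple eigenvalue extends to a holomorphic family of eigenvalues. -/
theorem exists_angular_branch (μ : ℕ) (σ : Bool) {p₀ : ℂ × ℂ} (h0 : angD μ σ p₀ = 0)
    (hJ : angJ μ 0 p₀ p₀ ≠ 0) :
    ∃ δ > 0, ∃ Λ : ℂ → ℂ, Λ p₀.2 = p₀.1 ∧ ∀ z ∈ Metric.ball p₀.2 δ, angD μ σ (Λ z, z) = 0 ∧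
      HasDerivAt Λ (-(angJ μ 1 (Λ z, z) (Λ z, z) / angJ μ 0 (Λ z, z) (Λ z, z))) z :=
  exists_zero_branch (continuous_angD_angE μ σ).1 (continuous_angD_angE μ σ).2
    (continuous_angJ μ 0) (continuous_angJ μ 1) (angD_green μ σ) h0 (angE_ne_zero μ σ p₀ h0) hJ

/-! ### The set of real angular eigenvalues -/

/-- The real numbers `L` for which the angular equation with real parameter `z` has an even or an
odd regular solution. -/
def angZeros (μ : ℕ) (z : ℝ) : Set ℝ := {L | ∃ σ, angD μ σ ((L : ℂ), (z : ℂ)) = 0}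

theorem angSol_mul_eq_zero_of_angD {μ : ℕ} {σ : Bool} {p : ℂ × ℂ} (h : angD μ σ p = 0) :
    angSol μ p.1 p.2 1 * angSol' μ p.1 p.2 1 = 0 := by
  cases σ
  · exact mul_eq_zero_of_left (by simpa [angD] using h) _
  · exact mul_eq_zero_of_right _ (by simpa [angD] using h)

theorem angD_of_angSol_mul_eq_zero {μ : ℕ} {p : ℂ × ℂ}
    (h : angSol μ p.1 p.2 1 * angSol' μ p.1 p.2 1 = 0) : ∃ σ, angD μ σ p = 0 := by
  rcases mul_eq_zero.1 h with h | h
  · exact ⟨false, by simpa [angD] using h⟩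
  · exact ⟨true, by simpa [angD] using h⟩

/-- If `L < -z` the potential `-(L + z (1 - y)²)` is positive on `[0, 1]`, and the energy identity
`(p f f')' = p |f'|² + (potential) |f|²` is incompatible with `f f' = 0` at the equator. -/
theorem neg_le_of_mem_angZeros {μ : ℕ} {z L : ℝ} (hz : 0 ≤ z) (h : L ∈ angZeros μ z) : -z ≤ L := by
  by_contra! hL
  obtain ⟨σ, hσ⟩ := h
  have hb := angSol_mul_eq_zero_of_angD hσ
  simp only at hb
  obtain ⟨hf, hf'⟩ := continuousOn_angSol_Icc μ L z
  have hw : ∀ y ∈ Icc (0:ℝ) 1, 0 ≤ y * (2 - y) := fun y hy => by nlinarith [hy.1, hy.2]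
  have hq : ∀ y ∈ Icc (0:ℝ) 1, 0 < -(L + z * (1 - y) ^ 2) := fun y hy => by
    have : (1 - y) ^ 2 ≤ 1 := by nlinarith [hy.1, hy.2]
    nlinarith [mul_le_mul_of_nonneg_left this hz]
  -- the energy density
  let g : ℝ → ℝ := fun y => (y * (2 - y)) ^ (μ + 1) * ‖angSol' μ L z y‖ ^ 2 +
    -(L + z * (1 - y) ^ 2) * (‖angSol μ L z y‖ ^ 2 * (y * (2 - y)) ^ μ)
  have hg : ContinuousOn g (Icc 0 1) := by
    have h1 := hf.norm
    have h2 := hf'.norm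
    exact ContinuousOn.add (ContinuousOn.mul (by fun_prop) (h2.pow 2))
      (ContinuousOn.mul (by fun_prop) ((h1.pow 2).mul (by fun_prop)))
  obtain ⟨c, hc, hne⟩ := exists_angSol_ne_zero μ L z
  have hpos : 0 < ∫ y in (0:ℝ)..1, g y := by
    refine intervalIntegral.integral_pos zero_lt_one hg (fun y hy => ?_)
      ⟨c, ⟨hc.1.le, hc.2.le⟩, ?_⟩
    · have h1 := hw y ⟨hy.1.le, hy.2⟩
      have h2 := (hq y ⟨hy.1.le, hy.2⟩).le
      exact add_nonneg (by positivity) (mul_nonneg h2 (by positivity))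
    · have h1 : 0 < ‖angSol μ L z c‖ := norm_pos_iff.2 hne
      have h2 : 0 < c * (2 - c) := mul_pos hc.1 (by linarith [hc.2])
      have h3 := hq c ⟨hc.1.le, hc.2.le⟩
      exact add_pos_of_nonneg_of_pos (by positivity) (mul_pos h3 (by positivity))
  have hconj : ∀ y : ℝ, (angSol μ L z y) ^ 2 = ((‖angSol μ L z y‖ ^ 2 : ℝ) : ℂ) ∧
      (angSol' μ L z y) ^ 2 = ((‖angSol' μ L z y‖ ^ 2 : ℝ) : ℂ) := by
    intro y
    have := angSol_conj μ L z y
    simp only [Complex.conj_ofReal] at this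
    push_cast
    rw [← Complex.conj_mul', ← Complex.conj_mul', ← this.1, ← this.2]
    exact ⟨sq _, sq _⟩
  have hder : ∀ y ∈ uIcc (0:ℝ) 1, HasDerivAt (fun y : ℝ => ((y : ℂ) * (2 - y)) ^ (μ + 1) *
      (angSol μ L z y * angSol' μ L z y)) ((g y : ℝ) : ℂ) y := by
    intro y h
    rw [uIcc_of_le zero_le_one] at h
    obtain ⟨d1, d2, ode⟩ := hasDerivAt_angSol_real μ L z (y := y)
      ⟨by linarith [h.1], by linarith [h.2]⟩
    have h1 : HasDerivAt (fun s : ℝ => (s : ℂ)) 1 y := Complex.ofRealCLM.hasDerivAt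
    have hp := (h1.mul (h1.const_sub 2)).fun_pow (μ + 1)
    refine (hp.mul (d1.mul d2)).congr_deriv ?_
    obtain ⟨c1, c2⟩ := hconj y
    simp only [Nat.add_sub_cancel, Pi.mul_apply, g]
    push_cast at c1 c2 ⊢
    rw [← c1, ← c2, pow_succ ((y : ℂ) * (2 - y))]
    linear_combination ((y:ℂ) * (2 - y)) ^ μ * (angSol μ L z y) * ode
  have hint := intervalIntegral.integral_eq_sub_of_hasDerivAt hder
    (ContinuousOn.intervalIntegrable (by
      rw [uIcc_of_le zero_le_one]; exact Complex.continuous_ofReal.comp_continuousOn hg))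
  rw [intervalIntegral.integral_ofReal] at hint
  push_cast at hint
  rw [hb] at hint
  norm_num at hint
  exact hpos.ne' hint

theorem angJ_real_pos (μ : ℕ) (L z : ℝ) : ∃ r₀ r₁ : ℝ, 0 < r₁ ∧ r₁ < r₀ ∧
    angJ μ 0 (L, z) (L, z) = r₀ ∧ angJ μ 1 (L, z) (L, z) = r₁ := by
  simpa only [Complex.conj_ofReal] using exists_angJ_conj_pos μ L z

/-- By Green's identity the zeros in `L` are isolated. -/
theorem eventually_angD_ne_zero (μ : ℕ) (σ : Bool) (z x : ℝ) :
    ∀ᶠ L : ℝ in 𝓝[≠] x, angD μ σ ((L : ℂ), (z : ℂ)) ≠ 0 := by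
  by_cases hx : angD μ σ ((x : ℂ), (z : ℂ)) = 0
  · obtain ⟨r₀, r₁, h1, h2, h3, -⟩ := angJ_real_pos μ x z
    have hpair : Continuous fun L : ℝ => (((L : ℂ), (z : ℂ)), ((x : ℂ), (z : ℂ))) := by fun_prop
    have hJ : Continuous fun L : ℝ => angJ μ 0 ((L : ℂ), (z : ℂ)) ((x : ℂ), (z : ℂ)) :=
      (continuous_angJ μ 0).comp hpair
    have hne : ∀ᶠ L : ℝ in 𝓝 x, angJ μ 0 ((L : ℂ), (z : ℂ)) ((x : ℂ), (z : ℂ)) ≠ 0 := by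
      refine hJ.continuousAt.eventually_ne ?_
      rw [h3]
      exact_mod_cast (h1.trans h2).ne'
    filter_upwards [hne.filter_mono nhdsWithin_le_nhds, self_mem_nhdsWithin] with L hL hLx h0
    have g := angD_green μ σ ((L : ℂ), (z : ℂ)) ((x : ℂ), (z : ℂ))
    rw [h0, hx] at g
    simp only [zero_mul, mul_zero, sub_self, add_zero] at g
    rcases mul_eq_zero.1 g.symm with h | h
    · exact hLx (by exact_mod_cast sub_eq_zero.1 h)
    · exact hL h
  · have hc : Continuous fun L : ℝ => angD μ σ ((L : ℂ), (z : ℂ)) :=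
      (continuous_angD_angE μ σ).1.comp (by fun_prop)
    exact (hc.continuousAt.eventually_ne hx).filter_mono nhdsWithin_le_nhds

theorem finite_angZeros (μ : ℕ) {z : ℝ} (hz : 0 ≤ z) (b : ℝ) : (angZeros μ z ∩ Iic b).Finite := by
  have hiso : ∀ x : ℝ, {L | L ∈ angZeros μ z → L = x} ∈ 𝓝 x := by
    intro x
    have h := (eventually_angD_ne_zero μ true z x).and (eventually_angD_ne_zero μ false z x)
    rw [eventually_nhdsWithin_iff] at h
    filter_upwards [h] with L hL hmem
    by_contra hne
    obtain ⟨σ, hσ⟩ := hmem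
    cases σ
    · exact (hL hne).2 hσ
    · exact (hL hne).1 hσ
  obtain ⟨t, -, ht⟩ := (isCompact_Icc (a := -z) (b := b)).elim_nhds_subcover _ fun x _ => hiso x
  refine (t.finite_toSet).subset fun L hL => ?_
  have := ht ⟨neg_le_of_mem_angZeros hz hL.1, hL.2⟩
  simp only [mem_iUnion] at this
  obtain ⟨x, hx, hLx⟩ := this
  rw [hLx hL.1]
  exact hx

/-- For `z = 0` the eigenfunctions are polynomials, and the eigenvalues are explicit. -/
theorem mem_angZeros_zero (μ N : ℕ) : (N * (N + 2 * μ + 1) : ℝ) ∈ angZeros μ 0 := by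
  refine angD_of_angSol_mul_eq_zero ?_
  set L : ℂ := ((N * (N + 2 * μ + 1) : ℝ) : ℂ) with hL
  have hc0 : ∀ n, N < n → angCoeff μ L 0 n = 0 := by
    intro n hn
    induction n, hn using Nat.le_induction with
    | base =>
      simp only [angCoeff, angTriple, hL]
      push_cast
      simp
    | succ n hn ih =>
      simp only [angCoeff] at ih
      simp only [angCoeff, angTriple, ih]
      simp
  have hb : ∀ n, ‖angCoeff μ L 0 n‖ ≤
      (∑ k ∈ Finset.range (N + 1), ‖angCoeff μ L 0 k‖ * 4 ^ k) * (1 / 4) ^ n := by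
    intro n
    have hS : 0 ≤ ∑ k ∈ Finset.range (N + 1), ‖angCoeff μ L 0 k‖ * (4:ℝ) ^ k :=
      Finset.sum_nonneg fun k _ => by positivity
    rcases lt_or_ge N n with h | h
    · rw [hc0 n h, norm_zero]; positivity
    · have := Finset.single_le_sum (f := fun k => ‖angCoeff μ L 0 k‖ * (4:ℝ) ^ k)
        (fun k _ => by positivity) (Finset.mem_range.2 (Nat.lt_succ_of_le h))
      calc ‖angCoeff μ L 0 n‖ = ‖angCoeff μ L 0 n‖ * 4 ^ n * (1 / 4) ^ n := by
            rw [mul_assoc, ← mul_pow]; norm_num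
        _ ≤ _ := by gcongr
  have hode := fun y (hy : ‖y‖ < 4) => angSol_ode_of_bound μ L 0
    (Finset.sum_nonneg fun k _ => by positivity) (by norm_num) hb (y := y) (by linarith)
  -- the Wronskian of the solution and its reflection vanishes
  have hder : ∀ y ∈ uIcc (0:ℝ) 1, HasDerivAt (fun y : ℝ => ((y : ℂ) * (2 - y)) ^ (μ + 1) *
      (angSol μ L 0 y * angSol' μ L 0 (2 - y : ℝ) + angSol' μ L 0 y * angSol μ L 0 (2 - y : ℝ)))
      0 y := by
    intro y h
    rw [uIcc_of_le zero_le_one] at h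
    have n1 : ‖(y : ℂ)‖ < 4 := by
      rw [Complex.norm_real, Real.norm_eq_abs, abs_of_nonneg h.1]; linarith [h.2]
    have n2 : ‖((2 - y : ℝ) : ℂ)‖ < 4 := by
      rw [Complex.norm_real, Real.norm_eq_abs, abs_of_nonneg (by linarith [h.2])]; linarith [h.1]
    obtain ⟨a1, a2, a3⟩ := hode _ n1
    obtain ⟨b1, b2, b3⟩ := hode _ n2
    have h1 : HasDerivAt (fun s : ℝ => (s : ℂ)) 1 y := Complex.ofRealCLM.hasDerivAt
    have hr : HasDerivAt (fun s : ℝ => 2 - s) (-1) y := (hasDerivAt_id y).const_sub 2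
    have b1' := b1.comp_ofReal.scomp y hr
    have b2' := b2.comp_ofReal.scomp y hr
    have hp := (h1.mul (h1.const_sub 2)).fun_pow (μ + 1)
    refine (hp.mul ((a1.comp_ofReal.mul b2').add (a2.comp_ofReal.mul b1'))).congr_deriv ?_
    simp only [Nat.add_sub_cancel, Pi.mul_apply, Pi.add_apply, Function.comp, neg_smul, one_smul]
    push_cast at b3 ⊢
    rw [pow_succ ((y : ℂ) * (2 - y))]
    linear_combination ((y:ℂ) * (2 - y)) ^ μ * (angSol μ L 0 (2 - y) * a3 - angSol μ L 0 y * b3)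
  have hint := intervalIntegral.integral_eq_sub_of_hasDerivAt hder (by simp)
  norm_num at hint
  have e : (1 : ℂ) = (2 - 1 : ℂ) := by norm_num
  have : angSol μ L 0 1 * angSol' μ L 0 1 + angSol' μ L 0 1 * angSol μ L 0 1 = 0 := by
    rw [eq_comm] at hint
    convert hint using 2
  simp only [Complex.ofReal_zero]
  linear_combination this / 2

/-- Eigenvalues persist along `0 ≤ z ≤ z₁`, decreasing at a rate less than `1`: on a branch
`dL / dz = -J₁ / J₀` with `0 < J₁ < J₀`. -/
theorem exists_angD_zero_of_start (μ : ℕ) (σ : Bool) {L₀ z₁ : ℝ} (hz₁ : 0 ≤ z₁)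
    (h : angD μ σ ((L₀ : ℂ), ((0 : ℝ) : ℂ)) = 0) :
    ∃ L : ℝ, L₀ - z₁ ≤ L ∧ angD μ σ ((L : ℂ), (z₁ : ℂ)) = 0 := by
  let S : Set ℝ := {z | ∃ L : ℝ, L₀ - z ≤ L ∧ L ≤ L₀ ∧ angD μ σ ((L : ℂ), (z : ℂ)) = 0}
  have hD : Continuous fun x : ℝ × ℝ => angD μ σ ((x.2 : ℂ), (x.1 : ℂ)) :=
    (continuous_angD_angE μ σ).1.comp (by fun_prop)
  have hclosed : IsClosed (S ∩ Icc 0 z₁) := by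
    have hK : IsCompact ((Icc (0:ℝ) z₁ ×ˢ Icc (L₀ - z₁) L₀) ∩
        ({x : ℝ × ℝ | L₀ - x.1 ≤ x.2} ∩ {x | angD μ σ ((x.2 : ℂ), (x.1 : ℂ)) = 0})) :=
      (isCompact_Icc.prod isCompact_Icc).inter_right
        ((isClosed_le (by fun_prop) (by fun_prop)).inter (isClosed_eq hD continuous_const))
    convert (hK.image continuous_fst).isClosed using 1
    ext z
    constructor
    · rintro ⟨⟨L, h1, h2, h3⟩, h4⟩
      exact ⟨(z, L), ⟨⟨h4, ⟨by simp only; linarith [h4.2], h2⟩⟩, h1, h3⟩, rfl⟩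
    · rintro ⟨⟨z', L⟩, ⟨⟨h4, h2⟩, h1, h3⟩, rfl⟩
      exact ⟨⟨L, h1, h2.2, h3⟩, h4⟩
  have hsub : Icc 0 z₁ ⊆ S := by
    refine hclosed.Icc_subset_of_forall_mem_nhdsWithin ⟨L₀, by simp, le_rfl, h⟩ ?_
    rintro x ⟨⟨L, h1, h2, h3⟩, -⟩
    obtain ⟨r₀, r₁, k1, k2, k3, k4⟩ := angJ_real_pos μ L x
    have hr₀ : 0 < r₀ := k1.trans k2
    have hJ : angJ μ 0 ((L : ℂ), (x : ℂ)) ((L : ℂ), (x : ℂ)) ≠ 0 := by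
      rw [k3]; exact_mod_cast hr₀.ne'
    obtain ⟨δ, hδ, Λ, hΛ0, hΛ⟩ := exists_angular_branch μ σ h3 hJ
    simp only at hΛ0 hΛ
    have hd := (hΛ x (Metric.mem_ball_self hδ)).2
    rw [hΛ0, k3, k4] at hd
    -- the branch is real on the real axis, with slope in `(-1, 0)`
    have hd' : HasDerivAt (fun t : ℝ => (Λ t).re) (-(r₁ / r₀)) x := by
      have := hd.real_of_complex
      convert this using 1
      rw [← Complex.ofReal_div, ← Complex.ofReal_neg, Complex.ofReal_re]
    rw [hasDerivAt_iff_tendsto_slope] at hd'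
    have hd'' := hd'.mono_left (nhdsWithin_mono x (fun t (ht : x < t) => ht.ne') :
      𝓝[>] x ≤ 𝓝[≠] x)
    have hlt : -(r₁ / r₀) < 0 := by have := div_pos k1 hr₀; linarith
    have hgt : -1 < -(r₁ / r₀) := by
      have := (div_lt_one hr₀).2 k2; linarith
    have hball : ∀ᶠ t : ℝ in 𝓝[>] x, (t : ℂ) ∈ Metric.ball (x : ℂ) δ :=
      mem_nhdsWithin_of_mem_nhds (Complex.continuous_ofReal.continuousAt.preimage_mem_nhds
        (Metric.ball_mem_nhds _ hδ))
    filter_upwards [hd''.eventually (gt_mem_nhds hlt), hd''.eventually (lt_mem_nhds hgt), hball,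
      self_mem_nhdsWithin] with t t1 t2 t3 t4
    have t4' : 0 < t - x := sub_pos.2 t4
    rw [slope_def_field, hΛ0, Complex.ofReal_re] at t1 t2
    rw [div_lt_iff₀ t4'] at t1
    rw [lt_div_iff₀ t4'] at t2
    have him := angD_zero_real μ σ (Λ t) t (hΛ t t3).1
    have hre : (((Λ t).re : ℝ) : ℂ) = Λ t := Complex.ext (by simp) (by simp [him])
    exact ⟨(Λ t).re, by linarith, by linarith, by rw [hre]; exact (hΛ t t3).1⟩
  obtain ⟨L, h1, -, h3⟩ := hsub (right_mem_Icc.2 hz₁)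
  exact ⟨L, h1, h3⟩

theorem exists_lt_mem_angZeros (μ : ℕ) {z : ℝ} (hz : 0 ≤ z) (b : ℝ) : ∃ L ∈ angZeros μ z, b < L := by
  obtain ⟨N, hN⟩ := exists_nat_gt (b + z)
  obtain ⟨σ, hσ⟩ := mem_angZeros_zero μ N
  obtain ⟨L, h1, h2⟩ := exists_angD_zero_of_start μ σ hz hσ
  refine ⟨L, ⟨σ, h2⟩, ?_⟩
  have h3 : (N : ℝ) ≤ N * (N + 2 * μ + 1) := by
    have : (0:ℝ) ≤ N * (N + 2 * μ) := by positivity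
    nlinarith
  linarith

/-- A set of reals that is locally finite, bounded below and unbounded above has an element with
exactly `n` elements below it. -/
theorem exists_encard_lt_eq {A : Set ℝ} (hfin : ∀ b, (A ∩ Iic b).Finite)
    (hub : ∀ b, ∃ L ∈ A, b < L) (n : ℕ) : ∃ L ∈ A, {x | x < L ∧ x ∈ A}.encard = n := by
  induction n with
  | zero =>
    obtain ⟨L', hL', -⟩ := hub 0
    obtain ⟨L, ⟨hL, hLL⟩, hmin⟩ := (hfin L').exists_minimalFor id _ ⟨L', hL', mem_Iic.2 le_rfl⟩
    refine ⟨L, hL, ?_⟩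
    rw [Nat.cast_zero, encard_eq_zero, eq_empty_iff_forall_notMem]
    rintro x ⟨hx, hxA⟩
    exact absurd (hmin ⟨hxA, hx.le.trans hLL⟩ hx.le) (not_le.2 hx)
  | succ n ih =>
    obtain ⟨L, hL, hn⟩ := ih
    obtain ⟨L', hL', hlt⟩ := hub L
    have hf : (A ∩ Ioc L L').Finite := (hfin L').subset fun x hx => ⟨hx.1, hx.2.2⟩
    obtain ⟨K, ⟨hK, hK1, hK2⟩, hmin⟩ := hf.exists_minimalFor id _ ⟨L', hL', hlt, le_rfl⟩
    refine ⟨K, hK, ?_⟩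
    have e : {x | x < K ∧ x ∈ A} = insert L {x | x < L ∧ x ∈ A} := by
      ext x
      constructor
      · rintro ⟨hx, hxA⟩
        rcases lt_trichotomy x L with h | h | h
        · exact Or.inr ⟨h, hxA⟩
        · exact Or.inl h
        · exact absurd (hmin ⟨hxA, h, hx.le.trans hK2⟩ hx.le) (not_le.2 hx)
      · rintro (rfl | ⟨hx, hxA⟩)
        · exact ⟨hK1, hL⟩
        · exact ⟨hx.trans hK1, hxA⟩
    rw [e, encard_insert_of_notMem (by simp), hn]
    push_cast
    rfl

/-! ### Angular eigenfunctions on the sphere -/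

/-- `(sin θ) ∂_θ (sin θ ^ μ * F (cos θ))`, as a function of `θ`, where `F'` is the derivative of
`F`. -/
def angFlux (μ : ℕ) (F F' : ℝ → ℂ) (θ : ℝ) : ℂ :=
  (Real.sin θ : ℂ) ^ μ *
    (μ * (Real.cos θ : ℂ) * F (Real.cos θ) - (Real.sin θ : ℂ) ^ 2 * F' (Real.cos θ))

/-- The substitution `S = sin θ ^ μ * F (cos θ)` in the angular equation. -/
theorem angular_substitution {μ : ℕ} {L z : ℂ} {F F' F'' : ℝ → ℂ} {α β θ : ℝ}
    (hF : ∀ x ∈ Ioo α β, HasDerivAt F (F' x) x ∧ HasDerivAt F' (F'' x) x ∧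
      (1 - (x : ℂ) ^ 2) * F'' x - 2 * (μ + 1) * x * F' x + (L + z * x ^ 2) * F x = 0)
    (hθ : Real.sin θ ≠ 0) (hx : Real.cos θ ∈ Ioo α β) :
    HasDerivAt (fun θ : ℝ => (Real.sin θ : ℂ) ^ μ * F (Real.cos θ))
      (angFlux μ F F' θ / Real.sin θ) θ ∧
    HasDerivAt (angFlux μ F F') (Real.sin θ *
      (((μ : ℂ) ^ 2 / (Real.sin θ : ℂ) ^ 2 - z * (Real.cos θ : ℂ) ^ 2 - (L + μ * (μ + 1))) *
        ((Real.sin θ : ℂ) ^ μ * F (Real.cos θ)))) θ := by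
  obtain ⟨h1, h2, h3⟩ := hF _ hx
  have hs : HasDerivAt (fun θ : ℝ => (Real.sin θ : ℂ)) (Real.cos θ : ℂ) θ :=
    (Real.hasDerivAt_sin θ).ofReal_comp
  have hc : HasDerivAt (fun θ : ℝ => (Real.cos θ : ℂ)) ((-Real.sin θ : ℝ) : ℂ) θ :=
    (Real.hasDerivAt_cos θ).ofReal_comp
  have hFc := h1.scomp θ (Real.hasDerivAt_cos θ)
  have hFc' := h2.scomp θ (Real.hasDerivAt_cos θ)
  have hsc : (Real.sin θ : ℂ) ^ 2 = 1 - (Real.cos θ : ℂ) ^ 2 := by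
    have := Real.sin_sq_add_cos_sq θ
    have h : (Real.sin θ : ℂ) ^ 2 + (Real.cos θ : ℂ) ^ 2 = 1 := by exact_mod_cast this
    linear_combination h
  have hne : (Real.sin θ : ℂ) ≠ 0 := by exact_mod_cast hθ
  have hp : HasDerivAt (fun θ : ℝ => (Real.sin θ : ℂ) ^ μ)
      (μ * (Real.sin θ : ℂ) ^ μ / Real.sin θ * Real.cos θ) θ := by
    refine (hs.fun_pow μ).congr_deriv ?_
    rcases μ with _ | ν
    · simp
    · rw [Nat.add_sub_cancel, pow_succ]; field_simp
  constructor
  · refine (hp.mul hFc).congr_deriv ?_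
    simp only [Function.comp, angFlux, Complex.real_smul]
    push_cast
    field_simp
    ring
  · have := hp.mul (((hc.const_mul (μ : ℂ)).mul hFc).sub ((hs.fun_pow 2).mul hFc'))
    have e : angFlux μ F F' = (fun θ : ℝ => (Real.sin θ : ℂ) ^ μ) *
      (((fun θ : ℝ => (μ : ℂ) * (Real.cos θ : ℂ)) * (F ∘ Real.cos)) -
        (fun θ : ℝ => (Real.sin θ : ℂ) ^ 2) * (F' ∘ Real.cos)) := by
      funext θ
      simp [angFlux]
    rw [e]
    refine this.congr_deriv ?_
    simp only [Function.comp, Complex.real_smul, Pi.mul_apply, Pi.sub_apply]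
    push_cast at h3 hsc hne ⊢
    rw [← hsc] at h3
    field_simp
    generalize Complex.sin (θ : ℂ) = s at *
    generalize Complex.cos (θ : ℂ) = c at *
    have hc2 : c ^ 2 = 1 - s ^ 2 := by linear_combination hsc
    linear_combination (s ^ 2) * h3 + (μ ^ 2 * F (Real.cos θ)) * hc2

/-- The regular solution, as a function of `x = cos θ`. -/
theorem hasDerivAt_angSol_one_sub (μ : ℕ) (L z : ℂ) {x : ℝ} (hx : x ∈ Ioo (-(1 / 3) : ℝ) (7 / 3)) :
    HasDerivAt (fun x : ℝ => angSol μ L z (1 - x : ℝ)) (-angSol' μ L z (1 - x : ℝ)) x ∧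
    HasDerivAt (fun x : ℝ => -angSol' μ L z (1 - x : ℝ)) (angSol'' μ L z (1 - x : ℝ)) x ∧
    (1 - (x : ℂ) ^ 2) * angSol'' μ L z (1 - x : ℝ) -
      2 * (μ + 1) * x * (-angSol' μ L z (1 - x : ℝ)) +
      (L + z * x ^ 2) * angSol μ L z (1 - x : ℝ) = 0 := by
  obtain ⟨h1, h2, h3⟩ := hasDerivAt_angSol_real μ L z (y := 1 - x)
    ⟨by linarith [hx.2], by linarith [hx.1]⟩
  have hr : HasDerivAt (fun s : ℝ => 1 - s) (-1) x := (hasDerivAt_id x).const_sub 1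
  refine ⟨?_, ?_, ?_⟩
  · exact (h1.scomp x hr).congr_deriv (by simp)
  · exact (h2.scomp x hr).fun_neg.congr_deriv (by simp)
  · push_cast at h3 ⊢
    linear_combination h3

/-- At an eigenvalue the regular solutions at the two poles agree up to sign, by uniqueness at the
equator. -/
theorem angSol_reflect {μ : ℕ} {σ : Bool} {L z : ℂ} (h : angD μ σ (L, z) = 0) {x : ℝ}
    (hx : x ∈ Ioo (-(1 / 3) : ℝ) (1 / 3)) :
    angSol μ L z (1 - x : ℝ) = (bif σ then 1 else -1) * angSol μ L z (1 + x : ℝ) := by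
  set ε : ℂ := bif σ then 1 else -1 with hε
  have hb : ∃ C, ∀ t ∈ Icc (-(1 / 3) : ℝ) (1 / 3),
      ‖(2 * (μ + 1) * t : ℂ) / (1 - t ^ 2)‖ ≤ C ∧ ‖-(L + z * t ^ 2 : ℂ) / (1 - t ^ 2)‖ ≤ C := by
    have hden : ∀ t ∈ Icc (-(1 / 3) : ℝ) (1 / 3), (1 - t ^ 2 : ℂ) ≠ 0 := by
      intro t ht
      have : 1 - t ^ 2 ≠ 0 := by nlinarith [ht.1, ht.2]
      exact_mod_cast this
    obtain ⟨C₁, h₁⟩ := isCompact_Icc.exists_bound_of_continuousOn (s := Icc (-(1 / 3) : ℝ) (1 / 3))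
      (f := fun t : ℝ => (2 * (μ + 1) * t : ℂ) / (1 - t ^ 2))
      (ContinuousOn.div (by fun_prop) (by fun_prop) hden)
    obtain ⟨C₂, h₂⟩ := isCompact_Icc.exists_bound_of_continuousOn (s := Icc (-(1 / 3) : ℝ) (1 / 3))
      (f := fun t : ℝ => -(L + z * t ^ 2 : ℂ) / (1 - t ^ 2))
      (ContinuousOn.div (by fun_prop) (by fun_prop) hden)
    exact ⟨max C₁ C₂, fun t ht => ⟨(h₁ t ht).trans (le_max_left _ _),
      (h₂ t ht).trans (le_max_right _ _)⟩⟩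
  obtain ⟨C, hC⟩ := hb
  have hd : ∀ t ∈ Ioo (-(1 / 3) : ℝ) (1 / 3),
      HasDerivAt (fun x : ℝ => angSol μ L z (1 + x : ℝ)) (angSol' μ L z (1 + t : ℝ)) t ∧
      HasDerivAt (fun x : ℝ => angSol' μ L z (1 + x : ℝ)) (angSol'' μ L z (1 + t : ℝ)) t ∧
      (1 - (t : ℂ) ^ 2) * angSol'' μ L z (1 + t : ℝ) -
        2 * (μ + 1) * t * (angSol' μ L z (1 + t : ℝ)) +
        (L + z * t ^ 2) * angSol μ L z (1 + t : ℝ) = 0 := by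
    intro t ht
    obtain ⟨h1, h2, h3⟩ := hasDerivAt_angSol_real μ L z (y := 1 + t)
      ⟨by linarith [ht.1], by linarith [ht.2]⟩
    have hr : HasDerivAt (fun s : ℝ => 1 + s) 1 t := (hasDerivAt_id t).const_add 1
    refine ⟨?_, ?_, ?_⟩
    · exact (h1.scomp t hr).congr_deriv (by simp)
    · exact (h2.scomp t hr).congr_deriv (by simp)
    · push_cast at h3 ⊢
      linear_combination h3
  have key := linear_ode_zero (α := -(1 / 3)) (β := 1 / 3) (t₀ := 0)
    (u := fun x : ℝ => angSol μ L z (1 - x : ℝ) - ε * angSol μ L z (1 + x : ℝ))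
    (u' := fun x : ℝ => -angSol' μ L z (1 - x : ℝ) - ε * angSol' μ L z (1 + x : ℝ))
    (fun t ht => hC t (Ioo_subset_Icc_self ht)) (by norm_num)
    (fun t ht => (hasDerivAt_angSol_one_sub μ L z ⟨ht.1, by linarith [ht.2]⟩).1.fun_sub
      ((hd t ht).1.const_mul ε))
    (fun t ht => by
      obtain ⟨-, a2, a3⟩ := hasDerivAt_angSol_one_sub μ L z (x := t) ⟨ht.1, by linarith [ht.2]⟩
      obtain ⟨-, b2, b3⟩ := hd t ht
      refine (a2.fun_sub (b2.const_mul ε)).congr_deriv ?_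
      have hden : (1 - t ^ 2 : ℂ) ≠ 0 := by
        have : 1 - t ^ 2 ≠ 0 := by nlinarith [ht.1, ht.2]
        exact_mod_cast this
      rw [div_mul_eq_mul_div, div_mul_eq_mul_div, ← add_div, eq_div_iff hden]
      linear_combination a3 - ε * b3) ?_ ?_ x hx
  · exact sub_eq_zero.1 key.1
  · cases σ
    · simp only [angD, cond_false] at h
      simp [h]
    · simp [hε]
  · cases σ
    · simp [hε]
    · simp only [angD, cond_true] at h
      simp [h]

theorem contDiffAt_angSol (μ : ℕ) (L z : ℂ) {y : ℝ} (hy : y ∈ Ioo (-(4 / 3) : ℝ) (4 / 3)) :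
    ContDiffAt ℝ (⊤ : ℕ∞) (fun y : ℝ => angSol μ L z y) y := by
  have hball : ‖(y : ℂ)‖ < 4 / 3 := by
    rw [Complex.norm_real, Real.norm_eq_abs]; exact abs_lt.2 hy
  have hd : DifferentiableOn ℂ (angSol μ L z) (Metric.ball 0 (4 / 3)) := fun w hw =>
    (angSol_ode μ L z (mem_ball_zero_iff.1 hw)).1.differentiableAt.differentiableWithinAt
  have h1 : ContDiffAt ℂ (⊤ : ℕ∞) (angSol μ L z) (y : ℂ) :=
    (hd.contDiffOn Metric.isOpen_ball).contDiffAt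
      (Metric.isOpen_ball.mem_nhds (mem_ball_zero_iff.2 hball))
  exact (h1.restrict_scalars ℝ).comp y Complex.ofRealCLM.contDiff.contDiffAt

/-- At an eigenvalue, the regular solutions at the two poles fit together to a function of
`x = cos θ` that is smooth across `[-1, 1]`. -/
theorem exists_angular_profile {μ : ℕ} {σ : Bool} {L z : ℂ} (h : angD μ σ (L, z) = 0) :
    ∃ F F' F'' : ℝ → ℂ, ContDiffOn ℝ (⊤ : ℕ∞) F (Ioo (-(4 / 3)) (4 / 3)) ∧
      (∀ x ∈ Ioo (-(4 / 3) : ℝ) (4 / 3), HasDerivAt F (F' x) x ∧ HasDerivAt F' (F'' x) x ∧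
        (1 - (x : ℂ) ^ 2) * F'' x - 2 * (μ + 1) * x * F' x + (L + z * x ^ 2) * F x = 0) ∧
      F 1 = 1 := by
  set ε : ℂ := bif σ then 1 else -1 with hε
  let F : ℝ → ℂ := fun x => if 0 < x then angSol μ L z (1 - x : ℝ) else ε * angSol μ L z (1 + x : ℝ)
  have hε2 : ε * ε = 1 := by cases σ <;> simp [hε]
  have hright : ∀ x : ℝ, -(1 / 3) < x → F =ᶠ[𝓝 x] fun x => angSol μ L z (1 - x : ℝ) := by
    intro x hx
    filter_upwards [Ioi_mem_nhds hx] with t ht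
    simp only [F]
    split_ifs with h0
    · rfl
    · have := angSol_reflect h (x := t) ⟨ht, by linarith⟩
      exact this.symm
  have hleft : ∀ x : ℝ, x < 1 / 3 → F =ᶠ[𝓝 x] fun x => ε * angSol μ L z (1 - (-x) : ℝ) := by
    intro x hx
    filter_upwards [Iio_mem_nhds hx] with t ht
    simp only [F]
    split_ifs with h0
    · have := angSol_reflect h (x := t) ⟨by linarith, ht⟩
      rw [this, sub_neg_eq_add]
    · rw [sub_neg_eq_add]
  refine ⟨F, deriv F, deriv (deriv F), ?_, ?_, ?_⟩
  · intro x hx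
    refine ContDiffAt.contDiffWithinAt ?_
    rcases lt_or_ge x 0 with h0 | h0
    · refine ContDiffAt.congr_of_eventuallyEq ?_ (hleft x (by linarith))
      refine contDiffAt_const.mul ?_
      exact (contDiffAt_angSol μ L z (y := 1 - (-x)) ⟨by linarith [hx.1], by linarith⟩).comp x
        (f := fun x : ℝ => 1 - (-x)) (by fun_prop)
    · refine ContDiffAt.congr_of_eventuallyEq ?_ (hright x (by linarith))
      exact (contDiffAt_angSol μ L z (y := 1 - x) ⟨by linarith [hx.2], by linarith⟩).comp x
        (f := fun x : ℝ => 1 - x) (by fun_prop)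
  · intro x hx
    rcases lt_or_ge x 0 with h0 | h0
    · have hd : ∀ t ∈ Ioo (-(4 / 3) : ℝ) (1 / 3),
          HasDerivAt F (ε * angSol' μ L z (1 - (-t) : ℝ)) t := by
        intro t ht
        have := (hasDerivAt_angSol_one_sub μ L z (x := -t)
          ⟨by linarith [ht.2], by linarith [ht.1]⟩).1.scomp t (hasDerivAt_neg t)
        exact ((this.const_mul ε).congr_deriv (by simp)).congr_of_eventuallyEq (hleft t ht.2)
      have e : deriv F =ᶠ[𝓝 x] fun t => ε * angSol' μ L z (1 - (-t) : ℝ) := by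
        filter_upwards [Ioo_mem_nhds hx.1 (by linarith : x < 1 / 3)] with t ht
        exact (hd t ht).deriv
      obtain ⟨-, a2, a3⟩ := hasDerivAt_angSol_one_sub μ L z (x := -x)
        ⟨by linarith, by linarith [hx.1]⟩
      have hd2 : HasDerivAt (deriv F) (ε * angSol'' μ L z (1 - (-x) : ℝ)) x := by
        have := ((a2.scomp x (hasDerivAt_neg x)).const_mul (-ε))
        refine HasDerivAt.congr_of_eventuallyEq (this.congr_deriv (by simp)) ?_
        filter_upwards [e] with t ht
        rw [ht]; simp
      have hF := (hleft x (by linarith)).eq_of_nhds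
      rw [hd2.deriv]
      refine ⟨(hd x ⟨hx.1, by linarith⟩).congr_deriv e.eq_of_nhds.symm, hd2, ?_⟩
      rw [hF, e.eq_of_nhds]
      push_cast at a3 ⊢
      linear_combination ε * a3
    · have hd : ∀ t ∈ Ioo (-(1 / 3) : ℝ) (4 / 3),
          HasDerivAt F (-angSol' μ L z (1 - t : ℝ)) t := by
        intro t ht
        exact (hasDerivAt_angSol_one_sub μ L z (x := t)
          ⟨ht.1, by linarith [ht.2]⟩).1.congr_of_eventuallyEq (hright t ht.1)
      have e : deriv F =ᶠ[𝓝 x] fun t => -angSol' μ L z (1 - t : ℝ) := by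
        filter_upwards [Ioo_mem_nhds (by linarith : -(1 / 3) < x) hx.2] with t ht
        exact (hd t ht).deriv
      obtain ⟨-, a2, a3⟩ := hasDerivAt_angSol_one_sub μ L z (x := x)
        ⟨by linarith, by linarith [hx.2]⟩
      have hd2 : HasDerivAt (deriv F) (angSol'' μ L z (1 - x : ℝ)) x := a2.congr_of_eventuallyEq e
      have hF := (hright x (by linarith)).eq_of_nhds
      rw [hd2.deriv]
      refine ⟨(hd x ⟨by linarith, hx.2⟩).congr_deriv e.eq_of_nhds.symm, hd2, ?_⟩
      rw [hF, e.eq_of_nhds]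
      exact a3
  · simp [F, angSol_zero]

theorem isAngularEigenfunction_of_profile {a : ℝ} {ω : ℂ} {m : ℤ} {L : ℂ} {F F' F'' : ℝ → ℂ}
    (hc : ContDiffOn ℝ (⊤ : ℕ∞) F (Ioo (-(4 / 3)) (4 / 3)))
    (hF : ∀ x ∈ Ioo (-(4 / 3) : ℝ) (4 / 3), HasDerivAt F (F' x) x ∧ HasDerivAt F' (F'' x) x ∧
        (1 - (x : ℂ) ^ 2) * F'' x - 2 * (m.natAbs + 1) * x * F' x +
          (L + (a : ℂ) ^ 2 * ω ^ 2 * x ^ 2) * F x = 0) (h1 : F 1 = 1) :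
    IsAngularEigenfunction a ω m (L + m.natAbs * (m.natAbs + 1))
      (fun θ => (Real.sin θ : ℂ) ^ m.natAbs * F (Real.cos θ)) := by
  have hmem : ∀ θ, Real.cos θ ∈ Ioo (-(4 / 3) : ℝ) (4 / 3) := fun θ =>
    ⟨by linarith [Real.neg_one_le_cos θ], by linarith [Real.cos_le_one θ]⟩
  have hsin : ∀ θ ∈ Ioo 0 Real.pi, Real.sin θ ≠ 0 := fun θ hθ => (Real.sin_pos_of_mem_Ioo hθ).ne'
  have hm : ((m.natAbs : ℕ) : ℂ) ^ 2 = (m : ℂ) ^ 2 := by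
    rw [← Int.cast_natCast, ← Int.cast_pow, Int.natAbs_sq, Int.cast_pow]
  refine ⟨?_, ?_, ?_, ?_⟩
  · have h2 : ContDiffOn ℝ (⊤ : ℕ∞) (fun θ => F (Real.cos θ)) (Ioo 0 Real.pi) :=
      hc.comp Real.contDiff_cos.contDiffOn fun θ _ => hmem θ
    have h3 : ContDiff ℝ (⊤ : ℕ∞) fun θ : ℝ => (Real.sin θ : ℂ) ^ m.natAbs :=
      (Complex.ofRealCLM.contDiff.comp Real.contDiff_sin).pow _
    exact h3.contDiffOn.mul h2
  · intro θ hθ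
    have e : (fun s : ℝ => (Real.sin s : ℂ) *
        deriv (fun θ : ℝ => (Real.sin θ : ℂ) ^ m.natAbs * F (Real.cos θ)) s) =ᶠ[𝓝 θ]
        angFlux m.natAbs F F' := by
      filter_upwards [Ioo_mem_nhds hθ.1 hθ.2] with s hs
      have hne : (Real.sin s : ℂ) ≠ 0 := by exact_mod_cast hsin s hs
      rw [(angular_substitution hF (hsin s hs) (hmem s)).1.deriv, mul_div_cancel₀ _ hne]
    have hne : (Real.sin θ : ℂ) ≠ 0 := by exact_mod_cast hsin θ hθ
    rw [e.deriv_eq, (angular_substitution hF (hsin θ hθ) (hmem θ)).2.deriv, hm, neg_mul,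
      ← mul_assoc (1 / (Real.sin θ : ℂ)), one_div_mul_cancel hne]
    ring
  · obtain ⟨B, hB⟩ := isCompact_Icc.exists_bound_of_continuousOn (s := Icc (-1 : ℝ) 1)
      (f := F) (hc.continuousOn.mono fun x hx => ⟨by linarith [hx.1], by linarith [hx.2]⟩)
    refine ⟨B, fun θ _ => ?_⟩
    rw [norm_mul, norm_pow, Complex.norm_real, Real.norm_eq_abs]
    have hp : |Real.sin θ| ^ m.natAbs ≤ 1 := pow_le_one₀ (abs_nonneg _) (Real.abs_sin_le_one θ)
    calc _ ≤ 1 * ‖F (Real.cos θ)‖ := by gcongr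
      _ ≤ B := by rw [one_mul]; exact hB _ ⟨Real.neg_one_le_cos θ, Real.cos_le_one θ⟩
  · have hcont : ContinuousAt (fun θ => F (Real.cos θ)) 0 :=
      ContinuousAt.comp (by
        rw [Real.cos_zero]; exact (hF 1 (by norm_num)).1.continuousAt) Real.continuous_cos.continuousAt
    have hne : ∀ᶠ θ in 𝓝 (0:ℝ), F (Real.cos θ) ≠ 0 := by
      refine hcont.eventually_ne ?_
      simp [h1]
    obtain ⟨θ, h3, h4⟩ := ((hne.filter_mono nhdsWithin_le_nhds).and
      (Ioo_mem_nhdsGT Real.pi_pos)).exists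
    refine ⟨θ, h4, mul_ne_zero (pow_ne_zero _ ?_) h3⟩
    exact_mod_cast hsin θ h4

/-- A solution that is bounded near the pole `θ = 0` has vanishing Wronskian with the regular
solution. Otherwise `sin θ ^ (μ + 1) S'` would have a nonzero limit at the pole, and `S` would be at
least logarithmically large. -/
theorem angular_wronskian_zero {μ : ℕ} {L z : ℂ} {S P : ℝ → ℂ} {B : ℝ}
    (hS : ∀ θ ∈ Ioo 0 Real.pi, HasDerivAt S (P θ / Real.sin θ) θ)
    (hP : ∀ θ ∈ Ioo 0 Real.pi, HasDerivAt P (Real.sin θ *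
      (((μ : ℂ) ^ 2 / (Real.sin θ : ℂ) ^ 2 - z * (Real.cos θ : ℂ) ^ 2 - (L + μ * (μ + 1))) *
        S θ)) θ) (hB : ∀ θ ∈ Ioo 0 Real.pi, ‖S θ‖ ≤ B) :
    S (Real.pi / 2) * angSol' μ L z 1 - P (Real.pi / 2) * angSol μ L z 1 = 0 := by
  set F : ℝ → ℂ := fun x => angSol μ L z (1 - x : ℝ) with hFdef
  set F' : ℝ → ℂ := fun x => -angSol' μ L z (1 - x : ℝ) with hF'def
  have hF := fun x (hx : x ∈ Ioo (-(1 / 3) : ℝ) (7 / 3)) => hasDerivAt_angSol_one_sub μ L z hx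
  set T : ℝ → ℂ := fun θ => (Real.sin θ : ℂ) ^ μ * F (Real.cos θ) with hT
  set Q : ℝ → ℂ := angFlux μ F F' with hQ
  have hpi := Real.pi_pos
  have hcos : ∀ θ ∈ Ioc 0 (Real.pi / 2), Real.cos θ ∈ Ioo (-(1 / 3) : ℝ) (7 / 3) := fun θ hθ =>
    ⟨by linarith [Real.cos_nonneg_of_mem_Icc ⟨by linarith [hθ.1], hθ.2⟩],
      by linarith [Real.cos_le_one θ]⟩
  have hI : ∀ θ ∈ Ioc 0 (Real.pi / 2), θ ∈ Ioo 0 Real.pi := fun θ hθ =>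
    ⟨hθ.1, by linarith [hθ.2]⟩
  have hsin : ∀ θ ∈ Ioc 0 (Real.pi / 2), 0 < Real.sin θ := fun θ hθ =>
    Real.sin_pos_of_mem_Ioo (hI θ hθ)
  let W : ℝ → ℂ := fun θ => S θ * Q θ - P θ * T θ
  have hW : ∀ θ ∈ Ioc 0 (Real.pi / 2), HasDerivAt W 0 θ := by
    intro θ hθ
    obtain ⟨t1, t2⟩ := angular_substitution (μ := μ) (L := L) (z := z) hF (hsin θ hθ).ne' (hcos θ hθ)
    have hne : (Real.sin θ : ℂ) ≠ 0 := by exact_mod_cast (hsin θ hθ).ne'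
    refine (((hS θ (hI θ hθ)).mul t2).fun_sub ((hP θ (hI θ hθ)).mul t1)).congr_deriv ?_
    ring
  have hWc : ∀ θ ∈ Ioc 0 (Real.pi / 2), W θ = W (Real.pi / 2) := by
    intro θ hθ
    have := intervalIntegral.integral_eq_sub_of_hasDerivAt (a := θ) (b := Real.pi / 2)
      (f := W) (f' := fun _ => 0) (fun t ht => by
        rw [uIcc_of_le hθ.2] at ht
        exact hW t ⟨hθ.1.trans_le ht.1, ht.2⟩) (by simp)
    rw [intervalIntegral.integral_zero] at this
    exact (sub_eq_zero.1 this.symm).symm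
  have hmain : W (Real.pi / 2) = 0 := by
    by_contra hc
    set c := W (Real.pi / 2) with hcdef
    have hFcont : ContinuousAt (fun θ => F (Real.cos θ)) 0 :=
      ContinuousAt.comp (g := F) (f := Real.cos)
        (by rw [Real.cos_zero]; exact (hF 1 (by norm_num)).1.continuousAt) Real.continuous_cos.continuousAt
    have hF'cont : ContinuousAt (fun θ => F' (Real.cos θ)) 0 :=
      ContinuousAt.comp (g := F') (f := Real.cos)
        (by rw [Real.cos_zero]; exact (hF 1 (by norm_num)).2.1.continuousAt) Real.continuous_cos.continuousAt
    have hQc : ContinuousAt Q 0 := by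
      have h1 : Continuous fun θ : ℝ => (Real.sin θ : ℂ) := by fun_prop
      have h2 : Continuous fun θ : ℝ => (Real.cos θ : ℂ) := by fun_prop
      exact (h1.continuousAt.pow μ).mul (((continuousAt_const.mul h2.continuousAt).mul hFcont).sub
        ((h1.continuousAt.pow 2).mul hF'cont))
    have hQ0 : Q 0 = 0 := by
      simp only [hQ, angFlux, Real.sin_zero]
      rcases μ with _ | ν <;> simp
    have hF0 : F (Real.cos 0) = 1 := by simp [hFdef, angSol_zero]
    have hSQ : Tendsto (fun θ => S θ * Q θ) (𝓝[>] 0) (𝓝 0) := by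
      have h1 : Tendsto (fun θ => B * ‖Q θ‖) (𝓝[>] 0) (𝓝 0) := by
        have := (hQc.tendsto.norm.const_mul B).mono_left (nhdsWithin_le_nhds (s := Ioi 0))
        simpa [hQ0] using this
      refine squeeze_zero_norm' ?_ h1
      filter_upwards [Ioo_mem_nhdsGT hpi] with θ hθ
      rw [norm_mul]
      exact mul_le_mul_of_nonneg_right (hB θ hθ) (norm_nonneg _)
    have hFt : Tendsto (fun θ => F (Real.cos θ)) (𝓝[>] 0) (𝓝 1) := by
      have := hFcont.tendsto.mono_left (nhdsWithin_le_nhds (s := Ioi 0))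
      rwa [hF0] at this
    -- the Wronskian is the constant `c`, and its part `S Q` tends to `0`
    have hPT : Tendsto (fun θ => P θ * (Real.sin θ : ℂ) ^ μ) (𝓝[>] 0) (𝓝 (-c)) := by
      have h1 : Tendsto (fun θ => (S θ * Q θ - c) / F (Real.cos θ)) (𝓝[>] 0) (𝓝 (-c)) := by
        have := (hSQ.sub_const c).div hFt one_ne_zero
        rw [zero_sub, div_one] at this
        exact this
      refine h1.congr' ?_
      filter_upwards [hFt.eventually_ne one_ne_zero, Ioc_mem_nhdsGT (half_pos hpi)] with θ h2 h3
      have := hWc θ h3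
      simp only [W, hT] at this
      rw [div_eq_iff h2]
      linear_combination this
    have hre : Tendsto (fun θ => (-(starRingEnd ℂ) c * (P θ * (Real.sin θ : ℂ) ^ μ)).re) (𝓝[>] 0)
        (𝓝 (‖c‖ ^ 2)) := by
      have := (Complex.continuous_re.tendsto _).comp (hPT.const_mul (-(starRingEnd ℂ) c))
      have e : (-(starRingEnd ℂ) c * -c).re = ‖c‖ ^ 2 := by
        rw [neg_mul_neg, Complex.conj_mul']
        norm_cast
      rwa [e] at this
    have hcpos : 0 < ‖c‖ ^ 2 := by have := norm_pos_iff.2 hc; positivity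
    have hev : ∀ᶠ θ in 𝓝[>] (0:ℝ), ‖c‖ ^ 2 / 2 <
        (-(starRingEnd ℂ) c * (P θ * (Real.sin θ : ℂ) ^ μ)).re :=
      hre.eventually (lt_mem_nhds (by linarith))
    obtain ⟨θ₁, hθ₁, hlow⟩ := mem_nhdsGT_iff_exists_Ioo_subset.1 hev
    set θ₀ := min θ₁ (Real.pi / 2) with hθ₀
    have hθ₀0 : 0 < θ₀ := lt_min hθ₁ (half_pos hpi)
    -- comparison of `Re (-c̄ S)` with a logarithm
    let φ : ℝ → ℝ := fun θ => (-(starRingEnd ℂ) c * S θ).re - ‖c‖ ^ 2 / 2 * Real.log θ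
    have hφ : ∀ θ ∈ Ioo 0 θ₀, HasDerivAt φ
        ((-(starRingEnd ℂ) c * (P θ / Real.sin θ)).re - ‖c‖ ^ 2 / 2 * θ⁻¹) θ := by
      intro θ hθ
      have hθ' : θ ∈ Ioo 0 Real.pi := ⟨hθ.1, by
        have := hθ.2.trans_le (min_le_right θ₁ (Real.pi / 2)); linarith⟩
      have h1 := ((hS θ hθ').const_mul (-(starRingEnd ℂ) c))
      have h2 := Complex.reCLM.hasFDerivAt.comp_hasDerivAt θ h1
      exact HasDerivAt.fun_sub h2 ((Real.hasDerivAt_log hθ.1.ne').const_mul _)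
    have hφ' : ∀ θ ∈ Ioo 0 θ₀,
        0 ≤ (-(starRingEnd ℂ) c * (P θ / Real.sin θ)).re - ‖c‖ ^ 2 / 2 * θ⁻¹ := by
      intro θ hθ
      have h1 : ‖c‖ ^ 2 / 2 < (-(starRingEnd ℂ) c * (P θ * (Real.sin θ : ℂ) ^ μ)).re :=
        hlow ⟨hθ.1, hθ.2.trans_le (min_le_left _ _)⟩
      have hs := hsin θ ⟨hθ.1, (hθ.2.trans_le (min_le_right _ _)).le⟩
      have hs1 := Real.sin_le_one θ
      have hsθ : Real.sin θ < θ := Real.sin_lt hθ.1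
      have e1 : (-(starRingEnd ℂ) c * (P θ * (Real.sin θ : ℂ) ^ μ)).re =
          (-(starRingEnd ℂ) c * P θ).re * Real.sin θ ^ μ := by
        rw [← mul_assoc, ← Complex.ofReal_pow, Complex.re_mul_ofReal]
      have e2 : (-(starRingEnd ℂ) c * (P θ / Real.sin θ)).re =
          (-(starRingEnd ℂ) c * P θ).re / Real.sin θ := by
        rw [← mul_div_assoc, Complex.div_ofReal_re]
      rw [e1] at h1
      rw [e2]
      have hp1 : Real.sin θ ^ μ ≤ 1 := pow_le_one₀ hs.le hs1
      have hp0 : 0 < Real.sin θ ^ μ := by positivity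
      have h2 : ‖c‖ ^ 2 / 2 ≤ (-(starRingEnd ℂ) c * P θ).re := by
        by_contra! hlt
        nlinarith
      rw [sub_nonneg, ← div_eq_mul_inv]
      exact div_le_div₀ (by linarith) h2 hs hsθ.le
    have hmono : MonotoneOn φ (Ioo 0 θ₀) := by
      refine monotoneOn_of_deriv_nonneg (convex_Ioo _ _)
        (fun θ hθ => (hφ θ hθ).continuousAt.continuousWithinAt) ?_ ?_
      · rw [interior_Ioo]
        exact fun θ hθ => (hφ θ hθ).differentiableAt.differentiableWithinAt
      · rw [interior_Ioo]
        intro θ hθ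
        rw [(hφ θ hθ).deriv]
        exact hφ' θ hθ
    have hlog : Tendsto (fun θ => -(‖c‖ * B) - ‖c‖ ^ 2 / 2 * Real.log θ) (𝓝[>] 0) atTop := by
      have h1 : Tendsto (fun θ => -(‖c‖ ^ 2 / 2) * Real.log θ) (𝓝[>] 0) atTop :=
        Real.tendsto_log_nhdsGT_zero.const_mul_atBot_of_neg (by linarith)
      refine (tendsto_atTop_add_const_left _ (-(‖c‖ * B)) h1).congr fun θ => by ring
    obtain ⟨θ, h1, h2⟩ := ((hlog.eventually (eventually_gt_atTop (φ (θ₀ / 2)))).and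
      (Ioo_mem_nhdsGT (half_pos hθ₀0))).exists
    have h3 : φ θ ≤ φ (θ₀ / 2) := hmono ⟨h2.1, by linarith [h2.2]⟩
      ⟨half_pos hθ₀0, half_lt_self hθ₀0⟩ h2.2.le
    have h4 : -(‖c‖ * B) ≤ (-(starRingEnd ℂ) c * S θ).re := by
      have h5 := neg_le_of_abs_le (Complex.abs_re_le_norm (-(starRingEnd ℂ) c * S θ))
      have h6 : ‖-(starRingEnd ℂ) c * S θ‖ = ‖c‖ * ‖S θ‖ := by
        rw [norm_mul, norm_neg, RCLike.norm_conj]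
      have h7 : ‖S θ‖ ≤ B := hB θ ⟨h2.1, by
        have := min_le_right θ₁ (Real.pi / 2); linarith [h2.2]⟩
      have h8 : ‖c‖ * ‖S θ‖ ≤ ‖c‖ * B := by gcongr
      linarith
    simp only [φ] at h1 h3
    linarith
  have e1 : Q (Real.pi / 2) = angSol' μ L z 1 := by
    simp [hQ, angFlux, hF'def]
  have e2 : T (Real.pi / 2) = angSol μ L z 1 := by
    simp [hT, hFdef]
  simp only [W, e1, e2] at hmain
  linear_combination hmain

/-- Eigenvalues of the angular equation are zeros of `angD`: the Wronskians of an eigenfunction and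
of its reflection `θ ↦ π - θ` with the regular solution vanish. -/
theorem angD_zero_of_isAngularEigenvalue {a : ℝ} {ω : ℂ} {m : ℤ} {lam : ℂ}
    (h : IsAngularEigenvalue a ω m lam) :
    ∃ σ, angD m.natAbs σ (lam - m.natAbs * (m.natAbs + 1), (a : ℂ) ^ 2 * ω ^ 2) = 0 := by
  obtain ⟨S, hSc, hode, ⟨B, hB⟩, θ₁, hθ₁, hne⟩ := h
  set μ := m.natAbs with hμ
  set L : ℂ := lam - μ * (μ + 1) with hL
  set z : ℂ := (a : ℂ) ^ 2 * ω ^ 2 with hz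
  have hm : ((μ : ℕ) : ℂ) ^ 2 = (m : ℂ) ^ 2 := by
    rw [← Int.cast_natCast, ← Int.cast_pow, Int.natAbs_sq, Int.cast_pow]
  have hpi := Real.pi_pos
  have hsin : ∀ θ ∈ Ioo 0 Real.pi, (Real.sin θ : ℂ) ≠ 0 := fun θ hθ => by
    exact_mod_cast (Real.sin_pos_of_mem_Ioo hθ).ne'
  have hat : ∀ θ ∈ Ioo 0 Real.pi, ContDiffAt ℝ (⊤ : ℕ∞) S θ := fun θ hθ =>
    hSc.contDiffAt (Ioo_mem_nhds hθ.1 hθ.2)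
  have hd : ∀ θ ∈ Ioo 0 Real.pi, HasDerivAt S (deriv S θ) θ := fun θ hθ =>
    ((hat θ hθ).differentiableAt (by simp)).hasDerivAt
  have hd2 : ∀ θ ∈ Ioo 0 Real.pi, DifferentiableAt ℝ (deriv S) θ := fun θ hθ =>
    ((hSc.deriv_of_isOpen (m := 1) isOpen_Ioo (by norm_cast)).contDiffAt
      (Ioo_mem_nhds hθ.1 hθ.2)).differentiableAt (by simp)
  set P : ℝ → ℂ := fun θ => (Real.sin θ : ℂ) * deriv S θ with hPdef
  have hS : ∀ θ ∈ Ioo 0 Real.pi, HasDerivAt S (P θ / Real.sin θ) θ := fun θ hθ =>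
    (hd θ hθ).congr_deriv (by rw [hPdef]; exact (mul_div_cancel_left₀ _ (hsin θ hθ)).symm)
  have hsd : ∀ θ : ℝ, HasDerivAt (fun θ : ℝ => (Real.sin θ : ℂ)) (Real.cos θ : ℂ) θ := fun θ =>
    (Real.hasDerivAt_sin θ).ofReal_comp
  have hP : ∀ θ ∈ Ioo 0 Real.pi, HasDerivAt P (Real.sin θ *
      (((μ : ℂ) ^ 2 / (Real.sin θ : ℂ) ^ 2 - z * (Real.cos θ : ℂ) ^ 2 - (L + μ * (μ + 1))) *
        S θ)) θ := by
    intro θ hθ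
    have h1 : DifferentiableAt ℝ P θ := (hsd θ).differentiableAt.mul (hd2 θ hθ)
    refine h1.hasDerivAt.congr_deriv ?_
    have h2 := hode θ hθ
    have hs := hsin θ hθ
    rw [hm, hL, hz]
    have h3 : deriv P θ = Real.sin θ * (1 / (Real.sin θ : ℂ) * deriv P θ) := by
      field_simp
    rw [h3]
    linear_combination (-(Real.sin θ : ℂ)) * h2
  have hrefl : ∀ θ : ℝ, HasDerivAt (fun s : ℝ => Real.pi - s) (-1) θ := fun θ =>
    (hasDerivAt_id θ).const_sub _
  have hmem : ∀ θ ∈ Ioo 0 Real.pi, Real.pi - θ ∈ Ioo 0 Real.pi := fun θ hθ =>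
    ⟨by linarith [hθ.2], by linarith [hθ.1]⟩
  have w1 := angular_wronskian_zero hS hP hB
  have w2 := angular_wronskian_zero (μ := μ) (L := L) (z := z) (S := fun θ => S (Real.pi - θ))
    (P := fun θ => -P (Real.pi - θ)) (B := B)
    (fun θ hθ => by
      refine ((hS _ (hmem θ hθ)).scomp θ (hrefl θ)).congr_deriv ?_
      rw [Real.sin_pi_sub, neg_one_smul, neg_div])
    (fun θ hθ => by
      refine ((hP _ (hmem θ hθ)).scomp θ (hrefl θ)).fun_neg.congr_deriv ?_
      rw [Real.sin_pi_sub, Real.cos_pi_sub, neg_one_smul, neg_neg, Complex.ofReal_neg, neg_sq])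
    (fun θ hθ => hB _ (hmem θ hθ))
  simp only [sub_half] at w2
  by_cases h0 : angSol μ L z 1 * angSol' μ L z 1 = 0
  · exact angD_of_angSol_mul_eq_zero (p := (L, z)) h0
  · exfalso
    have hf := left_ne_zero_of_mul h0
    have hf' := right_ne_zero_of_mul h0
    have hS0 : S (Real.pi / 2) = 0 := by
      have : 2 * (S (Real.pi / 2) * angSol' μ L z 1) = 0 := by linear_combination w1 + w2
      simpa [hf'] using this
    have hP0 : deriv S (Real.pi / 2) = 0 := by
      have : 2 * (P (Real.pi / 2) * angSol μ L z 1) = 0 := by linear_combination w2 - w1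
      simpa [hf, hPdef] using this
    set α := min θ₁ (Real.pi / 2) / 2 with hα
    set β := (max θ₁ (Real.pi / 2) + Real.pi) / 2 with hβ
    have hm1 := min_le_left θ₁ (Real.pi / 2)
    have hm2 := min_le_right θ₁ (Real.pi / 2)
    have hm3 := le_max_left θ₁ (Real.pi / 2)
    have hm4 := le_max_right θ₁ (Real.pi / 2)
    have hm5 : 0 < min θ₁ (Real.pi / 2) := lt_min hθ₁.1 (half_pos hpi)
    have hm6 : max θ₁ (Real.pi / 2) < Real.pi := max_lt hθ₁.2 (half_lt_self hpi)
    have hsub : ∀ θ ∈ Icc α β, θ ∈ Ioo 0 Real.pi := fun θ hθ =>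
      ⟨by linarith [hθ.1], by linarith [hθ.2]⟩
    have hac : ContinuousOn (fun θ : ℝ => -((Real.cos θ : ℂ) / Real.sin θ)) (Icc α β) := by
      refine (ContinuousOn.div (by fun_prop) (by fun_prop) fun θ hθ => ?_).neg
      exact hsin θ (hsub θ hθ)
    have hbc : ContinuousOn (fun θ : ℝ => (μ : ℂ) ^ 2 / (Real.sin θ : ℂ) ^ 2 -
        z * (Real.cos θ : ℂ) ^ 2 - (L + μ * (μ + 1))) (Icc α β) := by
      refine ((ContinuousOn.div (by fun_prop) (by fun_prop) fun θ hθ => ?_).sub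
        (by fun_prop)).sub (by fun_prop)
      exact pow_ne_zero _ (hsin θ (hsub θ hθ))
    obtain ⟨A, hA⟩ := isCompact_Icc.exists_bound_of_continuousOn hac
    obtain ⟨A', hA'⟩ := isCompact_Icc.exists_bound_of_continuousOn hbc
    refine hne (linear_ode_zero (u := S) (u' := deriv S) (α := α) (β := β) (t₀ := Real.pi / 2)
      (C := max A A') (fun t ht => ⟨(hA t ⟨ht.1.le, ht.2.le⟩).trans (le_max_left _ _),
        (hA' t ⟨ht.1.le, ht.2.le⟩).trans (le_max_right _ _)⟩) ⟨by linarith, by linarith⟩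
      (fun t ht => hd t (hsub t ⟨ht.1.le, ht.2.le⟩)) (fun t ht => ?_) hS0 hP0 θ₁
      ⟨by linarith, by linarith⟩).1
    have htm := hsub t ⟨ht.1.le, ht.2.le⟩
    have hs := hsin t htm
    have e1 : P =ᶠ[𝓝 t] fun θ => (Real.sin θ : ℂ) * deriv S θ := Eventually.of_forall fun _ => rfl
    have h1 := (hP t htm).congr_of_eventuallyEq e1.symm
    have h2 := (hsd t).mul (hd2 t htm).hasDerivAt
    have h3 := h2.unique h1
    refine (hd2 t htm).hasDerivAt.congr_deriv ?_
    refine mul_left_cancel₀ hs ?_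
    have h4 : (Real.sin t : ℂ) * (-((Real.cos t : ℂ) / Real.sin t) * deriv S t) =
      -(Real.cos t : ℂ) * deriv S t := by field_simp
    rw [mul_add, h4]
    linear_combination h3

/-! ### The family of spheroidal eigenvalues -/

/-- `F` is a smooth function near `[-1, 1]` with `F 1 = 1` for which `sin θ ^ |m| * F (cos θ)` solves
the angular equation with eigenvalue `lam`. -/
def IsAngularProfile (a : ℝ) (ω : ℂ) (m : ℤ) (lam : ℂ) (F : ℝ → ℂ) : Prop :=
  ContDiffOn ℝ (⊤ : ℕ∞) F (Ioo (-(4 / 3)) (4 / 3)) ∧ F 1 = 1 ∧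
  ∃ F' F'' : ℝ → ℂ, ∀ x ∈ Ioo (-(4 / 3) : ℝ) (4 / 3),
    HasDerivAt F (F' x) x ∧ HasDerivAt F' (F'' x) x ∧
      (1 - (x : ℂ) ^ 2) * F'' x - 2 * (m.natAbs + 1) * x * F' x +
        (lam - m.natAbs * (m.natAbs + 1) + (a : ℂ) ^ 2 * ω ^ 2 * x ^ 2) * F x = 0

theorem IsAngularProfile.isAngularEigenfunction {a : ℝ} {ω : ℂ} {m : ℤ} {lam : ℂ} {F : ℝ → ℂ}
    (h : IsAngularProfile a ω m lam F) :
    IsAngularEigenfunction a ω m lam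
      (fun θ => (Real.sin θ : ℂ) ^ m.natAbs * F (Real.cos θ)) := by
  obtain ⟨h1, h2, F', F'', h3⟩ := h
  have := isAngularEigenfunction_of_profile h1 h3 h2
  rwa [sub_add_cancel] at this

theorem exists_isAngularProfile {a : ℝ} {ω : ℂ} {m : ℤ} {lam : ℂ} {σ : Bool}
    (h : angD m.natAbs σ (lam - m.natAbs * (m.natAbs + 1), (a : ℂ) ^ 2 * ω ^ 2) = 0) :
    ∃ F, IsAngularProfile a ω m lam F := by
  obtain ⟨F, F', F'', h1, h2, h3⟩ := exists_angular_profile h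
  exact ⟨F, h1, h3, F', F'', h2⟩

/-- For real parameters, `z = a² ω²` and `L = lam - |m| (|m| + 1)`. -/
theorem isAngularEigenvalue_iff {a ω : ℝ} {m : ℤ} {lam : ℝ} :
    IsAngularEigenvalue a (ω : ℂ) m (lam : ℂ) ↔
      lam - m.natAbs * (m.natAbs + 1) ∈ angZeros m.natAbs (a ^ 2 * ω ^ 2) := by
  have e : (((lam - m.natAbs * (m.natAbs + 1) : ℝ) : ℂ), ((a ^ 2 * ω ^ 2 : ℝ) : ℂ)) =
      ((lam : ℂ) - m.natAbs * (m.natAbs + 1), (a : ℂ) ^ 2 * (ω : ℂ) ^ 2) := by push_cast; rfl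
  constructor
  · intro h
    obtain ⟨σ, h⟩ := angD_zero_of_isAngularEigenvalue h
    exact ⟨σ, by rw [e]; exact h⟩
  · rintro ⟨σ, h⟩
    rw [e] at h
    obtain ⟨F, hF⟩ := exists_isAngularProfile h
    exact ⟨_, hF.isAngularEigenfunction⟩

theorem exists_isRealSpheroidalEigenvalue (a ω : ℝ) (m : ℤ) (l : ℕ) (hl : m.natAbs ≤ l) :
    ∃ lam : ℝ, IsRealSpheroidalEigenvalue a ω m l lam := by
  have hz : 0 ≤ a ^ 2 * ω ^ 2 := by positivity
  obtain ⟨L, hL, hcard⟩ := exists_encard_lt_eq (fun b => finite_angZeros m.natAbs hz b)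
    (exists_lt_mem_angZeros m.natAbs hz) (l - m.natAbs)
  set c : ℝ := m.natAbs * (m.natAbs + 1) with hc
  refine ⟨L + c, isAngularEigenvalue_iff.2 (by rwa [add_sub_cancel_right]), ?_⟩
  have e : {ν : ℝ | ν < L + c ∧ IsAngularEigenvalue a (ω : ℂ) m (ν : ℂ)} =
      (fun x => x + c) '' {x | x < L ∧ x ∈ angZeros m.natAbs (a ^ 2 * ω ^ 2)} := by
    ext ν
    simp only [mem_ofPred_eq, mem_image, isAngularEigenvalue_iff]
    constructor
    · rintro ⟨h1, h2⟩
      exact ⟨ν - c, ⟨by linarith, h2⟩, by ring⟩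
    · rintro ⟨x, ⟨h1, h2⟩, rfl⟩
      exact ⟨by linarith, by rwa [← hc, add_sub_cancel_right]⟩
  rw [e, (add_left_injective c).injOn.encard_image, hcard, ← Nat.cast_add, Nat.sub_add_cancel hl]

/-- The holomorphic family of eigenvalues through `λ_{ωml}`. -/
theorem exists_spheroidal_family (a ωR : ℝ) (m : ℤ) (l : ℕ) (hl : m.natAbs ≤ l) :
    ∃ δ > 0, ∃ Λ : ℂ → ℂ, (Λ ωR).im = 0 ∧ ContinuousOn Λ (Metric.ball (ωR : ℂ) δ) ∧
      ∀ ω ∈ Metric.ball (ωR : ℂ) δ, ω.re = ωR →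
        IsSpheroidalEigenvalue a ω m l (Λ ω) ∧ ∃ F, IsAngularProfile a ω m (Λ ω) F := by
  obtain ⟨lam, hlam⟩ := exists_isRealSpheroidalEigenvalue a ωR m l hl
  obtain ⟨σ, hσ⟩ := isAngularEigenvalue_iff.1 hlam.1
  set c : ℝ := m.natAbs * (m.natAbs + 1) with hc
  obtain ⟨r₀, r₁, h1, h2, h3, -⟩ := angJ_real_pos m.natAbs (lam - c) (a ^ 2 * ωR ^ 2)
  obtain ⟨δ, hδ, Λ, hΛ0, hΛ⟩ := exists_angular_branch m.natAbs σ hσ (by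
    rw [h3]; exact_mod_cast (h1.trans h2).ne')
  have hq : Continuous fun ω : ℂ => (a : ℂ) ^ 2 * ω ^ 2 := by fun_prop
  have hq0 : (a : ℂ) ^ 2 * (ωR : ℂ) ^ 2 = ((a ^ 2 * ωR ^ 2 : ℝ) : ℂ) := by push_cast; rfl
  obtain ⟨δ', hδ', hsub⟩ := Metric.continuous_iff.1 hq (ωR : ℂ) δ hδ
  have hmem : ∀ ω ∈ Metric.ball (ωR : ℂ) δ',
      (a : ℂ) ^ 2 * ω ^ 2 ∈ Metric.ball ((a ^ 2 * ωR ^ 2 : ℝ) : ℂ) δ := fun ω hω => by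
    have := hsub ω hω
    rwa [hq0] at this
  have hcC : (c : ℂ) = m.natAbs * (m.natAbs + 1) := by rw [hc]; push_cast; rfl
  have hdiff : DifferentiableOn ℂ (fun ω => Λ ((a : ℂ) ^ 2 * ω ^ 2) + c)
      (Metric.ball (ωR : ℂ) δ') := fun ω hω => by
    refine DifferentiableAt.differentiableWithinAt (DifferentiableAt.add_const _ ?_)
    exact ((hΛ _ (hmem ω hω)).2.differentiableAt).comp ω (by fun_prop)
  have h0 : Λ ((a : ℂ) ^ 2 * (ωR : ℂ) ^ 2) + c = lam := by
    rw [hq0, hΛ0]; push_cast; ring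
  have hprof : ∀ ω ∈ Metric.ball (ωR : ℂ) δ',
      ∃ F, IsAngularProfile a ω m (Λ ((a : ℂ) ^ 2 * ω ^ 2) + c) F := fun ω hω =>
    exists_isAngularProfile (σ := σ) (by
      rw [← hcC, add_sub_cancel_right]; exact (hΛ _ (hmem ω hω)).1)
  refine ⟨δ', hδ', fun ω => Λ ((a : ℂ) ^ 2 * ω ^ 2) + c, by simp [h0], hdiff.continuousOn, ?_⟩
  intro ω hω hre
  refine ⟨⟨δ', fun ω => Λ ((a : ℂ) ^ 2 * ω ^ 2) + c, ?_, by rwa [hre], ?_, ⟨lam, ?_, ?_⟩, rfl⟩,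
    hprof ω hω⟩
  · rw [mem_ball_iff_norm] at hω
    have := Complex.abs_im_le_norm (ω - ωR)
    simp only [Complex.sub_im, Complex.ofReal_im, sub_zero] at this
    linarith
  · intro z hz
    rw [hre] at hz
    obtain ⟨F, hF⟩ := hprof z hz
    exact ⟨_, hF.isAngularEigenfunction⟩
  · rwa [hre]
  · rw [hre]; exact h0

/-! ### The Kerr wave operator on separated functions -/

theorem Del_eq {M a : ℝ} (h : |a| < M) (r : ℝ) : Del M a r = r ^ 2 + a ^ 2 - 2 * M * r := by
  have hpos : 0 ≤ M ^ 2 - a ^ 2 := by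
    have := sq_lt_sq' (by linarith [abs_nonneg a]) h
    rw [sq_abs] at this
    linarith
  have hs2 : √(M ^ 2 - a ^ 2) ^ 2 = M ^ 2 - a ^ 2 := Real.sq_sqrt hpos
  unfold Del rPlus rMinus
  linear_combination -hs2

theorem sqrt_pos_of_subextremal {M a : ℝ} (h : |a| < M) : 0 < √(M ^ 2 - a ^ 2) := by
  refine Real.sqrt_pos.2 ?_
  have := sq_lt_sq' (by linarith [abs_nonneg a]) h
  rw [sq_abs] at this
  linarith

theorem rPlus_pos {M a : ℝ} (h : |a| < M) : 0 < rPlus M a := by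
  have := sqrt_pos_of_subextremal h
  have : 0 ≤ |a| := abs_nonneg a
  unfold rPlus
  linarith

theorem Del_pos {M a r : ℝ} (h : |a| < M) (hr : rPlus M a < r) : 0 < Del M a r := by
  have := sqrt_pos_of_subextremal h
  unfold Del
  unfold rPlus at hr ⊢
  unfold rMinus
  exact mul_pos (by linarith) (by linarith)

theorem hasDerivAt_Del {M a : ℝ} (h : |a| < M) (r : ℝ) :
    HasDerivAt (Del M a) (2 * r - 2 * M) r := by
  have e : Del M a = fun r => r ^ 2 + a ^ 2 - 2 * M * r := funext (Del_eq h)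
  rw [e]
  refine ((((hasDerivAt_id r).fun_pow 2).add_const (a ^ 2)).sub
    ((hasDerivAt_id r).const_mul (2 * M))).congr_deriv ?_
  simp

/-- The determinant of a matrix of the shape of the metric: a `2 × 2` block in `t`, `φ`, and diagonal
entries in `r`, `θ`. -/
theorem det_block (p q b c d : ℝ) :
    (!![p, 0, 0, q; 0, b, 0, 0; 0, 0, c, 0; q, 0, 0, d] : Matrix (Fin 4) (Fin 4) ℝ).det =
      b * c * (p * d - q ^ 2) := by
  simp [Matrix.det_succ_row_zero, Fin.sum_univ_succ, Fin.succAbove]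
  ring

theorem inv_block {p q b c d e : ℝ} (hb : b ≠ 0) (hc : c ≠ 0) (he : p * d - q ^ 2 = e)
    (he0 : e ≠ 0) :
    (!![p, 0, 0, q; 0, b, 0, 0; 0, 0, c, 0; q, 0, 0, d] : Matrix (Fin 4) (Fin 4) ℝ)⁻¹ =
      !![d / e, 0, 0, -q / e; 0, 1 / b, 0, 0; 0, 0, 1 / c, 0; -q / e, 0, 0, p / e] := by
  refine Matrix.inv_eq_right_inv ?_
  ext i j
  fin_cases i <;> fin_cases j <;>
    simp [Matrix.mul_apply, Fin.sum_univ_succ, hb, hc] <;> field_simp <;> rw [← he] <;> ring_nf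

/-- The nonzero entries of `√(-det g) g⁻¹` for the Kerr metric. -/
theorem metric_density {M a : ℝ} (h : |a| < M) {x : Fin 4 → ℝ} (hx : x ∈ chartDomain M a) :
    √(-(metric M a x).det) = rhoSq a (x 1) (x 2) * Real.sin (x 2) ∧
    √(-(metric M a x).det) • (metric M a x)⁻¹ =
      !![-(Real.sin (x 2) * bigPi M a (x 1) (x 2) / Del M a (x 1)), 0, 0,
          -(2 * M * a * x 1 * Real.sin (x 2) / Del M a (x 1));
        0, Del M a (x 1) * Real.sin (x 2), 0, 0;
        0, 0, Real.sin (x 2), 0;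
        -(2 * M * a * x 1 * Real.sin (x 2) / Del M a (x 1)), 0, 0,
          (rhoSq a (x 1) (x 2) - 2 * M * x 1) / (Del M a (x 1) * Real.sin (x 2))] := by
  have hr : 0 < x 1 := (rPlus_pos h).trans hx.1
  have hD := Del_pos h hx.1
  have hs := Real.sin_pos_of_mem_Ioo hx.2
  have hsc := Real.sin_sq_add_cos_sq (x 2)
  have hρ : 0 < rhoSq a (x 1) (x 2) := by unfold rhoSq; positivity
  have hρe : rhoSq a (x 1) (x 2) = x 1 ^ 2 + a ^ 2 - a ^ 2 * Real.sin (x 2) ^ 2 := by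
    unfold rhoSq; linear_combination a ^ 2 * hsc
  have hDe := Del_eq h (x 1)
  have hP : bigPi M a (x 1) (x 2) =
      (x 1 ^ 2 + a ^ 2) ^ 2 - a ^ 2 * Real.sin (x 2) ^ 2 * Del M a (x 1) := rfl
  unfold metric
  generalize rhoSq a (x 1) (x 2) = ρ at *
  generalize Real.sin (x 2) = s at *
  generalize bigPi M a (x 1) (x 2) = Q at *
  generalize Del M a (x 1) = D at *
  generalize x 1 = r at *
  have he : -(1 - 2 * M * r / ρ) * (s ^ 2 * Q / ρ) - (-(2 * M * a * r * s ^ 2 / ρ)) ^ 2 =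
      -(D * s ^ 2) := by
    field_simp
    rw [hP, hρe, hDe]
    ring
  have hdet : √(-((ρ / D) * ρ * -(D * s ^ 2))) = ρ * s := by
    rw [← Real.sqrt_sq (mul_pos hρ hs).le]
    congr 1
    field_simp
  rw [det_block, he, hdet]
  refine ⟨rfl, ?_⟩
  rw [inv_block (div_pos hρ hD).ne' hρ.ne' he (neg_ne_zero.2 (by positivity))]
  ext i j
  fin_cases i <;> fin_cases j <;> simp <;> field_simp <;> ring_nf

theorem update_mem_chartDomain {M a : ℝ} {x : Fin 4 → ℝ} (hx : x ∈ chartDomain M a) (i : Fin 4) :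
    ∀ᶠ s in 𝓝 (x i), Function.update x i s ∈ chartDomain M a := by
  have ho : IsOpen (chartDomain M a) :=
    (isOpen_lt continuous_const (continuous_apply 1)).inter
      (isOpen_Ioo.preimage (continuous_apply (2 : Fin 4)))
  have hc : Continuous fun s => Function.update x i s := continuous_const.update i continuous_id
  refine hc.continuousAt.eventually_mem (ho.mem_nhds ?_)
  simpa using hx

theorem pderiv_congr {M a : ℝ} {x : Fin 4 → ℝ} (hx : x ∈ chartDomain M a) (i : Fin 4)
    {f g : (Fin 4 → ℝ) → ℂ} (hfg : ∀ y ∈ chartDomain M a, f y = g y) :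
    pderiv i f x = pderiv i g x := by
  refine Filter.EventuallyEq.deriv_eq ?_
  filter_upwards [update_mem_chartDomain hx i] with s hs
  exact hfg _ hs

/-- The separated function `e^{-iωt} e^{imφ} S(θ) R(r)`. -/
def separated (ω : ℂ) (m : ℤ) (S R : ℝ → ℂ) (x : Fin 4 → ℝ) : ℂ :=
  Complex.exp (-(Complex.I * ω * x 0)) * Complex.exp (Complex.I * m * x 3) * S (x 2) * R (x 1)

theorem hasDerivAt_cexp_mul (c : ℂ) (t : ℝ) :
    HasDerivAt (fun s : ℝ => Complex.exp (c * s)) (c * Complex.exp (c * t)) t := by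
  have h1 : HasDerivAt (fun s : ℝ => c * (s : ℂ)) c t := by
    simpa using (Complex.ofRealCLM.hasDerivAt (x := t)).const_mul c
  exact h1.cexp.congr_deriv (by ring)

/-- A coefficient that does not depend on `t` passes through `∂_t`; similarly for `φ` below. -/
theorem pderiv_separated_t (ω : ℂ) (m : ℤ) (S R : ℝ → ℂ) (G : ℝ → ℝ → ℂ) (x : Fin 4 → ℝ) :
    pderiv 0 (fun y => G (y 1) (y 2) * separated ω m S R y) x =
      G (x 1) (x 2) * (-(Complex.I * ω) * separated ω m S R x) := by
  unfold pderiv separated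
  have e : (fun s : ℝ => G (Function.update x 0 s 1) (Function.update x 0 s 2) *
      (Complex.exp (-(Complex.I * ω * (Function.update x 0 s 0 : ℝ))) *
        Complex.exp (Complex.I * m * (Function.update x 0 s 3 : ℝ)) *
        S (Function.update x 0 s 2) * R (Function.update x 0 s 1))) =
      fun s : ℝ => (G (x 1) (x 2) * Complex.exp (Complex.I * m * x 3) * S (x 2) * R (x 1)) *
        Complex.exp (-(Complex.I * ω) * s) := by
    funext s
    simp [Function.update]
    ring
  rw [e, deriv_const_mul_field, (hasDerivAt_cexp_mul _ _).deriv, ← neg_mul]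
  ring

theorem pderiv_separated_phi (ω : ℂ) (m : ℤ) (S R : ℝ → ℂ) (G : ℝ → ℝ → ℂ) (x : Fin 4 → ℝ) :
    pderiv 3 (fun y => G (y 1) (y 2) * separated ω m S R y) x =
      G (x 1) (x 2) * (Complex.I * m * separated ω m S R x) := by
  unfold pderiv separated
  have e : (fun s : ℝ => G (Function.update x 3 s 1) (Function.update x 3 s 2) *
      (Complex.exp (-(Complex.I * ω * (Function.update x 3 s 0 : ℝ))) *
        Complex.exp (Complex.I * m * (Function.update x 3 s 3 : ℝ)) *
        S (Function.update x 3 s 2) * R (Function.update x 3 s 1))) =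
      fun s : ℝ => (G (x 1) (x 2) * Complex.exp (-(Complex.I * ω * x 0)) * S (x 2) * R (x 1)) *
        Complex.exp (Complex.I * m * s) := by
    funext s
    simp [Function.update]
    ring
  rw [e, deriv_const_mul_field, (hasDerivAt_cexp_mul _ _).deriv]
  ring

theorem pderiv_separated_r (ω : ℂ) (m : ℤ) (S R : ℝ → ℂ) (G : ℝ → ℂ) (H : ℝ → ℂ) (x : Fin 4 → ℝ) :
    pderiv 1 (fun y => (H (y 2) * G (y 1)) * separated ω m S R y) x =
      H (x 2) * separated ω m S (deriv fun r => G r * R r) x := by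
  unfold pderiv separated
  have e : (fun s : ℝ => (H (Function.update x 1 s 2) * G (Function.update x 1 s 1)) *
      (Complex.exp (-(Complex.I * ω * (Function.update x 1 s 0 : ℝ))) *
        Complex.exp (Complex.I * m * (Function.update x 1 s 3 : ℝ)) *
        S (Function.update x 1 s 2) * R (Function.update x 1 s 1))) =
      fun s : ℝ => (H (x 2) * (Complex.exp (-(Complex.I * ω * x 0)) *
        Complex.exp (Complex.I * m * x 3) * S (x 2))) * (G s * R s) := by
    funext s
    simp [Function.update]
    ring
  rw [e, deriv_const_mul_field]
  ring

theorem pderiv_separated_theta (ω : ℂ) (m : ℤ) (S R : ℝ → ℂ) (G : ℝ → ℂ) (x : Fin 4 → ℝ) :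
    pderiv 2 (fun y => G (y 2) * separated ω m S R y) x =
      separated ω m (deriv fun θ => G θ * S θ) R x := by
  unfold pderiv separated
  have e : (fun s : ℝ => G (Function.update x 2 s 2) *
      (Complex.exp (-(Complex.I * ω * (Function.update x 2 s 0 : ℝ))) *
        Complex.exp (Complex.I * m * (Function.update x 2 s 3 : ℝ)) *
        S (Function.update x 2 s 2) * R (Function.update x 2 s 1))) =
      fun s : ℝ => (Complex.exp (-(Complex.I * ω * x 0)) *
        Complex.exp (Complex.I * m * x 3) * R (x 1)) * (G s * S s) := by
    funext s
    simp [Function.update]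
    ring
  rw [e, deriv_const_mul_field]
  ring

/-- The wave operator of the Kerr metric on a separated function. -/
theorem waveOp_separated {M a : ℝ} (h : |a| < M) (ω : ℂ) (m : ℤ) (S R : ℝ → ℂ) {x : Fin 4 → ℝ}
    (hx : x ∈ chartDomain M a) :
    waveOp (metric M a) (separated ω m S R) x =
      ((1 / (rhoSq a (x 1) (x 2) * Real.sin (x 2)) : ℝ) : ℂ) *
      (((Real.sin (x 2) * bigPi M a (x 1) (x 2) / Del M a (x 1) : ℝ) : ℂ) * ω ^ 2 *
          separated ω m S R x -
        2 * ((2 * M * a * x 1 * Real.sin (x 2) / Del M a (x 1) : ℝ) : ℂ) * (ω * m) *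
          separated ω m S R x -
        (((rhoSq a (x 1) (x 2) - 2 * M * x 1) / (Del M a (x 1) * Real.sin (x 2)) : ℝ) : ℂ) *
          (m : ℂ) ^ 2 * separated ω m S R x +
        Real.sin (x 2) * separated ω m S (deriv fun r => (Del M a r : ℂ) * deriv R r) x +
        separated ω m (deriv fun θ : ℝ => (Real.sin θ : ℂ) * deriv S θ) R x) := by
  -- the matrix `√(-det g) g⁻¹`, whose entries no longer contain square roots
  set K : (Fin 4 → ℝ) → Matrix (Fin 4) (Fin 4) ℝ := fun x =>
    !![-(Real.sin (x 2) * bigPi M a (x 1) (x 2) / Del M a (x 1)), 0, 0,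
          -(2 * M * a * x 1 * Real.sin (x 2) / Del M a (x 1));
        0, Del M a (x 1) * Real.sin (x 2), 0, 0;
        0, 0, Real.sin (x 2), 0;
        -(2 * M * a * x 1 * Real.sin (x 2) / Del M a (x 1)), 0, 0,
          (rhoSq a (x 1) (x 2) - 2 * M * x 1) / (Del M a (x 1) * Real.sin (x 2))] with hK
  have hcomp : ∀ (α β : Fin 4) (y : Fin 4 → ℝ), y ∈ chartDomain M a →
      √(-(metric M a y).det) * (metric M a y)⁻¹ α β = K y α β := by
    intro α β y hy
    exact congrFun (congrFun (metric_density h hy).2 α) β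
  have p0 : ∀ y, pderiv 0 (separated ω m S R) y = -(Complex.I * ω) * separated ω m S R y := by
    intro y
    simpa using pderiv_separated_t ω m S R (fun _ _ => 1) y
  have p3 : ∀ y, pderiv 3 (separated ω m S R) y = Complex.I * m * separated ω m S R y := by
    intro y
    simpa using pderiv_separated_phi ω m S R (fun _ _ => 1) y
  have p1 : ∀ y, pderiv 1 (separated ω m S R) y = separated ω m S (deriv R) y := by
    intro y
    simpa using pderiv_separated_r ω m S R (fun _ => 1) (fun _ => 1) y
  have p2 : ∀ y, pderiv 2 (separated ω m S R) y = separated ω m (deriv S) R y := by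
    intro y
    simpa using pderiv_separated_theta ω m S R (fun _ => 1) y
  have hterm : ∀ α β : Fin 4, pderiv α (fun y => ((√(-(metric M a y).det) *
      (metric M a y)⁻¹ α β : ℝ) : ℂ) * pderiv β (separated ω m S R) y) x =
      pderiv α (fun y => ((K y α β : ℝ) : ℂ) * pderiv β (separated ω m S R) y) x := by
    intro α β
    exact pderiv_congr hx α fun y hy => by rw [hcomp α β y hy]
  have hz : ∀ α : Fin 4, pderiv α (fun _ => 0) x = 0 := fun α => by simp [pderiv]
  have t00 := pderiv_separated_t ω m S R (fun r θ =>
    ((-(Real.sin θ * bigPi M a r θ / Del M a r) : ℝ) : ℂ) * -(Complex.I * ω)) x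
  have t03 := pderiv_separated_t ω m S R (fun r θ =>
    ((-(2 * M * a * r * Real.sin θ / Del M a r) : ℝ) : ℂ) * (Complex.I * m)) x
  have t30 := pderiv_separated_phi ω m S R (fun r θ =>
    ((-(2 * M * a * r * Real.sin θ / Del M a r) : ℝ) : ℂ) * -(Complex.I * ω)) x
  have t33 := pderiv_separated_phi ω m S R (fun r θ =>
    (((rhoSq a r θ - 2 * M * r) / (Del M a r * Real.sin θ) : ℝ) : ℂ) * (Complex.I * m)) x
  have t11 := pderiv_separated_r ω m S (deriv R) (fun r => (Del M a r : ℂ))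
    (fun θ => (Real.sin θ : ℂ)) x
  have t22 := pderiv_separated_theta ω m (deriv S) R (fun θ => (Real.sin θ : ℂ)) x
  unfold waveOp
  rw [(metric_density h hx).1]
  simp only [hterm, Fin.sum_univ_four]
  have q00 : (fun y => ((K y 0 0 : ℝ) : ℂ) * pderiv 0 (separated ω m S R) y) = fun y =>
      (((-(Real.sin (y 2) * bigPi M a (y 1) (y 2) / Del M a (y 1)) : ℝ) : ℂ) * -(Complex.I * ω)) *
        separated ω m S R y := by
    funext y; rw [p0, ← mul_assoc]; rfl
  have q03 : (fun y => ((K y 0 3 : ℝ) : ℂ) * pderiv 3 (separated ω m S R) y) = fun y =>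
      (((-(2 * M * a * y 1 * Real.sin (y 2) / Del M a (y 1)) : ℝ) : ℂ) * (Complex.I * m)) *
        separated ω m S R y := by
    funext y; rw [p3, ← mul_assoc]; rfl
  have q30 : (fun y => ((K y 3 0 : ℝ) : ℂ) * pderiv 0 (separated ω m S R) y) = fun y =>
      (((-(2 * M * a * y 1 * Real.sin (y 2) / Del M a (y 1)) : ℝ) : ℂ) * -(Complex.I * ω)) *
        separated ω m S R y := by
    funext y; rw [p0, ← mul_assoc]; rfl
  have q33 : (fun y => ((K y 3 3 : ℝ) : ℂ) * pderiv 3 (separated ω m S R) y) = fun y =>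
      ((((rhoSq a (y 1) (y 2) - 2 * M * y 1) / (Del M a (y 1) * Real.sin (y 2)) : ℝ) : ℂ) *
        (Complex.I * m)) * separated ω m S R y := by
    funext y; rw [p3, ← mul_assoc]; rfl
  have q11 : (fun y => ((K y 1 1 : ℝ) : ℂ) * pderiv 1 (separated ω m S R) y) = fun y =>
      ((Real.sin (y 2) : ℂ) * (Del M a (y 1) : ℂ)) * separated ω m S (deriv R) y := by
    funext y
    have : K y 1 1 = Del M a (y 1) * Real.sin (y 2) := rfl
    rw [p1, this, Complex.ofReal_mul, mul_comm (Del M a (y 1) : ℂ)]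
  have q22 : (fun y => ((K y 2 2 : ℝ) : ℂ) * pderiv 2 (separated ω m S R) y) = fun y =>
      (Real.sin (y 2) : ℂ) * separated ω m (deriv S) R y := by
    funext y; rw [p2]; rfl
  have qz : ∀ α β : Fin 4, (∀ y, K y α β = 0) →
      pderiv α (fun y => ((K y α β : ℝ) : ℂ) * pderiv β (separated ω m S R) y) x = 0 := by
    intro α β hy
    simp only [hy, Complex.ofReal_zero, zero_mul]
    exact hz α
  rw [q00, q03, q30, q33, q11, q22, t00, t03, t30, t33, t11, t22,
    qz 0 1 fun _ => rfl, qz 0 2 fun _ => rfl, qz 1 0 fun _ => rfl, qz 1 2 fun _ => rfl,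
    qz 1 3 fun _ => rfl, qz 2 0 fun _ => rfl, qz 2 1 fun _ => rfl, qz 2 3 fun _ => rfl,
    qz 3 1 fun _ => rfl, qz 3 2 fun _ => rfl]
  congr 1
  push_cast
  linear_combination (-(Complex.sin (x 2) * bigPi M a (x 1) (x 2) / Del M a (x 1)) * ω ^ 2 *
    separated ω m S R x + 2 * (2 * M * a * x 1 * Complex.sin (x 2) / Del M a (x 1)) * (ω * m) *
    separated ω m S R x + (rhoSq a (x 1) (x 2) - 2 * M * x 1) / (Del M a (x 1) *
    Complex.sin (x 2)) * m ^ 2 * separated ω m S R x) * Complex.I_sq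

/-! ### Reduction to the radial equation -/

theorem rMinus_lt_rPlus {M a : ℝ} (h : |a| < M) : rMinus M a < rPlus M a := by
  have := sqrt_pos_of_subextremal h
  unfold rPlus rMinus
  linarith

theorem contDiffOn_rStar {M a : ℝ} (h : |a| < M) :
    ContDiffOn ℝ (⊤ : ℕ∞) (rStar M a) (Ioi (rPlus M a)) := by
  intro r hr
  have hr : rPlus M a < r := hr
  have h1 : r - rPlus M a ≠ 0 := by linarith
  have h2 : r - rMinus M a ≠ 0 := by linarith [rMinus_lt_rPlus h]
  refine ContDiffAt.contDiffWithinAt ?_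
  unfold rStar
  have e1 : ContDiffAt ℝ (⊤ : ℕ∞) (fun r => Real.log (r - rPlus M a)) r :=
    (contDiffAt_id.sub contDiffAt_const).log h1
  have e2 : ContDiffAt ℝ (⊤ : ℕ∞) (fun r => Real.log (r - rMinus M a)) r :=
    (contDiffAt_id.sub contDiffAt_const).log h2
  exact (contDiffAt_id.add (contDiffAt_const.mul e1)).sub (contDiffAt_const.mul e2)

/-- The radial function `R` with `u (r_*) = (r² + a²)^{1/2} R (r)`. -/
def radialOf (M a : ℝ) (u : ℝ → ℂ) (r : ℝ) : ℂ := u (rStar M a r) / (√(r ^ 2 + a ^ 2) : ℂ)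

theorem contDiffOn_radialOf {M a : ℝ} (h : |a| < M) {u : ℝ → ℂ} (hu : ContDiff ℝ (⊤ : ℕ∞) u) :
    ContDiffOn ℝ (⊤ : ℕ∞) (fun r => radialOf M a u r) (Ioi (rPlus M a)) := by
  have hpos : ∀ r ∈ Ioi (rPlus M a), 0 < r ^ 2 + a ^ 2 := fun r hr => by
    have : 0 < r := (rPlus_pos h).trans hr
    positivity
  simp only [radialOf, div_eq_mul_inv]
  refine (hu.comp_contDiffOn (contDiffOn_rStar h)).mul (ContDiffOn.inv ?_ ?_)
  · refine Complex.ofRealCLM.contDiff.comp_contDiffOn (ContDiffOn.sqrt (by fun_prop) ?_)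
    exact fun r hr => (hpos r hr).ne'
  · intro r hr
    exact_mod_cast (Real.sqrt_pos.2 (hpos r hr)).ne'

/-- The separated radial equation in terms of `r`. -/
theorem deriv_Del_deriv_radialOf {M a : ℝ} (h : |a| < M) {V : ℝ → ℂ} {ω : ℂ} {m : ℤ} {lam : ℂ}
    {u : ℝ → ℂ} (hu : ContDiff ℝ (⊤ : ℕ∞) u) {r : ℝ} (hr : rPlus M a < r)
    (hode : deriv (deriv u) (rStar M a r) +
      (ω ^ 2 - radialPotential M a ω m lam r - V r) * u (rStar M a r) = 0) :
    deriv (fun r => (Del M a r : ℂ) * deriv (radialOf M a u) r) r =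
      -(((ω ^ 2 - V r) * ((r : ℂ) ^ 2 + a ^ 2) ^ 2 - 4 * M * r * a * m * ω + a ^ 2 * m ^ 2) /
        (Del M a r : ℂ) - (lam + a ^ 2 * ω ^ 2)) * radialOf M a u r := by
  have hw : ∀ r, rPlus M a < r → 0 < √(r ^ 2 + a ^ 2) := fun r hr => by
    have : 0 < r := (rPlus_pos h).trans hr
    exact Real.sqrt_pos.2 (by positivity)
  have hw2 : ∀ r : ℝ, √(r ^ 2 + a ^ 2) ^ 2 = r ^ 2 + a ^ 2 := fun r => Real.sq_sqrt (by positivity)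
  have hdw : ∀ r, rPlus M a < r → HasDerivAt (fun r : ℝ => ((√(r ^ 2 + a ^ 2) : ℝ) : ℂ))
      ((r / √(r ^ 2 + a ^ 2) : ℝ) : ℂ) r := fun r hr => by
    have h1 : HasDerivAt (fun r : ℝ => r ^ 2 + a ^ 2) (2 * r) r :=
      (((hasDerivAt_id r).fun_pow 2).add_const (a ^ 2)).congr_deriv (by simp)
    have := (h1.sqrt (Real.sqrt_pos.1 (hw r hr)).ne').ofReal_comp
    refine this.congr_deriv ?_
    field_simp
  have hu1 : ∀ s, HasDerivAt u (deriv u s) s := fun s =>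
    (hu.differentiable (by simp)).differentiableAt.hasDerivAt
  have hu2 : ∀ s, HasDerivAt (deriv u) (deriv (deriv u) s) s := fun s => by
    have : ContDiff ℝ 1 (deriv u) := (contDiff_infty_iff_deriv.1 hu).2.of_le (by norm_cast)
    exact (this.differentiable (by simp)).differentiableAt.hasDerivAt
  have hcu : ∀ r, rPlus M a < r → HasDerivAt (fun r => u (rStar M a r))
      (((r ^ 2 + a ^ 2) / Del M a r : ℝ) * deriv u (rStar M a r)) r := fun r hr => by
    refine ((hu1 _).scomp r (hasDerivAt_rStar h hr)).congr_deriv ?_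
    rw [Complex.real_smul]
  have hcu2 : HasDerivAt (fun r => deriv u (rStar M a r))
      (((r ^ 2 + a ^ 2) / Del M a r : ℝ) * deriv (deriv u) (rStar M a r)) r := by
    refine ((hu2 _).scomp r (hasDerivAt_rStar h hr)).congr_deriv ?_
    rw [Complex.real_smul]
  have hR : ∀ r, rPlus M a < r → HasDerivAt (radialOf M a u)
      (deriv u (rStar M a r) * (√(r ^ 2 + a ^ 2) : ℂ) / Del M a r -
        u (rStar M a r) * r / (√(r ^ 2 + a ^ 2) : ℂ) ^ 3) r := fun r hr => by
    have hD : (Del M a r : ℂ) ≠ 0 := by exact_mod_cast (Del_pos h hr).ne'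
    have hwc : (√(r ^ 2 + a ^ 2) : ℂ) ≠ 0 := by exact_mod_cast (hw r hr).ne'
    have h2 : (√(r ^ 2 + a ^ 2) : ℂ) ^ 2 = (r : ℂ) ^ 2 + a ^ 2 := by exact_mod_cast hw2 r
    refine ((hcu r hr).div (hdw r hr) hwc).congr_deriv ?_
    push_cast
    rw [← h2]
    field_simp
  have hX : (fun r => (Del M a r : ℂ) * deriv (radialOf M a u) r) =ᶠ[𝓝 r] fun r =>
      deriv u (rStar M a r) * (√(r ^ 2 + a ^ 2) : ℂ) -
        (Del M a r : ℂ) * (u (rStar M a r) * (r : ℂ) / (√(r ^ 2 + a ^ 2) : ℂ) ^ 3) := by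
    filter_upwards [Ioi_mem_nhds hr] with t ht
    have hD : (Del M a t : ℂ) ≠ 0 := by exact_mod_cast (Del_pos h ht).ne'
    rw [(hR t ht).deriv]
    field_simp
  have hD : (Del M a r : ℂ) ≠ 0 := by exact_mod_cast (Del_pos h hr).ne'
  have hwc : (√(r ^ 2 + a ^ 2) : ℂ) ≠ 0 := by exact_mod_cast (hw r hr).ne'
  have h2 : (√(r ^ 2 + a ^ 2) : ℂ) ^ 2 = (r : ℂ) ^ 2 + a ^ 2 := by exact_mod_cast hw2 r
  have hDe : (Del M a r : ℂ) = (r : ℂ) ^ 2 + a ^ 2 - 2 * M * r := by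
    rw [Del_eq h]; push_cast; ring
  have hid : HasDerivAt (fun r : ℝ => (r : ℂ)) 1 r := Complex.ofRealCLM.hasDerivAt
  have hd := ((hcu2.mul (hdw r hr)).fun_sub ((hasDerivAt_Del h r).ofReal_comp.mul
    (((hcu r hr).mul hid).div ((hdw r hr).fun_pow 3) (pow_ne_zero 3 hwc))))
  rw [hX.deriv_eq]
  refine hd.deriv.trans ?_
  unfold radialPotential at hode
  unfold radialOf
  simp only [Pi.mul_apply, Pi.div_apply]
  push_cast at hode ⊢
  rw [← h2] at hode ⊢
  have hr2 : (r : ℂ) ^ 2 = (√(r ^ 2 + a ^ 2) : ℂ) ^ 2 - a ^ 2 := by rw [h2]; ring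
  have hDe' : (Del M a r : ℂ) = (√(r ^ 2 + a ^ 2) : ℂ) ^ 2 - 2 * M * r := by rw [h2, hDe]
  have hode' : deriv (deriv u) (rStar M a r) = - (ω ^ 2 -
      ((4 * M * r * a * m * ω - (a : ℂ) ^ 2 * (m : ℂ) ^ 2 +
      (Del M a r : ℂ) * (lam + (a : ℂ) ^ 2 * ω ^ 2)) / ((√(r ^ 2 + a ^ 2) : ℂ) ^ 2) ^ 2 +
      (Del M a r : ℂ) / ((√(r ^ 2 + a ^ 2) : ℂ) ^ 2) ^ 4 *
      (a ^ 2 * Del M a r + 2 * M * r * ((r : ℂ) ^ 2 - a ^ 2))) - V r) * u (rStar M a r) := by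
    linear_combination hode
  rw [hode']
  generalize ((√(r ^ 2 + a ^ 2) : ℝ) : ℂ) = w at *
  generalize deriv u (rStar M a r) = u1 at *
  generalize u (rStar M a r) = u0 at *
  generalize (Del M a r : ℂ) = D at *
  field_simp
  rw [hDe']
  field_simp
  linear_combination ((w ^ 2 - 2 * M * r) * u0 * (4 * M * r - w ^ 2)) * h2

/-- Separated functions solve the wave equation. -/
theorem waveOp_eq_of_separated {M a : ℝ} (h : |a| < M) {V : ℝ → ℂ} {ω : ℂ} {m : ℤ} {lam : ℂ}
    {S u : ℝ → ℂ} (hS : IsAngularEigenfunction a ω m lam S) (hu : IsOutgoingRadial M a V ω m lam u)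
    {x : Fin 4 → ℝ} (hx : x ∈ chartDomain M a) :
    waveOp (metric M a) (separated ω m S (radialOf M a u)) x -
      (((x 1 ^ 2 + a ^ 2) ^ 2 / (Del M a (x 1) * rhoSq a (x 1) (x 2)) : ℝ) : ℂ) *
        V (x 1) * separated ω m S (radialOf M a u) x = 0 := by
  have hang := hS.2.1 (x 2) hx.2
  rw [waveOp_separated h ω m S _ hx]
  unfold separated
  rw [deriv_Del_deriv_radialOf h hu.1 hx.1 (hu.2.1 _ hx.1)]
  have hr : 0 < x 1 := (rPlus_pos h).trans hx.1
  have hs : (Real.sin (x 2) : ℂ) ≠ 0 := by exact_mod_cast (Real.sin_pos_of_mem_Ioo hx.2).ne'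
  have hD : (Del M a (x 1) : ℂ) ≠ 0 := by exact_mod_cast (Del_pos h hx.1).ne'
  have hρ : (rhoSq a (x 1) (x 2) : ℂ) ≠ 0 := by
    have : 0 < rhoSq a (x 1) (x 2) := by unfold rhoSq; positivity
    exact_mod_cast this.ne'
  have hsc : (Real.cos (x 2) : ℂ) ^ 2 = 1 - (Real.sin (x 2) : ℂ) ^ 2 := by
    have := Real.cos_sq' (x 2)
    exact_mod_cast this
  have hρe : (rhoSq a (x 1) (x 2) : ℂ) = (x 1 : ℂ) ^ 2 + a ^ 2 * (Real.cos (x 2) : ℂ) ^ 2 := by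
    unfold rhoSq; push_cast; rfl
  have hDe : (Del M a (x 1) : ℂ) = (x 1 : ℂ) ^ 2 + a ^ 2 - 2 * M * x 1 := by
    rw [Del_eq h]; push_cast; ring
  have hP : (bigPi M a (x 1) (x 2) : ℂ) = ((x 1 : ℂ) ^ 2 + a ^ 2) ^ 2 -
      a ^ 2 * (Real.sin (x 2) : ℂ) ^ 2 * Del M a (x 1) := by
    unfold bigPi; push_cast; rfl
  have hang' : deriv (fun s : ℝ => (Real.sin s : ℂ) * deriv S s) (x 2) = Real.sin (x 2) *
      ((m : ℂ) ^ 2 / (Real.sin (x 2) : ℂ) ^ 2 - a ^ 2 * ω ^ 2 * (Real.cos (x 2) : ℂ) ^ 2 - lam) *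
        S (x 2) := by
    have e : deriv (fun s : ℝ => (Real.sin s : ℂ) * deriv S s) (x 2) = Real.sin (x 2) *
      (1 / (Real.sin (x 2) : ℂ) * deriv (fun s : ℝ => (Real.sin s : ℂ) * deriv S s) (x 2)) := by
      field_simp
    rw [e]
    linear_combination (-(Real.sin (x 2) : ℂ)) * hang
  rw [hang']
  simp only [Complex.ofReal_mul, Complex.ofReal_div, Complex.ofReal_sub, Complex.ofReal_add,
    Complex.ofReal_pow, Complex.ofReal_one, Complex.ofReal_ofNat]
  rw [hP, hsc]
  rw [hsc] at hρe
  generalize (Real.sin (x 2) : ℂ) = s at *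
  generalize (rhoSq a (x 1) (x 2) : ℂ) = ρ at *
  generalize (Del M a (x 1) : ℂ) = D at *
  generalize radialOf M a u (x 1) = R at *
  generalize S (x 2) = S0 at *
  generalize V (x 1) = V0 at *
  generalize Complex.exp (-(Complex.I * ω * (x 0))) = E0 at *
  generalize Complex.exp (Complex.I * m * (x 3)) = E3 at *
  field_simp
  rw [hρe]
  linear_combination (E0 * E3 * S0 * R * m ^ 2) * hDe

/-- `y₁ ± i y₂`, with the sign of `m`, a smooth function on `ℝ³` that extends `r sin θ e^{± i φ}`. -/
def planar (m : ℤ) (y : EuclideanSpace ℝ (Fin 3)) : ℂ :=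
  (y 0 : ℂ) + (if 0 ≤ m then Complex.I else -Complex.I) * (y 1 : ℂ)

theorem planar_toExterior (m : ℤ) (x : Fin 4 → ℝ) :
    planar m (toExterior x).2 ^ m.natAbs =
      (x 1 : ℂ) ^ m.natAbs * (Real.sin (x 2) : ℂ) ^ m.natAbs * Complex.exp (Complex.I * m * x 3) := by
  have key : ∀ ε : ℂ, ε = 1 ∨ ε = -1 → ((x 1 * Real.sin (x 2) * Real.cos (x 3) : ℝ) : ℂ) +
      (ε * Complex.I) * ((x 1 * Real.sin (x 2) * Real.sin (x 3) : ℝ) : ℂ) =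
      (x 1 : ℂ) * (Real.sin (x 2) : ℂ) * Complex.exp (ε * x 3 * Complex.I) := by
    intro ε hε
    rw [Complex.exp_mul_I]
    rcases hε with rfl | rfl
    · push_cast; rw [one_mul, one_mul]; ring
    · rw [neg_one_mul, neg_one_mul (x 3 : ℂ), Complex.cos_neg, Complex.sin_neg]; push_cast; ring
  have h0 : planar m (toExterior x).2 = ((x 1 * Real.sin (x 2) * Real.cos (x 3) : ℝ) : ℂ) +
      ((if 0 ≤ m then 1 else -1) * Complex.I) *
        ((x 1 * Real.sin (x 2) * Real.sin (x 3) : ℝ) : ℂ) := by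
    unfold planar
    split_ifs <;> simp [toExterior]
  rw [h0, key _ (by split_ifs <;> simp), mul_pow, mul_pow, ← Complex.exp_nat_mul]
  congr 2
  have hm : ((if 0 ≤ m then 1 else -1 : ℂ)) * (m.natAbs : ℂ) = m := by
    split_ifs with hm
    · rw [← Int.cast_natCast, Int.natAbs_of_nonneg hm, one_mul]
    · rw [← Int.cast_natCast, Int.ofNat_natAbs_of_nonpos (by omega)]
      push_cast; ring
  linear_combination (x 3 : ℂ) * Complex.I * hm

theorem norm_toExterior {x : Fin 4 → ℝ} (hx : 0 ≤ x 1) : ‖(toExterior x).2‖ = x 1 := by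
  rw [EuclideanSpace.norm_eq, Fin.sum_univ_three]
  simp only [toExterior, Real.norm_eq_abs, sq_abs]
  refine (congrArg Real.sqrt ?_).trans (Real.sqrt_sq hx)
  have h1 := Real.sin_sq_add_cos_sq (x 2)
  have h2 := Real.sin_sq_add_cos_sq (x 3)
  simp
  linear_combination (x 1 ^ 2 * Real.sin (x 2) ^ 2) * h2 + x 1 ^ 2 * h1

/-- In Cartesian coordinates `y = r (sin θ cos φ, sin θ sin φ, cos θ)` the angular factor is
`((y₁ ± i y₂) / |y|) ^ |m| * F (y₃ / |y|)`, which is smooth across the axis. -/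
theorem smoothOnExterior_separated {M a : ℝ} (h : |a| < M) {ω : ℂ} {m : ℤ} {F R : ℝ → ℂ}
    (hF : ContDiffOn ℝ (⊤ : ℕ∞) F (Ioo (-(4 / 3)) (4 / 3)))
    (hR : ContDiffOn ℝ (⊤ : ℕ∞) R (Ioi (rPlus M a))) :
    SmoothOnExterior M a (separated ω m
      (fun θ => (Real.sin θ : ℂ) ^ m.natAbs * F (Real.cos θ)) R) := by
  refine ⟨fun p => Complex.exp (-(Complex.I * ω * p.1)) * R ‖p.2‖ *
    (planar m p.2 ^ m.natAbs * (((‖p.2‖⁻¹ : ℝ) : ℂ)) ^ m.natAbs) * F (p.2 2 * ‖p.2‖⁻¹), ?_, ?_⟩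
  · have hne : ∀ p ∈ {p : ℝ × EuclideanSpace ℝ (Fin 3) | rPlus M a < ‖p.2‖}, p.2 ≠ 0 := by
      intro p hp h0
      have : rPlus M a < ‖p.2‖ := hp
      rw [h0, norm_zero] at this
      linarith [rPlus_pos h]
    have hn : ContDiffOn ℝ (⊤ : ℕ∞) (fun p : ℝ × EuclideanSpace ℝ (Fin 3) => ‖p.2‖)
        {p | rPlus M a < ‖p.2‖} := contDiff_snd.contDiffOn.norm ℝ hne
    have hni := hn.inv fun p hp => norm_ne_zero_iff.2 (hne p hp)
    have hcoord : ∀ i : Fin 3, ContDiff ℝ (⊤ : ℕ∞)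
        (fun p : ℝ × EuclideanSpace ℝ (Fin 3) => p.2 i) := fun i => by fun_prop
    have hpl : ContDiff ℝ (⊤ : ℕ∞) (fun p : ℝ × EuclideanSpace ℝ (Fin 3) => planar m p.2) := by
      unfold planar
      exact (Complex.ofRealCLM.contDiff.comp (hcoord 0)).add
        (contDiff_const.mul (Complex.ofRealCLM.contDiff.comp (hcoord 1)))
    have he : ContDiff ℝ (⊤ : ℕ∞) (fun p : ℝ × EuclideanSpace ℝ (Fin 3) =>
        Complex.exp (-(Complex.I * ω * p.1))) :=
      (contDiff_const.mul (Complex.ofRealCLM.contDiff.comp contDiff_fst)).neg.cexp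
    refine ((he.contDiffOn.mul (hR.comp hn fun p hp => hp)).mul ((hpl.pow _).contDiffOn.mul
      ((Complex.ofRealCLM.contDiff.comp_contDiffOn hni).pow _))).mul
      (hF.comp ((hcoord 2).contDiffOn.mul hni) ?_)
    intro p hp
    have hpos : 0 < ‖p.2‖ := norm_pos_iff.2 (hne p hp)
    have h1 : |p.2 2| ≤ ‖p.2‖ := by
      have := PiLp.norm_apply_le p.2 2
      rwa [Real.norm_eq_abs] at this
    have h2 : |p.2 2 * ‖p.2‖⁻¹| ≤ 1 := by
      rw [abs_mul, abs_inv, abs_norm, ← div_eq_mul_inv]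
      exact (div_le_one hpos).2 h1
    have := abs_le.1 h2
    exact ⟨by linarith, by linarith⟩
  · intro x hx
    have hr : 0 < x 1 := (rPlus_pos h).trans hx.1
    have hrc : (x 1 : ℂ) ≠ 0 := by exact_mod_cast hr.ne'
    simp only [planar_toExterior, norm_toExterior hr.le]
    have e2 : (toExterior x).2 2 * (x 1)⁻¹ = Real.cos (x 2) := by
      simp [toExterior]; field_simp
    have e1 : (toExterior x).1 = x 0 := rfl
    rw [e1, e2]
    unfold separated
    have e3 : (x 1 : ℂ) ^ m.natAbs * (((x 1)⁻¹ : ℝ) : ℂ) ^ m.natAbs = 1 := by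
      rw [← mul_pow, Complex.ofReal_inv, mul_inv_cancel₀ hrc, one_pow]
    linear_combination (-(Complex.exp (-(Complex.I * ω * x 0)) * Complex.exp (Complex.I * m * x 3) *
      ((Real.sin (x 2) : ℂ) ^ m.natAbs * F (Real.cos (x 2))) * R (x 1))) * e3

/-- Reduction to the radial problem: an angular profile and an outgoing radial solution that does not
vanish somewhere make up an outgoing mode. -/
theorem exists_isOutgoingMode {M a : ℝ} (h : |a| < M) {V : ℝ → ℂ} {ω : ℂ} {m : ℤ} {l : ℕ} {lam : ℂ}
    {F u : ℝ → ℂ} (hω : ω ≠ 0) (him : 0 ≤ ω.im) (hl : m.natAbs ≤ l)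
    (hlam : IsSpheroidalEigenvalue a ω m l lam) (hF : IsAngularProfile a ω m lam F)
    (hu : IsOutgoingRadial M a V ω m lam u) {r₁ : ℝ} (hr₁ : rPlus M a < r₁)
    (hne : u (rStar M a r₁) ≠ 0) : ∃ ψ, IsOutgoingMode M a V ω m l ψ := by
  set S : ℝ → ℂ := fun θ => (Real.sin θ : ℂ) ^ m.natAbs * F (Real.cos θ) with hS
  have hSe : IsAngularEigenfunction a ω m lam S := hF.isAngularEigenfunction
  have hw : ∀ r, rPlus M a < r → (√(r ^ 2 + a ^ 2) : ℂ) ≠ 0 := fun r hr => by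
    have : 0 < r := (rPlus_pos h).trans hr
    exact_mod_cast (Real.sqrt_pos.2 (by positivity)).ne'
  refine ⟨separated ω m S (radialOf M a u), hω, him, hl,
    ⟨smoothOnExterior_separated h hF.1 (contDiffOn_radialOf h hu.1),
      fun x hx => waveOp_eq_of_separated h hSe hu hx⟩, ?_, lam, S, radialOf M a u, u, hlam, hSe,
      fun x _ => rfl, fun r hr => ?_, hu⟩
  · obtain ⟨θ, hθ, hSθ⟩ := hSe.2.2.2
    refine ⟨![0, r₁, θ, 0], ⟨hr₁, hθ⟩, ?_⟩
    refine mul_ne_zero (mul_ne_zero (mul_ne_zero (Complex.exp_ne_zero _) (Complex.exp_ne_zero _))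
      hSθ) (div_ne_zero hne (hw r₁ hr₁))
  · exact (mul_div_cancel₀ _ (hw r hr)).symm

/-! ### The radius as a function of `r_*` -/

theorem Del_le {M a r : ℝ} (h : |a| < M) (hr : 0 ≤ r) : Del M a r ≤ r ^ 2 + a ^ 2 := by
  have hM : 0 < M := lt_of_le_of_lt (abs_nonneg a) h
  rw [Del_eq h]
  have : 0 ≤ 2 * M * r := by positivity
  linarith

/-- `dr / dr_* = Δ / (r² + a²)`. -/
def radialSpeed (M a r : ℝ) : ℝ := Del M a r / (r ^ 2 + a ^ 2)

theorem radialSpeed_pos {M a r : ℝ} (h : |a| < M) (hr : rPlus M a < r) : 0 < radialSpeed M a r := by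
  have : 0 < r := (rPlus_pos h).trans hr
  exact div_pos (Del_pos h hr) (by positivity)

theorem radialSpeed_le_one {M a r : ℝ} (h : |a| < M) (hr : rPlus M a < r) :
    radialSpeed M a r ≤ 1 := by
  have : 0 < r := (rPlus_pos h).trans hr
  exact (div_le_one (by positivity)).2 (Del_le h this.le)

theorem hasDerivAt_rStar' {M a r : ℝ} (h : |a| < M) (hr : rPlus M a < r) :
    HasDerivAt (rStar M a) (radialSpeed M a r)⁻¹ r := by
  rw [radialSpeed, inv_div]
  exact hasDerivAt_rStar h hr

theorem rStar_sub_ge {M a r₁ r₂ : ℝ} (h : |a| < M) (hr : rPlus M a < r₁) (h12 : r₁ ≤ r₂) :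
    r₂ - r₁ ≤ rStar M a r₂ - rStar M a r₁ := by
  have hmono : MonotoneOn (fun r => rStar M a r - r) (Icc r₁ r₂) := by
    have hd : ∀ r ∈ Icc r₁ r₂, HasDerivAt (fun r => rStar M a r - r) ((radialSpeed M a r)⁻¹ - 1) r :=
      fun r h1 => (hasDerivAt_rStar' h (hr.trans_le h1.1)).sub (hasDerivAt_id r)
    refine monotoneOn_of_deriv_nonneg (convex_Icc _ _)
      (fun r h1 => (hd r h1).continuousAt.continuousWithinAt)
      (fun r h1 => (hd r (interior_subset h1)).differentiableAt.differentiableWithinAt)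
      (fun r h1 => ?_)
    rw [(hd r (interior_subset h1)).deriv, sub_nonneg]
    have h2 : rPlus M a < r := hr.trans_le (interior_subset h1).1
    exact (one_le_inv₀ (radialSpeed_pos h h2)).2 (radialSpeed_le_one h h2)
  have := hmono (left_mem_Icc.2 h12) (right_mem_Icc.2 h12) h12
  simp only at this
  linarith

theorem strictMonoOn_rStar {M a : ℝ} (h : |a| < M) : StrictMonoOn (rStar M a) (Ioi (rPlus M a)) := by
  intro r₁ h1 r₂ _ h12
  have := rStar_sub_ge h h1 h12.le
  linarith

theorem tendsto_rStar_horizon {M a : ℝ} (h : |a| < M) :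
    Tendsto (rStar M a) (𝓝[>] (rPlus M a)) atBot := by
  have hM : 0 < M := lt_of_le_of_lt (abs_nonneg a) h
  have hlt := rMinus_lt_rPlus h
  have hA : 0 < 2 * M * rPlus M a / (rPlus M a - rMinus M a) :=
    div_pos (by have := rPlus_pos h; positivity) (by linarith)
  have h1 : Tendsto (fun r => Real.log (r - rPlus M a)) (𝓝[>] (rPlus M a)) atBot := by
    refine Real.tendsto_log_nhdsGT_zero.comp ?_
    refine tendsto_nhdsWithin_iff.2 ⟨?_, ?_⟩
    · have : ContinuousAt (fun r => r - rPlus M a) (rPlus M a) := by fun_prop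
      have := this.tendsto.mono_left (nhdsWithin_le_nhds (s := Ioi (rPlus M a)))
      simpa using this
    · filter_upwards [self_mem_nhdsWithin] with r hr
      exact sub_pos.2 (show rPlus M a < r from hr)
  have h2 : ContinuousAt (fun r => r - 2 * M * rMinus M a / (rPlus M a - rMinus M a) *
      Real.log (r - rMinus M a)) (rPlus M a) := by
    refine continuousAt_id.sub (continuousAt_const.mul (ContinuousAt.log (by fun_prop) ?_))
    linarith
  have h3 := (h1.const_mul_atBot hA).atBot_add
    (h2.tendsto.mono_left (nhdsWithin_le_nhds (s := Ioi (rPlus M a))))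
  refine h3.congr fun r => ?_
  unfold rStar
  ring

theorem exists_rStar_eq {M a : ℝ} (h : |a| < M) (s : ℝ) : ∃ r, rPlus M a < r ∧ rStar M a r = s := by
  obtain ⟨r₁, h1, h2⟩ := (((tendsto_rStar_horizon h).eventually (eventually_lt_atBot s)).and
    self_mem_nhdsWithin).exists
  have h2 : rPlus M a < r₁ := h2
  set r₂ := r₁ + (s - rStar M a r₁) with hr₂
  have h3 := rStar_sub_ge h h2 (by linarith : r₁ ≤ r₂)
  have hc : ContinuousOn (rStar M a) (Icc r₁ r₂) := fun r hr =>
    (hasDerivAt_rStar h (h2.trans_le hr.1)).continuousAt.continuousWithinAt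
  obtain ⟨r, hr, he⟩ := intermediate_value_Icc (by linarith : r₁ ≤ r₂) hc
    (show s ∈ Icc (rStar M a r₁) (rStar M a r₂) from ⟨h1.le, by linarith⟩)
  exact ⟨r, h2.trans_le hr.1, he⟩

open Classical in
/-- The area radius as a function of `r_*`, the inverse of `rStar`. -/
def radius (M a s : ℝ) : ℝ := if h : |a| < M then (exists_rStar_eq h s).choose else 0

theorem rPlus_lt_radius {M a : ℝ} (h : |a| < M) (s : ℝ) : rPlus M a < radius M a s := by
  rw [radius, dif_pos h]; exact (exists_rStar_eq h s).choose_spec.1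

theorem rStar_radius {M a : ℝ} (h : |a| < M) (s : ℝ) : rStar M a (radius M a s) = s := by
  rw [radius, dif_pos h]; exact (exists_rStar_eq h s).choose_spec.2

theorem radius_rStar {M a r : ℝ} (h : |a| < M) (hr : rPlus M a < r) :
    radius M a (rStar M a r) = r :=
  (strictMonoOn_rStar h).injOn (rPlus_lt_radius h _) hr (rStar_radius h _)

theorem radius_pos {M a : ℝ} (h : |a| < M) (s : ℝ) : 0 < radius M a s :=
  (rPlus_pos h).trans (rPlus_lt_radius h s)

theorem strictMono_radius {M a : ℝ} (h : |a| < M) : StrictMono (radius M a) := by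
  intro s t hst
  refine (strictMonoOn_rStar h).lt_iff_lt (rPlus_lt_radius h s) (rPlus_lt_radius h t) |>.1 ?_
  rwa [rStar_radius h, rStar_radius h]

theorem hasDerivAt_radius {M a : ℝ} (h : |a| < M) (s : ℝ) :
    HasDerivAt (radius M a) (radialSpeed M a (radius M a s)) s := by
  have hc : ContinuousAt (radius M a) s := by
    refine continuousAt_of_monotoneOn_of_image_mem_nhds (s := univ)
      ((strictMono_radius h).monotone.monotoneOn _) univ_mem ?_
    rw [image_univ]
    refine Filter.mem_of_superset (Ioi_mem_nhds (rPlus_lt_radius h s)) fun r hr => ?_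
    exact ⟨rStar M a r, radius_rStar h hr⟩
  have := HasDerivAt.of_local_left_inverse hc (hasDerivAt_rStar' h (rPlus_lt_radius h s))
    (inv_ne_zero (radialSpeed_pos h (rPlus_lt_radius h s)).ne')
    (Eventually.of_forall fun t => rStar_radius h t)
  rwa [inv_inv] at this

theorem contDiff_radius {M a : ℝ} (h : |a| < M) : ContDiff ℝ (⊤ : ℕ∞) (radius M a) := by
  have hpos : ∀ s, radius M a s ^ 2 + a ^ 2 ≠ 0 := fun s => by
    have := radius_pos h s
    positivity
  have hd : deriv (radius M a) = fun s => radialSpeed M a (radius M a s) :=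
    funext fun s => (hasDerivAt_radius h s).deriv
  refine contDiff_infty.2 fun n => ?_
  induction n with
  | zero =>
    refine contDiff_zero.2 ?_
    exact continuous_iff_continuousAt.2 fun s => (hasDerivAt_radius h s).continuousAt
  | succ n ih =>
    rw [Nat.cast_succ]
    refine contDiff_succ_iff_deriv.2 ⟨fun s => (hasDerivAt_radius h s).differentiableAt,
      fun hn => absurd hn (by simp), ?_⟩
    rw [hd]
    unfold radialSpeed Del
    exact ((ih.sub contDiff_const).mul (ih.sub contDiff_const)).div
      ((ih.pow 2).add contDiff_const) hpos

theorem continuous_radius {M a : ℝ} (h : |a| < M) : Continuous (radius M a) :=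
  (contDiff_radius h).continuous

theorem tendsto_radius_atBot {M a : ℝ} (h : |a| < M) :
    Tendsto (radius M a) atBot (𝓝 (rPlus M a)) := by
  refine tendsto_order.2 ⟨fun b hb => Eventually.of_forall fun s => hb.trans (rPlus_lt_radius h s),
    fun b hb => ?_⟩
  filter_upwards [eventually_lt_atBot (rStar M a b)] with s hs
  have := strictMono_radius h hs
  rwa [radius_rStar h hb] at this

theorem tendsto_radius_atTop {M a : ℝ} (h : |a| < M) : Tendsto (radius M a) atTop atTop := by
  refine tendsto_atTop.2 fun b => ?_
  have hb : rPlus M a < max b (rPlus M a + 1) := lt_max_of_lt_right (by linarith)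
  filter_upwards [eventually_ge_atTop (rStar M a (max b (rPlus M a + 1)))] with s hs
  have := (strictMono_radius h).monotone hs
  rw [radius_rStar h hb] at this
  exact (le_max_left _ _).trans this

/-- Far away `dr / dr_* ≥ 1 / 2`. -/
theorem half_le_radialSpeed {M a r : ℝ} (h : |a| < M) (hr : 4 * M ≤ r) :
    1 / 2 ≤ radialSpeed M a r := by
  have hM : 0 < M := lt_of_le_of_lt (abs_nonneg a) h
  have hr0 : 0 < r := by linarith
  rw [radialSpeed, le_div_iff₀ (by positivity), Del_eq h]
  nlinarith [sq_nonneg a]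

/-- `dr / dr_*` is integrable at the horizon. -/
theorem integrableOn_radialSpeed_neg {M a : ℝ} (h : |a| < M) (s : ℝ) :
    IntegrableOn (fun t => radialSpeed M a (radius M a (-t))) (Ioi s) := by
  refine integrableOn_Ioi_deriv_of_nonneg' (a := s) (g := fun t => -radius M a (-t))
    (l := -rPlus M a) (fun t _ => ?_)
    (fun t _ => (radialSpeed_pos h (rPlus_lt_radius h _)).le)
    ((tendsto_radius_atBot h).comp tendsto_neg_atTop_atBot).neg
  refine ((hasDerivAt_radius h (-t)).scomp t (hasDerivAt_neg t)).fun_neg.congr_deriv ?_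
  simp

/-- The integral of `r ^ (-2)` over `r_* > s` is at most `2 / r (s)` far away. -/
theorem integral_radius_inv_sq {M a : ℝ} (h : |a| < M) {s : ℝ} (hs : 4 * M ≤ radius M a s) :
    IntegrableOn (fun t => (radius M a t ^ 2)⁻¹) (Ioi s) ∧
      ∫ t in Ioi s, (radius M a t ^ 2)⁻¹ ≤ 2 * (radius M a s)⁻¹ := by
  have hpos := radius_pos h
  have hd : ∀ t, HasDerivAt (fun t => -(radius M a t)⁻¹)
      (radialSpeed M a (radius M a t) / radius M a t ^ 2) t := fun t => by
    refine ((hasDerivAt_radius h t).inv (hpos t).ne').fun_neg.congr_deriv ?_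
    ring
  have hlim : Tendsto (fun t => -(radius M a t)⁻¹) atTop (𝓝 0) := by
    simpa using (tendsto_inv_atTop_zero.comp (tendsto_radius_atTop h)).neg
  have hnn : ∀ t ∈ Ioi s, 0 ≤ radialSpeed M a (radius M a t) / radius M a t ^ 2 := fun t _ =>
    div_nonneg (radialSpeed_pos h (rPlus_lt_radius h t)).le (by positivity)
  have hint := integrableOn_Ioi_deriv_of_nonneg' (a := s) (fun t _ => hd t) hnn hlim
  have hval := integral_Ioi_of_hasDerivAt_of_nonneg' (a := s) (fun t _ => hd t) hnn hlim
  have hle : ∀ t ∈ Ioi s, (radius M a t ^ 2)⁻¹ ≤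
      2 * (radialSpeed M a (radius M a t) / radius M a t ^ 2) := fun t ht => by
    have h1 := half_le_radialSpeed h (hs.trans ((strictMono_radius h).monotone (le_of_lt ht)))
    have := hpos t
    rw [div_eq_mul_inv, ← mul_assoc]
    exact le_mul_of_one_le_left (by positivity) (by linarith)
  have hcont : Continuous fun t => (radius M a t ^ 2)⁻¹ :=
    ((continuous_radius h).pow 2).inv₀ fun t => pow_ne_zero 2 (hpos t).ne'
  have hI : IntegrableOn (fun t => (radius M a t ^ 2)⁻¹) (Ioi s) := by
    refine (hint.const_mul 2).mono' hcont.aestronglyMeasurable ?_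
    refine (ae_restrict_iff' measurableSet_Ioi).2 (Eventually.of_forall fun t ht => ?_)
    rw [Real.norm_of_nonneg (by positivity)]
    exact hle t ht
  refine ⟨hI, ?_⟩
  calc _ ≤ ∫ t in Ioi s, 2 * (radialSpeed M a (radius M a t) / radius M a t ^ 2) :=
        setIntegral_mono_on hI (hint.const_mul 2) measurableSet_Ioi hle
    _ = 2 * (radius M a s)⁻¹ := by rw [integral_const_mul, hval]; ring

/-! ### Gluing two solutions through modulus and flux -/

/-- `|u|²`. -/
def sqAbs (u : ℝ → ℂ) (s : ℝ) : ℝ := (u s).re ^ 2 + (u s).im ^ 2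

/-- `Re (u' ū)`, half of the derivative of `|u|²`. -/
def growth (u u' : ℝ → ℂ) (s : ℝ) : ℝ := (u' s).re * (u s).re + (u' s).im * (u s).im

/-- `Im (u' ū)`, the flux (Wronskian) of `u`. -/
def flux (u u' : ℝ → ℂ) (s : ℝ) : ℝ := (u' s).im * (u s).re - (u' s).re * (u s).im

/-- The interpolated modulus squared, with the cut-off `χ` and the weight `c` of `|v|²`. -/
def glueP (χ : ℝ → ℝ) (c : ℝ) (u v : ℝ → ℂ) (s : ℝ) : ℝ :=
  (1 - χ s) * sqAbs u s + χ s * (c * sqAbs v s)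

/-- The derivative of `glueP`. -/
def glueP' (χ : ℝ → ℝ) (c : ℝ) (u u' v v' : ℝ → ℂ) (s : ℝ) : ℝ :=
  (1 - χ s) * (2 * growth u u' s) + χ s * (c * (2 * growth v v' s)) +
    deriv χ s * (c * sqAbs v s - sqAbs u s)

/-- The second derivative of `glueP`, when `u''` and `v''` are imaginary multiples of `u`, `v`. -/
def glueP'' (χ : ℝ → ℝ) (c : ℝ) (u u' v v' : ℝ → ℂ) (s : ℝ) : ℝ :=
  (1 - χ s) * (2 * sqAbs u' s) + χ s * (c * (2 * sqAbs v' s)) +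
    2 * deriv χ s * (c * (2 * growth v v' s) - 2 * growth u u' s) +
    deriv (deriv χ) s * (c * sqAbs v s - sqAbs u s)

/-- The interpolated flux. The integral cancels the terms with `χ'`, so that the derivative involves
only the interpolated modulus; it vanishes beyond the transition when `c` balances the fluxes. -/
def glueQ (χ : ℝ → ℝ) (s₀ c : ℝ) (u u' v v' : ℝ → ℂ) (s : ℝ) : ℝ :=
  (1 - χ s) * flux u u' s + χ s * (c * flux v v' s) -
    ∫ t in s₀..s, deriv χ t * (c * flux v v' t - flux u u' t)

/-- A function with `|w|² = P` and `Im (w' w̄) = Q` satisfies `w'' = -(E + i G) w` where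
`Q' = -G P` and `E` is this function. -/
def glueE (χ : ℝ → ℝ) (s₀ c : ℝ) (u u' v v' : ℝ → ℂ) (s : ℝ) : ℝ :=
  (glueQ χ s₀ c u u' v v' s ^ 2 + glueP' χ c u u' v v' s ^ 2 / 4 -
    glueP χ c u v s * glueP'' χ c u u' v v' s / 2) / glueP χ c u v s ^ 2

theorem hasDerivAt_re {u : ℝ → ℂ} {u' : ℂ} {s : ℝ} (h : HasDerivAt u u' s) :
    HasDerivAt (fun s => (u s).re) u'.re s :=
  Complex.reCLM.hasFDerivAt.comp_hasDerivAt s h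

theorem hasDerivAt_im {u : ℝ → ℂ} {u' : ℂ} {s : ℝ} (h : HasDerivAt u u' s) :
    HasDerivAt (fun s => (u s).im) u'.im s :=
  Complex.imCLM.hasFDerivAt.comp_hasDerivAt s h

theorem hasDerivAt_sqAbs {u u' : ℝ → ℂ} {s : ℝ} (h : HasDerivAt u (u' s) s) :
    HasDerivAt (sqAbs u) (2 * growth u u' s) s := by
  refine (((hasDerivAt_re h).fun_pow 2).fun_add ((hasDerivAt_im h).fun_pow 2)).congr_deriv ?_
  unfold growth
  push_cast
  ring

theorem hasDerivAt_growth {u u' : ℝ → ℂ} {g s : ℝ} (h : HasDerivAt u (u' s) s)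
    (h' : HasDerivAt u' (-(Complex.I * g) * u s) s) :
    HasDerivAt (growth u u') (sqAbs u' s) s := by
  refine (((hasDerivAt_re h').mul (hasDerivAt_re h)).fun_add
    ((hasDerivAt_im h').mul (hasDerivAt_im h))).congr_deriv ?_
  unfold sqAbs
  simp
  ring

theorem hasDerivAt_flux {u u' : ℝ → ℂ} {g s : ℝ} (h : HasDerivAt u (u' s) s)
    (h' : HasDerivAt u' (-(Complex.I * g) * u s) s) :
    HasDerivAt (flux u u') (-g * sqAbs u s) s := by
  refine (((hasDerivAt_im h').mul (hasDerivAt_re h)).fun_sub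
    ((hasDerivAt_re h').mul (hasDerivAt_im h))).congr_deriv ?_
  unfold sqAbs
  simp
  ring

theorem growth_sq_add_flux_sq (u u' : ℝ → ℂ) (s : ℝ) :
    growth u u' s ^ 2 + flux u u' s ^ 2 = sqAbs u s * sqAbs u' s := by
  unfold growth flux sqAbs; ring

theorem sqAbs_eq_norm (u : ℝ → ℂ) (s : ℝ) : sqAbs u s = ‖u s‖ ^ 2 := by
  rw [Complex.sq_norm, Complex.normSq_apply]; unfold sqAbs; ring

theorem mul_sqAbs (u u' : ℝ → ℂ) (s : ℝ) :
    u' s * (sqAbs u s : ℂ) = ((growth u u' s : ℂ) + Complex.I * flux u u' s) * u s := by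
  apply Complex.ext <;> simp [sqAbs, growth, flux, pow_two] <;> ring

section smooth
variable {u u' : ℝ → ℂ}

theorem contDiff_re (h : ContDiff ℝ (⊤ : ℕ∞) u) : ContDiff ℝ (⊤ : ℕ∞) fun s => (u s).re :=
  Complex.reCLM.contDiff.comp h

theorem contDiff_im (h : ContDiff ℝ (⊤ : ℕ∞) u) : ContDiff ℝ (⊤ : ℕ∞) fun s => (u s).im :=
  Complex.imCLM.contDiff.comp h

theorem contDiff_sqAbs (h : ContDiff ℝ (⊤ : ℕ∞) u) : ContDiff ℝ (⊤ : ℕ∞) (sqAbs u) :=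
  ((contDiff_re h).pow 2).add ((contDiff_im h).pow 2)

theorem contDiff_growth (h : ContDiff ℝ (⊤ : ℕ∞) u) (h' : ContDiff ℝ (⊤ : ℕ∞) u') :
    ContDiff ℝ (⊤ : ℕ∞) (growth u u') :=
  ((contDiff_re h').mul (contDiff_re h)).add ((contDiff_im h').mul (contDiff_im h))

theorem contDiff_flux (h : ContDiff ℝ (⊤ : ℕ∞) u) (h' : ContDiff ℝ (⊤ : ℕ∞) u') :
    ContDiff ℝ (⊤ : ℕ∞) (flux u u') :=
  ((contDiff_im h').mul (contDiff_re h)).sub ((contDiff_re h').mul (contDiff_im h))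

theorem contDiff_deriv_infty {χ : ℝ → ℝ} (h : ContDiff ℝ (⊤ : ℕ∞) χ) :
    ContDiff ℝ (⊤ : ℕ∞) (deriv χ) := (contDiff_infty_iff_deriv.1 h).2

theorem contDiff_primitive {f : ℝ → ℝ} (h : ContDiff ℝ (⊤ : ℕ∞) f) (s₀ : ℝ) :
    ContDiff ℝ (⊤ : ℕ∞) fun s => ∫ t in s₀..s, f t := by
  have hd : ∀ s, HasDerivAt (fun s => ∫ t in s₀..s, f t) (f s) s := fun s =>
    intervalIntegral.integral_hasDerivAt_right (h.continuous.intervalIntegrable _ _)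
      (h.continuous.stronglyMeasurableAtFilter _ _) h.continuous.continuousAt
  refine contDiff_infty_iff_deriv.2 ⟨fun s => (hd s).differentiableAt, ?_⟩
  rwa [show deriv (fun s => ∫ t in s₀..s, f t) = f from funext fun s => (hd s).deriv]

end smooth

section glue
variable {χ : ℝ → ℝ} {s₀ c : ℝ} {u u' v v' : ℝ → ℂ}

theorem contDiff_glue (hχ : ContDiff ℝ (⊤ : ℕ∞) χ)
    (hu : ContDiff ℝ (⊤ : ℕ∞) u) (hu' : ContDiff ℝ (⊤ : ℕ∞) u')
    (hv : ContDiff ℝ (⊤ : ℕ∞) v) (hv' : ContDiff ℝ (⊤ : ℕ∞) v') :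
    ContDiff ℝ (⊤ : ℕ∞) (glueP χ c u v) ∧ ContDiff ℝ (⊤ : ℕ∞) (glueP' χ c u u' v v') ∧
      ContDiff ℝ (⊤ : ℕ∞) (glueP'' χ c u u' v v') ∧
      ContDiff ℝ (⊤ : ℕ∞) (glueQ χ s₀ c u u' v v') := by
  have h1 := contDiff_deriv_infty hχ
  have h2 := contDiff_deriv_infty h1
  have a1 := contDiff_sqAbs hu
  have a2 := contDiff_sqAbs hv
  have a3 := contDiff_sqAbs hu'
  have a4 := contDiff_sqAbs hv'
  have a5 := contDiff_growth hu hu'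
  have a6 := contDiff_growth hv hv'
  have a7 := contDiff_flux hu hu'
  have a8 := contDiff_flux hv hv'
  refine ⟨?_, ?_, ?_, ?_⟩
  · unfold glueP; fun_prop
  · unfold glueP'; fun_prop
  · unfold glueP''; fun_prop
  · have a9 := contDiff_primitive (f := fun t => deriv χ t * (c * flux v v' t - flux u u' t))
      (by fun_prop) s₀
    unfold glueQ
    fun_prop

theorem hasDerivAt_glueP {s : ℝ} (hχ : ContDiff ℝ (⊤ : ℕ∞) χ) (hu : HasDerivAt u (u' s) s)
    (hv : HasDerivAt v (v' s) s) :
    HasDerivAt (glueP χ c u v) (glueP' χ c u u' v v' s) s := by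
  have h1 : HasDerivAt χ (deriv χ s) s := (hχ.differentiable (by simp)).differentiableAt.hasDerivAt
  refine (((h1.const_sub 1).mul (hasDerivAt_sqAbs hu)).fun_add
    (h1.mul ((hasDerivAt_sqAbs hv).const_mul c))).congr_deriv ?_
  unfold glueP'
  ring

theorem hasDerivAt_glueP' {g s : ℝ} (hχ : ContDiff ℝ (⊤ : ℕ∞) χ) (hu : HasDerivAt u (u' s) s)
    (hv : HasDerivAt v (v' s) s) (hu' : HasDerivAt u' (-(Complex.I * g) * u s) s)
    (hv' : HasDerivAt v' (-(Complex.I * g) * v s) s) :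
    HasDerivAt (glueP' χ c u u' v v') (glueP'' χ c u u' v v' s) s := by
  have h1 : HasDerivAt χ (deriv χ s) s := (hχ.differentiable (by simp)).differentiableAt.hasDerivAt
  have h2 : HasDerivAt (deriv χ) (deriv (deriv χ) s) s :=
    ((contDiff_deriv_infty hχ).differentiable (by simp)).differentiableAt.hasDerivAt
  refine ((((h1.const_sub 1).mul ((hasDerivAt_growth hu hu').const_mul 2)).fun_add
    (h1.mul (((hasDerivAt_growth hv hv').const_mul 2).const_mul c))).fun_add
    (h2.mul (((hasDerivAt_sqAbs hv).const_mul c).sub (hasDerivAt_sqAbs hu)))).congr_deriv ?_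
  unfold glueP''
  simp only [Pi.sub_apply]
  ring

theorem hasDerivAt_glueQ {g s : ℝ} (hχ : ContDiff ℝ (⊤ : ℕ∞) χ) (hu : HasDerivAt u (u' s) s)
    (hv : HasDerivAt v (v' s) s) (hu' : HasDerivAt u' (-(Complex.I * g) * u s) s)
    (hv' : HasDerivAt v' (-(Complex.I * g) * v s) s)
    (hf : Continuous fun t => deriv χ t * (c * flux v v' t - flux u u' t)) :
    HasDerivAt (glueQ χ s₀ c u u' v v') (-g * glueP χ c u v s) s := by
  have h1 : HasDerivAt χ (deriv χ s) s := (hχ.differentiable (by simp)).differentiableAt.hasDerivAt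
  have h2 := intervalIntegral.integral_hasDerivAt_right (hf.intervalIntegrable s₀ s)
      (hf.stronglyMeasurableAtFilter _ _) hf.continuousAt
  refine ((((h1.const_sub 1).mul (hasDerivAt_flux hu hu')).fun_add
    (h1.mul ((hasDerivAt_flux hv hv').const_mul c))).fun_sub h2).congr_deriv ?_
  unfold glueP
  ring

/-- Gluing: between two functions `u`, `v` with `u'' = -i G u` and `v'' = -i G v` there is an
interpolating solution `w` of `w'' = -(E + i G) w`, equal to `u` on the left and proportional to `v`
on the right. It is `exp ∫ q` with `q = (P' / 2 + i Q) / P`, where `q' + q² = -(E + i G)`; on the left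
`q` is the logarithmic derivative of `u`, on the right that of `v`. -/
theorem exists_glued {G : ℝ → ℝ} {sL sa sb sR : ℝ} (hLa : sL < sa) (hab : sa ≤ sb) (hbR : sb < sR)
    (hχ : ContDiff ℝ (⊤ : ℕ∞) χ) (hχa : ∀ s ≤ sa, χ s = 0) (hχb : ∀ s, sb ≤ s → χ s = 1)
    (hu : ContDiff ℝ (⊤ : ℕ∞) u) (hu' : ContDiff ℝ (⊤ : ℕ∞) u')
    (hv : ContDiff ℝ (⊤ : ℕ∞) v) (hv' : ContDiff ℝ (⊤ : ℕ∞) v')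
    (hdu : ∀ s ∈ Ioo sL sR, HasDerivAt u (u' s) s ∧ HasDerivAt u' (-(Complex.I * G s) * u s) s)
    (hdv : ∀ s ∈ Ioo sL sR, HasDerivAt v (v' s) s ∧ HasDerivAt v' (-(Complex.I * G s) * v s) s)
    (hc : c ≠ 0) (hP : ∀ s ∈ Ioo sL sR, 0 < glueP χ c u v s)
    (hbal : ∫ t in sL..sR, deriv χ t * (c * flux v v' t - flux u u' t) = 0) :
    ContDiffOn ℝ (⊤ : ℕ∞) (glueE χ sL c u u' v v') (Ioo sL sR) ∧
    (∀ s ∈ Ioo sL sa, glueE χ sL c u u' v v' s = 0) ∧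
    (∀ s ∈ Ioo sb sR, glueE χ sL c u u' v v' s = 0) ∧
    ∃ (w w' : ℝ → ℂ) (γ : ℂ), γ ≠ 0 ∧
      (∀ s ∈ Ioo sL sR, HasDerivAt w (w' s) s ∧
        HasDerivAt w' (-(glueE χ sL c u u' v v' s + Complex.I * G s) * w s) s) ∧
      (∀ s ∈ Ioo sL sa, w s = u s) ∧ (∀ s ∈ Ioo sb sR, w s = γ * v s) := by
  obtain ⟨cP, cP', cP'', cQ⟩ := contDiff_glue (s₀ := sL) (c := c) hχ hu hu' hv hv'
  have hf : Continuous fun t => deriv χ t * (c * flux v v' t - flux u u' t) := by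
    have h1 := (contDiff_deriv_infty hχ).continuous
    have h2 := (contDiff_flux hu hu').continuous
    have h3 := (contDiff_flux hv hv').continuous
    fun_prop
  have hab' : ∀ s ∈ Ioo sL sa, s ∈ Ioo sL sR := fun s hs => ⟨hs.1, by linarith [hs.2]⟩
  have hab'' : ∀ s ∈ Ioo sb sR, s ∈ Ioo sL sR := fun s hs => ⟨by linarith [hs.1], hs.2⟩
  -- the cut-off is locally constant outside `[sa, sb]`
  have dχ : ∀ s, s < sa ∨ sb < s → deriv χ s = 0 := by
    rintro s (hs | hs)
    · have : χ =ᶠ[𝓝 s] fun _ => 0 := by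
        filter_upwards [Iio_mem_nhds hs] with t ht using hχa t (le_of_lt ht)
      rw [this.deriv_eq, deriv_const]
    · have : χ =ᶠ[𝓝 s] fun _ => 1 := by
        filter_upwards [Ioi_mem_nhds hs] with t ht using hχb t (le_of_lt ht)
      rw [this.deriv_eq, deriv_const]
  have d2χ : ∀ s, s < sa ∨ sb < s → deriv (deriv χ) s = 0 := by
    rintro s (hs | hs)
    · have : deriv χ =ᶠ[𝓝 s] fun _ => 0 := by
        filter_upwards [Iio_mem_nhds hs] with t ht using dχ t (Or.inl ht)
      rw [this.deriv_eq, deriv_const]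
    · have : deriv χ =ᶠ[𝓝 s] fun _ => 0 := by
        filter_upwards [Ioi_mem_nhds hs] with t ht using dχ t (Or.inr ht)
      rw [this.deriv_eq, deriv_const]
  have int0 : ∀ s ∈ Ioo sL sa, ∫ t in sL..s, deriv χ t * (c * flux v v' t - flux u u' t) = 0 := by
    intro s hs
    refine intervalIntegral.integral_zero_ae (Eventually.of_forall fun t ht => ?_)
    rw [uIoc_of_le hs.1.le] at ht
    rw [dχ t (Or.inl (ht.2.trans_lt hs.2)), zero_mul]
  have int1 : ∀ s ∈ Ioo sb sR, ∫ t in sL..s, deriv χ t * (c * flux v v' t - flux u u' t) = 0 := by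
    intro s hs
    have h1 := intervalIntegral.integral_add_adjacent_intervals (hf.intervalIntegrable sL s)
      (hf.intervalIntegrable s sR) (μ := volume)
    have h2 : ∫ t in s..sR, deriv χ t * (c * flux v v' t - flux u u' t) = 0 := by
      refine intervalIntegral.integral_zero_ae (Eventually.of_forall fun t ht => ?_)
      rw [uIoc_of_le hs.2.le] at ht
      rw [dχ t (Or.inr (hs.1.trans ht.1)), zero_mul]
    rwa [h2, add_zero, hbal] at h1
  have vals0 : ∀ s ∈ Ioo sL sa, glueP χ c u v s = sqAbs u s ∧
      glueP' χ c u u' v v' s = 2 * growth u u' s ∧ glueP'' χ c u u' v v' s = 2 * sqAbs u' s ∧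
      glueQ χ sL c u u' v v' s = flux u u' s := by
    intro s hs
    simp [glueP, glueP', glueP'', glueQ, dχ s (Or.inl hs.2), d2χ s (Or.inl hs.2), hχa s hs.2.le,
      int0 s hs]
  have vals1 : ∀ s ∈ Ioo sb sR, glueP χ c u v s = c * sqAbs v s ∧
      glueP' χ c u u' v v' s = c * (2 * growth v v' s) ∧
      glueP'' χ c u u' v v' s = c * (2 * sqAbs v' s) ∧
      glueQ χ sL c u u' v v' s = c * flux v v' s := by
    intro s hs
    simp [glueP, glueP', glueP'', glueQ, dχ s (Or.inr hs.1), d2χ s (Or.inr hs.1), hχb s hs.1.le,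
      int1 s hs]
  refine ⟨?_, ?_, ?_, ?_⟩
  · unfold glueE
    refine ContDiffOn.div ?_ ((cP.pow 2).contDiffOn) fun s hs => pow_ne_zero 2 (hP s hs).ne'
    exact (((cQ.pow 2).add ((cP'.pow 2).div_const 4)).sub ((cP.mul cP'').div_const 2)).contDiffOn
  · intro s hs
    obtain ⟨h1, h2, h3, h4⟩ := vals0 s hs
    unfold glueE
    rw [h1, h2, h3, h4]
    have := growth_sq_add_flux_sq u u' s
    rw [div_eq_zero_iff]
    left
    linear_combination this
  · intro s hs
    obtain ⟨h1, h2, h3, h4⟩ := vals1 s hs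
    unfold glueE
    rw [h1, h2, h3, h4]
    have := growth_sq_add_flux_sq v v' s
    rw [div_eq_zero_iff]
    left
    linear_combination c ^ 2 * this
  · set q : ℝ → ℂ := fun s => ((glueP' χ c u u' v v' s / 2 : ℝ) + Complex.I *
      (glueQ χ sL c u u' v v' s : ℝ)) / (glueP χ c u v s : ℝ) with hq
    have hPc : ∀ s ∈ Ioo sL sR, ((glueP χ c u v s : ℝ) : ℂ) ≠ 0 := fun s hs => by
      exact_mod_cast (hP s hs).ne'
    have hqd : ∀ s ∈ Ioo sL sR, HasDerivAt q (-(glueE χ sL c u u' v v' s + Complex.I * G s) -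
        q s ^ 2) s := by
      intro s hs
      obtain ⟨a1, a2⟩ := hdu s hs
      obtain ⟨b1, b2⟩ := hdv s hs
      have e1 := (hasDerivAt_glueP (c := c) hχ a1 b1).ofReal_comp
      have e2 := ((hasDerivAt_glueP' (c := c) hχ a1 b1 a2 b2).div_const 2).ofReal_comp
      have e3 := (hasDerivAt_glueQ (s₀ := sL) hχ a1 b1 a2 b2 hf).ofReal_comp
      refine ((e2.fun_add (e3.const_mul Complex.I)).div e1 (hPc s hs)).congr_deriv ?_
      have hne := hPc s hs
      simp only [hq, glueE]
      push_cast
      field_simp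
      linear_combination (glueQ χ sL c u u' v v' s : ℂ) ^ 2 * 16 * Complex.I_sq
    have hqc : ContinuousOn q (Ioo sL sR) := fun s hs =>
      (hqd s hs).continuousAt.continuousWithinAt
    set s₁ := (sL + sR) / 2 with hs₁
    have hs₁m : s₁ ∈ Ioo sL sR := ⟨by linarith, by linarith⟩
    set W : ℝ → ℂ := fun s => Complex.exp (∫ t in s₁..s, q t) with hW
    have hWd : ∀ s ∈ Ioo sL sR, HasDerivAt W (q s * W s) s := by
      intro s hs
      have hsub : uIcc s₁ s ⊆ Ioo sL sR := (ordConnected_Ioo).uIcc_subset hs₁m hs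
      have h1 : HasDerivAt (fun s => ∫ t in s₁..s, q t) (q s) s :=
        intervalIntegral.integral_hasDerivAt_right ((hqc.mono hsub).intervalIntegrable)
          (hqc.stronglyMeasurableAtFilter isOpen_Ioo s hs) (hqd s hs).continuousAt
      exact h1.cexp.congr_deriv (mul_comm _ _)
    have hWne : ∀ s, W s ≠ 0 := fun s => Complex.exp_ne_zero _
    -- a function with logarithmic derivative `q` is a multiple of `W`
    have hconst : ∀ (f f' : ℝ → ℂ) (α β : ℝ), α < β → Ioo α β ⊆ Ioo sL sR →
        (∀ s ∈ Ioo α β, HasDerivAt f (f' s) s ∧ f' s = q s * f s ∧ f s ≠ 0) →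
        ∃ κ : ℂ, κ ≠ 0 ∧ ∀ s ∈ Ioo α β, f s = κ * W s := by
      intro f f' α β hαβ hsub hfd
      have hd : ∀ s ∈ Ioo α β, HasDerivAt (fun s => f s / W s) 0 s := by
        intro s hs
        obtain ⟨f1, f2, -⟩ := hfd s hs
        refine (f1.div (hWd s (hsub hs)) (hWne s)).congr_deriv ?_
        rw [f2, div_eq_zero_iff]
        left; ring
      have hm : (α + β) / 2 ∈ Ioo α β := ⟨by linarith, by linarith⟩
      refine ⟨f ((α + β) / 2) / W ((α + β) / 2), div_ne_zero (hfd _ hm).2.2 (hWne _), ?_⟩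
      intro s hs
      have : f s / W s = f ((α + β) / 2) / W ((α + β) / 2) :=
        isOpen_Ioo.is_const_of_deriv_eq_zero isPreconnected_Ioo
        (f := fun s => f s / W s)
        (fun t ht => (hd t ht).differentiableAt.differentiableWithinAt)
        (fun t ht => (hd t ht).deriv) hs hm
      rw [← this, div_mul_cancel₀ _ (hWne s)]
    obtain ⟨κ, hκ, hκu⟩ := hconst u u' sL sa hLa (fun s hs => hab' s hs) (fun s hs => by
      obtain ⟨h1, h2, h3, h4⟩ := vals0 s hs
      have hne := hPc s (hab' s hs)
      rw [h1] at hne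
      refine ⟨(hdu s (hab' s hs)).1, ?_, fun h0 => hne (by simp [sqAbs, h0])⟩
      simp only [hq, h1, h2, h4]
      rw [div_mul_eq_mul_div, eq_div_iff hne, mul_sqAbs]
      push_cast; ring)
    obtain ⟨κ', hκ', hκv⟩ := hconst v v' sb sR hbR (fun s hs => hab'' s hs) (fun s hs => by
      obtain ⟨h1, h2, h3, h4⟩ := vals1 s hs
      have hne := hPc s (hab'' s hs)
      rw [h1] at hne
      have hne' : (sqAbs v s : ℂ) ≠ 0 := fun h0 => hne (by rw [Complex.ofReal_mul, h0, mul_zero])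
      have hcc : (c : ℂ) ≠ 0 := by exact_mod_cast hc
      refine ⟨(hdv s (hab'' s hs)).1, ?_, fun h0 => hne' (by simp [sqAbs, h0])⟩
      simp only [hq, h1, h2, h4]
      rw [div_mul_eq_mul_div, eq_div_iff hne, Complex.ofReal_mul, mul_left_comm, mul_sqAbs]
      push_cast; ring)
    refine ⟨fun s => κ * W s, fun s => κ * (q s * W s), κ / κ', div_ne_zero hκ hκ',
      fun s hs => ⟨(hWd s hs).const_mul κ, ?_⟩, fun s hs => (hκu s hs).symm, fun s hs => ?_⟩
    · refine (((hqd s hs).mul (hWd s hs)).const_mul κ).congr_deriv ?_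
      ring
    · rw [hκv s hs]
      field_simp
end glue

/-! ### The size of the gluing potential -/

theorem smooth_smoothTransition : ContDiff ℝ (⊤ : ℕ∞) Real.smoothTransition :=
  Real.smoothTransition.contDiff

theorem deriv_smoothTransition_eq_zero {x : ℝ} (hx : x < 0 ∨ 1 < x) :
    deriv Real.smoothTransition x = 0 ∧ deriv (deriv Real.smoothTransition) x = 0 := by
  have h1 : ∀ x : ℝ, x < 0 ∨ 1 < x → deriv Real.smoothTransition x = 0 := by
    rintro x (hx | hx)
    · have : Real.smoothTransition =ᶠ[𝓝 x] fun _ => 0 := by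
        filter_upwards [Iio_mem_nhds hx] with t ht
          using Real.smoothTransition.zero_of_nonpos (le_of_lt ht)
      rw [this.deriv_eq, deriv_const]
    · have : Real.smoothTransition =ᶠ[𝓝 x] fun _ => 1 := by
        filter_upwards [Ioi_mem_nhds hx] with t ht
          using Real.smoothTransition.one_of_one_le (le_of_lt ht)
      rw [this.deriv_eq, deriv_const]
  refine ⟨h1 x hx, ?_⟩
  have : deriv Real.smoothTransition =ᶠ[𝓝 x] fun _ => 0 := by
    rcases hx with hx | hx
    · filter_upwards [Iio_mem_nhds hx] with t ht using h1 t (Or.inl ht)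
    · filter_upwards [Ioi_mem_nhds hx] with t ht using h1 t (Or.inr ht)
  rw [this.deriv_eq, deriv_const]

theorem exists_smoothTransition_bound : ∃ B : ℝ, 0 ≤ B ∧
    ∀ x, |deriv Real.smoothTransition x| ≤ B ∧ |deriv (deriv Real.smoothTransition) x| ≤ B := by
  have c1 := contDiff_deriv_infty smooth_smoothTransition
  have c2 := contDiff_deriv_infty c1
  obtain ⟨B₁, h1⟩ := isCompact_Icc.exists_bound_of_continuousOn
    (s := Icc (0:ℝ) 1) c1.continuous.continuousOn
  obtain ⟨B₂, h2⟩ := isCompact_Icc.exists_bound_of_continuousOn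
    (s := Icc (0:ℝ) 1) c2.continuous.continuousOn
  have hB : 0 ≤ max B₁ B₂ :=
    ((norm_nonneg _).trans (h1 0 ⟨le_rfl, zero_le_one⟩)).trans (le_max_left _ _)
  refine ⟨max B₁ B₂, hB, fun x => ?_⟩
  by_cases hx : x ∈ Icc (0:ℝ) 1
  · exact ⟨(h1 x hx).trans (le_max_left _ _), (h2 x hx).trans (le_max_right _ _)⟩
  · have : x < 0 ∨ 1 < x := by
      by_contra! hh
      exact hx ⟨hh.1, hh.2⟩
    obtain ⟨e1, e2⟩ := deriv_smoothTransition_eq_zero this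
    rw [e1, e2, abs_zero]
    exact ⟨hB, hB⟩

/-- A cut-off that rises from `0` to `1` in the middle third of `[α, α + L]`. -/
def cutoff (α L s : ℝ) : ℝ := Real.smoothTransition (3 * (s - α) / L - 1)

theorem contDiff_cutoff (α L : ℝ) : ContDiff ℝ (⊤ : ℕ∞) (cutoff α L) :=
  smooth_smoothTransition.comp
    (((contDiff_const.mul (contDiff_id.sub contDiff_const)).div_const L).sub contDiff_const)

theorem cutoff_mem (α L s : ℝ) : 0 ≤ cutoff α L s ∧ cutoff α L s ≤ 1 :=
  ⟨Real.smoothTransition.nonneg _, Real.smoothTransition.le_one _⟩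

theorem cutoff_eq_zero {α L s : ℝ} (hL : 0 < L) (hs : s ≤ α + L / 3) : cutoff α L s = 0 := by
  refine Real.smoothTransition.zero_of_nonpos ?_
  rw [sub_nonpos, div_le_one hL]
  linarith

theorem cutoff_eq_one {α L s : ℝ} (hL : 0 < L) (hs : α + 2 * L / 3 ≤ s) : cutoff α L s = 1 := by
  refine Real.smoothTransition.one_of_one_le ?_
  rw [le_sub_iff_add_le, le_div_iff₀ hL]
  linarith

theorem deriv_cutoff (α L s : ℝ) :
    deriv (cutoff α L) s = 3 / L * deriv Real.smoothTransition (3 * (s - α) / L - 1) ∧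
    deriv (deriv (cutoff α L)) s =
      (3 / L) ^ 2 * deriv (deriv Real.smoothTransition) (3 * (s - α) / L - 1) := by
  have hl : ∀ s, HasDerivAt (fun s => 3 * (s - α) / L - 1) (3 / L) s := fun s => by
    refine (((((hasDerivAt_id s).sub_const α).const_mul 3).div_const L).sub_const 1).congr_deriv ?_
    ring
  have h1 : deriv (cutoff α L) =
      fun s => 3 / L * deriv Real.smoothTransition (3 * (s - α) / L - 1) := by
    funext s
    have := ((smooth_smoothTransition.differentiable (by simp)).differentiableAt
      (x := 3 * (s - α) / L - 1)).hasDerivAt.comp s (hl s)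
    exact (this.deriv).trans (mul_comm _ _)
  refine ⟨congrFun h1 s, ?_⟩
  rw [h1]
  have := ((((contDiff_deriv_infty smooth_smoothTransition).differentiable
    (by simp)).differentiableAt (x := 3 * (s - α) / L - 1)).hasDerivAt.comp s (hl s)).const_mul (3 / L)
  refine this.deriv.trans ?_
  ring

theorem abs_growth_le (u u' : ℝ → ℂ) (s : ℝ) : |growth u u' s| ≤ ‖u' s‖ * ‖u s‖ := by
  refine abs_le_of_sq_le_sq ?_ (by positivity)
  rw [mul_pow, ← sqAbs_eq_norm, ← sqAbs_eq_norm, mul_comm, ← growth_sq_add_flux_sq]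
  linarith [sq_nonneg (flux u u' s)]

theorem abs_flux_le (u u' : ℝ → ℂ) (s : ℝ) : |flux u u' s| ≤ ‖u' s‖ * ‖u s‖ := by
  refine abs_le_of_sq_le_sq ?_ (by positivity)
  rw [mul_pow, ← sqAbs_eq_norm, ← sqAbs_eq_norm, mul_comm, ← growth_sq_add_flux_sq]
  linarith [sq_nonneg (growth u u' s)]

theorem linear_of_deriv_deriv_zero {u u' : ℝ → ℂ} {α β : ℝ}
    (h : ∀ s ∈ Icc α β, HasDerivAt u (u' s) s ∧ HasDerivAt u' 0 s) {s t : ℝ} (hs : s ∈ Icc α β)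
    (ht : t ∈ Icc α β) : u' s = u' t ∧ u s = u t + u' t * (s - t) := by
  have h1 : ∀ s ∈ Icc α β, u' s = u' t := by
    intro s hs
    have hsub : uIcc t s ⊆ Icc α β := ordConnected_Icc.uIcc_subset ht hs
    have := intervalIntegral.integral_eq_sub_of_hasDerivAt (a := t) (b := s)
      (fun r hr => (h r (hsub hr)).2) (by simp)
    rw [intervalIntegral.integral_zero] at this
    exact sub_eq_zero.1 this.symm
  refine ⟨h1 s hs, ?_⟩
  have hsub : uIcc t s ⊆ Icc α β := ordConnected_Icc.uIcc_subset ht hs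
  have := intervalIntegral.integral_eq_sub_of_hasDerivAt (a := t) (b := s) (f' := fun _ => u' t)
    (fun r hr => (h1 r (hsub hr)) ▸ (h r (hsub hr)).1) (by simp)
  rw [intervalIntegral.integral_const, Complex.real_smul] at this
  push_cast at this
  linear_combination -this

/-- An affine function of nonzero flux grows linearly away from the point `t`. -/
theorem norm_affine_bounds {u u' : ℝ → ℂ} {K w L s t : ℝ} (hK : 0 < K) (hL : 1 ≤ L)
    (hw : 0 < w) (hLw : 6 * K ^ 2 / w ≤ L) (hu : ‖u t‖ ≤ K) (hu' : ‖u' t‖ ≤ K)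
    (hflux : w ≤ |flux u u' t|) (hlin : u s = u t + u' t * (s - t)) (h1 : L / 3 ≤ |s - t|)
    (h2 : |s - t| ≤ L) : w / (6 * K) * L ≤ ‖u s‖ ∧ ‖u s‖ ≤ 2 * K * L := by
  have e : ‖u' t * ((s : ℂ) - t)‖ = ‖u' t‖ * |s - t| := by
    rw [norm_mul, ← Complex.ofReal_sub, Complex.norm_real, Real.norm_eq_abs]
  have h3 : w / K ≤ ‖u' t‖ := by
    rw [div_le_iff₀ hK]
    exact (hflux.trans (abs_flux_le u u' t)).trans (by gcongr)
  have h4 : w / K * (L / 3) ≤ ‖u' t‖ * |s - t| := by gcongr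
  have h5 : ‖u' t‖ * |s - t| ≤ K * L := by gcongr
  have h6 : K ≤ w / (6 * K) * L := by
    rw [div_le_iff₀ hw] at hLw
    rw [div_mul_eq_mul_div, le_div_iff₀ (by positivity)]
    nlinarith
  have h7 : w / K * (L / 3) = 2 * (w / (6 * K) * L) := by field_simp; norm_num
  constructor
  · have := norm_sub_le (u s) (u t)
    rw [hlin, add_sub_cancel_left, e, ← hlin] at this
    linarith
  · rw [hlin]
    have := norm_add_le (u t) (u' t * (s - t))
    rw [e] at this
    nlinarith

/-- If `u`, `v` are affine with fluxes of the same sign, then `E` is `O(L ^ (-2))` in the region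
where they are interpolated. Each is bounded at its own end of the interval, and both are of size `L`
in the middle third, where `P`, `P'`, `P''` are of sizes `L²`, `L`, `1`, and `P` is bounded below by a
multiple of `L²`. -/
theorem exists_glueE_bound {K Wu Wv : ℝ} (hK : 1 ≤ K) (hW : 0 < Wu * Wv) :
    ∃ L₀ C : ℝ, 1 ≤ L₀ ∧ ∀ L ≥ L₀, ∀ (α : ℝ) (u u' v v' : ℝ → ℂ),
      (∀ s ∈ Icc α (α + L), HasDerivAt u (u' s) s ∧ HasDerivAt u' 0 s) →
      (∀ s ∈ Icc α (α + L), HasDerivAt v (v' s) s ∧ HasDerivAt v' 0 s) →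
      (∀ s ∈ Icc α (α + L), flux u u' s = Wu ∧ flux v v' s = Wv) →
      ‖u α‖ ≤ K → ‖u' α‖ ≤ K → ‖v (α + L)‖ ≤ K → ‖v' (α + L)‖ ≤ K →
      (∀ s ∈ Icc α (α + L), 0 < glueP (cutoff α L) (Wu / Wv) u v s) ∧
      ∀ s ∈ Icc (α + L / 3) (α + 2 * L / 3),
        |glueE (cutoff α L) α (Wu / Wv) u u' v v' s| ≤ C / L ^ 2 := by
  obtain ⟨B, hB0, hB⟩ := exists_smoothTransition_bound
  have hWv : Wv ≠ 0 := right_ne_zero_of_mul hW.ne'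
  have hWu : Wu ≠ 0 := left_ne_zero_of_mul hW.ne'
  set c := Wu / Wv with hc
  have hc0 : 0 < c := by
    have : c = Wu * Wv / Wv ^ 2 := by rw [hc]; field_simp
    rw [this]; positivity
  have hK0 : 0 < K := by linarith
  set p := min ((|Wu| / (6 * K)) ^ 2) (c * (|Wv| / (6 * K)) ^ 2) with hp
  have hp0 : 0 < p := lt_min (by positivity) (by positivity)
  set n := (|Wu| ^ 2 + ((4 + 12 * B) * K ^ 2 * (1 + c)) ^ 2 / 4 +
    (4 * K ^ 2 * (1 + c)) * ((2 + 60 * B) * K ^ 2 * (1 + c)) / 2) with hn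
  refine ⟨max 1 (max (6 * K ^ 2 / |Wu|) (6 * K ^ 2 / |Wv|)), n / p ^ 2, le_max_left _ _, ?_⟩
  intro L hL α u u' v v' hu hv hfl hu1 hu2 hv1 hv2
  have hL1 : 1 ≤ L := (le_max_left _ _).trans hL
  have hL0 : 0 < L := by linarith
  have hLu : 6 * K ^ 2 / |Wu| ≤ L := ((le_max_left _ _).trans (le_max_right _ _)).trans hL
  have hLv : 6 * K ^ 2 / |Wv| ≤ L := ((le_max_right _ _).trans (le_max_right _ _)).trans hL
  have hαm : α ∈ Icc α (α + L) := ⟨le_rfl, by linarith⟩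
  have hβm : α + L ∈ Icc α (α + L) := ⟨by linarith, le_rfl⟩
  have posu : ∀ s ∈ Icc α (α + L), 0 < sqAbs u s := by
    intro s hs
    rw [sqAbs_eq_norm]
    have : u s ≠ 0 := fun h0 => hWu (by rw [← (hfl s hs).1]; simp [flux, h0])
    have := norm_pos_iff.2 this
    positivity
  have posv : ∀ s ∈ Icc α (α + L), 0 < c * sqAbs v s := by
    intro s hs
    rw [sqAbs_eq_norm]
    have : v s ≠ 0 := fun h0 => hWv (by rw [← (hfl s hs).2]; simp [flux, h0])
    have := norm_pos_iff.2 this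
    positivity
  have hmin : ∀ s, min (sqAbs u s) (c * sqAbs v s) ≤ glueP (cutoff α L) c u v s := by
    intro s
    obtain ⟨h0, h1⟩ := cutoff_mem α L s
    unfold glueP
    have h2 := mul_le_mul_of_nonneg_left (min_le_left (sqAbs u s) (c * sqAbs v s))
      (sub_nonneg.2 h1)
    have h3 := mul_le_mul_of_nonneg_left (min_le_right (sqAbs u s) (c * sqAbs v s)) h0
    linarith
  refine ⟨fun s hs => (lt_min (posu s hs) (posv s hs)).trans_le (hmin s), ?_⟩
  intro s hs
  have hsm : s ∈ Icc α (α + L) := ⟨by linarith [hs.1], by linarith [hs.2]⟩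
  obtain ⟨lu', lu⟩ := linear_of_deriv_deriv_zero hu hsm hαm
  obtain ⟨lv', lv⟩ := linear_of_deriv_deriv_zero hv hsm hβm
  have bu := norm_affine_bounds (s := s) (t := α) hK0 hL1 (abs_pos.2 hWu) hLu hu1 hu2
    (by rw [(hfl α hαm).1]) lu (by rw [abs_of_nonneg (by linarith [hs.1])]; linarith [hs.1])
    (by rw [abs_of_nonneg (by linarith [hs.1])]; linarith [hs.2])
  have bv := norm_affine_bounds (s := s) (t := α + L) hK0 hL1 (abs_pos.2 hWv) hLv hv1 hv2
    (by rw [(hfl _ hβm).2]) lv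
    (by rw [abs_of_nonpos (by linarith [hs.2])]; linarith [hs.2])
    (by rw [abs_of_nonpos (by linarith [hs.2])]; linarith [hs.1])
  obtain ⟨hχ0, hχ1⟩ := cutoff_mem α L s
  obtain ⟨eχ1, eχ2⟩ := deriv_cutoff α L s
  set χ := cutoff α L with hχ
  have dχ1 : |deriv χ s| ≤ 3 * B / L := by
    rw [eχ1, abs_mul, abs_of_pos (by positivity), div_mul_eq_mul_div]
    gcongr
    exact (hB _).1
  have dχ2 : |deriv (deriv χ) s| ≤ 9 * B / L ^ 2 := by
    rw [eχ2, abs_mul, abs_of_pos (by positivity), div_pow, div_mul_eq_mul_div]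
    gcongr
    · norm_num
    · exact (hB _).2
  -- the functions are of size `L`, their derivatives of size `1`
  have su : sqAbs u s ≤ 4 * K ^ 2 * L ^ 2 := by
    rw [sqAbs_eq_norm]
    calc ‖u s‖ ^ 2 ≤ (2 * K * L) ^ 2 := by gcongr; exact bu.2
      _ = _ := by ring
  have sv : sqAbs v s ≤ 4 * K ^ 2 * L ^ 2 := by
    rw [sqAbs_eq_norm]
    calc ‖v s‖ ^ 2 ≤ (2 * K * L) ^ 2 := by gcongr; exact bv.2
      _ = _ := by ring
  have su0 : 0 ≤ sqAbs u s := (posu s hsm).le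
  have sv0 : 0 ≤ sqAbs v s := by unfold sqAbs; positivity
  have su' : sqAbs u' s ≤ K ^ 2 := by rw [sqAbs_eq_norm, lu']; gcongr
  have sv' : sqAbs v' s ≤ K ^ 2 := by rw [sqAbs_eq_norm, lv']; gcongr
  have su'0 : 0 ≤ sqAbs u' s := by unfold sqAbs; positivity
  have sv'0 : 0 ≤ sqAbs v' s := by unfold sqAbs; positivity
  have gu : |growth u u' s| ≤ 2 * K ^ 2 * L := by
    refine (abs_growth_le u u' s).trans ?_
    rw [lu']
    calc ‖u' α‖ * ‖u s‖ ≤ K * (2 * K * L) := by gcongr; exact bu.2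
      _ = _ := by ring
  have gv : |growth v v' s| ≤ 2 * K ^ 2 * L := by
    refine (abs_growth_le v v' s).trans ?_
    rw [lv']
    calc ‖v' (α + L)‖ * ‖v s‖ ≤ K * (2 * K * L) := by gcongr; exact bv.2
      _ = _ := by ring
  have conv : ∀ x y X : ℝ, |x| ≤ X → |y| ≤ X →
      |(1 - χ s) * x + χ s * (c * y)| ≤ X * (1 + c) := by
    intro x y X hx hy
    have hX : 0 ≤ X := (abs_nonneg _).trans hx
    calc _ ≤ |(1 - χ s) * x| + |χ s * (c * y)| := abs_add_le _ _
      _ = (1 - χ s) * |x| + χ s * (c * |y|) := by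
        rw [abs_mul, abs_mul, abs_mul, abs_of_nonneg hχ0, abs_of_nonneg (sub_nonneg.2 hχ1),
          abs_of_pos hc0]
      _ ≤ 1 * X + 1 * (c * X) := by
        gcongr
        linarith
      _ = _ := by ring
  have diff : ∀ x y X : ℝ, |x| ≤ X → |y| ≤ X → |c * y - x| ≤ X * (1 + c) := by
    intro x y X hx hy
    calc _ ≤ |c * y| + |x| := abs_sub _ _
      _ ≤ c * X + X := by rw [abs_mul, abs_of_pos hc0]; gcongr
      _ = _ := by ring
  have b0 : |glueP χ c u v s| ≤ 4 * K ^ 2 * (1 + c) * L ^ 2 := by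
    refine (conv _ _ (4 * K ^ 2 * L ^ 2) ?_ ?_).trans (le_of_eq (by ring))
    · rwa [abs_of_nonneg su0]
    · rwa [abs_of_nonneg sv0]
  have b1 : |glueP' χ c u u' v v' s| ≤ (4 + 12 * B) * K ^ 2 * (1 + c) * L := by
    have h1 := conv (2 * growth u u' s) (2 * growth v v' s) (4 * K ^ 2 * L)
      (by rw [abs_mul, abs_two]; linarith) (by rw [abs_mul, abs_two]; linarith)
    have h2 := diff (sqAbs u s) (sqAbs v s) (4 * K ^ 2 * L ^ 2)
      (by rwa [abs_of_nonneg su0]) (by rwa [abs_of_nonneg sv0])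
    have h3 : |deriv χ s * (c * sqAbs v s - sqAbs u s)| ≤
        3 * B / L * (4 * K ^ 2 * L ^ 2 * (1 + c)) := by
      rw [abs_mul]; gcongr
    have h4 : 3 * B / L * (4 * K ^ 2 * L ^ 2 * (1 + c)) = 12 * B * K ^ 2 * (1 + c) * L := by
      field_simp; ring
    unfold glueP'
    refine (abs_add_le _ _).trans ?_
    rw [h4] at h3
    linarith
  have b2 : |glueP'' χ c u u' v v' s| ≤ (2 + 60 * B) * K ^ 2 * (1 + c) := by
    have h1 := conv (2 * sqAbs u' s) (2 * sqAbs v' s) (2 * K ^ 2)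
      (by rw [abs_of_nonneg (by positivity)]; linarith)
      (by rw [abs_of_nonneg (by positivity)]; linarith)
    have h2 := diff (sqAbs u s) (sqAbs v s) (4 * K ^ 2 * L ^ 2)
      (by rwa [abs_of_nonneg su0]) (by rwa [abs_of_nonneg sv0])
    have h3 := diff (2 * growth u u' s) (2 * growth v v' s) (4 * K ^ 2 * L)
      (by rw [abs_mul, abs_two]; linarith) (by rw [abs_mul, abs_two]; linarith)
    have h4 : |2 * deriv χ s * (c * (2 * growth v v' s) - 2 * growth u u' s)| ≤
        2 * (3 * B / L) * (4 * K ^ 2 * L * (1 + c)) := by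
      rw [abs_mul, abs_mul, abs_two]; gcongr
    have h5 : |deriv (deriv χ) s * (c * sqAbs v s - sqAbs u s)| ≤
        9 * B / L ^ 2 * (4 * K ^ 2 * L ^ 2 * (1 + c)) := by
      rw [abs_mul]; gcongr
    have h6 : 2 * (3 * B / L) * (4 * K ^ 2 * L * (1 + c)) = 24 * B * K ^ 2 * (1 + c) := by
      field_simp; ring
    have h7 : 9 * B / L ^ 2 * (4 * K ^ 2 * L ^ 2 * (1 + c)) = 36 * B * K ^ 2 * (1 + c) := by
      field_simp; ring
    rw [h6] at h4
    rw [h7] at h5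
    unfold glueP''
    refine ((abs_add_le _ _).trans (add_le_add_left (abs_add_le _ _) _)).trans ?_
    linarith
  have bQ : glueQ χ α c u u' v v' s = Wu := by
    have hcW : c * Wv = Wu := by rw [hc]; field_simp
    have h0 : ∫ t in α..s, deriv χ t * (c * flux v v' t - flux u u' t) = 0 := by
      refine intervalIntegral.integral_zero_ae (Eventually.of_forall fun t ht => ?_)
      rw [uIoc_of_le hsm.1] at ht
      have := hfl t ⟨ht.1.le, ht.2.trans hsm.2⟩
      rw [this.1, this.2, hcW, sub_self, mul_zero]
    unfold glueQ
    rw [h0, (hfl s hsm).1, (hfl s hsm).2, hcW]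
    ring
  have bP : p * L ^ 2 ≤ glueP χ c u v s := by
    refine le_trans ?_ (hmin s)
    refine le_min ?_ ?_
    · calc p * L ^ 2 ≤ (|Wu| / (6 * K)) ^ 2 * L ^ 2 := by gcongr; exact min_le_left _ _
        _ = (|Wu| / (6 * K) * L) ^ 2 := by ring
        _ ≤ sqAbs u s := by rw [sqAbs_eq_norm]; gcongr; exact bu.1
    · calc p * L ^ 2 ≤ (c * (|Wv| / (6 * K)) ^ 2) * L ^ 2 := by gcongr; exact min_le_right _ _
        _ = c * (|Wv| / (6 * K) * L) ^ 2 := by ring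
        _ ≤ c * sqAbs v s := by rw [sqAbs_eq_norm]; gcongr; exact bv.1
  unfold glueE
  have hPL : 0 < p * L ^ 2 := by positivity
  rw [abs_div, abs_of_nonneg (sq_nonneg (glueP χ c u v s)), div_div]
  refine div_le_div₀ (c := n * L ^ 2) (by positivity) ?_ (d := (p * L ^ 2) ^ 2) (by positivity)
    (by gcongr) |>.trans (le_of_eq ?_)
  · rw [bQ]
    have e1 : |Wu ^ 2| ≤ |Wu| ^ 2 * L ^ 2 := by
      rw [abs_pow]
      exact le_mul_of_one_le_right (by positivity) (one_le_pow₀ hL1)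
    have e2 : |glueP' χ c u u' v v' s ^ 2 / 4| ≤ ((4 + 12 * B) * K ^ 2 * (1 + c)) ^ 2 / 4 * L ^ 2 := by
      rw [abs_div, abs_pow, abs_of_pos (by norm_num : (0:ℝ) < 4)]
      calc _ ≤ ((4 + 12 * B) * K ^ 2 * (1 + c) * L) ^ 2 / 4 := by gcongr
        _ = _ := by ring
    have e3 : |glueP χ c u v s * glueP'' χ c u u' v v' s / 2| ≤
        (4 * K ^ 2 * (1 + c)) * ((2 + 60 * B) * K ^ 2 * (1 + c)) / 2 * L ^ 2 := by
      rw [abs_div, abs_mul, abs_two]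
      calc _ ≤ (4 * K ^ 2 * (1 + c) * L ^ 2) * ((2 + 60 * B) * K ^ 2 * (1 + c)) / 2 := by gcongr
        _ = _ := by ring
    refine ((abs_sub _ _).trans (add_le_add_left (abs_add_le _ _) _)).trans ?_
    rw [hn]
    linarith
  · field_simp

/-! ### Openness of the gluing, and global solutions -/

/-- Solutions of a linear second order equation with smooth coefficient are smooth. -/
theorem contDiff_of_linear_ode {u u' q : ℝ → ℂ} (hu : ∀ s, HasDerivAt u (u' s) s)
    (hu' : ∀ s, HasDerivAt u' (q s * u s) s) (hq : ContDiff ℝ (⊤ : ℕ∞) q) :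
    ContDiff ℝ (⊤ : ℕ∞) u ∧ ContDiff ℝ (⊤ : ℕ∞) u' := by
  have hd : deriv u = u' := funext fun s => (hu s).deriv
  have hd' : deriv u' = fun s => q s * u s := funext fun s => (hu' s).deriv
  have key : ∀ n : ℕ, ContDiff ℝ n u ∧ ContDiff ℝ n u' := by
    intro n
    induction n with
    | zero =>
      exact ⟨contDiff_zero.2 (continuous_iff_continuousAt.2 fun s => (hu s).continuousAt),
        contDiff_zero.2 (continuous_iff_continuousAt.2 fun s => (hu' s).continuousAt)⟩
    | succ n ih =>
      rw [Nat.cast_succ]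
      refine ⟨contDiff_succ_iff_deriv.2 ⟨fun s => (hu s).differentiableAt,
        fun hn => absurd hn (by simp), ?_⟩, contDiff_succ_iff_deriv.2
        ⟨fun s => (hu' s).differentiableAt, fun hn => absurd hn (by simp), ?_⟩⟩
      · rw [hd]; exact ih.2
      · rw [hd']; exact (hq.of_le (by exact_mod_cast le_top)).mul ih.1
  exact ⟨contDiff_infty.2 fun n => (key n).1, contDiff_infty.2 fun n => (key n).2⟩

/-- For parameters near `x₀`, where `u` and `v` are affine, the gluing is possible with `|E| < η`. The
length `L` depends only on the bounds and the fluxes, and not on the position `α`. The weight is the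
quotient of the `χ'`-averages of the fluxes, which makes the balance exact. -/
theorem eventually_glue {K Wu Wv η : ℝ} (hK : 1 ≤ K) (hW : 0 < Wu * Wv) (hη : 0 < η) :
    ∃ L : ℝ, 1 ≤ L ∧ ∀ {X : Type} [TopologicalSpace X] (x₀ : X) (α : ℝ) (u u' v v' : X → ℝ → ℂ),
      (Continuous fun p : X × ℝ => u p.1 p.2) → (Continuous fun p : X × ℝ => u' p.1 p.2) →
      (Continuous fun p : X × ℝ => v p.1 p.2) → (Continuous fun p : X × ℝ => v' p.1 p.2) →
      (∀ s ∈ Icc α (α + L), HasDerivAt (u x₀) (u' x₀ s) s ∧ HasDerivAt (u' x₀) 0 s) →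
      (∀ s ∈ Icc α (α + L), HasDerivAt (v x₀) (v' x₀ s) s ∧ HasDerivAt (v' x₀) 0 s) →
      (∀ s ∈ Icc α (α + L), flux (u x₀) (u' x₀) s = Wu ∧ flux (v x₀) (v' x₀) s = Wv) →
      ‖u x₀ α‖ ≤ K → ‖u' x₀ α‖ ≤ K → ‖v x₀ (α + L)‖ ≤ K → ‖v' x₀ (α + L)‖ ≤ K →
      ∀ᶠ x in 𝓝 x₀, ∃ c : ℝ, c ≠ 0 ∧
        (∀ s ∈ Icc α (α + L), 0 < glueP (cutoff α L) c (u x) (v x) s) ∧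
        (∀ s ∈ Icc (α + L / 3) (α + 2 * L / 3),
          |glueE (cutoff α L) α c (u x) (u' x) (v x) (v' x) s| < η) ∧
        ∫ t in α..(α + L), deriv (cutoff α L) t *
          (c * flux (v x) (v' x) t - flux (u x) (u' x) t) = 0 := by
  obtain ⟨L₀, C, hL₀, hmain⟩ := exists_glueE_bound hK hW
  have hWv : Wv ≠ 0 := right_ne_zero_of_mul hW.ne'
  have hWu : Wu ≠ 0 := left_ne_zero_of_mul hW.ne'
  obtain ⟨L, hLL, hLC⟩ : ∃ L ≥ L₀, C / L ^ 2 < η := by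
    have h1 : Tendsto (fun L : ℝ => C / L ^ 2) atTop (𝓝 0) :=
      tendsto_const_nhds.div_atTop (tendsto_pow_atTop two_ne_zero)
    exact ((eventually_ge_atTop L₀).and (h1.eventually (gt_mem_nhds hη))).exists
  refine ⟨L, hL₀.trans hLL, ?_⟩
  intro X _ x₀ α u u' v v' cu cu' cv cv' hu hv hfl hu1 hu2 hv1 hv2
  have hL0 : 0 < L := by linarith
  obtain ⟨hP, hE⟩ := hmain L hLL α _ _ _ _ hu hv hfl hu1 hu2 hv1 hv2
  set χ := cutoff α L with hχ
  have hχs := contDiff_cutoff α L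
  have cχ : Continuous χ := hχs.continuous
  have cχ1 : Continuous (deriv χ) := (contDiff_deriv_infty hχs).continuous
  have cχ2 : Continuous (deriv (deriv χ)) :=
    (contDiff_deriv_infty (contDiff_deriv_infty hχs)).continuous
  have csu : Continuous fun p : X × ℝ => sqAbs (u p.1) p.2 := by unfold sqAbs; fun_prop
  have csv : Continuous fun p : X × ℝ => sqAbs (v p.1) p.2 := by unfold sqAbs; fun_prop
  have csu' : Continuous fun p : X × ℝ => sqAbs (u' p.1) p.2 := by unfold sqAbs; fun_prop
  have csv' : Continuous fun p : X × ℝ => sqAbs (v' p.1) p.2 := by unfold sqAbs; fun_prop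
  have cgu : Continuous fun p : X × ℝ => growth (u p.1) (u' p.1) p.2 := by unfold growth; fun_prop
  have cgv : Continuous fun p : X × ℝ => growth (v p.1) (v' p.1) p.2 := by unfold growth; fun_prop
  have cfu : Continuous fun p : X × ℝ => flux (u p.1) (u' p.1) p.2 := by unfold flux; fun_prop
  have cfv : Continuous fun p : X × ℝ => flux (v p.1) (v' p.1) p.2 := by unfold flux; fun_prop
  have cFu : Continuous fun p : X × ℝ => ∫ t in α..p.2, deriv χ t * flux (u p.1) (u' p.1) t := by
    refine intervalIntegral.continuous_parametric_primitive_of_continuous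
      (f := fun x t => deriv χ t * flux (u x) (u' x) t) ?_
    exact (cχ1.comp continuous_snd).mul cfu
  have cFv : Continuous fun p : X × ℝ => ∫ t in α..p.2, deriv χ t * flux (v p.1) (v' p.1) t := by
    refine intervalIntegral.continuous_parametric_primitive_of_continuous
      (f := fun x t => deriv χ t * flux (v x) (v' x) t) ?_
    exact (cχ1.comp continuous_snd).mul cfv
  have cfu1 : ∀ x, Continuous fun t => deriv χ t * flux (u x) (u' x) t := fun x =>
    cχ1.mul (cfu.comp (Continuous.prodMk_right x))
  have cfv1 : ∀ x, Continuous fun t => deriv χ t * flux (v x) (v' x) t := fun x =>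
    cχ1.mul (cfv.comp (Continuous.prodMk_right x))
  have hsplit : ∀ (x : X) (c s : ℝ),
      ∫ t in α..s, deriv χ t * (c * flux (v x) (v' x) t - flux (u x) (u' x) t) =
        c * (∫ t in α..s, deriv χ t * flux (v x) (v' x) t) -
          ∫ t in α..s, deriv χ t * flux (u x) (u' x) t := by
    intro x c s
    rw [← intervalIntegral.integral_const_mul, ← intervalIntegral.integral_sub
      (((cfv1 x).const_mul c).intervalIntegrable _ _) ((cfu1 x).intervalIntegrable _ _)]
    congr 1
    funext t
    ring
  -- the total transition of the cut-off is one
  have hχint : ∫ t in α..(α + L), deriv χ t = 1 := by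
    rw [intervalIntegral.integral_deriv_eq_sub
      (fun t _ => (hχs.differentiable (by simp)).differentiableAt) (cχ1.intervalIntegrable _ _)]
    rw [cutoff_eq_one hL0 (by linarith), cutoff_eq_zero hL0 (by linarith), sub_zero]
  have hval : ∀ (f : ℝ → ℝ) (W : ℝ), (∀ s ∈ Icc α (α + L), f s = W) →
      ∫ t in α..(α + L), deriv χ t * f t = W := by
    intro f W hf
    have : ∫ t in α..(α + L), deriv χ t * f t = ∫ t in α..(α + L), deriv χ t * W := by
      refine intervalIntegral.integral_congr fun t ht => ?_
      rw [uIcc_of_le (by linarith)] at ht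
      simp only [hf t ht]
    rw [this, intervalIntegral.integral_mul_const, hχint, one_mul]
  set N : X → ℝ := fun x => ∫ t in α..(α + L), deriv χ t * flux (u x) (u' x) t with hN
  set D : X → ℝ := fun x => ∫ t in α..(α + L), deriv χ t * flux (v x) (v' x) t with hD
  have cN : Continuous N := cFu.comp (Continuous.prodMk_left (α + L))
  have cD : Continuous D := cFv.comp (Continuous.prodMk_left (α + L))
  have hN0 : N x₀ = Wu := hval _ _ fun s hs => (hfl s hs).1
  have hD0 : D x₀ = Wv := hval _ _ fun s hs => (hfl s hs).2
  have hcat : ContinuousAt (fun x => N x / D x) x₀ :=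
    cN.continuousAt.div cD.continuousAt (by rw [hD0]; exact hWv)
  have hc0 : N x₀ / D x₀ = Wu / Wv := by rw [hN0, hD0]
  have hcat2 : ∀ s : ℝ, ContinuousAt (fun p : X × ℝ => N p.1 / D p.1) (x₀, s) := fun s =>
    ContinuousAt.comp (f := Prod.fst) (g := fun x => N x / D x) hcat continuousAt_fst
  have hPc : ∀ s, ContinuousAt (fun p : X × ℝ => glueP χ (N p.1 / D p.1) (u p.1) (v p.1) p.2)
      (x₀, s) := by
    intro s
    unfold glueP
    exact ((continuous_const.sub (cχ.comp continuous_snd)).mul csu).continuousAt.add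
      ((cχ.comp continuous_snd).continuousAt.mul ((hcat2 s).mul csv.continuousAt))
  have hEc : ∀ s ∈ Icc α (α + L), ContinuousAt (fun p : X × ℝ =>
      glueE χ α (N p.1 / D p.1) (u p.1) (u' p.1) (v p.1) (v' p.1) p.2) (x₀, s) := by
    intro s hs
    have h1 := hcat2 s
    have k0 := (cχ.comp (continuous_snd (X := X))).continuousAt (x := (x₀, s))
    have k1 := (cχ1.comp (continuous_snd (X := X))).continuousAt (x := (x₀, s))
    have k2 := (cχ2.comp (continuous_snd (X := X))).continuousAt (x := (x₀, s))
    have hP' : ContinuousAt (fun p : X × ℝ =>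
        glueP' χ (N p.1 / D p.1) (u p.1) (u' p.1) (v p.1) (v' p.1) p.2) (x₀, s) :=
      ((((continuousAt_const.sub k0).mul (cgu.continuousAt.const_mul 2)).add
        (k0.mul (h1.mul (cgv.continuousAt.const_mul 2)))).add
        (k1.mul ((h1.mul csv.continuousAt).sub csu.continuousAt)))
    have hP'' : ContinuousAt (fun p : X × ℝ =>
        glueP'' χ (N p.1 / D p.1) (u p.1) (u' p.1) (v p.1) (v' p.1) p.2) (x₀, s) :=
      ((((continuousAt_const.sub k0).mul (csu'.continuousAt.const_mul 2)).add
        (k0.mul (h1.mul (csv'.continuousAt.const_mul 2)))).add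
        ((k1.const_mul 2).mul ((h1.mul (cgv.continuousAt.const_mul 2)).sub
          (cgu.continuousAt.const_mul 2)))).add
        (k2.mul ((h1.mul csv.continuousAt).sub csu.continuousAt))
    have hQ : ContinuousAt (fun p : X × ℝ =>
        glueQ χ α (N p.1 / D p.1) (u p.1) (u' p.1) (v p.1) (v' p.1) p.2) (x₀, s) := by
      unfold glueQ
      simp only [hsplit]
      exact (((continuousAt_const.sub k0).mul cfu.continuousAt).add
        (k0.mul (h1.mul cfv.continuousAt))).sub
        ((h1.mul cFv.continuousAt).sub cFu.continuousAt)
    refine ((((hQ.pow 2).add ((hP'.pow 2).div_const 4)).sub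
      (((hPc s).mul hP'').div_const 2)).div ((hPc s).pow 2) ?_)
    simp only [hc0]
    exact pow_ne_zero 2 (hP s hs).ne'
  have e1 : ∀ᶠ x in 𝓝 x₀, ∀ s ∈ Icc α (α + L), 0 < glueP χ (N x / D x) (u x) (v x) s := by
    refine isCompact_Icc.eventually_forall_of_forall_eventually fun s hs => ?_
    refine (hPc s).eventually (lt_mem_nhds ?_)
    simp only [hc0]
    exact hP s hs
  have e2 : ∀ᶠ x in 𝓝 x₀, ∀ s ∈ Icc (α + L / 3) (α + 2 * L / 3),
      |glueE χ α (N x / D x) (u x) (u' x) (v x) (v' x) s| < η := by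
    refine isCompact_Icc.eventually_forall_of_forall_eventually fun s hs => ?_
    refine (hEc s ⟨by linarith [hs.1], by linarith [hs.2]⟩).abs.eventually (gt_mem_nhds ?_)
    simp only [hc0]
    exact (hE s hs).trans_lt hLC
  have e3 : ∀ᶠ x in 𝓝 x₀, D x ≠ 0 := cD.continuousAt.eventually_ne (by rw [hD0]; exact hWv)
  have e4 : ∀ᶠ x in 𝓝 x₀, N x ≠ 0 := cN.continuousAt.eventually_ne (by rw [hN0]; exact hWu)
  filter_upwards [e1, e2, e3, e4] with x h1 h2 h3 h4
  refine ⟨N x / D x, div_ne_zero h4 h3, h1, h2, ?_⟩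
  rw [hsplit]
  exact sub_eq_zero.2 (div_mul_cancel₀ _ h3)

/-- Gluing of two global solutions along an interval on which they solve the same equation. The
coefficient `q` agrees with `qu` on the left and with `qv` on the right. -/
theorem exists_global_solution {α L c η : ℝ} {u u' v v' qu qv q : ℝ → ℂ} {G : ℝ → ℝ} (hL : 0 < L)
    (hη : 0 < η) (hu : ∀ s, HasDerivAt u (u' s) s) (hu' : ∀ s, HasDerivAt u' (qu s * u s) s)
    (hv : ∀ s, HasDerivAt v (v' s) s) (hv' : ∀ s, HasDerivAt v' (qv s * v s) s)
    (hqu : ContDiff ℝ (⊤ : ℕ∞) qu) (hqv : ContDiff ℝ (⊤ : ℕ∞) qv)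
    (hqL : ∀ s ≤ α + L, q s = qu s) (hqR : ∀ s, α ≤ s → q s = qv s)
    (hqG : ∀ s ∈ Icc α (α + L), q s = -(Complex.I * G s))
    (hc : c ≠ 0) (hP : ∀ s ∈ Icc α (α + L), 0 < glueP (cutoff α L) c u v s)
    (hE : ∀ s ∈ Icc (α + L / 3) (α + 2 * L / 3), |glueE (cutoff α L) α c u u' v v' s| < η)
    (hbal : ∫ t in α..(α + L), deriv (cutoff α L) t * (c * flux v v' t - flux u u' t) = 0) :
    ∃ (E : ℝ → ℝ) (y y' : ℝ → ℂ) (γ : ℂ), ContDiff ℝ (⊤ : ℕ∞) E ∧ (∀ s, |E s| < η) ∧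
      (∀ s, s < α + L / 3 ∨ α + 2 * L / 3 < s → E s = 0) ∧
      (∀ s, HasDerivAt y (y' s) s) ∧ (∀ s, HasDerivAt y' ((q s - E s) * y s) s) ∧
      (∀ s < α + L / 3, y s = u s ∧ y' s = u' s) ∧
      (∀ s, α + 2 * L / 3 < s → y s = γ * v s ∧ y' s = γ * v' s) := by
  obtain ⟨su, su'⟩ := contDiff_of_linear_ode hu hu' hqu
  obtain ⟨sv, sv'⟩ := contDiff_of_linear_ode hv hv' hqv
  obtain ⟨g1, g2, g3, w, w', γ, -, gw, gu, gv⟩ := exists_glued (G := G) (sL := α) (sa := α + L / 3)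
    (sb := α + 2 * L / 3) (sR := α + L) (c := c) (by linarith) (by linarith) (by linarith)
    (contDiff_cutoff α L) (fun s hs => cutoff_eq_zero hL hs) (fun s hs => cutoff_eq_one hL hs)
    su su' sv sv'
    (fun s hs => ⟨hu s, by
      rw [← hqG s ⟨hs.1.le, hs.2.le⟩, hqL s hs.2.le]; exact hu' s⟩)
    (fun s hs => ⟨hv s, by
      rw [← hqG s ⟨hs.1.le, hs.2.le⟩, hqR s hs.1.le]; exact hv' s⟩)
    hc (fun s hs => hP s ⟨hs.1.le, hs.2.le⟩) hbal
  set E₀ := glueE (cutoff α L) α c u u' v v' with hE₀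
  obtain ⟨E, hEdef⟩ : ∃ E : ℝ → ℝ, E = fun s => if s ∈ Ioo α (α + L) then E₀ s else 0 := ⟨_, rfl⟩
  have Ein : ∀ s ∈ Ioo α (α + L), E s = E₀ s := fun s hs => by rw [hEdef]; simp only [if_pos hs]
  have Eout : ∀ s, s < α + L / 3 ∨ α + 2 * L / 3 < s → E s = 0 := by
    intro s hs
    rw [hEdef]
    by_cases h : s ∈ Ioo α (α + L)
    · simp only [if_pos h]
      rcases hs with hs | hs
      · exact g2 s ⟨h.1, hs⟩
      · exact g3 s ⟨hs, h.2⟩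
    · simp only [if_neg h]
  have hcov : ∀ s : ℝ, s < α + L / 3 ∨ s ∈ Ioo α (α + L) ∨ α + 2 * L / 3 < s := by
    intro s
    rcases lt_or_ge s (α + L / 3) with h1 | h1
    · exact Or.inl h1
    · rcases lt_or_ge (α + 2 * L / 3) s with h2 | h2
      · exact Or.inr (Or.inr h2)
      · exact Or.inr (Or.inl ⟨by linarith, by linarith⟩)
  obtain ⟨y, hy⟩ : ∃ y : ℝ → ℂ, y = fun s => if s ≤ α + L / 6 then u s else
      if s ≤ α + 5 * L / 6 then w s else γ * v s := ⟨_, rfl⟩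
  have yL : ∀ s < α + L / 3, y s = u s := by
    intro s hs
    rw [hy]
    dsimp only
    split_ifs with h1 h2
    · rfl
    · exact gu s ⟨by linarith, hs⟩
    · linarith
  have yM : ∀ s ∈ Ioo α (α + L), y s = w s := by
    intro s hs
    rw [hy]
    dsimp only
    split_ifs with h1 h2
    · exact (gu s ⟨hs.1, by linarith⟩).symm
    · rfl
    · exact (gv s ⟨by linarith, hs.2⟩).symm
  have yR : ∀ s, α + 2 * L / 3 < s → y s = γ * v s := by
    intro s hs
    rw [hy]
    dsimp only
    split_ifs with h1 h2
    · linarith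
    · exact gv s ⟨hs, by linarith⟩
    · rfl
  have y1L : ∀ s < α + L / 3, HasDerivAt y (u' s) s := fun s hs =>
    (hu s).congr_of_eventuallyEq (by filter_upwards [Iio_mem_nhds hs] with t ht using yL t ht)
  have y1M : ∀ s ∈ Ioo α (α + L), HasDerivAt y (w' s) s := fun s hs =>
    (gw s hs).1.congr_of_eventuallyEq
      (by filter_upwards [Ioo_mem_nhds hs.1 hs.2] with t ht using yM t ht)
  have y1R : ∀ s, α + 2 * L / 3 < s → HasDerivAt y (γ * v' s) s := fun s hs =>
    ((hv s).const_mul γ).congr_of_eventuallyEq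
      (by filter_upwards [Ioi_mem_nhds hs] with t ht using yR t ht)
  refine ⟨E, y, deriv y, γ, ?_, ?_, Eout, ?_, ?_, fun s hs => ⟨yL s hs, (y1L s hs).deriv⟩,
    fun s hs => ⟨yR s hs, (y1R s hs).deriv⟩⟩
  · refine contDiff_iff_contDiffAt.2 fun s => ?_
    rcases hcov s with h | h | h
    · refine (contDiffAt_const (c := (0:ℝ))).congr_of_eventuallyEq ?_
      filter_upwards [Iio_mem_nhds h] with t ht using Eout t (Or.inl ht)
    · refine (g1.contDiffAt (Ioo_mem_nhds h.1 h.2)).congr_of_eventuallyEq ?_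
      filter_upwards [Ioo_mem_nhds h.1 h.2] with t ht using Ein t ht
    · refine (contDiffAt_const (c := (0:ℝ))).congr_of_eventuallyEq ?_
      filter_upwards [Ioi_mem_nhds h] with t ht using Eout t (Or.inr ht)
  · intro s
    by_cases h : s ∈ Icc (α + L / 3) (α + 2 * L / 3)
    · rw [Ein s ⟨by linarith [h.1], by linarith [h.2]⟩]
      exact hE s h
    · have : s < α + L / 3 ∨ α + 2 * L / 3 < s := by
        by_contra! hh
        exact h ⟨hh.1, hh.2⟩
      rw [Eout s this, abs_zero]
      exact hη
  · intro s
    rcases hcov s with h | h | h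
    · exact (y1L s h).differentiableAt.hasDerivAt
    · exact (y1M s h).differentiableAt.hasDerivAt
    · exact (y1R s h).differentiableAt.hasDerivAt
  · intro s
    rcases hcov s with h | h | h
    · have := (hu' s).congr_of_eventuallyEq (f₁ := deriv y)
        (by filter_upwards [Iio_mem_nhds h] with t ht using (y1L t ht).deriv)
      rwa [← hqL s (by linarith), ← yL s h, ← sub_zero (q s), ← Complex.ofReal_zero,
        ← Eout s (Or.inl h)] at this
    · have := (gw s h).2.congr_of_eventuallyEq (f₁ := deriv y)
        (by filter_upwards [Ioo_mem_nhds h.1 h.2] with t ht using (y1M t ht).deriv)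
      refine this.congr_deriv ?_
      rw [hqG s ⟨h.1.le, h.2.le⟩, yM s h, Ein s h]
      ring
    · have := ((hv' s).const_mul γ).congr_of_eventuallyEq (f₁ := deriv y)
        (by filter_upwards [Ioi_mem_nhds h] with t ht using (y1R t ht).deriv)
      refine this.congr_deriv ?_
      rw [hqR s (by linarith), yR s h, Eout s (Or.inr h)]
      push_cast
      ring

/-! ### Bounds for the radial potential; outgoing solutions -/

theorem rPlus_add_rMinus (M a : ℝ) : rPlus M a + rMinus M a = 2 * M := by
  unfold rPlus rMinus; ring

theorem rPlus_sq_add {M a : ℝ} (h : |a| < M) : rPlus M a ^ 2 + a ^ 2 = 2 * M * rPlus M a := by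
  have := Del_eq h (rPlus M a)
  rw [Del, sub_self, zero_mul] at this
  linarith

/-- The second part of the radial potential is bounded by `Δ / (r² + a²)²`. -/
theorem abs_curvature_term_le {M a r : ℝ} (h : |a| < M) (hr : rPlus M a < r) :
    |Del M a r / (r ^ 2 + a ^ 2) ^ 4 * (a ^ 2 * Del M a r + 2 * M * r * (r ^ 2 - a ^ 2))| ≤
      (1 + 2 * M / rPlus M a) * (Del M a r / (r ^ 2 + a ^ 2) ^ 2) := by
  have hM : 0 < M := lt_of_le_of_lt (abs_nonneg a) h
  have hp := rPlus_pos h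
  have hr0 : 0 < r := hp.trans hr
  have hD := Del_pos h hr
  have hDle := Del_le h hr0.le
  have hρ : 0 < r ^ 2 + a ^ 2 := by positivity
  have h1 : |a ^ 2 * Del M a r + 2 * M * r * (r ^ 2 - a ^ 2)| ≤
      (1 + 2 * M / rPlus M a) * (r ^ 2 + a ^ 2) ^ 2 := by
    have e1 : |a ^ 2 * Del M a r| ≤ (r ^ 2 + a ^ 2) ^ 2 := by
      rw [abs_of_nonneg (by positivity), sq (r ^ 2 + a ^ 2)]
      exact mul_le_mul (by linarith [sq_nonneg r]) hDle hD.le hρ.le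
    have e2 : |r ^ 2 - a ^ 2| ≤ r ^ 2 + a ^ 2 :=
      abs_le.2 ⟨by nlinarith [sq_nonneg r], by nlinarith [sq_nonneg a]⟩
    have e3 : r ≤ (r ^ 2 + a ^ 2) / rPlus M a := by
      rw [le_div_iff₀ hp]; nlinarith [sq_nonneg a]
    have e4 : |2 * M * r * (r ^ 2 - a ^ 2)| ≤
        2 * M * ((r ^ 2 + a ^ 2) / rPlus M a) * (r ^ 2 + a ^ 2) := by
      rw [abs_mul, abs_of_pos (by positivity)]
      gcongr
    refine (abs_add_le _ _).trans ((add_le_add e1 e4).trans (le_of_eq ?_))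
    ring
  rw [abs_mul, abs_of_pos (by positivity)]
  calc _ ≤ Del M a r / (r ^ 2 + a ^ 2) ^ 4 * ((1 + 2 * M / rPlus M a) * (r ^ 2 + a ^ 2) ^ 2) := by
        gcongr
    _ = _ := by field_simp

/-- The radial potential decays like `r ^ (-2)`. -/
theorem exists_norm_radialPotential_le {M a : ℝ} (h : |a| < M) (m : ℤ) (A : ℝ) (hA : 0 ≤ A) :
    ∃ C : ℝ, 0 ≤ C ∧ ∀ (ω lam : ℂ), ‖ω‖ ≤ A → ‖lam‖ ≤ A → ∀ r, rPlus M a < r →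
      ‖radialPotential M a ω m lam r‖ ≤ C * (r ^ 2)⁻¹ := by
  have hM : 0 < M := lt_of_le_of_lt (abs_nonneg a) h
  have hp := rPlus_pos h
  refine ⟨4 * M * |a| * |(m : ℝ)| * A / rPlus M a + (m : ℝ) ^ 2 + (A + a ^ 2 * A ^ 2) +
    (1 + 2 * M / rPlus M a), by positivity, ?_⟩
  intro ω lam hω hlam r hr
  have hr0 : 0 < r := hp.trans hr
  have hD := Del_pos h hr
  have hDle := Del_le h hr0.le
  have hρ : 0 < r ^ 2 + a ^ 2 := by positivity
  have e3 : r ≤ (r ^ 2 + a ^ 2) / rPlus M a := by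
    rw [le_div_iff₀ hp]; nlinarith [sq_nonneg a]
  have hm : ‖(m : ℂ)‖ = |(m : ℝ)| := by rw [← Complex.ofReal_intCast, Complex.norm_real,
    Real.norm_eq_abs]
  have n1 : ‖(4 * M * r * a * m * ω : ℂ)‖ ≤
      4 * M * |a| * |(m : ℝ)| * A / rPlus M a * (r ^ 2 + a ^ 2) := by
    simp only [norm_mul, Complex.norm_real, Real.norm_eq_abs, hm, Complex.norm_ofNat]
    rw [abs_of_pos hM, abs_of_pos hr0]
    calc 4 * M * r * |a| * |(m : ℝ)| * ‖ω‖ ≤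
          4 * M * ((r ^ 2 + a ^ 2) / rPlus M a) * |a| * |(m : ℝ)| * A := by gcongr
      _ = _ := by ring
  have n2 : ‖((a : ℂ) ^ 2 * (m : ℂ) ^ 2)‖ ≤ (m : ℝ) ^ 2 * (r ^ 2 + a ^ 2) := by
    rw [norm_mul, norm_pow, norm_pow, Complex.norm_real, Real.norm_eq_abs, hm, sq_abs, sq_abs,
      mul_comm]
    gcongr
    nlinarith [sq_nonneg r]
  have n3 : ‖(Del M a r : ℂ) * (lam + (a : ℂ) ^ 2 * ω ^ 2)‖ ≤
      (A + a ^ 2 * A ^ 2) * (r ^ 2 + a ^ 2) := by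
    rw [norm_mul, Complex.norm_real, Real.norm_of_nonneg hD.le, mul_comm]
    refine mul_le_mul ((norm_add_le _ _).trans ?_) hDle hD.le (by positivity)
    rw [norm_mul, norm_pow, norm_pow, Complex.norm_real, Real.norm_eq_abs, sq_abs]
    gcongr
  have n4 := abs_curvature_term_le h hr
  have n5 : (1 + 2 * M / rPlus M a) * (Del M a r / (r ^ 2 + a ^ 2) ^ 2) ≤
      (1 + 2 * M / rPlus M a) * (r ^ 2 + a ^ 2)⁻¹ := by
    gcongr
    rw [div_le_iff₀ (by positivity)]
    calc Del M a r ≤ r ^ 2 + a ^ 2 := hDle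
      _ = _ := by field_simp
  have n6 : (r ^ 2 + a ^ 2)⁻¹ ≤ (r ^ 2)⁻¹ := by
    gcongr
    linarith [sq_nonneg a]
  unfold radialPotential
  refine (norm_add_le _ _).trans ?_
  rw [Complex.norm_real, Real.norm_eq_abs]
  have n7 : ‖(r : ℂ) ^ 2 + (a : ℂ) ^ 2‖ = r ^ 2 + a ^ 2 := by
    have : (r : ℂ) ^ 2 + (a : ℂ) ^ 2 = ((r ^ 2 + a ^ 2 : ℝ) : ℂ) := by push_cast; rfl
    rw [this, Complex.norm_real, Real.norm_of_nonneg hρ.le]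
  rw [norm_div, norm_pow, n7]
  set c₁ := 4 * M * |a| * |(m : ℝ)| * A / rPlus M a + (m : ℝ) ^ 2 + (A + a ^ 2 * A ^ 2) with hc₁
  have hc₁0 : 0 ≤ c₁ := by positivity
  have n8 : ‖(4 * M * r * a * m * ω - (a : ℂ) ^ 2 * (m : ℂ) ^ 2 +
      (Del M a r : ℂ) * (lam + (a : ℂ) ^ 2 * ω ^ 2))‖ ≤ c₁ * (r ^ 2 + a ^ 2) := by
    refine (norm_add_le _ _).trans ?_
    have := norm_sub_le (4 * M * r * a * m * ω : ℂ) ((a : ℂ) ^ 2 * (m : ℂ) ^ 2)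
    rw [hc₁]
    linarith
  have n9 : ‖(4 * M * r * a * m * ω - (a : ℂ) ^ 2 * (m : ℂ) ^ 2 +
      (Del M a r : ℂ) * (lam + (a : ℂ) ^ 2 * ω ^ 2))‖ / (r ^ 2 + a ^ 2) ^ 2 ≤
      c₁ * (r ^ 2 + a ^ 2)⁻¹ := by
    rw [div_le_iff₀ (by positivity)]
    refine n8.trans (le_of_eq ?_)
    field_simp
  calc _ ≤ c₁ * (r ^ 2 + a ^ 2)⁻¹ + (1 + 2 * M / rPlus M a) * (r ^ 2 + a ^ 2)⁻¹ :=
        add_le_add n9 (n4.trans n5)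
    _ = (c₁ + (1 + 2 * M / rPlus M a)) * (r ^ 2 + a ^ 2)⁻¹ := by ring
    _ ≤ _ := by gcongr

/-- The frequency `ω - a m / (2 M r₊)` with respect to the horizon generator. -/
def horizonFreq (M a : ℝ) (m : ℤ) (ω : ℂ) : ℂ :=
  ω - ((a * m / (2 * M * rPlus M a) : ℝ) : ℂ)

/-- At the horizon the radial potential tends to `ω² - κ²`, at the rate `dr / dr_*`. -/
theorem exists_norm_radialPotential_horizon_le {M a : ℝ} (h : |a| < M) (m : ℤ) (A : ℝ)
    (hA : 0 ≤ A) : ∃ C : ℝ, 0 ≤ C ∧ ∀ (ω lam : ℂ), ‖ω‖ ≤ A → ‖lam‖ ≤ A → ∀ r, rPlus M a < r →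
      ‖radialPotential M a ω m lam r - ω ^ 2 + horizonFreq M a m ω ^ 2‖ ≤ C * radialSpeed M a r := by
  have hM : 0 < M := lt_of_le_of_lt (abs_nonneg a) h
  have hp := rPlus_pos h
  have hlt := rMinus_lt_rPlus h
  have hsum := rPlus_add_rMinus M a
  have hsq := rPlus_sq_add h
  set P := rPlus M a with hP
  set N := rMinus M a with hN
  have hPN : 0 < P - N := by linarith
  set k := a * m / (2 * M * P) with hk
  set T := 2 * P / (P - N) with hT
  set d := 2 * M * P with hd
  have hd0 : 0 < d := by positivity
  refine ⟨2 * A * |a| * |(m : ℝ)| * (T / d + 1 / d) + a ^ 2 * (m : ℝ) ^ 2 * (2 * T / d ^ 2) +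
    (A + a ^ 2 * A ^ 2) / d + (1 + 2 * M / P) / d, by positivity, ?_⟩
  intro ω lam hω hlam r hr
  have hr0 : 0 < r := hp.trans hr
  have hD := Del_pos h hr
  have hDe := Del_eq h r
  have hS0 := radialSpeed_pos h hr
  have hρ : 0 < r ^ 2 + a ^ 2 := by positivity
  have hρd : d ≤ r ^ 2 + a ^ 2 := by rw [← hsq]; gcongr
  set S := radialSpeed M a r with hS
  have hSD : Del M a r = S * (r ^ 2 + a ^ 2) := by rw [hS, radialSpeed]; field_simp
  set y := (r ^ 2 + a ^ 2)⁻¹ with hy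
  have hy0 : 0 < y := by positivity
  have hyd : y ≤ 1 / d := by rw [hy, ← one_div]; gcongr
  have hDy : Del M a r * y = S := by rw [hSD, hy]; field_simp
  have i1 : |y - 1 / d| ≤ S * (T / d) := by
    rw [abs_of_nonpos (by linarith)]
    have e : -(y - 1 / d) = (r - P) * (r + P) * y / d := by
      rw [hy]
      field_simp
      rw [← hsq]; ring
    have hrN : 0 < r - N := by linarith
    have e2 : (r - P) = Del M a r / (r - N) := by
      rw [Del, ← hP, ← hN]; field_simp
    have e3 : (r + P) / (r - N) ≤ T := by
      rw [hT, div_le_div_iff₀ hrN hPN]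
      have : 0 ≤ (r - P) * (P + N) := mul_nonneg (by linarith) (by linarith)
      nlinarith
    calc -(y - 1 / d) = S * ((r + P) / (r - N) / d) := by
          rw [e, e2, ← hDy]; ring
      _ ≤ S * (T / d) := by gcongr
  have i2 : |y ^ 2 - 1 / d ^ 2| ≤ S * (2 * T / d ^ 2) := by
    have e : y ^ 2 - 1 / d ^ 2 = (y - 1 / d) * (y + 1 / d) := by ring
    rw [e, abs_mul, abs_of_pos (by positivity : 0 < y + 1 / d)]
    calc |y - 1 / d| * (y + 1 / d) ≤ S * (T / d) * (1 / d + 1 / d) := by gcongr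
      _ = _ := by ring
  have hm : ‖(m : ℂ)‖ = |(m : ℝ)| := by rw [← Complex.ofReal_intCast, Complex.norm_real,
    Real.norm_eq_abs]
  have hcurv : |Del M a r / (r ^ 2 + a ^ 2) ^ 4 *
      (a ^ 2 * Del M a r + 2 * M * r * (r ^ 2 - a ^ 2))| ≤ (1 + 2 * M / P) / d * S := by
    refine (abs_curvature_term_le h hr).trans ?_
    have e : Del M a r / (r ^ 2 + a ^ 2) ^ 2 = S * y := by rw [← hDy, hy]; field_simp
    rw [e]
    calc (1 + 2 * M / P) * (S * y) ≤ (1 + 2 * M / P) * (S * (1 / d)) := by gcongr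
      _ = _ := by ring
  set cv := Del M a r / (r ^ 2 + a ^ 2) ^ 4 *
      (a ^ 2 * Del M a r + 2 * M * r * (r ^ 2 - a ^ 2)) with hcv
  have key : radialPotential M a ω m lam r - ω ^ 2 + horizonFreq M a m ω ^ 2 =
      2 * ω * a * m * ((y - 1 / d - S * y : ℝ) : ℂ) -
        (a : ℂ) ^ 2 * (m : ℂ) ^ 2 * ((y ^ 2 - 1 / d ^ 2 : ℝ) : ℂ) +
        (lam + (a : ℂ) ^ 2 * ω ^ 2) * ((S * y : ℝ) : ℂ) + (cv : ℂ) := by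
    have hρc : (r : ℂ) ^ 2 + (a : ℂ) ^ 2 ≠ 0 := by
      have : (r : ℂ) ^ 2 + (a : ℂ) ^ 2 = ((r ^ 2 + a ^ 2 : ℝ) : ℂ) := by push_cast; rfl
      rw [this]; exact_mod_cast hρ.ne'
    have hdc : (d : ℂ) ≠ 0 := by exact_mod_cast hd0.ne'
    have hyc : (y : ℂ) = ((r : ℂ) ^ 2 + (a : ℂ) ^ 2)⁻¹ := by rw [hy]; push_cast; rfl
    have hSc : (Del M a r : ℂ) = S * ((r : ℂ) ^ 2 + (a : ℂ) ^ 2) := by rw [hSD]; push_cast; rfl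
    have hr2 : 2 * (M : ℂ) * r = ((r : ℂ) ^ 2 + (a : ℂ) ^ 2) - S * ((r : ℂ) ^ 2 + (a : ℂ) ^ 2) := by
      rw [← hSc, hDe]; push_cast; ring
    unfold radialPotential horizonFreq
    rw [← hP, ← hk, ← hcv, hk]
    rw [show (4 * (M : ℂ) * r * a * m * ω) = 2 * (2 * M * r) * a * m * ω by ring, hr2, hSc]
    push_cast
    rw [hyc]
    field_simp
    ring
  rw [key]
  have b1 : ‖2 * ω * a * m * ((y - 1 / d - S * y : ℝ) : ℂ)‖ ≤
      2 * A * |a| * |(m : ℝ)| * (S * (T / d) + S * (1 / d)) := by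
    simp only [norm_mul, Complex.norm_real, Real.norm_eq_abs, hm, Complex.norm_ofNat]
    have : |y - 1 / d - S * y| ≤ S * (T / d) + S * (1 / d) := by
      refine (abs_sub _ _).trans (add_le_add i1 ?_)
      rw [abs_of_nonneg (by positivity)]
      gcongr
    gcongr
  have b2 : ‖(a : ℂ) ^ 2 * (m : ℂ) ^ 2 * ((y ^ 2 - 1 / d ^ 2 : ℝ) : ℂ)‖ ≤
      a ^ 2 * (m : ℝ) ^ 2 * (S * (2 * T / d ^ 2)) := by
    simp only [norm_mul, norm_pow, Complex.norm_real, Real.norm_eq_abs, hm, sq_abs]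
    gcongr
  have b3 : ‖(lam + (a : ℂ) ^ 2 * ω ^ 2) * ((S * y : ℝ) : ℂ)‖ ≤
      (A + a ^ 2 * A ^ 2) * (S * (1 / d)) := by
    rw [norm_mul, Complex.norm_real, Real.norm_of_nonneg (by positivity)]
    gcongr
    refine (norm_add_le _ _).trans ?_
    rw [norm_mul, norm_pow, norm_pow, Complex.norm_real, Real.norm_eq_abs, sq_abs]
    gcongr
  have b4 : ‖(cv : ℂ)‖ ≤ (1 + 2 * M / P) / d * S := by
    rw [Complex.norm_real, Real.norm_eq_abs]; exact hcurv
  refine (norm_add_le _ _).trans ((add_le_add ((norm_add_le _ _).trans (add_le_add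
    ((norm_sub_le _ _).trans (add_le_add b1 b2)) b3)) b4).trans (le_of_eq ?_))
  ring

/-- `ω² - V_{ωml}` as a function of `r_*`. -/
def waveNumberSq (M a : ℝ) (m : ℤ) (ω lam : ℂ) (s : ℝ) : ℂ :=
  ω ^ 2 - radialPotential M a ω m lam (radius M a s)

theorem contDiff_waveNumberSq {M a : ℝ} (h : |a| < M) (m : ℤ) (ω lam : ℂ) :
    ContDiff ℝ (⊤ : ℕ∞) (waveNumberSq M a m ω lam) := by
  have hr := contDiff_radius h
  have hrc : ContDiff ℝ (⊤ : ℕ∞) fun s => (radius M a s : ℂ) := Complex.ofRealCLM.contDiff.comp hr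
  have hD : ContDiff ℝ (⊤ : ℕ∞) fun s => Del M a (radius M a s) := by
    unfold Del; fun_prop
  have hDc : ContDiff ℝ (⊤ : ℕ∞) fun s => (Del M a (radius M a s) : ℂ) :=
    Complex.ofRealCLM.contDiff.comp hD
  have hpos : ∀ s, radius M a s ^ 2 + a ^ 2 ≠ 0 := fun s => by
    have := radius_pos h s
    positivity
  have hposc : ∀ s, (radius M a s : ℂ) ^ 2 + (a : ℂ) ^ 2 ≠ 0 := fun s => by
    exact_mod_cast hpos s
  have h1 : ContDiff ℝ (⊤ : ℕ∞) fun s => (((radius M a s : ℂ) ^ 2 + (a : ℂ) ^ 2) ^ 2)⁻¹ :=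
    (((hrc.pow 2).add contDiff_const).pow 2).inv fun s => pow_ne_zero 2 (hposc s)
  have h2 : ContDiff ℝ (⊤ : ℕ∞) fun s => ((radius M a s ^ 2 + a ^ 2) ^ 4)⁻¹ :=
    (((hr.pow 2).add contDiff_const).pow 4).inv fun s => pow_ne_zero 4 (hpos s)
  have h3 : ContDiff ℝ (⊤ : ℕ∞) fun s => ((Del M a (radius M a s) *
      ((radius M a s ^ 2 + a ^ 2) ^ 4)⁻¹ * (a ^ 2 * Del M a (radius M a s) +
      2 * M * radius M a s * (radius M a s ^ 2 - a ^ 2)) : ℝ) : ℂ) :=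
    Complex.ofRealCLM.contDiff.comp ((hD.mul h2).mul ((contDiff_const.mul hD).add
      ((contDiff_const.mul hr).mul ((hr.pow 2).sub contDiff_const))))
  unfold waveNumberSq radialPotential
  simp only [div_eq_mul_inv]
  exact contDiff_const.sub ((ContDiff.mul (by fun_prop) h1).add h3)

theorem continuous_waveNumberSq {M a : ℝ} (h : |a| < M) (m : ℤ) {X : Type*} [TopologicalSpace X]
    {ω lam : X → ℂ} (hω : Continuous ω) (hlam : Continuous lam) :
    Continuous fun p : X × ℝ => waveNumberSq M a m (ω p.1) (lam p.1) p.2 := by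
  have hr : Continuous fun p : X × ℝ => radius M a p.2 := (continuous_radius h).comp continuous_snd
  have hD : Continuous fun p : X × ℝ => Del M a (radius M a p.2) := by unfold Del; fun_prop
  have hpos : ∀ s, radius M a s ^ 2 + a ^ 2 ≠ 0 := fun s => by
    have := radius_pos h s
    positivity
  have hposc : ∀ s, (radius M a s : ℂ) ^ 2 + (a : ℂ) ^ 2 ≠ 0 := fun s => by
    exact_mod_cast hpos s
  unfold waveNumberSq radialPotential
  refine Continuous.sub (by fun_prop) (Continuous.add (Continuous.div (by fun_prop) (by fun_prop)
    fun p => pow_ne_zero 2 (hposc _)) (Complex.continuous_ofReal.comp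
    (Continuous.mul (Continuous.div (by fun_prop) (by fun_prop) fun p => pow_ne_zero 4 (hpos _))
      (by fun_prop))))

theorem waveNumberSq_im {M a : ℝ} (m : ℤ) {ω lam : ℂ} (hω : ω.im = 0) (hlam : lam.im = 0) (s : ℝ) :
    (waveNumberSq M a m ω lam s).im = 0 := by
  have e1 : ω = (ω.re : ℂ) := Complex.ext rfl (by simp [hω])
  have e2 : lam = (lam.re : ℂ) := Complex.ext rfl (by simp [hlam])
  have : waveNumberSq M a m ω lam s = ((ω.re ^ 2 - ((4 * M * radius M a s * a * m * ω.re -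
      a ^ 2 * m ^ 2 + Del M a (radius M a s) * (lam.re + a ^ 2 * ω.re ^ 2)) /
      (radius M a s ^ 2 + a ^ 2) ^ 2 + Del M a (radius M a s) / (radius M a s ^ 2 + a ^ 2) ^ 4 *
      (a ^ 2 * Del M a (radius M a s) + 2 * M * radius M a s * (radius M a s ^ 2 - a ^ 2))) : ℝ) :
      ℂ) := by
    unfold waveNumberSq radialPotential
    rw [e1, e2]
    push_cast
    simp only [Complex.ofReal_re]
  rw [this, Complex.ofReal_im]

/-- The flux of a solution of an equation with real coefficient is constant. -/
theorem flux_eq_of_real {u u' q : ℝ → ℂ} (hu : ∀ s, HasDerivAt u (u' s) s)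
    (hu' : ∀ s, HasDerivAt u' (q s * u s) s) (hq : ∀ s, (q s).im = 0) (s t : ℝ) :
    flux u u' s = flux u u' t := by
  refine is_const_of_deriv_eq_zero (fun r => ?_) (fun r => ?_) s t
  all_goals
    have hd : HasDerivAt (flux u u') 0 r := by
      refine (((hasDerivAt_im (hu' r)).mul (hasDerivAt_re (hu r))).fun_sub
        ((hasDerivAt_re (hu' r)).mul (hasDerivAt_im (hu r)))).congr_deriv ?_
      simp [hq r]
      ring
  · exact hd.differentiableAt
  · exact hd.deriv

theorem flux_mul_exp (v v' : ℝ → ℂ) {κ e : ℂ} (s : ℝ) (hκ : κ.im = 0) (he : ‖e‖ = 1) :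
    flux (fun _ => e * v s) (fun _ => e * (Complex.I * κ * v s + v' s)) s =
      κ.re * sqAbs v s + flux v v' s := by
  have h1 : e.re ^ 2 + e.im ^ 2 = 1 := by
    have := Complex.sq_norm e
    rw [he, Complex.normSq_apply] at this
    linarith
  simp only [flux, sqAbs, Complex.mul_re, Complex.mul_im, Complex.add_re, Complex.add_im,
    Complex.I_re, Complex.I_im, hκ]
  linear_combination (κ.re * (v s).re ^ 2 + κ.re * (v s).im ^ 2 + (v' s).im * (v s).re -
    (v' s).re * (v s).im) * h1

/-- Solutions of `u'' = (U - κ²) u` that are outgoing at `+∞`, with a parameter. -/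
theorem exists_outgoing {X : Type*} [TopologicalSpace X] [FirstCountableTopology X] {κ : X → ℂ}
    (hκ : Continuous κ) (hκim : ∀ x, 0 ≤ (κ x).im) {κ₀ : ℝ} (hκ₀ : 0 < κ₀)
    (hκn : ∀ x, κ₀ ≤ ‖κ x‖) {U : X → ℝ → ℂ} (hU : Continuous fun p : X × ℝ => U p.1 p.2)
    {B : ℝ → ℝ} (hB : Continuous B) (hBi : ∀ s, IntegrableOn B (Ioi s))
    (hUB : ∀ x t, ‖U x t‖ ≤ B t) (hB0 : ∀ t, 0 ≤ B t) :
    ∃ u u' : X → ℝ → ℂ, (Continuous fun p : X × ℝ => u p.1 p.2) ∧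
      (Continuous fun p : X × ℝ => u' p.1 p.2) ∧
      (∀ x s, HasDerivAt (u x) (u' x s) s) ∧
      (∀ x s, HasDerivAt (u' x) ((U x s - κ x ^ 2) * u x s) s) ∧
      (∀ x, Tendsto (fun s : ℝ => Complex.exp (-(Complex.I * κ x * s)) *
        (u' x s - Complex.I * κ x * u x s)) atTop (𝓝 0)) ∧
      (∀ x, (κ x).im = 0 → (∀ s, ‖u x s‖ ≤ 2 * Real.exp (2 / κ₀ * ∫ t in Ioi s, B t) ∧
        ‖u' x s‖ ≤ (2 * ‖κ x‖ + κ₀) * Real.exp (2 / κ₀ * ∫ t in Ioi s, B t)) ∧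
        Tendsto (flux (u x) (u' x)) atTop (𝓝 (κ x).re)) := by
  obtain ⟨v, v', cv, cv', dv, dv', bv, bv', lv, lv'⟩ :=
    exists_jost hκ hκim hκ₀ hκn hU hB hBi hUB hB0
  have hexp : ∀ x (s : ℝ), HasDerivAt (fun s : ℝ => Complex.exp (Complex.I * κ x * s))
      (Complex.I * κ x * Complex.exp (Complex.I * κ x * s)) s := fun x s => hasDerivAt_cexp_mul _ s
  refine ⟨fun x s => Complex.exp (Complex.I * κ x * s) * v x s,
    fun x s => Complex.exp (Complex.I * κ x * s) * (Complex.I * κ x * v x s + v' x s),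
    by fun_prop, by fun_prop, fun x s => ?_, fun x s => ?_, fun x => ?_, fun x hx => ?_⟩
  · refine ((hexp x s).mul (dv x s)).congr_deriv ?_
    ring
  · refine ((hexp x s).mul (((dv x s).const_mul (Complex.I * κ x)).add (dv' x s))).congr_deriv ?_
    simp only [Pi.add_apply]
    linear_combination (Complex.exp (Complex.I * κ x * s) * κ x ^ 2 * v x s) * Complex.I_sq
  · refine (lv' x).congr fun s => ?_
    have : Complex.exp (-(Complex.I * κ x * s)) * Complex.exp (Complex.I * κ x * s) = 1 := by
      rw [← Complex.exp_add]; simp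
    linear_combination (-(v' x s)) * this
  · have hn : ∀ s : ℝ, ‖Complex.exp (Complex.I * κ x * s)‖ = 1 := fun s => by
      rw [Complex.norm_exp]; simp [hx]
    refine ⟨fun s => ⟨?_, ?_⟩, ?_⟩
    · rw [norm_mul, hn, one_mul]; exact bv x s
    · rw [norm_mul, hn, one_mul]
      refine (norm_add_le _ _).trans ?_
      rw [norm_mul, norm_mul, Complex.norm_I, one_mul, add_mul]
      refine add_le_add ?_ (bv' x s)
      calc ‖κ x‖ * ‖v x s‖ ≤ ‖κ x‖ * (2 * Real.exp (2 / κ₀ * ∫ t in Ioi s, B t)) := by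
            gcongr; exact bv x s
        _ = _ := by ring
    · have e : flux (fun s : ℝ => Complex.exp (Complex.I * κ x * s) * v x s)
          (fun s : ℝ => Complex.exp (Complex.I * κ x * s) * (Complex.I * κ x * v x s + v' x s)) =
          fun s => (κ x).re * sqAbs (v x) s + flux (v x) (v' x) s := by
        funext s
        exact flux_mul_exp (v x) (v' x) s hx (hn s)
      have l1 := (Complex.continuous_re.tendsto _).comp (lv x)
      have l2 := (Complex.continuous_im.tendsto _).comp (lv x)
      have l3 := (Complex.continuous_re.tendsto _).comp (lv' x)
      have l4 := (Complex.continuous_im.tendsto _).comp (lv' x)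
      have l5 := (((l1.pow 2).add (l2.pow 2)).const_mul (κ x).re).add ((l4.mul l1).sub (l3.mul l2))
      simp only [Complex.one_re, Complex.one_im, Complex.zero_re, Complex.zero_im] at l5
      rw [show (κ x).re * (1 ^ 2 + 0 ^ 2) + (0 * 1 - 0 * 0) = (κ x).re by ring] at l5
      rw [e]
      refine l5.congr fun s => ?_
      simp only [Function.comp_apply, sqAbs, flux]

/-! ### Outgoing solutions for the plateau potential -/

/-- A smooth step that vanishes for `s ≤ α - 1` and equals `1` for `s ≥ α`. -/
def edgeL (α s : ℝ) : ℝ := Real.smoothTransition (s - (α - 1))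

/-- A smooth step that equals `1` for `s ≤ β` and vanishes for `s ≥ β + 1`. -/
def edgeR (β s : ℝ) : ℝ := Real.smoothTransition (β + 1 - s)

theorem contDiff_edgeL (α : ℝ) : ContDiff ℝ (⊤ : ℕ∞) (edgeL α) :=
  smooth_smoothTransition.comp (contDiff_id.sub contDiff_const)

theorem contDiff_edgeR (β : ℝ) : ContDiff ℝ (⊤ : ℕ∞) (edgeR β) :=
  smooth_smoothTransition.comp (contDiff_const.sub contDiff_id)

theorem edgeL_mem (α s : ℝ) : 0 ≤ edgeL α s ∧ edgeL α s ≤ 1 :=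
  ⟨Real.smoothTransition.nonneg _, Real.smoothTransition.le_one _⟩

theorem edgeR_mem (β s : ℝ) : 0 ≤ edgeR β s ∧ edgeR β s ≤ 1 :=
  ⟨Real.smoothTransition.nonneg _, Real.smoothTransition.le_one _⟩

theorem edgeL_eq_zero {α s : ℝ} (hs : s ≤ α - 1) : edgeL α s = 0 :=
  Real.smoothTransition.zero_of_nonpos (by linarith)

theorem edgeL_eq_one {α s : ℝ} (hs : α ≤ s) : edgeL α s = 1 :=
  Real.smoothTransition.one_of_one_le (by linarith)

theorem edgeR_eq_zero {β s : ℝ} (hs : β + 1 ≤ s) : edgeR β s = 0 :=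
  Real.smoothTransition.zero_of_nonpos (by linarith)

theorem edgeR_eq_one {β s : ℝ} (hs : s ≤ β) : edgeR β s = 1 :=
  Real.smoothTransition.one_of_one_le (by linarith)

/-- Grönwall's inequality for the energy `|u'|² + ω² |u|²`. -/
theorem energy_le {u u' q : ℝ → ℂ} {b : ℝ → ℝ} {w s₁ s₂ : ℝ} (hw : 0 < w) (hs : s₁ ≤ s₂)
    (hu : ∀ s, HasDerivAt u (u' s) s) (hu' : ∀ s, HasDerivAt u' (q s * u s) s)
    (hb : Continuous b) (hq : ∀ s, s₁ ≤ s → ‖q s + w ^ 2‖ ≤ b s) :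
    sqAbs u' s₂ + w ^ 2 * sqAbs u s₂ ≤
      (sqAbs u' s₁ + w ^ 2 * sqAbs u s₁) * Real.exp (∫ t in s₁..s₂, b t / w) := by
  set e : ℝ → ℝ := fun s => sqAbs u' s + w ^ 2 * sqAbs u s with he
  have hed : ∀ s, HasDerivAt e (2 * ((q s + w ^ 2) * u s * (starRingEnd ℂ) (u' s)).re) s := by
    intro s
    refine ((hasDerivAt_sqAbs (u' := fun s => q s * u s) (hu' s)).fun_add
      ((hasDerivAt_sqAbs (hu s)).const_mul (w ^ 2))).congr_deriv ?_
    simp [growth, pow_two]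
    ring
  have hebd : ∀ s, s₁ ≤ s → 2 * ((q s + w ^ 2) * u s * (starRingEnd ℂ) (u' s)).re ≤
      b s / w * e s := by
    intro s h1
    have h2 : ((q s + w ^ 2) * u s * (starRingEnd ℂ) (u' s)).re ≤ b s * ‖u s‖ * ‖u' s‖ := by
      refine (Complex.re_le_norm _).trans ?_
      rw [norm_mul, norm_mul, RCLike.norm_conj]
      gcongr
      exact hq s h1
    have hb0 : 0 ≤ b s := (norm_nonneg _).trans (hq s h1)
    have h3 : 2 * (w * ‖u s‖) * ‖u' s‖ ≤ e s := by
      simp only [he, sqAbs_eq_norm]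
      nlinarith [sq_nonneg (w * ‖u s‖ - ‖u' s‖)]
    have h4 : 2 * (b s * ‖u s‖ * ‖u' s‖) = b s / w * (2 * (w * ‖u s‖) * ‖u' s‖) := by
      field_simp
    have h5 : b s / w * (2 * (w * ‖u s‖) * ‖u' s‖) ≤ b s / w * e s := by gcongr
    linarith
  have hbc : Continuous fun t => b t / w := hb.div_const w
  set I : ℝ → ℝ := fun s => ∫ t in s₁..s, b t / w with hI
  have hId : ∀ s, HasDerivAt I (b s / w) s := fun s =>
    intervalIntegral.integral_hasDerivAt_right (hbc.intervalIntegrable _ _)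
      (hbc.stronglyMeasurableAtFilter _ _) hbc.continuousAt
  have hfd : ∀ s, HasDerivAt (fun s => e s * Real.exp (-I s))
      ((2 * ((q s + w ^ 2) * u s * (starRingEnd ℂ) (u' s)).re - b s / w * e s) *
        Real.exp (-I s)) s := fun s => by
    refine ((hed s).mul (hId s).fun_neg.exp).congr_deriv ?_
    ring
  have hanti : AntitoneOn (fun s => e s * Real.exp (-I s)) (Icc s₁ s₂) := by
    refine antitoneOn_of_deriv_nonpos (convex_Icc _ _)
      (fun s _ => (hfd s).continuousAt.continuousWithinAt)
      (fun s _ => (hfd s).differentiableAt.differentiableWithinAt) fun s h1 => ?_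
    rw [(hfd s).deriv]
    refine mul_nonpos_of_nonpos_of_nonneg ?_ (Real.exp_pos _).le
    rw [sub_nonpos]
    exact hebd s (interior_subset h1).1
  have := hanti (left_mem_Icc.2 hs) (right_mem_Icc.2 hs) hs
  have hI0 : I s₁ = 0 := intervalIntegral.integral_same
  simp only [hI0, neg_zero, Real.exp_zero, mul_one] at this
  calc e s₂ = e s₂ * Real.exp (-I s₂) * Real.exp (I s₂) := by
        rw [mul_assoc, ← Real.exp_add]; simp
    _ ≤ e s₁ * Real.exp (I s₂) := by gcongr

theorem integrableOn_Ioi_of_tail {f : ℝ → ℝ} (hf : Continuous f) {s₁ : ℝ}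
    (h : IntegrableOn f (Ioi s₁)) (s : ℝ) : IntegrableOn f (Ioi s) := by
  refine ((hf.integrableOn_Icc (a := s) (b := s₁)).union h).mono_set fun t ht => ?_
  rcases le_or_gt t s₁ with h1 | h1
  · exact Or.inl ⟨le_of_lt ht, h1⟩
  · exact Or.inr h1

theorem continuous_radius_inv_sq {M a : ℝ} (h : |a| < M) :
    Continuous fun s => (radius M a s ^ 2)⁻¹ :=
  ((continuous_radius h).pow 2).inv₀ fun s => pow_ne_zero 2 (radius_pos h s).ne'

theorem four_mul_gt_rPlus {M a : ℝ} (h : |a| < M) : rPlus M a < 4 * M := by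
  have hM : 0 < M := lt_of_le_of_lt (abs_nonneg a) h
  have : √(M ^ 2 - a ^ 2) ≤ M := by
    rw [Real.sqrt_le_left hM.le]
    nlinarith [sq_nonneg a]
  unfold rPlus
  linarith

/-- The three bounds on `ω² - V_{ωml}`, uniform for bounded `ω` and `lam`: towards infinity, towards the
horizon, and global. -/
theorem exists_norm_waveNumberSq_le {M a : ℝ} (h : |a| < M) (m : ℤ) (A : ℝ) (hA : 0 ≤ A) :
    ∃ C₁ C₂ C₃ : ℝ, 0 ≤ C₁ ∧ 0 ≤ C₂ ∧ 0 ≤ C₃ ∧ ∀ (ω lam : ℂ), ‖ω‖ ≤ A → ‖lam‖ ≤ A → ∀ s,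
      ‖waveNumberSq M a m ω lam s - ω ^ 2‖ ≤ C₁ * (radius M a s ^ 2)⁻¹ ∧
      ‖waveNumberSq M a m ω lam s - horizonFreq M a m ω ^ 2‖ ≤
        C₂ * radialSpeed M a (radius M a s) ∧
      ‖waveNumberSq M a m ω lam s‖ ≤ C₃ := by
  obtain ⟨C₁, hC₁, h1⟩ := exists_norm_radialPotential_le h m A hA
  obtain ⟨C₂, hC₂, h2⟩ := exists_norm_radialPotential_horizon_le h m A hA
  have hp := rPlus_pos h
  refine ⟨C₁, C₂, A ^ 2 + C₁ * (rPlus M a ^ 2)⁻¹, hC₁, hC₂, by positivity, ?_⟩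
  intro ω lam hω hlam s
  have hr := rPlus_lt_radius h s
  have b1 := h1 ω lam hω hlam _ hr
  refine ⟨?_, ?_, ?_⟩
  · rw [waveNumberSq, sub_sub_cancel_left, norm_neg]; exact b1
  · rw [waveNumberSq, ← norm_neg]
    refine (le_of_eq (congrArg norm ?_)).trans (h2 ω lam hω hlam _ hr)
    ring
  · unfold waveNumberSq
    refine (norm_sub_le _ _).trans (add_le_add ?_ (b1.trans ?_))
    · rw [norm_pow]; gcongr
    · gcongr

theorem integral_edgeL_le {M a : ℝ} (h : |a| < M) {s₁ α : ℝ} (hαs : s₁ ≤ α - 1)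
    (hs₁ : 4 * M ≤ radius M a s₁) {C₁ C₃ : ℝ} (hC₁ : 0 ≤ C₁) (hC₃ : 0 ≤ C₃) :
    ∫ t in s₁..α, (C₁ * (radius M a t ^ 2)⁻¹ + C₃ * edgeL α t) ≤
      C₁ * (2 * (radius M a s₁)⁻¹) + C₃ := by
  have cE : Continuous (edgeL α) := (contDiff_edgeL α).continuous
  have i1 : ∫ t in s₁..α, (radius M a t ^ 2)⁻¹ ≤ 2 * (radius M a s₁)⁻¹ := by
    obtain ⟨k1, k2⟩ := integral_radius_inv_sq h hs₁
    rw [intervalIntegral.integral_of_le (by linarith)]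
    refine (setIntegral_mono_set k1 (Eventually.of_forall fun t => ?_)
      (Eventually.of_forall fun t ht => ht.1)).trans k2
    simp only [Pi.zero_apply]
    positivity
  have i2 : ∫ t in s₁..α, edgeL α t ≤ 1 := by
    rw [← intervalIntegral.integral_add_adjacent_intervals
      (cE.intervalIntegrable s₁ (α - 1)) (cE.intervalIntegrable (α - 1) α)]
    have z : ∫ t in s₁..(α - 1), edgeL α t = 0 := by
      refine intervalIntegral.integral_zero_ae (Eventually.of_forall fun t ht => ?_)
      rw [uIoc_of_le hαs] at ht
      exact edgeL_eq_zero ht.2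
    have o := intervalIntegral.integral_mono_on (by linarith : α - 1 ≤ α)
      (μ := volume) (cE.intervalIntegrable (α - 1) α)
      (continuous_const.intervalIntegrable (α - 1) α) (g := fun _ => (1:ℝ)) (fun t _ => (edgeL_mem α t).2)
    rw [intervalIntegral.integral_const] at o
    rw [z]
    simp only [smul_eq_mul, mul_one] at o
    linarith
  have i3 : ∫ t in s₁..α, (C₁ * (radius M a t ^ 2)⁻¹ + C₃ * edgeL α t) =
      C₁ * (∫ t in s₁..α, (radius M a t ^ 2)⁻¹) + C₃ * ∫ t in s₁..α, edgeL α t := by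
    rw [← intervalIntegral.integral_const_mul, ← intervalIntegral.integral_const_mul,
      ← intervalIntegral.integral_add]
    · exact ((continuous_radius_inv_sq h).const_mul C₁).intervalIntegrable _ _
    · exact (cE.const_mul C₃).intervalIntegrable _ _
  rw [i3]
  have := mul_le_mul_of_nonneg_left i1 hC₁
  have := mul_le_mul_of_nonneg_left i2 hC₃
  linarith

set_option maxHeartbeats 1000000 in
/-- Solutions that are outgoing at the horizon, for the potential with the left edge `edgeL`, with
bounds at `α` that do not depend on `α`. -/
theorem exists_horizon_family {M a : ℝ} (h : |a| < M) (m : ℤ) {A κ₀ : ℝ} (hA : 0 ≤ A)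
    (hκ₀ : 0 < κ₀) : ∃ K : ℝ, ∀ α : ℝ, 4 * M ≤ radius M a (α - 1) →
      ∀ {X : Type} [TopologicalSpace X] [FirstCountableTopology X] {ω lam : X → ℂ},
      Continuous ω → Continuous lam → (∀ x, ‖ω x‖ ≤ A) → (∀ x, ‖lam x‖ ≤ A) →
      (∀ x, 0 ≤ (ω x).im) → (∀ x, κ₀ ≤ ‖ω x‖) → (∀ x, κ₀ ≤ ‖horizonFreq M a m (ω x)‖) →
      ∃ u u' : X → ℝ → ℂ, (Continuous fun p : X × ℝ => u p.1 p.2) ∧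
        (Continuous fun p : X × ℝ => u' p.1 p.2) ∧
        (∀ x s, HasDerivAt (u x) (u' x s) s) ∧
        (∀ x s, HasDerivAt (u' x) ((edgeL α s * (waveNumberSq M a m (ω x) (lam x) s).re -
          waveNumberSq M a m (ω x) (lam x) s) * u x s) s) ∧
        (∀ x, Tendsto (fun s : ℝ => Complex.exp (Complex.I * horizonFreq M a m (ω x) * s) *
          (u' x s + Complex.I * horizonFreq M a m (ω x) * u x s)) atBot (𝓝 0)) ∧
        ∀ x, (ω x).im = 0 → (lam x).im = 0 → ‖u x α‖ ≤ K ∧ ‖u' x α‖ ≤ K ∧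
          ∀ s, flux (u x) (u' x) s = -(horizonFreq M a m (ω x)).re := by
  have hM : 0 < M := lt_of_le_of_lt (abs_nonneg a) h
  obtain ⟨C₁, C₂, C₃, hC₁, hC₂, hC₃, hbd⟩ := exists_norm_waveNumberSq_le h m A hA
  set S : ℝ → ℝ := fun s => radialSpeed M a (radius M a s) with hS
  have hScont : Continuous S := by
    have hr := continuous_radius h
    have hD : Continuous fun s => Del M a (radius M a s) := by unfold Del; fun_prop
    refine hD.div (by fun_prop) fun s => ?_
    have := radius_pos h s
    positivity
  have hS0 : ∀ s, 0 ≤ S s := fun s => (radialSpeed_pos h (rPlus_lt_radius h s)).le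
  set B : ℝ → ℝ := fun t => (C₂ + 2 * C₃) * S (-t) with hB
  have hBcont : Continuous B := (hScont.comp continuous_neg).const_mul _
  have hBint : ∀ s, IntegrableOn B (Ioi s) := fun s =>
    (integrableOn_radialSpeed_neg h s).const_mul _
  have hB0 : ∀ t, 0 ≤ B t := fun t => mul_nonneg (by positivity) (hS0 _)
  set s₁ := rStar M a (4 * M) with hs₁
  have hrs₁ : radius M a s₁ = 4 * M := radius_rStar h (four_mul_gt_rPlus h)
  set J := Real.exp (2 / κ₀ * ∫ t in Ioi (-s₁), B t) with hJ
  have hJ0 : 0 < J := Real.exp_pos _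
  set k := |a * m / (2 * M * rPlus M a)| with hk
  set D := (C₁ * (2 * (4 * M)⁻¹) + C₃) / κ₀ with hD
  set E := (((2 * (A + k) + κ₀) * J) ^ 2 + A ^ 2 * (2 * J) ^ 2) * Real.exp D with hE
  have hE0 : 0 ≤ E := by positivity
  refine ⟨max (E + 1) (E / κ₀ ^ 2 + 1), ?_⟩
  intro α hα X _ _ ω lam cω clam bω blam hωim hωκ hκκ
  set κ : X → ℂ := fun x => horizonFreq M a m (ω x) with hκdef
  have cκ : Continuous κ := cω.sub continuous_const
  have hκim : ∀ x, (κ x).im = (ω x).im := fun x => by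
    simp only [hκdef, horizonFreq, Complex.sub_im, Complex.ofReal_im, sub_zero]
  have cW : Continuous fun p : X × ℝ => waveNumberSq M a m (ω p.1) (lam p.1) p.2 :=
    continuous_waveNumberSq h m cω clam
  have cW' : Continuous fun p : X × ℝ => waveNumberSq M a m (ω p.1) (lam p.1) (-p.2) :=
    cW.comp (continuous_fst.prodMk continuous_snd.neg)
  have cE : Continuous (edgeL α) := (contDiff_edgeL α).continuous
  set q : X → ℝ → ℂ := fun x s => edgeL α s * (waveNumberSq M a m (ω x) (lam x) s).re -
    waveNumberSq M a m (ω x) (lam x) s with hq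
  have hαs : s₁ ≤ α - 1 := by
    refine (strictMono_radius h).le_iff_le.1 ?_
    rwa [hrs₁]
  have hedge : ∀ x s, ‖((edgeL α s * (waveNumberSq M a m (ω x) (lam x) s).re : ℝ) : ℂ)‖ ≤
      C₃ * edgeL α s := by
    intro x s
    rw [Complex.norm_real, Real.norm_eq_abs, abs_mul, abs_of_nonneg (edgeL_mem α s).1, mul_comm]
    exact mul_le_mul_of_nonneg_right ((Complex.abs_re_le_norm _).trans
      (hbd _ _ (bω x) (blam x) s).2.2) (edgeL_mem α s).1
  have hedge2 : ∀ s, edgeL α s ≤ 2 * S s := by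
    intro s
    rcases le_or_gt s (α - 1) with h1 | h1
    · rw [edgeL_eq_zero h1]; linarith [hS0 s]
    · have := half_le_radialSpeed h (hα.trans ((strictMono_radius h).monotone h1.le))
      have h2 := (edgeL_mem α s).2
      simp only [hS]
      linarith
  obtain ⟨f, f', cf, cf', df, df', lf, bf⟩ := exists_outgoing (κ := κ) cκ
    (fun x => by rw [hκim]; exact hωim x) hκ₀ hκκ (U := fun x t => q x (-t) + κ x ^ 2)
    (by
      have ce : Continuous fun p : X × ℝ => edgeL α (-p.2) := cE.comp continuous_snd.neg
      exact (((Complex.continuous_ofReal.comp ce).mul (Complex.continuous_ofReal.comp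
        (Complex.continuous_re.comp cW'))).sub cW').add ((cκ.comp continuous_fst).pow 2)) hBcont hBint
    (fun x t => by
      have h1 := (hbd _ _ (bω x) (blam x) (-t)).2.1
      have h2 := hedge x (-t)
      have h3 := mul_le_mul_of_nonneg_left (hedge2 (-t)) hC₃
      have e : q x (-t) + κ x ^ 2 =
          ((edgeL α (-t) * (waveNumberSq M a m (ω x) (lam x) (-t)).re : ℝ) : ℂ) -
          (waveNumberSq M a m (ω x) (lam x) (-t) - κ x ^ 2) := by
        simp only [hq]; push_cast; ring
      rw [e]
      refine (norm_sub_le _ _).trans ?_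
      simp only [hB]
      linarith) hB0
  refine ⟨fun x s => f x (-s), fun x s => -f' x (-s),
    cf.comp (continuous_fst.prodMk continuous_snd.neg),
    (cf'.comp (continuous_fst.prodMk continuous_snd.neg)).neg, ?_, ?_, ?_, ?_⟩
  · intro x s
    exact ((df x (-s)).scomp s (hasDerivAt_neg s)).congr_deriv (by simp)
  · intro x s
    refine ((df' x (-s)).scomp s (hasDerivAt_neg s)).fun_neg.congr_deriv ?_
    simp only [neg_neg, add_sub_cancel_right, neg_one_smul]
    rfl
  · intro x
    have := ((lf x).comp tendsto_neg_atBot_atTop).neg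
    rw [neg_zero] at this
    refine this.congr fun s => ?_
    simp only [Function.comp_apply, Complex.ofReal_neg, mul_neg, neg_neg]
    ring
  · intro x hx hlx
    have du : ∀ s, HasDerivAt (fun s => f x (-s)) (-f' x (-s)) s := fun s =>
      ((df x (-s)).scomp s (hasDerivAt_neg s)).congr_deriv (by simp)
    have du' : ∀ s, HasDerivAt (fun s => -f' x (-s)) (q x s * f x (-s)) s := fun s => by
      refine ((df' x (-s)).scomp s (hasDerivAt_neg s)).fun_neg.congr_deriv ?_
      simp only [neg_neg, add_sub_cancel_right, neg_one_smul]
    have hxκ : (κ x).im = 0 := by rw [hκim, hx]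
    obtain ⟨bnd, lflux⟩ := bf x hxκ
    -- From `s₁`, where `r = 4 M`, to `α` the coefficient differs from `-ω²` by an integrable amount, and
    -- the edge contributes at most `C₃`, so that the growth of the energy does not depend on `α`.
    set w := |(ω x).re| with hw
    have hωre : ω x = ((ω x).re : ℂ) := Complex.ext rfl (by simp [hx])
    have hwn : ‖ω x‖ = w :=
      (congrArg norm hωre).trans (by rw [Complex.norm_real, Real.norm_eq_abs])
    have hw0 : κ₀ ≤ w := by rw [← hwn]; exact hωκ x
    have hwpos : 0 < w := hκ₀.trans_le hw0
    have hwA : w ≤ A := by rw [← hwn]; exact bω x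
    have hw2 : ((w : ℝ) : ℂ) ^ 2 = ω x ^ 2 := by
      rw [hw, ← Complex.ofReal_pow, sq_abs, Complex.ofReal_pow, ← hωre]
    set b : ℝ → ℝ := fun s => C₁ * (radius M a s ^ 2)⁻¹ + C₃ * edgeL α s with hb
    have cb : Continuous b := ((continuous_radius_inv_sq h).const_mul C₁).add (cE.const_mul C₃)
    have hen := energy_le (u := fun s => f x (-s)) (u' := fun s => -f' x (-s)) (q := q x) (b := b)
      hwpos (by linarith : s₁ ≤ α) du du' cb (fun s _ => by
        have h1 := (hbd _ _ (bω x) (blam x) s).1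
        have h2 := hedge x s
        have e : q x s + (w : ℂ) ^ 2 =
            ((edgeL α s * (waveNumberSq M a m (ω x) (lam x) s).re : ℝ) : ℂ) -
            (waveNumberSq M a m (ω x) (lam x) s - ω x ^ 2) := by
          simp only [hq, hw2]; push_cast; ring
        rw [e]
        refine (norm_sub_le _ _).trans ?_
        simp only [hb]
        linarith)
    have hint : ∫ t in s₁..α, b t / w ≤ D := by
      rw [intervalIntegral.integral_div, hD]
      have := integral_edgeL_le h hαs (le_of_eq hrs₁.symm) hC₁ hC₃
      rw [hrs₁] at this
      exact div_le_div₀ (by positivity) this hκ₀ hw0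
    have hκn : ‖κ x‖ ≤ A + k := by
      refine (norm_sub_le _ _).trans (add_le_add (bω x) ?_)
      rw [Complex.norm_real, Real.norm_eq_abs]
    have hE' : sqAbs (fun s => -f' x (-s)) α + w ^ 2 * sqAbs (fun s => f x (-s)) α ≤ E := by
      refine hen.trans ?_
      rw [hE]
      obtain ⟨n1, n2⟩ := bnd (-s₁)
      have n3 : sqAbs (fun s => -f' x (-s)) s₁ ≤ ((2 * (A + k) + κ₀) * J) ^ 2 := by
        rw [sqAbs_eq_norm, norm_neg]
        have : (2 * ‖κ x‖ + κ₀) * J ≤ (2 * (A + k) + κ₀) * J := by gcongr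
        exact pow_le_pow_left₀ (norm_nonneg _) (n2.trans this) 2
      have n4 : w ^ 2 * sqAbs (fun s => f x (-s)) s₁ ≤ A ^ 2 * (2 * J) ^ 2 := by
        rw [sqAbs_eq_norm]
        exact mul_le_mul (pow_le_pow_left₀ hwpos.le hwA 2)
          (pow_le_pow_left₀ (norm_nonneg _) n1 2) (by positivity) (by positivity)
      exact mul_le_mul (add_le_add n3 n4) (Real.exp_le_exp.2 hint) (Real.exp_pos _).le (by positivity)
    have hsq : ∀ t y : ℝ, t ^ 2 ≤ y → t ≤ y + 1 := fun t y ht => by nlinarith [sq_nonneg (t - 1)]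
    have s1 : 0 ≤ sqAbs (fun s => -f' x (-s)) α := by unfold sqAbs; positivity
    have s2 : 0 ≤ sqAbs (fun s => f x (-s)) α := by unfold sqAbs; positivity
    refine ⟨(hsq _ _ ?_).trans (le_max_right _ _), (hsq _ _ ?_).trans (le_max_left _ _), ?_⟩
    · rw [le_div_iff₀ (by positivity), ← sqAbs_eq_norm (fun s => f x (-s))]
      have h1 : κ₀ ^ 2 ≤ w ^ 2 := by gcongr
      have h2 := mul_le_mul_of_nonneg_right h1 s2
      rw [mul_comm]
      linarith
    · rw [← sqAbs_eq_norm (fun s => -f' x (-s))]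
      have : 0 ≤ w ^ 2 * sqAbs (fun s => f x (-s)) α := by positivity
      linarith
    · intro s
      have hqim : ∀ s, (q x s).im = 0 := fun s => by
        simp [hq, waveNumberSq_im m hx hlx s]
      have hconst := fun t => flux_eq_of_real du du' hqim t s
      have hlim : Tendsto (flux (fun s => f x (-s)) (fun s => -f' x (-s))) atBot
          (𝓝 (-(κ x).re)) := by
        refine (lflux.comp tendsto_neg_atBot_atTop).neg.congr fun t => ?_
        simp only [Function.comp_apply, flux, Complex.neg_im, Complex.neg_re]
        ring
      exact tendsto_nhds_unique (tendsto_const_nhds.congr fun t => (hconst t).symm) hlim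

/-- Solutions that are outgoing at infinity, for the potential with the right edge `edgeR`, with
bounds at `β` that do not depend on `β`. -/
theorem exists_infinity_family {M a : ℝ} (h : |a| < M) (m : ℤ) {A κ₀ : ℝ} (hA : 0 ≤ A)
    (hκ₀ : 0 < κ₀) : ∃ K : ℝ, ∀ β : ℝ, 4 * M ≤ radius M a β →
      ∀ {X : Type} [TopologicalSpace X] [FirstCountableTopology X] {ω lam : X → ℂ},
      Continuous ω → Continuous lam → (∀ x, ‖ω x‖ ≤ A) → (∀ x, ‖lam x‖ ≤ A) →
      (∀ x, 0 ≤ (ω x).im) → (∀ x, κ₀ ≤ ‖ω x‖) →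
      ∃ u u' : X → ℝ → ℂ, (Continuous fun p : X × ℝ => u p.1 p.2) ∧
        (Continuous fun p : X × ℝ => u' p.1 p.2) ∧
        (∀ x s, HasDerivAt (u x) (u' x s) s) ∧
        (∀ x s, HasDerivAt (u' x) ((edgeR β s * (waveNumberSq M a m (ω x) (lam x) s).re -
          waveNumberSq M a m (ω x) (lam x) s) * u x s) s) ∧
        (∀ x, Tendsto (fun s : ℝ => Complex.exp (-(Complex.I * ω x * s)) *
          (u' x s - Complex.I * ω x * u x s)) atTop (𝓝 0)) ∧
        ∀ x, (ω x).im = 0 → (lam x).im = 0 → ‖u x β‖ ≤ K ∧ ‖u' x β‖ ≤ K ∧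
          ∀ s, flux (u x) (u' x) s = (ω x).re := by
  have hM : 0 < M := lt_of_le_of_lt (abs_nonneg a) h
  obtain ⟨C₁, C₂, C₃, hC₁, hC₂, hC₃, hbd⟩ := exists_norm_waveNumberSq_le h m A hA
  set J := Real.exp (2 / κ₀ * (C₁ * (2 * (4 * M)⁻¹) + C₃)) with hJ
  have hJ0 : 0 < J := Real.exp_pos _
  refine ⟨max (2 * J) ((2 * A + κ₀) * J), ?_⟩
  intro β hβ X _ _ ω lam cω clam bω blam hωim hωκ
  have cW : Continuous fun p : X × ℝ => waveNumberSq M a m (ω p.1) (lam p.1) p.2 :=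
    continuous_waveNumberSq h m cω clam
  have cE : Continuous (edgeR β) := (contDiff_edgeR β).continuous
  set q : X → ℝ → ℂ := fun x s => edgeR β s * (waveNumberSq M a m (ω x) (lam x) s).re -
    waveNumberSq M a m (ω x) (lam x) s with hq
  have hedge : ∀ x s, ‖((edgeR β s * (waveNumberSq M a m (ω x) (lam x) s).re : ℝ) : ℂ)‖ ≤
      C₃ * edgeR β s := by
    intro x s
    rw [Complex.norm_real, Real.norm_eq_abs, abs_mul, abs_of_nonneg (edgeR_mem β s).1, mul_comm]
    exact mul_le_mul_of_nonneg_right ((Complex.abs_re_le_norm _).trans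
      (hbd _ _ (bω x) (blam x) s).2.2) (edgeR_mem β s).1
  obtain ⟨k1, k2⟩ := integral_radius_inv_sq h hβ
  have eint : IntegrableOn (edgeR β) (Ioi β) := by
    refine integrableOn_Ioi_of_tail cE (s₁ := β + 1) ?_ β
    refine integrableOn_zero.congr_fun (fun t ht => ?_) measurableSet_Ioi
    exact (edgeR_eq_zero (le_of_lt ht)).symm
  have eint1 : ∫ t in Ioi β, edgeR β t ≤ 1 := by
    have e : ∫ t in Ioi β, edgeR β t = ∫ t in Ioc β (β + 1), edgeR β t := by
      refine setIntegral_eq_of_subset_of_forall_sdiff_eq_zero measurableSet_Ioi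
        (fun t ht => ht.1) fun t ht => ?_
      refine edgeR_eq_zero ?_
      by_contra! hh
      exact ht.2 ⟨ht.1, hh.le⟩
    rw [e, ← intervalIntegral.integral_of_le (by linarith)]
    have o := intervalIntegral.integral_mono_on (by linarith : β ≤ β + 1)
      (μ := volume) (cE.intervalIntegrable β (β + 1))
      (continuous_const.intervalIntegrable β (β + 1)) (g := fun _ => (1:ℝ)) (fun t _ => (edgeR_mem β t).2)
    rw [intervalIntegral.integral_const] at o
    simpa using o
  set B : ℝ → ℝ := fun t => C₁ * (radius M a t ^ 2)⁻¹ + C₃ * edgeR β t with hB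
  have hBcont : Continuous B := ((continuous_radius_inv_sq h).const_mul C₁).add (cE.const_mul C₃)
  have hBint : IntegrableOn B (Ioi β) := (k1.const_mul C₁).add (eint.const_mul C₃)
  have hBle : ∫ t in Ioi β, B t ≤ C₁ * (2 * (4 * M)⁻¹) + C₃ := by
    have e : ∫ t in Ioi β, B t = C₁ * (∫ t in Ioi β, (radius M a t ^ 2)⁻¹) +
        C₃ * ∫ t in Ioi β, edgeR β t := by
      rw [← integral_const_mul, ← integral_const_mul]
      exact integral_add (k1.const_mul C₁) (eint.const_mul C₃)
    rw [e]
    have h1 : ∫ t in Ioi β, (radius M a t ^ 2)⁻¹ ≤ 2 * (4 * M)⁻¹ := k2.trans (by gcongr)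
    have := mul_le_mul_of_nonneg_left h1 hC₁
    have := mul_le_mul_of_nonneg_left eint1 hC₃
    linarith
  have hB0 : ∀ t, 0 ≤ B t := fun t => by
    have := (edgeR_mem β t).1
    simp only [hB]
    positivity
  obtain ⟨f, f', cf, cf', df, df', lf, bf⟩ := exists_outgoing (κ := ω) cω hωim hκ₀ hωκ
    (U := fun x t => q x t + ω x ^ 2)
    (by
      have ce : Continuous fun p : X × ℝ => edgeR β p.2 := cE.comp continuous_snd
      exact (((Complex.continuous_ofReal.comp ce).mul (Complex.continuous_ofReal.comp
        (Complex.continuous_re.comp cW))).sub cW).add ((cω.comp continuous_fst).pow 2))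
    hBcont (integrableOn_Ioi_of_tail hBcont hBint)
    (fun x t => by
      have h1 := (hbd _ _ (bω x) (blam x) t).1
      have h2 := hedge x t
      have e : q x t + ω x ^ 2 =
          ((edgeR β t * (waveNumberSq M a m (ω x) (lam x) t).re : ℝ) : ℂ) -
          (waveNumberSq M a m (ω x) (lam x) t - ω x ^ 2) := by
        simp only [hq]; push_cast; ring
      rw [e]
      refine (norm_sub_le _ _).trans ?_
      simp only [hB]
      linarith) hB0
  simp only [add_sub_cancel_right] at df'
  refine ⟨f, f', cf, cf', df, df', lf, fun x hx hlx => ?_⟩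
  obtain ⟨bnd, lflux⟩ := bf x hx
  obtain ⟨n1, n2⟩ := bnd β
  have hexp : Real.exp (2 / κ₀ * ∫ t in Ioi β, B t) ≤ J := by
    rw [hJ]
    gcongr
  refine ⟨(n1.trans ?_).trans (le_max_left _ _), (n2.trans ?_).trans (le_max_right _ _), fun s => ?_⟩
  · gcongr
  · have := bω x
    gcongr
  · have hqim : ∀ s, (q x s).im = 0 := fun s => by
      simp [hq, waveNumberSq_im m hx hlx s]
    have hconst := fun t => flux_eq_of_real (df x) (df' x) hqim t s
    exact tendsto_nhds_unique (tendsto_const_nhds.congr fun t => (hconst t).symm) lflux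

/-! ### The potential and the mode -/

/-- A potential of the tortoise coordinate `r_*`, as a function of `r`, extended by `0` to `r ≤ r₊`. -/
def potentialOf (M a : ℝ) (W : ℝ → ℝ) (r : ℝ) : ℝ := if rPlus M a < r then W (rStar M a r) else 0

theorem support_potentialOf {M a : ℝ} (h : |a| < M) {W : ℝ → ℝ} {r₀ L : ℝ} (hr₀ : rPlus M a < r₀)
    (hW : ∀ s, s < rStar M a r₀ ∨ rStar M a r₀ + L < s → W s = 0) :
    Function.support (potentialOf M a W) ⊆ Icc r₀ (r₀ + L) := by
  intro r hr
  by_cases h1 : rPlus M a < r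
  · have h2 : W (rStar M a r) ≠ 0 := by
      rwa [Function.mem_support, potentialOf, if_pos h1] at hr
    have h3 := mt (hW _) h2
    push Not at h3
    have h4 : r₀ ≤ r := (strictMonoOn_rStar h).le_iff_le hr₀ h1 |>.1 h3.1
    have := rStar_sub_ge h hr₀ h4
    exact ⟨h4, by linarith⟩
  · exact absurd (if_neg h1) hr

theorem contDiff_potentialOf {M a : ℝ} (h : |a| < M) {W : ℝ → ℝ} {r₀ L : ℝ}
    (hr₀ : rPlus M a < r₀) (hWs : ContDiff ℝ (⊤ : ℕ∞) W)
    (hW : ∀ s, s < rStar M a r₀ ∨ rStar M a r₀ + L < s → W s = 0) :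
    ContDiff ℝ (⊤ : ℕ∞) (potentialOf M a W) := by
  refine contDiff_iff_contDiffAt.2 fun r => ?_
  rcases lt_or_ge (rPlus M a) r with h1 | h1
  · have h2 : ContDiffAt ℝ (⊤ : ℕ∞) (fun r => W (rStar M a r)) r :=
      hWs.contDiffAt.comp r ((contDiffOn_rStar h).contDiffAt (Ioi_mem_nhds h1))
    refine h2.congr_of_eventuallyEq ?_
    filter_upwards [Ioi_mem_nhds h1] with x hx
    exact if_pos hx
  · refine contDiffAt_const (c := 0) |>.congr_of_eventuallyEq ?_
    filter_upwards [Iio_mem_nhds (h1.trans_lt hr₀)] with x hx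
    by_contra hne
    exact not_lt.2 (support_potentialOf h hr₀ hW hne).1 hx

set_option maxHeartbeats 1000000 in
/-- The core of the construction: for `ω = ω_R + iτ` with `τ` small, a potential `W(r_*)` and an
outgoing solution of the radial equation. The potential is `Re (ω² - V_{ωml})` between two smooth
edges, minus the small correction `E` that glues the solution outgoing at the horizon to the one
outgoing at infinity; superradiance makes the fluxes of the two of the same sign. -/
theorem exists_trapping_potential {M a : ℝ} (h : |a| < M) (m : ℤ) {ωR A τ₀ : ℝ} (hτ₀ : 0 ≤ τ₀)
    (hτR : τ₀ ≤ |ωR| / 2) (hωA : |ωR| + τ₀ ≤ A)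
    (hsuper : ωR * (ωR - a * m / (2 * M * rPlus M a)) < 0) {lam : Icc (0 : ℝ) τ₀ → ℂ}
    (clam : Continuous lam) (blam : ∀ τ, ‖lam τ‖ ≤ A)
    (hlam : ∀ τ : Icc (0 : ℝ) τ₀, (τ : ℝ) = 0 → (lam τ).im = 0) :
    ∃ C L : ℝ, rPlus M a < C ∧ 0 < L ∧ ∀ r₀, C < r₀ → ∃ ε > 0, ∀ τ : Icc (0 : ℝ) τ₀, (τ : ℝ) < ε →
      ∃ W : ℝ → ℝ, ContDiff ℝ (⊤ : ℕ∞) W ∧ (∀ s, 0 ≤ W s ∧ W s ≤ 2 * ωR ^ 2) ∧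
        (∀ s, s < rStar M a r₀ ∨ rStar M a r₀ + L < s → W s = 0) ∧
        ∃ y : ℝ → ℂ, (∃ s, y s ≠ 0) ∧
          IsOutgoingRadial M a (fun r => (potentialOf M a W r : ℂ))
            ((ωR : ℂ) + ((τ : ℝ) : ℂ) * Complex.I) m (lam τ) y := by
  have hM : 0 < M := lt_of_le_of_lt (abs_nonneg a) h
  have hA : 0 ≤ A := by linarith [abs_nonneg ωR]
  set k : ℝ := a * m / (2 * M * rPlus M a) with hk
  have hωR : ωR ≠ 0 := fun h0 => by simp [h0] at hsuper
  have hκR : ωR - k ≠ 0 := fun h0 => by simp [h0] at hsuper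
  have hωR2 : 0 < ωR ^ 2 := by positivity
  obtain ⟨κ₀, hκ₀, hκ1, hκ2⟩ : ∃ κ₀ : ℝ, 0 < κ₀ ∧ κ₀ ≤ |ωR| ∧ κ₀ ≤ |ωR - k| :=
    ⟨min |ωR| |ωR - k|, lt_min (abs_pos.2 hωR) (abs_pos.2 hκR), min_le_left _ _, min_le_right _ _⟩
  obtain ⟨C₁, C₂, C₃, hC₁, -, -, hbd⟩ := exists_norm_waveNumberSq_le h m A hA
  obtain ⟨K₁, hK₁⟩ := exists_horizon_family h m hA hκ₀
  obtain ⟨K₂, hK₂⟩ := exists_infinity_family h m hA hκ₀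
  obtain ⟨K, hK, hKK₁, hKK₂⟩ : ∃ K : ℝ, 1 ≤ K ∧ K₁ ≤ K ∧ K₂ ≤ K :=
    ⟨max 1 (max K₁ K₂), le_max_left _ _, (le_max_left _ _).trans (le_max_right _ _),
      (le_max_right _ _).trans (le_max_right _ _)⟩
  obtain ⟨η, hη, hη4⟩ : ∃ η : ℝ, 0 < η ∧ η = ωR ^ 2 / 4 := ⟨_, by positivity, rfl⟩
  obtain ⟨L, hL1, hglue⟩ := eventually_glue (Wu := -(ωR - k)) (Wv := ωR) hK
    (by linarith [mul_comm ωR (ωR - k)]) hη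
  have hL : 0 < L := by linarith
  obtain ⟨C, hC4, hCsq⟩ : ∃ C : ℝ, 4 * M ≤ C ∧ ∀ r, C ≤ r → C₁ * (r ^ 2)⁻¹ ≤ η := by
    have h1 : Tendsto (fun r : ℝ => C₁ * (r ^ 2)⁻¹) atTop (𝓝 (C₁ * 0)) :=
      (tendsto_inv_atTop_zero.comp (tendsto_pow_atTop two_ne_zero)).const_mul _
    rw [mul_zero] at h1
    obtain ⟨C, hC⟩ := eventually_atTop.1 (h1.eventually (ge_mem_nhds hη))
    exact ⟨max (4 * M) C, le_max_left _ _, fun r hr => hC r ((le_max_right _ _).trans hr)⟩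
  have hpC : rPlus M a < C := (four_mul_gt_rPlus h).trans_le hC4
  refine ⟨C, L + 2, hpC, by linarith, fun r₀ hr₀ => ?_⟩
  obtain ⟨α, hα⟩ : ∃ α, α = rStar M a r₀ + 1 := ⟨_, rfl⟩
  have hrα : radius M a (α - 1) = r₀ := by
    rw [hα, add_sub_cancel_right, radius_rStar h (hpC.trans hr₀)]
  have hrad : ∀ s, α - 1 ≤ s → C ≤ radius M a s := fun s hs =>
    hr₀.le.trans (hrα ▸ (strictMono_radius h).monotone hs)
  obtain ⟨β, hβ⟩ : ∃ β, β = α + L := ⟨_, rfl⟩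
  obtain ⟨ω, hω⟩ : ∃ ω : Icc (0 : ℝ) τ₀ → ℂ,
    ω = fun τ : Icc (0 : ℝ) τ₀ => (ωR : ℂ) + ((τ : ℝ) : ℂ) * Complex.I := ⟨_, rfl⟩
  have ωre : ∀ τ, (ω τ).re = ωR := fun τ => by simp [hω]
  have ωim : ∀ τ, (ω τ).im = τ := fun τ => by simp [hω]
  have cω : Continuous ω := by rw [hω]; fun_prop
  have bω : ∀ τ, ‖ω τ‖ ≤ A := fun τ => by
    have := Complex.norm_le_abs_re_add_abs_im (ω τ)
    rw [ωre, ωim, abs_of_nonneg τ.2.1] at this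
    linarith [τ.2.2]
  have hκre : ∀ τ, (horizonFreq M a m (ω τ)).re = ωR - k := fun τ => by
    simp only [horizonFreq, Complex.sub_re, Complex.ofReal_re, ωre, hk]
  obtain ⟨u, u', cu, cu', du, du', lu, bu⟩ := hK₁ α (hC4.trans (hrad _ le_rfl)) cω clam bω blam
    (fun τ => by rw [ωim]; exact τ.2.1)
    (fun τ => hκ1.trans (by rw [← ωre τ]; exact Complex.abs_re_le_norm _))
    (fun τ => hκ2.trans (by rw [← hκre τ]; exact Complex.abs_re_le_norm _))
  obtain ⟨v, v', cv, cv', dv, dv', lv, bv⟩ := hK₂ β (hC4.trans (hrad _ (by linarith))) cω clam bω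
    blam (fun τ => by rw [ωim]; exact τ.2.1)
    (fun τ => hκ1.trans (by rw [← ωre τ]; exact Complex.abs_re_le_norm _))
  obtain ⟨H, hH⟩ : ∃ H : Icc (0 : ℝ) τ₀ → ℝ → ℂ,
    H = fun τ => waveNumberSq M a m (ω τ) (lam τ) := ⟨_, rfl⟩
  have sH : ∀ τ, ContDiff ℝ (⊤ : ℕ∞) (H τ) := fun τ => by
    rw [hH]; exact contDiff_waveNumberSq h m _ _
  have du' : ∀ τ s, HasDerivAt (u' τ) ((edgeL α s * (H τ s).re - H τ s) * u τ s) s := by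
    rw [hH]; exact du'
  have dv' : ∀ τ s, HasDerivAt (v' τ) ((edgeR β s * (H τ s).re - H τ s) * v τ s) s := by
    rw [hH]; exact dv'
  have hre : ∀ τ s, α - 1 ≤ s → ωR ^ 2 / 2 ≤ (H τ s).re ∧ (H τ s).re ≤ 5 / 4 * ωR ^ 2 := by
    intro τ s hs
    have h1 := (Complex.abs_re_le_norm _).trans ((hbd _ _ (bω τ) (blam τ) s).1.trans
      (hCsq _ (hrad s hs)))
    have h2 : (ω τ ^ 2).re = ωR ^ 2 - (τ : ℝ) ^ 2 := by
      rw [pow_two, Complex.mul_re, ωre, ωim]; ring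
    have h3 : (τ : ℝ) ^ 2 ≤ ωR ^ 2 / 4 := by
      have := pow_le_pow_left₀ τ.2.1 (τ.2.2.trans hτR) 2
      rw [div_pow, sq_abs] at this
      linarith
    rw [Complex.sub_re, h2, abs_le, hη4] at h1
    simp only [hH]
    have h4 := sq_nonneg (τ : ℝ)
    constructor <;> linarith [h1.1, h1.2]
  obtain ⟨x₀, hx₀⟩ : ∃ x₀ : Icc (0 : ℝ) τ₀, (x₀ : ℝ) = 0 := ⟨⟨0, le_rfl, hτ₀⟩, rfl⟩
  have hH0 : ∀ s, ((H x₀ s).re : ℂ) = H x₀ s := fun s => by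
    refine Complex.ext rfl ?_
    rw [Complex.ofReal_im, hH]
    exact (waveNumberSq_im m (by rw [ωim, hx₀]) (hlam x₀ hx₀) s).symm
  obtain ⟨bu1, bu2, bu3⟩ := bu x₀ (by rw [ωim, hx₀]) (hlam x₀ hx₀)
  obtain ⟨bv1, bv2, bv3⟩ := bv x₀ (by rw [ωim, hx₀]) (hlam x₀ hx₀)
  have hev := hglue x₀ α u u' v v' cu cu' cv cv'
    (fun s hs => ⟨du x₀ s, (du' x₀ s).congr_deriv (by
      rw [edgeL_eq_one hs.1, hH0, Complex.ofReal_one, one_mul, sub_self, zero_mul])⟩)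
    (fun s hs => ⟨dv x₀ s, (dv' x₀ s).congr_deriv (by
      rw [edgeR_eq_one (hs.2.trans_eq hβ.symm), hH0, Complex.ofReal_one, one_mul, sub_self,
        zero_mul])⟩)
    (fun s _ => ⟨by rw [bu3, hκre], by rw [bv3, ωre]⟩)
    (bu1.trans hKK₁) (bu2.trans hKK₁) (by rw [← hβ]; exact bv1.trans hKK₂)
    (by rw [← hβ]; exact bv2.trans hKK₂)
  obtain ⟨ε, hε, hball⟩ := Metric.eventually_nhds_iff.1 hev
  refine ⟨ε, hε, fun τ hτ => ?_⟩
  obtain ⟨c, hc, hP, hE, hbal⟩ := hball (y := τ) (by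
    rw [Subtype.dist_eq, hx₀, Real.dist_eq, sub_zero, abs_of_nonneg τ.2.1]; exact hτ)
  have sre : ContDiff ℝ (⊤ : ℕ∞) fun s => (H τ s).re := contDiff_re (sH τ)
  have ofRe : ∀ {f : ℝ → ℝ}, ContDiff ℝ (⊤ : ℕ∞) f → ContDiff ℝ (⊤ : ℕ∞) fun s => (f s : ℂ) :=
    fun hf => Complex.ofRealCLM.contDiff.comp hf
  have sL := contDiff_edgeL α
  have sR := contDiff_edgeR β
  have hqin : ∀ s ∈ Icc α (α + L), edgeL α s * edgeR β s = 1 := fun s hs => by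
    rw [edgeL_eq_one hs.1, edgeR_eq_one (hs.2.trans_eq hβ.symm), one_mul]
  obtain ⟨E, y, y', γ, sE, Ele, E0, dy, dy', yu, yv⟩ := exists_global_solution
    (q := fun s => (edgeL α s * edgeR β s : ℝ) * (H τ s).re - H τ s) (G := fun s => (H τ s).im)
    hL hη (du τ) (du' τ) (dv τ) (dv' τ)
    (((ofRe sL).mul (ofRe sre)).sub (sH τ)) (((ofRe sR).mul (ofRe sre)).sub (sH τ))
    (fun s hs => by rw [edgeR_eq_one (hs.trans_eq hβ.symm), mul_one])
    (fun s hs => by rw [edgeL_eq_one hs, one_mul])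
    (fun s hs => by
      rw [hqin s hs, Complex.ofReal_one, one_mul]
      nth_rw 2 [← Complex.re_add_im (H τ s)]
      ring)
    hc hP hE hbal
  obtain ⟨W, hW⟩ : ∃ W : ℝ → ℝ, W = fun s => edgeL α s * edgeR β s * (H τ s).re - E s := ⟨_, rfl⟩
  have sW : ContDiff ℝ (⊤ : ℕ∞) W := by rw [hW]; exact ((sL.mul sR).mul sre).sub sE
  have dyW : ∀ s, HasDerivAt y' ((W s - H τ s) * y s) s := fun s => by
    refine (dy' s).congr_deriv ?_
    rw [hW]; push_cast; ring
  have hW0 : ∀ s, s < rStar M a r₀ ∨ rStar M a r₀ + (L + 2) < s → W s = 0 := by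
    intro s hs
    have h1 : E s = 0 := E0 s (hs.imp (fun h => by linarith) (fun h => by linarith))
    simp only [hW, h1, sub_zero]
    rcases hs with hs | hs
    · rw [edgeL_eq_zero (by linarith), zero_mul, zero_mul]
    · rw [edgeR_eq_zero (by linarith), mul_zero, zero_mul]
  have hWle : ∀ s, 0 ≤ W s ∧ W s ≤ 2 * ωR ^ 2 := by
    intro s
    rcases lt_or_ge s (α - 1) with hs | hs
    · rw [hW0 s (Or.inl (by linarith))]
      exact ⟨le_rfl, by positivity⟩
    obtain ⟨h1, h2⟩ := hre τ s hs
    have h3 := abs_lt.1 (Ele s)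
    rw [hη4] at h3
    by_cases hin : s < α + L / 3 ∨ α + 2 * L / 3 < s
    · obtain ⟨l0, l1⟩ := edgeL_mem α s
      obtain ⟨m0, m1⟩ := edgeR_mem β s
      have p0 := mul_nonneg l0 m0
      have p1 := mul_le_one₀ l1 m0 m1
      have p2 := mul_nonneg p0 (by linarith : 0 ≤ (H τ s).re)
      have p3 := mul_le_of_le_one_left (by linarith : 0 ≤ (H τ s).re) p1
      simp only [hW, E0 s hin, sub_zero]
      exact ⟨p2, by linarith⟩
    · push Not at hin
      simp only [hW, hqin s ⟨by linarith, by linarith⟩, one_mul]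
      constructor <;> linarith
  refine ⟨W, sW, hWle, hW0, y, ⟨α, ?_⟩, ?_⟩
  · rw [(yu α (by linarith)).1]
    intro h0
    have := hP α ⟨le_rfl, by linarith⟩
    simp [glueP, cutoff_eq_zero hL (by linarith : α ≤ α + L / 3), sqAbs, h0] at this
  have hdy : deriv y = y' := funext fun s => (dy s).deriv
  refine ⟨(contDiff_of_linear_ode dy dyW ((ofRe sW).sub (sH τ))).1, fun r hr => ?_, ?_, ?_⟩
  · rw [hdy, (dyW _).deriv, hH, hω]
    simp only [waveNumberSq, radius_rStar h hr, potentialOf, if_pos hr]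
    ring
  · rw [hdy]
    have := (lv τ).const_mul γ
    rw [mul_zero] at this
    refine this.congr' ?_
    filter_upwards [eventually_gt_atTop (α + 2 * L / 3)] with s hs
    rw [(yv s hs).1, (yv s hs).2, hω]
    ring
  · rw [hdy]
    refine (lu τ).congr' ?_
    filter_upwards [eventually_lt_atBot (α + L / 3)] with s hs
    rw [(yu s hs).1, (yu s hs).2, hω]
    rfl

end Kerr

end

open Filter Topology Set Kerr

theorem theorem1 (M a : ℝ) (ha : 0 < |a|) (haM : |a| < M) (ωR : ℝ) (m : ℤ) (l : ℕ)
    (hl : m.natAbs ≤ l)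
    (hsuper : ωR * (ωR - a * m / (2 * M * Kerr.rPlus M a)) < 0) :
    ∃ C : ℝ, Kerr.rPlus M a < C ∧ ∃ C₀ : ℝ, 0 < C₀ ∧
      ∀ r₀ : ℝ, C < r₀ → ∃ ε : ℝ, 0 < ε ∧ ∀ ωI : ℝ, 0 ≤ ωI → ωI < ε →
        ∃ V : ℝ → ℝ, ContDiff ℝ (⊤ : ℕ∞) V ∧
          (∀ r, 0 ≤ V r ∧ V r ≤ 2 * ωR ^ 2) ∧
          Function.support V ⊆ Set.Icc r₀ (r₀ + C₀) ∧
          ∃ ψ : (Fin 4 → ℝ) → ℂ,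
            Kerr.IsOutgoingMode M a (fun r => (V r : ℂ)) ((ωR : ℂ) + (ωI : ℂ) * Complex.I)
              m l ψ := by
  have hωR : ωR ≠ 0 := fun h0 => by simp [h0] at hsuper
  obtain ⟨δ, hδ, Λ, hΛ0, hΛc, hΛ⟩ := exists_spheroidal_family a ωR m l hl
  obtain ⟨τ₀, hτ₀, hτR, hτδ⟩ : ∃ τ₀ : ℝ, 0 < τ₀ ∧ τ₀ ≤ |ωR| / 2 ∧ τ₀ < δ :=
    ⟨min (|ωR| / 2) (δ / 2), lt_min (half_pos (abs_pos.2 hωR)) (half_pos hδ), min_le_left _ _,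
      (min_le_right _ _).trans_lt (half_lt_self hδ)⟩
  have hmem : ∀ τ : Icc (0 : ℝ) τ₀,
      (ωR : ℂ) + ((τ : ℝ) : ℂ) * Complex.I ∈ Metric.ball (ωR : ℂ) δ := fun τ => by
    rw [Metric.mem_ball, dist_eq_norm, add_sub_cancel_left, norm_mul, Complex.norm_I, mul_one,
      Complex.norm_real, Real.norm_eq_abs, abs_of_nonneg τ.2.1]
    exact τ.2.2.trans_lt hτδ
  have clam : Continuous fun τ : Icc (0 : ℝ) τ₀ => Λ ((ωR : ℂ) + ((τ : ℝ) : ℂ) * Complex.I) :=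
    hΛc.comp_continuous (by fun_prop) hmem
  obtain ⟨B, hB⟩ := isCompact_range clam |>.isBounded.exists_norm_le
  obtain ⟨C, L, hpC, hL, hmain⟩ := exists_trapping_potential haM m (A := max (|ωR| + τ₀) B) hτ₀.le
    hτR (le_max_left _ _) hsuper clam
    (fun τ => (hB _ (mem_range_self τ)).trans (le_max_right _ _))
    (fun τ hτ => by rw [hτ, Complex.ofReal_zero, zero_mul, add_zero]; exact hΛ0)
  refine ⟨C, hpC, L, hL, fun r₀ hr₀ => ?_⟩
  obtain ⟨ε, hε, hW⟩ := hmain r₀ hr₀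
  refine ⟨min ε τ₀, lt_min hε hτ₀, fun ωI h0 h1 => ?_⟩
  have hωI : ωI ∈ Icc (0 : ℝ) τ₀ := ⟨h0, (h1.trans_le (min_le_right _ _)).le⟩
  obtain ⟨W, sW, hWle, hW0, y, ⟨s, hs⟩, hy⟩ := hW ⟨ωI, hωI⟩ (h1.trans_le (min_le_left _ _))
  have hr₀' : rPlus M a < r₀ := hpC.trans hr₀
  obtain ⟨hlam, F, hF⟩ := hΛ _ (hmem ⟨ωI, hωI⟩) (by simp)
  refine ⟨potentialOf M a W, contDiff_potentialOf haM hr₀' sW hW0, fun r => ?_,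
    support_potentialOf haM hr₀' hW0,
    exists_isOutgoingMode haM (fun h => hωR ?_) (by simpa using h0) hl hlam hF hy
      (rPlus_lt_radius haM s) (by rwa [rStar_radius haM])⟩
  · unfold potentialOf
    split_ifs
    · exact hWle _
    · exact ⟨le_rfl, by positivity⟩
  · simpa using congrArg Complex.re h
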